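/- Let $d\ge 1$, let $u:\mathbb Z^d\to\mathbb R$ be periodic, i.e. there are integers $p_1,\dots,p_d\ge 1$ with $u(x+p_je_j)=u(x)$ for all $x\in\mathbb Z^d$ and $1\le j\le d$, and let $\lambda>0$. Let $v_x(t)$, $x\in\mathbb Z^d$, $t\ge 0$, be the flip process: the initial values $v_x(0)$ are independent and uniform in $\{-1,1\}$, and $v_x(t)$ changes its sign at each jump time of a Poisson process $N_x$ of a fixed rate $r>0$ (the same for all $x$), where the processes $N_x$ are independent of each other and of the initial values. Denote by $\mathbb E$ the expectation with respect to this randomness. For $\psi_0\in\ell^2(\mathbb Z^d)$ let $\psi_t\in\ell^2(\mathbb Z^d)$ be the (almost surely unique, continuous in $t\ge 0$) solution, in the time-integrated sense, of $$ i\,\partial_t\psi_t(x)=\sum_{|y-x|=1}\psi_t(y)+u(x)\psi_t(x)+\lambda\, v_x(t)\,\psi_t(x),\qquad x\in\mathbb Z^d, $$ with initial value $\psi_0$. Then there is a (symmetric) positive definite real $d\times d$ matrix $D=D(\lambda,u)$ (depending also on the fixed rate $r$, but not on $\psi_0$ or $f$) such that for every $\psi_0\in\ell^2(\mathbb Z^d)$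 with $\|\psi_0\|_{\ell^2}=1$ and every bounded continuous $f:\mathbb R^d\to\mathbb R$, $$ \lim_{t\to\infty}\sum_{x\in\mathbb Z^d} f\!\left(\frac{x}{\sqrt t}\right)\mathbb E\big(|\psi_t(x)|^2\big)=\int_{\mathbb R^d} f(r)\,\frac{1}{(2\pi)^{d/2}(\det D)^{1/2}}\,e^{-\frac12\langle r,D^{-1}r\rangle}\,dr. \tag{1}$$ If furthermore $\sum_{x}(1+|x|^2)|\psi_0(x)|^2<\infty$, then $\sum_x|x|^2\,\mathbb E(|\psi_t(x)|^2)<\infty$ for all $t\ge 0$, $$ \lim_{t\to\infty}\frac1t\sum_{x\in\mathbb Z^d}|x|^2\,\mathbb E\big(|\psi_t(x)|^2\big)=\operatorname{tr}D\in(0,\infty), $$ and (1) holds for every continuous $f:\mathbb R^d\to\mathbb R$ with $\sup_{x}(1+|x|^2)^{-1}|f(x)|<\infty$ (the series in (1) being absolutely convergent). -/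

import Mathlib

open MeasureTheory ProbabilityTheory Filter Topology
open scoped NNReal ENNReal

noncomputable section

/-- The cubic lattice `ℤ^d`. -/
abbrev CubicLattice (d : ℕ) : Type := Fin d → ℤ

/-- The Hilbert space `ℓ²(ℤ^d)` of complex valued square summable functions. -/
abbrev L2Lattice (d : ℕ) : Type := lp (fun _ : CubicLattice d => ℂ) 2

/-- A lattice point as a vector of the Euclidean space `ℝ^d`; in particular
`‖latticeVec x‖` is the Euclidean length `|x|`. -/
def latticeVec {d : ℕ} (x : CubicLattice d) : EuclideanSpace ℝ (Fin d) :=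
  WithLp.toLp 2 (fun j => (x j : ℝ))

/-- The potential `u` is `p`-periodic: all `p_j` are positive and `u (x + p_j e_j) = u x`. -/
def IsPeriodicPotential {d : ℕ} (p : Fin d → ℕ) (u : CubicLattice d → ℝ) : Prop :=
  (∀ j, 0 < p j) ∧ ∀ (j : Fin d) (x : CubicLattice d), u (x + Pi.single j (p j : ℤ)) = u x

/-- `N` is a Poisson process with rate `r` under `P`: an integer valued process starting at `0`,
with almost surely nondecreasing right continuous paths, with independent increments, such that
`N t - N s` has the Poisson distribution with mean `r (t - s)` for `s ≤ t`. (The difference is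
taken in `ℕ`, which is harmless as the paths are nondecreasing.) -/
structure IsPoissonProcess {Ω : Type*} [MeasurableSpace Ω] (P : Measure Ω) (r : ℝ≥0)
    (N : ℝ≥0 → Ω → ℕ) : Prop where
  measurable : ∀ t, Measurable (N t)
  zero : ∀ᵐ ω ∂P, N 0 ω = 0
  monotone : ∀ᵐ ω ∂P, Monotone fun t => N t ω
  right_continuous : ∀ᵐ ω ∂P, ∀ t, ContinuousWithinAt (fun s => N s ω) (Set.Ici t) t
  indep_increments : HasIndepIncrements N P
  law_increment : ∀ s t, s ≤ t → P.map (fun ω => N t ω - N s ω) = poissonMeasure (r * (t - s))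

/-- The random data of the flip process: initial spins `σ x`, `x ∈ ℤ^d`, that are independent and
uniform on `{-1, 1}`, and independent Poisson processes `N x`, `x ∈ ℤ^d`, all with the same
rate `r`; the family of spins is independent of the family of Poisson processes. -/
structure IsFlipProcessData {d : ℕ} {Ω : Type*} [MeasurableSpace Ω] (P : Measure Ω) (r : ℝ≥0)
    (σ : CubicLattice d → Ω → ℝ) (N : CubicLattice d → ℝ≥0 → Ω → ℕ) : Prop where
  measurable_spin : ∀ x, Measurable (σ x)
  law_spin : ∀ x, P.map (σ x) =
    (1 / 2 : ℝ≥0∞) • (Measure.dirac (-1 : ℝ) + Measure.dirac (1 : ℝ))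
  indep_spin : iIndepFun σ P
  poisson : ∀ x, IsPoissonProcess P r (N x)
  indep_poisson : iIndepFun (fun (x : CubicLattice d) (ω : Ω) (t : ℝ≥0) => N x t ω) P
  indep : IndepFun (fun (ω : Ω) (x : CubicLattice d) => σ x ω)
    (fun (ω : Ω) (x : CubicLattice d) (t : ℝ≥0) => N x t ω) P

/-- The flip process `v_x(ω(t))`: the spin at `x` starts from `σ x` and changes its sign at each
jump of the Poisson process `N x`. -/
def flipSpin {d : ℕ} {Ω : Type*} (σ : CubicLattice d → Ω → ℝ) (N : CubicLattice d → ℝ≥0 → Ω → ℕ)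
    (ω : Ω) (t : ℝ≥0) (x : CubicLattice d) : ℝ :=
  σ x ω * (-1) ^ N x t ω

/-- The nearest neighbour hopping operator `φ ↦ ∑_{|y - x| = 1} φ y`; the lattice points at
Euclidean distance `1` from `x` are the `2d` points `x ± e_j`. -/
def hopping {d : ℕ} (φ : CubicLattice d → ℂ) (x : CubicLattice d) : ℂ :=
  ∑ j : Fin d, (φ (x + Pi.single j 1) + φ (x - Pi.single j 1))

/-- `ψ` solves, for one realization `v : ℝ≥0 → ℤ^d → ℝ` of the random potential, the equation
`i ∂_t ψ_t(x) = ∑_{|y - x| = 1} ψ_t(y) + u(x) ψ_t(x) + lam v_t(x) ψ_t(x)` with initial value `ψ₀`.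
Since `t ↦ v_t(x)` jumps, the equation is understood, as usual, in its time-integrated form; `ψ`
is a continuous curve in `ℓ²(ℤ^d)`. -/
structure IsSchrodingerSolution {d : ℕ} (u : CubicLattice d → ℝ) (lam : ℝ) (v : ℝ≥0 → CubicLattice d → ℝ)
    (ψ₀ : L2Lattice d) (ψ : ℝ≥0 → L2Lattice d) : Prop where
  continuous : Continuous ψ
  integral_eq : ∀ (t : ℝ≥0) (x : CubicLattice d),
    ψ t x = ψ₀ x - Complex.I * ∫ s in (0 : ℝ)..(t : ℝ),
      (hopping (ψ s.toNNReal) x + (u x : ℂ) * ψ s.toNNReal x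
        + (lam : ℂ) * (v s.toNNReal x : ℂ) * ψ s.toNNReal x)

/-- The averaged probability density `𝔼 |ψ_t(x)|²`. -/
def meanDensity {d : ℕ} {Ω : Type*} [MeasurableSpace Ω] (P : Measure Ω)
    (ψ : Ω → ℝ≥0 → L2Lattice d) (t : ℝ≥0) (x : CubicLattice d) : ℝ :=
  ∫ ω, ‖ψ ω t x‖ ^ 2 ∂P

/-- The density `(2π)^{-d/2} (det D)^{-1/2} exp (-⟨r, D⁻¹ r⟩ / 2)` of the centred Gaussian
distribution on `ℝ^d` with covariance matrix `D`. -/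
def gaussianDensity {d : ℕ} (D : Matrix (Fin d) (Fin d) ℝ) (r : EuclideanSpace ℝ (Fin d)) : ℝ :=
  (1 / (2 * Real.pi)) ^ ((d : ℝ) / 2) * (Real.sqrt D.det)⁻¹ *
    Real.exp (-(1 / 2) * (r.ofLp ⬝ᵥ D⁻¹.mulVec r.ofLp))

/-- The central limit theorem for the test function `f`: for every time `t` the series
`∑_x f(x / √t) 𝔼 |ψ_t(x)|²` converges (absolutely), and its sum tends, as `t → ∞`, to the integral
of `f` against the centred Gaussian distribution with covariance matrix `D`. -/
def CLTHolds {d : ℕ} {Ω : Type*} [MeasurableSpace Ω] (P : Measure Ω)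
    (ψ : Ω → ℝ≥0 → L2Lattice d) (D : Matrix (Fin d) (Fin d) ℝ)
    (f : EuclideanSpace ℝ (Fin d) → ℝ) : Prop :=
  (∀ t : ℝ≥0, Summable fun x : CubicLattice d =>
      f ((Real.sqrt t)⁻¹ • latticeVec x) * meanDensity P ψ t x) ∧
    Tendsto (fun t : ℝ≥0 => ∑' x : CubicLattice d,
        f ((Real.sqrt t)⁻¹ • latticeVec x) * meanDensity P ψ t x)
      atTop (𝓝 (∫ r : EuclideanSpace ℝ (Fin d), f r * gaussianDensity D r))

end

/-! The averaged dynamics is a linear evolution with a dissipative generator, and the theorem is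
second order perturbation theory, in the momentum, for its eigenvalue zero.

Spins become algebra through the products `spinChar v A` over finite sets `A`, which are
orthonormal. The correlations `R_t(x, y, A)`, the expectations of `ψ_t(x)` times the conjugate of
`ψ_t(y)` times the spin product over `A` (`densityMoment`), satisfy a closed equation: the
commutator with the Hamiltonian, in which `v_x` acts as `A ↦ A Δ {x}`, and a decay at rate `2 r
|A|`. This is `IsSpinField.hasDerivAt_densityMoment`; it rests on the Markov property and on the
fact that `ψ_t` does not anticipate flips after time `t` (`IsNonanticipating`).

The equation commutes with translations by the periods. Summing over `x` in a residue class `a` with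
the phase `exp (i k · x)` decouples the momenta `k` (`IsSpinField.exists_fiberSolution`). The fiber
unknown depends on `a`, on `z = y - x` and on the sites relative to `x`. It is only bounded in `z`,
so it is multiplied by `exp (-η |z|)` to make it square summable. Its component along the stationary
vector `fiberStat` is, up to normalization, the characteristic function of the averaged density.

At momentum zero, the generator damps only the sites with `A ≠ ∅`. The flip feeds the sites with `A
= ∅`, `z ≠ 0` into those, and hopping feeds the diagonal `z = 0` into its neighbors by discrete
gradients, which control the diagonal part by a Poincaré inequality on the torus of residue classes.
`exists_hypocoercive_unweighted` combines these mechanisms by a modified inner product, and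
`exists_hypocoerciveGenerator` allows a small `η`. Hence the part orthogonal to the stationary
vector stays bounded uniformly in time.

At momentum `s κ` no spectral theory is used: `e + s w₁ + s² w₂` is a left eigenvector with
eigenvalue `ν s²` up to `O(|s|³)`. Paired with a solution it shows that the characteristic function
at `s κ` is `exp (-ν s² t)` times its initial value, up to `O(|s| + |s|³ t)`
(`PerturbedGenerator.exists_norm_inner_sub_le`). The matrix `D` is given by `Re ν = ⟨κ, D κ⟩ / 2`.
It is positive definite because `Re ν` dominates the excited part of the weighted corrector, and
without excited part the corrector equation forces `κ = 0` (`le_re_inner_corrector`,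
`eq_zero_of_corrector`).

With `s` of order `1 / √t` the error vanishes and Lévy's theorem gives the central limit theorem. If
the initial second moment is finite, the sum of the values at `s κ` and `-s κ` is known up to `O(s²
+ |s|³ t)`; dividing by `s²` and letting `s → 0` shows that second moments equal `t ⟨κ, D κ⟩` up to
a constant (`IsDiffusive.exists_sq_moment_bound`). Convergence of second moments extends the weak
limit to quadratically bounded functions. -/

noncomputable section

/-! ### The Hilbert space of square summable functions and weighted composition operators. -/

section EllTwo

variable {ι : Type*} {𝕜 : Type*} [RCLike 𝕜]

/-- The Hilbert space `ℓ²(ι)`. -/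
abbrev Ell2 (𝕜 : Type*) [RCLike 𝕜] (ι : Type*) : Type _ := lp (fun _ : ι => 𝕜) 2

theorem memℓp_two_iff {f : ι → 𝕜} : Memℓp f 2 ↔ Summable fun i => ‖f i‖ ^ 2 := by
  rw [memℓp_gen_iff (by norm_num)]
  simp

theorem Ell2.hasSum_norm_sq (f : Ell2 𝕜 ι) : HasSum (fun i => ‖f i‖ ^ 2) (‖f‖ ^ 2) := by
  have := lp.hasSum_norm (p := 2) (by norm_num) f
  simpa using this

theorem Ell2.summable_norm_sq (f : Ell2 𝕜 ι) : Summable fun i => ‖f i‖ ^ 2 :=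
  f.hasSum_norm_sq.summable

theorem Ell2.norm_sq_eq (f : Ell2 𝕜 ι) : ‖f‖ ^ 2 = ∑' i, ‖f i‖ ^ 2 :=
  f.hasSum_norm_sq.tsum_eq.symm

theorem Ell2.norm_apply_le (f : Ell2 𝕜 ι) (i : ι) : ‖f i‖ ≤ ‖f‖ :=
  lp.norm_apply_le_norm (by norm_num) f i

/-- The norms in `ℓ²` of two functions compare if their absolute values do. -/
theorem Ell2.norm_le_of_le {𝕜' : Type*} [RCLike 𝕜'] (f : Ell2 𝕜 ι) (g : Ell2 𝕜' ι)
    (h : ∀ i, ‖f i‖ ≤ ‖g i‖) : ‖f‖ ≤ ‖g‖ := by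
  have : ‖f‖ ^ 2 ≤ ‖g‖ ^ 2 := by
    rw [f.norm_sq_eq, g.norm_sq_eq]
    exact f.summable_norm_sq.tsum_le_tsum (fun i => by gcongr; exact h i) g.summable_norm_sq
  exact le_of_sq_le_sq this (norm_nonneg _)

theorem Ell2.hasSum_inner (f g : Ell2 𝕜 ι) : HasSum (fun i => inner 𝕜 (f i) (g i)) (inner 𝕜 f g) :=
  lp.hasSum_inner f g

theorem Ell2.summable_mul (f g : Ell2 𝕜 ι) : Summable fun i => ‖f i‖ * ‖g i‖ := by
  refine Summable.of_nonneg_of_le (fun i => by positivity)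
    (fun i => ?_) (f.summable_norm_sq.add g.summable_norm_sq)
  nlinarith [sq_nonneg (‖f i‖ - ‖g i‖), sq_nonneg (‖f i‖), sq_nonneg (‖g i‖)]

theorem Ell2.tsum_mul_le (f g : Ell2 𝕜 ι) : ∑' i, ‖f i‖ * ‖g i‖ ≤ ‖f‖ * ‖g‖ := by
  have := lp.tsum_mul_le_mul_norm' (p := 2) (q := 2)
    (by simpa using Real.HolderConjugate.two_two) f g
  simpa using this

theorem Ell2.summable_mul_comp (f : Ell2 𝕜 ι) (g : Ell2 𝕜 ι) (σ : ι ≃ ι) :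
    Summable fun i => ‖f i‖ * ‖g (σ i)‖ := by
  have hg : Summable fun i => ‖g (σ i)‖ ^ 2 := σ.summable_iff.mpr g.summable_norm_sq
  refine Summable.of_nonneg_of_le (fun i => by positivity)
    (fun i => ?_) (f.summable_norm_sq.add hg)
  nlinarith [sq_nonneg (‖f i‖ - ‖g (σ i)‖), sq_nonneg (‖f i‖), sq_nonneg (‖g (σ i)‖)]

section WComp

/-- The weighted composition operator `f ↦ c · (f ∘ σ)` on `ℓ²(ι)`. -/
def wcomp (c : ι → 𝕜) (hc : ∃ C, ∀ i, ‖c i‖ ≤ C) (σ : ι ≃ ι) : Ell2 𝕜 ι →L[𝕜] Ell2 𝕜 ι :=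
  LinearMap.mkContinuousOfExistsBound
    { toFun := fun f => ⟨fun i => c i * f (σ i), by
        obtain ⟨C, hC⟩ := hc
        refine memℓp_two_iff.mpr (Summable.of_nonneg_of_le (fun i => by positivity) (fun i => ?_)
          ((σ.summable_iff.mpr f.summable_norm_sq).mul_left (C ^ 2)))
        rw [norm_mul, mul_pow]
        gcongr
        · exact hC i
        · rfl⟩
      map_add' := fun f g => by ext i; exact mul_add _ _ _
      map_smul' := fun a f => by ext i; simp; ring }
    (by
      obtain ⟨C, hC⟩ := hc
      refine ⟨|C|, fun f => ?_⟩
      refine le_of_sq_le_sq ?_ (by positivity)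
      have h1 : HasSum (fun i => C ^ 2 * ‖f (σ i)‖ ^ 2) (C ^ 2 * ‖f‖ ^ 2) :=
        (σ.hasSum_iff.mpr f.hasSum_norm_sq).mul_left _
      rw [mul_pow, sq_abs]
      refine hasSum_le (fun i => ?_) (Ell2.hasSum_norm_sq _) h1
      change ‖c i * f (σ i)‖ ^ 2 ≤ _
      rw [norm_mul, mul_pow]
      gcongr
      exact hC i)

variable {c : ι → 𝕜} {hc : ∃ C, ∀ i, ‖c i‖ ≤ C} {σ : ι ≃ ι}

@[simp]
theorem wcomp_apply (f : Ell2 𝕜 ι) (i : ι) : wcomp c hc σ f i = c i * f (σ i) := rfl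

theorem wcomp_norm_le {C : ℝ} (hC0 : 0 ≤ C) (hC : ∀ i, ‖c i‖ ≤ C) : ‖wcomp c hc σ‖ ≤ C := by
  refine ContinuousLinearMap.opNorm_le_bound _ hC0 fun f => ?_
  refine le_of_sq_le_sq ?_ (by positivity)
  have h1 : HasSum (fun i => C ^ 2 * ‖f (σ i)‖ ^ 2) (C ^ 2 * ‖f‖ ^ 2) :=
    (σ.hasSum_iff.mpr f.hasSum_norm_sq).mul_left _
  rw [mul_pow]
  refine hasSum_le (fun i => ?_) (Ell2.hasSum_norm_sq _) h1
  rw [wcomp_apply, norm_mul, mul_pow]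
  gcongr
  exact hC i

theorem inner_wcomp_left {c' : ι → 𝕜} {hc' : ∃ C, ∀ i, ‖c' i‖ ≤ C} {σ' : ι ≃ ι}
    (hσ : ∀ i, σ' (σ i) = i) (h : ∀ i, c' (σ i) = starRingEnd 𝕜 (c i)) (f g : Ell2 𝕜 ι) :
    inner 𝕜 (wcomp c hc σ f) g = inner 𝕜 f (wcomp c' hc' σ' g) := by
  refine (Ell2.hasSum_inner _ _).unique ?_
  have := σ.hasSum_iff.mpr (Ell2.hasSum_inner f (wcomp c' hc' σ' g))
  convert this using 2 with i
  simp only [wcomp_apply, Function.comp, hσ, h, RCLike.inner_apply, map_mul]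
  ring

end WComp

end EllTwo

/-! ### Hypocoercive generators and weak solutions. -/

section AbstractDynamics

open scoped InnerProductSpace
open Set

/-- A linear functional that is controlled by a linear map `T` into a Hilbert space is of the form
`v ↦ ⟪w, T v⟫`. -/
theorem exists_inner_eq_of_norm_le {V E : Type*} [AddCommGroup V] [Module ℂ V]
    [NormedAddCommGroup E] [InnerProductSpace ℂ E] [CompleteSpace E] (T : V →ₗ[ℂ] E)
    (l : V →ₗ[ℂ] ℂ) (C : ℝ) (h : ∀ v, ‖l v‖ ≤ C * ‖T v‖) : ∃ w : E, ∀ v, l v = ⟪w, T v⟫_ℂ := by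
  have hker : LinearMap.ker T ≤ LinearMap.ker l := fun v hv => by
    have := h v
    rw [LinearMap.mem_ker.mp hv, norm_zero, mul_zero] at this
    exact norm_le_zero_iff.mp this
  let l₁ : LinearMap.range T →ₗ[ℂ] ℂ :=
    ((LinearMap.ker T).liftQ l hker) ∘ₗ T.quotKerEquivRange.symm.toLinearMap
  have hl₁ : ∀ v, l₁ ⟨T v, LinearMap.mem_range_self T v⟩ = l v := fun v => by
    have := LinearMap.quotKerEquivRange_symm_apply_image T v (LinearMap.mem_range_self T v)
    simp [l₁, this]
  let l₂ : LinearMap.range T →L[ℂ] ℂ := l₁.mkContinuous C (by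
    rintro ⟨_, v, rfl⟩
    rw [hl₁]
    exact h v)
  obtain ⟨L, hL, -⟩ := exists_extension_norm_eq _ l₂
  refine ⟨(InnerProductSpace.toDual ℂ E).symm L, fun v => ?_⟩
  rw [InnerProductSpace.toDual_symm_apply, ← hl₁]
  exact (hL ⟨T v, LinearMap.mem_range_self T v⟩).symm

variable {ι : Type*}

theorem Ell2.apply_eq_inner [DecidableEq ι] (f : Ell2 ℂ ι) (j : ι) :
    f j = ⟪lp.single 2 j (1 : ℂ), f⟫_ℂ := by
  rw [lp.inner_single_left]; simp

/-- A generator `G + b` on `ℓ²(ι)`, with `G` bounded and `b ≥ 0` a possibly unbounded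
multiplication operator, that is hypocoercive on the orthogonal complement of its stationary unit
vector `e`: it is coercive with respect to the modified inner product `⟪f, (1 + A) g⟫`. -/
structure HypocoerciveGenerator (ι : Type*) where
  G : Ell2 ℂ ι →L[ℂ] Ell2 ℂ ι
  b : ι → ℝ
  A : Ell2 ℂ ι →L[ℂ] Ell2 ℂ ι
  e : Ell2 ℂ ι
  c : ℝ
  b_nonneg : ∀ j, 0 ≤ b j
  norm_e : ‖e‖ = 1
  c_pos : 0 < c
  A_symm : ∀ f g, ⟪A f, g⟫_ℂ = ⟪f, A g⟫_ℂ
  norm_A : ‖A‖ ≤ 1 / 2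
  A_apply : ∀ f j, b j ≠ 0 → A f j = 0
  e_apply : ∀ j, b j ≠ 0 → e j = 0
  A_e : A e = 0
  G_e : G e = 0
  e_G : ∀ f, ⟪e, G f⟫_ℂ = 0
  coercive : ∀ Y, ⟪e, Y⟫_ℂ = 0 → c * ‖Y‖ ^ 2 ≤ (⟪Y + A Y, G Y⟫_ℂ).re

namespace HypocoerciveGenerator

variable (S : HypocoerciveGenerator ι)

theorem inner_e_e : ⟪S.e, S.e⟫_ℂ = 1 := by
  rw [inner_self_eq_norm_sq_to_K, S.norm_e]; simp

/-- The orthogonal projection onto the complement of the stationary vector. -/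
def proj (f : Ell2 ℂ ι) : Ell2 ℂ ι := f - ⟪S.e, f⟫_ℂ • S.e

theorem inner_e_proj (f : Ell2 ℂ ι) : ⟪S.e, S.proj f⟫_ℂ = 0 := by
  simp [proj, S.norm_e]

theorem proj_apply (f : Ell2 ℂ ι) (j : ι) : S.proj f j = f j - ⟪S.e, f⟫_ℂ * S.e j := rfl

theorem norm_proj_le (f : Ell2 ℂ ι) : ‖S.proj f‖ ≤ ‖f‖ := by
  have h : f = S.proj f + ⟪S.e, f⟫_ℂ • S.e := by simp [proj]
  have h2 : ‖f‖ ^ 2 = ‖S.proj f‖ ^ 2 + ‖⟪S.e, f⟫_ℂ • S.e‖ ^ 2 := by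
    conv_lhs => rw [h]
    rw [sq, sq, sq]
    apply norm_add_sq_eq_norm_sq_add_norm_sq_of_inner_eq_zero (𝕜 := ℂ)
    have : ⟪S.proj f, S.e⟫_ℂ = 0 := by rw [← inner_conj_symm, inner_e_proj]; simp
    rw [inner_smul_right, this, mul_zero]
  refine le_of_sq_le_sq ?_ (norm_nonneg _)
  nlinarith [sq_nonneg ‖⟪S.e, f⟫_ℂ • S.e‖]

theorem norm_add_A_le (Y : Ell2 ℂ ι) : ‖Y + S.A Y‖ ≤ 3 / 2 * ‖Y‖ := by
  have h1 : ‖S.A Y‖ ≤ 1 / 2 * ‖Y‖ := S.A.le_of_opNorm_le S.norm_A Y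
  linarith [norm_add_le Y (S.A Y)]

theorem G_proj (f : Ell2 ℂ ι) : S.G (S.proj f) = S.G f := by
  simp [proj, S.G_e]

/-- The adjoint equation `(G + b)† w = g` is solvable if `g` is orthogonal to `e`. -/
theorem exists_adjoint_solution (g : Ell2 ℂ ι) (hg : ⟪S.e, g⟫_ℂ = 0) :
    ∃ w h : Ell2 ℂ ι, ⟪S.e, w⟫_ℂ = 0 ∧ (∀ j, h j = S.b j * w j) ∧
      ContinuousLinearMap.adjoint S.G w + h = g := by
  classical
  let δ : ι → Ell2 ℂ ι := fun j => lp.single 2 j 1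
  let emb : (ι →₀ ℂ) →ₗ[ℂ] Ell2 ℂ ι := Finsupp.linearCombination ℂ δ
  let bm : (ι →₀ ℂ) →ₗ[ℂ] Ell2 ℂ ι := Finsupp.linearCombination ℂ (fun j => (S.b j : ℂ) • δ j)
  let T : (ι →₀ ℂ) →ₗ[ℂ] Ell2 ℂ ι := S.G.toLinearMap ∘ₗ emb + bm
  have hδ : ∀ (f : Ell2 ℂ ι) j, ⟪f, δ j⟫_ℂ = starRingEnd ℂ (f j) := fun f j => by
    rw [lp.inner_single_right]; simp
  have hemb : ∀ f j, emb f j = f j := fun f j => by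
    have : ⟪emb f, δ j⟫_ℂ = starRingEnd ℂ (f j) := by
      simp only [emb, Finsupp.linearCombination_apply, Finsupp.sum, sum_inner, inner_smul_left]
      simp only [hδ, δ, lp.single_apply]
      by_cases hj : f j = 0
      · simp [Pi.single_apply, hj]
      · simp [Pi.single_apply, hj]
    rw [hδ] at this
    exact (starRingEnd ℂ).injective this
  -- The unbounded part contributes with the right sign: where `b j ≠ 0`, both `A` and `e` vanish,
  -- so the tested vector has the coordinate `f j` there.
  have hpos : ∀ f : ι →₀ ℂ, 0 ≤ (⟪S.proj (emb f) + S.A (S.proj (emb f)), bm f⟫_ℂ).re := fun f => by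
    simp only [bm, Finsupp.linearCombination_apply, Finsupp.sum, inner_sum, inner_smul_right, hδ,
      Complex.re_sum]
    refine Finset.sum_nonneg fun j _ => ?_
    by_cases hb : S.b j = 0
    · simp [hb]
    · have h1 : (S.proj (emb f) + S.A (S.proj (emb f))) j = f j := by
        rw [lp.coeFn_add, Pi.add_apply, S.A_apply _ _ hb]
        simp [proj_apply, S.e_apply j hb, hemb]
      rw [h1]
      have : f j * ((S.b j : ℂ) * starRingEnd ℂ (f j)) = ((S.b j * ‖f j‖ ^ 2 : ℝ) : ℂ) := by
        have := Complex.mul_conj' (f j)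
        push_cast
        rw [← this]; ring
      rw [this, Complex.ofReal_re]
      have := S.b_nonneg j
      positivity
  -- Coercivity gives `c ‖Y‖² ≤ 3/2 ‖Y‖ ‖T f‖`, a lower bound of `T` modulo `e` on finitely
  -- supported vectors.
  have hlow : ∀ f : ι →₀ ℂ, ‖S.proj (emb f)‖ ≤ 3 / (2 * S.c) * ‖T f‖ := fun f => by
    set Y := S.proj (emb f) with hY
    have h1 := S.coercive Y (S.inner_e_proj _)
    have h2 : S.c * ‖Y‖ ^ 2 ≤ (⟪Y + S.A Y, T f⟫_ℂ).re := by
      have : T f = S.G Y + bm f := by simp [T, hY, G_proj]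
      rw [this, inner_add_right, Complex.add_re]
      linarith [hpos f]
    have h3 : (⟪Y + S.A Y, T f⟫_ℂ).re ≤ 3 / 2 * ‖Y‖ * ‖T f‖ :=
      (Complex.re_le_norm _).trans ((norm_inner_le_norm _ _).trans (by
        gcongr; exact S.norm_add_A_le Y))
    rcases (norm_nonneg Y).eq_or_lt with h0 | h0
    · rw [← h0]; have := S.c_pos; positivity
    · have h4 : S.c * ‖Y‖ ≤ 3 / 2 * ‖T f‖ := by
        have : ‖Y‖ * (S.c * ‖Y‖) ≤ ‖Y‖ * (3 / 2 * ‖T f‖) := by nlinarith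
        exact le_of_mul_le_mul_left this h0
      have hc := S.c_pos
      rw [div_mul_eq_mul_div, le_div_iff₀ (by positivity)]
      linarith
  -- As `g ⊥ e`, the functional `⟪g, ·⟫` is controlled by `T` and hence represented by some `w`;
  -- testing with unit vectors turns this into the adjoint equation in coordinates.
  obtain ⟨w, hw⟩ := exists_inner_eq_of_norm_le T
    ((innerSL ℂ g).toLinearMap ∘ₗ emb) (‖g‖ * (3 / (2 * S.c))) (fun f => by
      have h1 : ⟪g, emb f⟫_ℂ = ⟪g, S.proj (emb f)⟫_ℂ := by
        have : ⟪g, S.e⟫_ℂ = 0 := by rw [← inner_conj_symm, hg]; simp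
        simp [proj, this]
      change ‖⟪g, emb f⟫_ℂ‖ ≤ _
      rw [h1, mul_assoc]
      exact (norm_inner_le_norm _ _).trans (by gcongr; exact hlow f))
  have hcomp : ∀ j, (ContinuousLinearMap.adjoint S.G w) j + S.b j * w j = g j := fun j => by
    have h1 := hw (Finsupp.single j 1)
    have h2 : ⟪g, δ j⟫_ℂ = ⟪w, S.G (δ j) + (S.b j : ℂ) • δ j⟫_ℂ := by
      simpa [T, emb, bm] using h1
    rw [inner_add_right, ← ContinuousLinearMap.adjoint_inner_left, inner_smul_right, hδ, hδ, hδ] at h2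
    have h3 := congrArg (starRingEnd ℂ) h2
    simpa using h3.symm
  have hadj_e : ContinuousLinearMap.adjoint S.G S.e = 0 := by
    refine ext_inner_right ℂ fun f => ?_
    rw [ContinuousLinearMap.adjoint_inner_left, S.e_G, inner_zero_left]
  -- Projecting `w` keeps the equation, since the adjoint of `G` and `b` both annihilate `e`.
  -- Defining `h` as the remainder makes it square summable without any bound on `b`.
  refine ⟨S.proj w, g - ContinuousLinearMap.adjoint S.G (S.proj w), S.inner_e_proj w,
    fun j => ?_, by abel⟩
  have h4 : ContinuousLinearMap.adjoint S.G (S.proj w) = ContinuousLinearMap.adjoint S.G w := by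
    simp [proj, hadj_e]
  rw [h4]
  have h5 : (S.b j : ℂ) * S.proj w j = S.b j * w j := by
    by_cases hb : S.b j = 0
    · simp [hb]
    · simp [proj_apply, S.e_apply j hb]
  rw [h5, lp.coeFn_sub, Pi.sub_apply, ← hcomp j]
  ring

end HypocoerciveGenerator

/-- A componentwise solution `R` of `R' = -(G + b) R - ξ` with values in `ℓ²(ι)`. -/
structure IsWeakSolution (G : Ell2 ℂ ι →L[ℂ] Ell2 ℂ ι) (b : ι → ℝ) (ξ R : ℝ → Ell2 ℂ ι) :
    Prop where
  cont : ∀ j, ContinuousOn (fun t => R t j) (Ici 0)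
  bdd : ∀ T, ∃ M, ∀ t ∈ Icc 0 T, ‖R t‖ ≤ M
  source_cont : ∀ j, ContinuousOn (fun t => ξ t j) (Ici 0)
  source_bdd : ∀ T, ∃ M, ∀ t ∈ Icc 0 T, ‖ξ t‖ ≤ M
  deriv : ∀ j, ∀ t > 0, HasDerivAt (fun t => R t j) (-(G (R t) j + b j * R t j + ξ t j)) t

/-- Componentwise continuous locally bounded curves in `ℓ²(ι)` are weakly continuous. -/
theorem continuousOn_inner_of_apply {R : ℝ → Ell2 ℂ ι}
    (hc : ∀ j, ContinuousOn (fun t => R t j) (Ici 0))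
    (hb : ∀ T, ∃ M, ∀ t ∈ Icc 0 T, ‖R t‖ ≤ M) (w : Ell2 ℂ ι) :
    ContinuousOn (fun t => ⟪w, R t⟫_ℂ) (Ici 0) := by
  classical
  intro t₀ ht₀
  obtain ⟨M, hM⟩ := hb (t₀ + 1)
  have hw : HasSum (fun j => lp.single 2 j (w j)) w := lp.hasSum_single (by norm_num) w
  -- Finite truncations of `w` have continuous pairings, and these converge uniformly on bounded
  -- time intervals because `R` is bounded there.
  have hu : TendstoUniformlyOn (fun (s : Finset ι) t => ⟪∑ j ∈ s, lp.single 2 j (w j), R t⟫_ℂ)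
      (fun t => ⟪w, R t⟫_ℂ) atTop (Icc 0 (t₀ + 1)) := by
    rw [Metric.tendstoUniformlyOn_iff]
    intro ε hε
    have hM0 : 0 ≤ M := (norm_nonneg _).trans (hM 0 ⟨le_rfl, by linarith [mem_Ici.mp ht₀]⟩)
    have := Metric.tendsto_nhds.mp (show Tendsto (fun s : Finset ι => ∑ j ∈ s, lp.single 2 j (w j)) atTop (𝓝 w) from hw)
      (ε / (M + 1)) (by positivity)
    filter_upwards [this] with s hs t ht
    rw [dist_eq_norm, ← inner_sub_left]
    refine (norm_inner_le_norm _ _).trans_lt ?_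
    rw [dist_eq_norm, norm_sub_rev] at hs
    have h1 := hM t ht
    calc _ ≤ ‖w - ∑ j ∈ s, lp.single 2 j (w j)‖ * (M + 1) := by gcongr; linarith
      _ < ε / (M + 1) * (M + 1) := by gcongr
      _ = ε := by field_simp
  have hcont : ContinuousOn (fun t => ⟪w, R t⟫_ℂ) (Icc 0 (t₀ + 1)) := by
    refine hu.continuousOn (Frequently.of_forall fun s => ?_)
    simp only [sum_inner, lp.inner_single_left]
    refine continuousOn_finsetSum _ fun j _ => ?_
    simp only [RCLike.inner_apply]
    exact ((hc j).mono Icc_subset_Ici_self).mul continuousOn_const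
  have h2 := hcont t₀ ⟨ht₀, by linarith⟩
  refine h2.mono_of_mem_nhdsWithin ?_
  rw [← Ici_inter_Iic]
  exact inter_mem self_mem_nhdsWithin (mem_nhdsWithin_of_mem_nhds (Iic_mem_nhds (by linarith)))

namespace IsWeakSolution

variable {G : Ell2 ℂ ι →L[ℂ] Ell2 ℂ ι} {b : ι → ℝ} {ξ R : ℝ → Ell2 ℂ ι}

/-- A weak solution can be tested against the elements of the domain of `b`. -/
theorem hasDerivAt_inner (hR : IsWeakSolution G b ξ R) {w h : Ell2 ℂ ι}
    (hwh : ∀ j, h j = b j * w j) {t : ℝ} (ht : 0 < t) :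
    HasDerivAt (fun t => ⟪w, R t⟫_ℂ)
      (-(⟪w, G (R t)⟫_ℂ + ⟪h, R t⟫_ℂ + ⟪w, ξ t⟫_ℂ)) t := by
  classical
  obtain ⟨M, hM⟩ := hR.bdd (t + 1)
  obtain ⟨M', hM'⟩ := hR.source_bdd (t + 1)
  have hM0 : 0 ≤ M := (norm_nonneg _).trans (hM 0 ⟨le_rfl, by linarith⟩)
  have hM0' : 0 ≤ M' := (norm_nonneg _).trans (hM' 0 ⟨le_rfl, by linarith⟩)
  let pr : Finset ι → Ell2 ℂ ι → Ell2 ℂ ι := fun s f => ∑ j ∈ s, lp.single 2 j (f j)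
  have hpr : ∀ f : Ell2 ℂ ι, Tendsto (fun s => pr s f) atTop (𝓝 f) := fun f =>
    (lp.hasSum_single (by norm_num) f : HasSum _ f)
  have hin : ∀ s (f g : Ell2 ℂ ι), ⟪pr s f, g⟫_ℂ = ∑ j ∈ s, g j * starRingEnd ℂ (f j) :=
    fun s f g => by simp [pr, lp.inner_single_left]
  -- For finite truncations `b` can be moved onto `w`, where it produces truncations of `h`; so the
  -- derivatives converge uniformly although `b` is unbounded.
  refine hasDerivAt_of_tendstoUniformlyOn (l := (atTop : Filter (Finset ι))) (s := Ioo 0 (t + 1))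
    (f := fun s t => ⟪pr s w, R t⟫_ℂ)
    (f' := fun s t => -(⟪pr s w, G (R t)⟫_ℂ + ⟪pr s h, R t⟫_ℂ + ⟪pr s w, ξ t⟫_ℂ))
    (g' := fun t => -(⟪w, G (R t)⟫_ℂ + ⟪h, R t⟫_ℂ + ⟪w, ξ t⟫_ℂ)) isOpen_Ioo ?_ ?_ ?_
    ⟨ht, by linarith⟩
  · rw [Metric.tendstoUniformlyOn_iff]
    intro ε hε
    set K := ‖G‖ * M + M + M' + 1 with hK
    have hK0 : 0 < K := by positivity
    filter_upwards [Metric.tendsto_nhds.mp (hpr w) (ε / (2 * K)) (by positivity),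
      Metric.tendsto_nhds.mp (hpr h) (ε / (2 * K)) (by positivity)] with s h1 h2 τ hτ
    have hτ' : τ ∈ Icc 0 (t + 1) := Ioo_subset_Icc_self hτ
    rw [dist_eq_norm, norm_sub_rev] at h1 h2
    have e1 : dist (-(⟪w, G (R τ)⟫_ℂ + ⟪h, R τ⟫_ℂ + ⟪w, ξ τ⟫_ℂ))
        (-(⟪pr s w, G (R τ)⟫_ℂ + ⟪pr s h, R τ⟫_ℂ + ⟪pr s w, ξ τ⟫_ℂ)) =
        ‖⟪w - pr s w, G (R τ)⟫_ℂ + ⟪h - pr s h, R τ⟫_ℂ + ⟪w - pr s w, ξ τ⟫_ℂ‖ := by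
      rw [dist_eq_norm, ← norm_neg]
      simp only [inner_sub_left]
      congr 1; ring
    rw [e1]
    have a1 : ‖⟪w - pr s w, G (R τ)⟫_ℂ‖ ≤ ε / (2 * K) * (‖G‖ * M) :=
      (norm_inner_le_norm _ _).trans (mul_le_mul h1.le
        ((G.le_opNorm _).trans (by gcongr; exact hM τ hτ')) (norm_nonneg _) (by positivity))
    have a2 : ‖⟪h - pr s h, R τ⟫_ℂ‖ ≤ ε / (2 * K) * M :=
      (norm_inner_le_norm _ _).trans (mul_le_mul h2.le (hM τ hτ') (norm_nonneg _) (by positivity))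
    have a3 : ‖⟪w - pr s w, ξ τ⟫_ℂ‖ ≤ ε / (2 * K) * M' :=
      (norm_inner_le_norm _ _).trans (mul_le_mul h1.le (hM' τ hτ') (norm_nonneg _) (by positivity))
    calc _ ≤ ε / (2 * K) * (‖G‖ * M) + ε / (2 * K) * M + ε / (2 * K) * M' :=
          norm_add₃_le.trans (by gcongr)
      _ ≤ ε / (2 * K) * K := by
          rw [← mul_add, ← mul_add]
          gcongr
          linarith
      _ = ε / 2 := by field_simp
      _ < ε := by linarith
  · refine Eventually.of_forall fun s τ hτ => ?_
    simp only [hin]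
    have := HasDerivAt.fun_sum (u := s) (A := fun j τ => R τ j * starRingEnd ℂ (w j))
      (fun j _ => (hR.deriv j τ hτ.1).mul_const (starRingEnd ℂ (w j)))
    convert this using 1
    rw [← Finset.sum_add_distrib, ← Finset.sum_add_distrib, ← Finset.sum_neg_distrib]
    refine Finset.sum_congr rfl fun j _ => ?_
    rw [hwh j]
    simp only [map_mul, Complex.conj_ofReal]
    ring
  · intro τ _
    exact ((continuous_id.inner continuous_const).tendsto w).comp (hpr w)

theorem continuousOn_inner (hR : IsWeakSolution G b ξ R) (w : Ell2 ℂ ι) :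
    ContinuousOn (fun t => ⟪w, R t⟫_ℂ) (Ici 0) :=
  continuousOn_inner_of_apply hR.cont hR.bdd w

theorem continuousOn_source_inner (hR : IsWeakSolution G b ξ R) (w : Ell2 ℂ ι) :
    ContinuousOn (fun t => ⟪w, ξ t⟫_ℂ) (Ici 0) :=
  continuousOn_inner_of_apply hR.source_cont hR.source_bdd w

/-- A coordinate of `L (R t)` is the pairing of `R t` with the adjoint of `L` applied to a unit
vector, so weak continuity suffices. -/
theorem continuousOn_clm_apply (hR : IsWeakSolution G b ξ R) (L : Ell2 ℂ ι →L[ℂ] Ell2 ℂ ι)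
    (j : ι) : ContinuousOn (fun t => L (R t) j) (Ici 0) := by
  classical
  have := hR.continuousOn_inner (ContinuousLinearMap.adjoint L (lp.single 2 j (1 : ℂ)))
  refine this.congr fun t _ => ?_
  simp only [ContinuousLinearMap.adjoint_inner_left, ← Ell2.apply_eq_inner]

theorem continuousOn_clm_source_apply (hR : IsWeakSolution G b ξ R)
    (L : Ell2 ℂ ι →L[ℂ] Ell2 ℂ ι) (j : ι) : ContinuousOn (fun t => L (ξ t) j) (Ici 0) := by
  classical
  have := hR.continuousOn_source_inner (ContinuousLinearMap.adjoint L (lp.single 2 j (1 : ℂ)))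
  refine this.congr fun t _ => ?_
  simp only [ContinuousLinearMap.adjoint_inner_left, ← Ell2.apply_eq_inner]

end IsWeakSolution

end AbstractDynamics

/-! ### The energy estimate in the modified inner product. -/

section Energy

open scoped InnerProductSpace
open Set

variable {ι : Type*}

theorem Ell2.hasSum_re_inner (f g : Ell2 ℂ ι) :
    HasSum (fun j => (starRingEnd ℂ (f j) * g j).re) (⟪f, g⟫_ℂ).re := by
  have := Complex.hasSum_re (Ell2.hasSum_inner f g)
  simpa [mul_comm] using this

theorem Ell2.sum_abs_re_le (f g : Ell2 ℂ ι) (s : Finset ι) :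
    ∑ j ∈ s, |(starRingEnd ℂ (f j) * g j).re| ≤ ‖f‖ * ‖g‖ := by
  refine (Finset.sum_le_sum fun j _ => (?_ : _ ≤ ‖f j‖ * ‖g j‖)).trans
    ((Summable.sum_le_tsum s (fun _ _ => by positivity) (f.summable_mul g)).trans (f.tsum_mul_le g))
  refine (Complex.abs_re_le_norm _).trans_eq ?_
  simp

namespace HypocoerciveGenerator

variable (S : HypocoerciveGenerator ι) {ξ Y : ℝ → Ell2 ℂ ι}

/-- The modified energy `⟪Y, (1 + A) Y⟫`. -/
def energy (Y : Ell2 ℂ ι) : ℝ := (⟪Y, Y + S.A Y⟫_ℂ).re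

theorem energy_le (Y : Ell2 ℂ ι) : S.energy Y ≤ 3 / 2 * ‖Y‖ ^ 2 := by
  refine (Complex.re_le_norm _).trans ((norm_inner_le_norm _ _).trans ?_)
  have := S.norm_add_A_le Y
  nlinarith [norm_nonneg Y]

theorem le_energy (Y : Ell2 ℂ ι) : 1 / 2 * ‖Y‖ ^ 2 ≤ S.energy Y := by
  have h1 : ‖S.A Y‖ ≤ 1 / 2 * ‖Y‖ := S.A.le_of_opNorm_le S.norm_A Y
  have h2 : |(⟪Y, S.A Y⟫_ℂ).re| ≤ ‖Y‖ * (1 / 2 * ‖Y‖) :=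
    (Complex.abs_re_le_norm _).trans ((norm_inner_le_norm _ _).trans (by gcongr))
  have h3 : (⟪Y, Y⟫_ℂ).re = ‖Y‖ ^ 2 := by
    rw [inner_self_eq_norm_sq_to_K]; norm_cast
  rw [energy, inner_add_right, Complex.add_re, h3]
  have := (abs_le.mp h2).1
  linarith

/-- The part of the time derivative of the energy density (weighted by `exp (γ t)`) that does not
involve the unbounded multiplication operator. -/
def energyRate (γ : ℝ) (Y f : Ell2 ℂ ι) (j : ι) : ℝ :=
  γ * (starRingEnd ℂ (Y j) * (Y + S.A Y) j).re - (starRingEnd ℂ (Y j) * f j).re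
    - (starRingEnd ℂ (f j) * (Y + S.A Y) j).re - (starRingEnd ℂ (Y j) * S.A f j).re

theorem hasSum_energyRate (γ : ℝ) (Y f : Ell2 ℂ ι) :
    HasSum (S.energyRate γ Y f) (γ * S.energy Y - 2 * (⟪Y + S.A Y, f⟫_ℂ).re) := by
  have h := ((((Ell2.hasSum_re_inner Y (Y + S.A Y)).mul_left γ).sub
    (Ell2.hasSum_re_inner Y f)).sub (Ell2.hasSum_re_inner f (Y + S.A Y))).sub
    (Ell2.hasSum_re_inner Y (S.A f))
  convert! h using 1
  have h1 : (⟪f, Y + S.A Y⟫_ℂ).re = (⟪Y + S.A Y, f⟫_ℂ).re := by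
    rw [← inner_conj_symm, Complex.conj_re]
  have h2 : ⟪Y, S.A f⟫_ℂ = ⟪S.A Y, f⟫_ℂ := (S.A_symm _ _).symm
  rw [h1, h2, energy, inner_add_left, Complex.add_re]
  ring

theorem sum_energyRate_le (γ : ℝ) (Y f : Ell2 ℂ ι) (s : Finset ι) :
    ‖∑ j ∈ s, S.energyRate γ Y f j‖ ≤
      |γ| * (‖Y‖ * (3 / 2 * ‖Y‖)) + ‖Y‖ * ‖f‖ + ‖f‖ * (3 / 2 * ‖Y‖) + ‖Y‖ * (1 / 2 * ‖f‖) := by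
  refine (norm_sum_le _ _).trans ?_
  have h1 := Ell2.sum_abs_re_le Y (Y + S.A Y) s
  have h2 := Ell2.sum_abs_re_le Y f s
  have h3 := Ell2.sum_abs_re_le f (Y + S.A Y) s
  have h4 := Ell2.sum_abs_re_le Y (S.A f) s
  have h5 := S.norm_add_A_le Y
  have h6 : ‖S.A f‖ ≤ 1 / 2 * ‖f‖ := S.A.le_of_opNorm_le S.norm_A f
  calc ∑ j ∈ s, ‖S.energyRate γ Y f j‖
      ≤ ∑ j ∈ s, (|γ| * |(starRingEnd ℂ (Y j) * (Y + S.A Y) j).re|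
        + |(starRingEnd ℂ (Y j) * f j).re| + |(starRingEnd ℂ (f j) * (Y + S.A Y) j).re|
        + |(starRingEnd ℂ (Y j) * S.A f j).re|) := by
        refine Finset.sum_le_sum fun j _ => ?_
        rw [energyRate, Real.norm_eq_abs, ← abs_mul]
        refine (abs_sub _ _).trans (add_le_add_left ?_ _)
        refine (abs_sub _ _).trans (add_le_add_left ?_ _)
        exact abs_sub _ _
    _ ≤ _ := by
        rw [Finset.sum_add_distrib, Finset.sum_add_distrib, Finset.sum_add_distrib,
          ← Finset.mul_sum]
        gcongr
        · exact h1.trans (by gcongr)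
        · exact h3.trans (by gcongr)
        · exact h4.trans (by gcongr)

/-- The curve is only weakly continuous and `b` is unbounded, so the energy is differentiated
coordinate by coordinate. The `b`-terms of each coordinate have a sign and are dropped, which leaves
an inequality; the remaining terms can be summed under the integral. -/
theorem energy_integral_le [Countable ι] (hY : IsWeakSolution S.G S.b ξ Y) (γ : ℝ) {T : ℝ}
    (hT : 0 ≤ T) :
    Real.exp (γ * T) * S.energy (Y T) - S.energy (Y 0) ≤
      ∫ t in (0 : ℝ)..T, Real.exp (γ * t) *
        (γ * S.energy (Y t) - 2 * (⟪Y t + S.A (Y t), S.G (Y t) + ξ t⟫_ℂ).re) := by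
  classical
  set f : ℝ → Ell2 ℂ ι := fun t => S.G (Y t) + ξ t with hf
  let dens : ι → ℝ → ℝ := fun j t =>
    Real.exp (γ * t) * (starRingEnd ℂ (Y t j) * (Y t + S.A (Y t)) j).re
  have hYc := hY.cont
  have hAc : ∀ j, ContinuousOn (fun t => (Y t + S.A (Y t)) j) (Ici 0) := fun j =>
    (hY.cont j).add (hY.continuousOn_clm_apply S.A j)
  have hfc : ∀ j, ContinuousOn (fun t => f t j) (Ici 0) := fun j =>
    (hY.continuousOn_clm_apply S.G j).add (hY.source_cont j)
  have hAfc : ∀ j, ContinuousOn (fun t => S.A (f t) j) (Ici 0) := fun j => by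
    have : ∀ t, S.A (f t) j = (S.A ∘L S.G) (Y t) j + S.A (ξ t) j := fun t => by simp [hf]
    simp only [this]
    exact (hY.continuousOn_clm_apply _ j).add (hY.continuousOn_clm_source_apply _ j)
  have hexp : ContinuousOn (fun t : ℝ => Real.exp (γ * t)) (Ici 0) := by fun_prop
  have hrate : ∀ j, ContinuousOn (fun t => Real.exp (γ * t) * S.energyRate γ (Y t) (f t) j)
      (Ici 0) := fun j => by
    unfold energyRate
    have c1 := Complex.continuous_conj.comp_continuousOn (hYc j)
    have c2 := Complex.continuous_conj.comp_continuousOn (hfc j)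
    refine hexp.mul ((((continuousOn_const.mul ?_).sub ?_).sub ?_).sub ?_)
    · exact Complex.continuous_re.comp_continuousOn (c1.mul (hAc j))
    · exact Complex.continuous_re.comp_continuousOn (c1.mul (hfc j))
    · exact Complex.continuous_re.comp_continuousOn (c2.mul (hAc j))
    · exact Complex.continuous_re.comp_continuousOn (c1.mul (hAfc j))
  -- `A` maps unit vectors to vectors supported where `b` vanishes, hence no `b`-term appears in the
  -- derivative of `A (Y t)`.
  have hderivA : ∀ j, ∀ t > 0, HasDerivAt (fun t => S.A (Y t) j) (-(S.A (f t) j)) t := fun j t ht => by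
    have h0 : ∀ k, (0 : Ell2 ℂ ι) k = S.b k * (S.A (lp.single 2 j (1 : ℂ))) k := fun k => by
      by_cases hb : S.b k = 0
      · simp [hb]
      · simp [S.A_apply _ k hb]
    have := hY.hasDerivAt_inner h0 ht
    simp only [S.A_symm, ← Ell2.apply_eq_inner, inner_zero_left, add_zero] at this
    simpa [hf] using this
  have hderivY : ∀ j, ∀ t > 0, HasDerivAt (fun t => Y t j) (-(f t j + S.b j * Y t j)) t :=
    fun j t ht => by
      have := hY.deriv j t ht
      convert this using 1
      simp only [hf, lp.coeFn_add, Pi.add_apply]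
      ring
  have hstep : ∀ j, dens j T - dens j 0 ≤
      ∫ t in (0 : ℝ)..T, Real.exp (γ * t) * S.energyRate γ (Y t) (f t) j := fun j => by
    have hd : ∀ t > 0, HasDerivAt (dens j) (Real.exp (γ * t) * S.energyRate γ (Y t) (f t) j
        - 2 * Real.exp (γ * t) * (S.b j * ‖Y t j‖ ^ 2)) t := fun t ht => by
      have d1 := hderivY j t ht
      have d2 : HasDerivAt (fun t => starRingEnd ℂ (Y t j))
          (starRingEnd ℂ (-(f t j + S.b j * Y t j))) t := d1.star
      have d3 : HasDerivAt (fun t => (Y t + S.A (Y t)) j)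
          (-(f t j + S.b j * Y t j) + -(S.A (f t) j)) t := d1.add (hderivA j t ht)
      have d4 := (d2.mul d3)
      have d5 : HasDerivAt (fun t => (starRingEnd ℂ (Y t j) * (Y t + S.A (Y t)) j).re)
          _ t := (Complex.reCLM.hasFDerivAt.comp_hasDerivAt t d4)
      have d6 : HasDerivAt (fun t => Real.exp (γ * t)) (Real.exp (γ * t) * γ) t := by
        simpa using ((hasDerivAt_id t).const_mul γ).exp
      convert! d6.mul d5 using 1
      -- The two `b`-terms coincide: `b` does not see `A Y`, so each of them equals `b |Y|²`.
      have hb0 : S.b j * ‖Y t j‖ ^ 2 + S.b j * ‖Y t j‖ ^ 2 =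
          ((starRingEnd ℂ (S.b j * Y t j)) * (Y t + S.A (Y t)) j
            + starRingEnd ℂ (Y t j) * (S.b j * Y t j)).re := by
        have e1 : (S.b j : ℂ) * (Y t + S.A (Y t)) j = S.b j * Y t j := by
          by_cases hb : S.b j = 0
          · simp [hb]
          · simp [S.A_apply _ j hb]
        have e2 : starRingEnd ℂ (Y t j) * Y t j = ((‖Y t j‖ ^ 2 : ℝ) : ℂ) := by
          rw [Complex.conj_mul']; push_cast; ring
        have e3 : (starRingEnd ℂ (S.b j * Y t j)) * (Y t + S.A (Y t)) j
            = ((S.b j * ‖Y t j‖ ^ 2 : ℝ) : ℂ) := by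
          rw [map_mul, Complex.conj_ofReal, mul_right_comm, e1, mul_right_comm, mul_assoc, e2]
          push_cast; ring
        have e4 : starRingEnd ℂ (Y t j) * (S.b j * Y t j) = ((S.b j * ‖Y t j‖ ^ 2 : ℝ) : ℂ) := by
          rw [mul_left_comm, e2]; push_cast; ring
        rw [e3, e4, ← Complex.ofReal_add, Complex.ofReal_re]
      have hb1 : 2 * Real.exp (γ * t) * (S.b j * ‖Y t j‖ ^ 2) =
        Real.exp (γ * t) * (S.b j * ‖Y t j‖ ^ 2 + S.b j * ‖Y t j‖ ^ 2) := by ring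
      rw [hb1, hb0]
      simp only [energyRate, Complex.reCLM_apply, map_neg, map_add, Complex.add_re, neg_mul,
        mul_neg, add_mul, mul_add]
      ring
    have hc : ContinuousOn (dens j) (Icc 0 T) := by
      refine (hexp.mul (Complex.continuous_re.comp_continuousOn
        ((Complex.continuous_conj.comp_continuousOn (hYc j)).mul (hAc j)))).mono Icc_subset_Ici_self
    have hc2 : ContinuousOn (fun t => Real.exp (γ * t) * S.energyRate γ (Y t) (f t) j
        - 2 * Real.exp (γ * t) * (S.b j * ‖Y t j‖ ^ 2)) (Icc 0 T) := by
      refine ((hrate j).mono Icc_subset_Ici_self).sub ?_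
      have := (hYc j).mono (Icc_subset_Ici_self : Icc 0 T ⊆ Ici 0)
      fun_prop
    have hc1 : ContinuousOn (fun t => Real.exp (γ * t) * S.energyRate γ (Y t) (f t) j) (Icc 0 T) :=
      (hrate j).mono Icc_subset_Ici_self
    rw [← intervalIntegral.integral_eq_sub_of_hasDerivAt_of_le hT hc (fun t ht => hd t ht.1)
      (ContinuousOn.intervalIntegrable_of_Icc hT hc2)]
    refine intervalIntegral.integral_mono_on hT (ContinuousOn.intervalIntegrable_of_Icc hT hc2)
      (ContinuousOn.intervalIntegrable_of_Icc hT hc1) fun t _ => ?_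
    have := S.b_nonneg j
    have : 0 ≤ 2 * Real.exp (γ * t) * (S.b j * ‖Y t j‖ ^ 2) := by positivity
    linarith
  have hdens : ∀ t, HasSum (fun j => dens j t) (Real.exp (γ * t) * S.energy (Y t)) := fun t =>
    (Ell2.hasSum_re_inner (Y t) (Y t + S.A (Y t))).mul_left _
  have hL : Tendsto (fun s : Finset ι => ∑ j ∈ s, (dens j T - dens j 0)) atTop
      (𝓝 (Real.exp (γ * T) * S.energy (Y T) - S.energy (Y 0))) := by
    have := (hdens T).sub (hdens 0)
    simp only [mul_zero, Real.exp_zero, one_mul] at this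
    exact this
  obtain ⟨M, hM⟩ := hY.bdd T
  obtain ⟨M', hM'⟩ := hY.source_bdd T
  have hM0 : 0 ≤ M := (norm_nonneg _).trans (hM 0 ⟨le_rfl, hT⟩)
  have hM0' : 0 ≤ M' := (norm_nonneg _).trans (hM' 0 ⟨le_rfl, hT⟩)
  -- Dominated convergence along finite sets of coordinates; countability of `ι` makes this filter
  -- countably generated.
  have hI : Tendsto (fun s : Finset ι => ∫ t in (0 : ℝ)..T,
      ∑ j ∈ s, Real.exp (γ * t) * S.energyRate γ (Y t) (f t) j) atTop
      (𝓝 (∫ t in (0 : ℝ)..T, Real.exp (γ * t) *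
        (γ * S.energy (Y t) - 2 * (⟪Y t + S.A (Y t), S.G (Y t) + ξ t⟫_ℂ).re))) := by
    have hF : ∀ t ∈ Icc 0 T, ‖f t‖ ≤ ‖S.G‖ * M + M' := fun t ht =>
      (norm_add_le _ _).trans (add_le_add ((S.G.le_opNorm _).trans
        (by gcongr; exact hM t ht)) (hM' t ht))
    refine intervalIntegral.tendsto_integral_filter_of_dominated_convergence
      (fun _ => Real.exp (|γ| * T) * (|γ| * (M * (3 / 2 * M)) + M * (‖S.G‖ * M + M') +
        (‖S.G‖ * M + M') * (3 / 2 * M) + M * (1 / 2 * (‖S.G‖ * M + M')))) ?_ ?_ ?_ ?_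
    · refine Eventually.of_forall fun s => ?_
      rw [uIoc_of_le hT]
      refine ContinuousOn.aestronglyMeasurable ?_ measurableSet_Ioc
      exact continuousOn_finsetSum _ fun j _ =>
        (hrate j).mono (Ioc_subset_Icc_self.trans Icc_subset_Ici_self)
    · refine Eventually.of_forall fun s => Eventually.of_forall fun t ht => ?_
      rw [uIoc_of_le hT] at ht
      have ht' : t ∈ Icc 0 T := Ioc_subset_Icc_self ht
      rw [← Finset.mul_sum, norm_mul, Real.norm_of_nonneg (Real.exp_pos _).le]
      have h1 := hM t ht'
      have h2 := hF t ht'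
      have h3 : γ * t ≤ |γ| * T := by
        have := ht.1
        calc γ * t ≤ |γ| * t := by gcongr; exact le_abs_self γ
          _ ≤ |γ| * T := by gcongr; exact ht.2
      refine mul_le_mul (Real.exp_le_exp.mpr h3) ((S.sum_energyRate_le γ (Y t) (f t) s).trans ?_)
        (norm_nonneg _) (Real.exp_pos _).le
      gcongr
    · exact intervalIntegrable_const
    · refine Eventually.of_forall fun t _ => ?_
      have := (S.hasSum_energyRate γ (Y t) (f t)).mul_left (Real.exp (γ * t))
      exact this
  refine le_of_tendsto_of_tendsto' hL hI fun s => ?_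
  rw [intervalIntegral.integral_finsetSum]
  · exact Finset.sum_le_sum fun j _ => hstep j
  · exact fun j _ => ContinuousOn.intervalIntegrable_of_Icc hT
      ((hrate j).mono Icc_subset_Ici_self)

/-- Solutions in the complement of the stationary vector stay bounded, uniformly in time. -/
theorem norm_sq_le_of_orthogonal [Countable ι] (hY : IsWeakSolution S.G S.b ξ Y)
    (horth : ∀ t ≥ 0, ⟪S.e, Y t⟫_ℂ = 0) {δ₀ δ₁ : ℝ} (hδ₁ : δ₁ ≤ S.c / 6)
    (hξ : ∀ t ≥ 0, ‖ξ t‖ ≤ δ₀ + δ₁ * ‖Y t‖) {T : ℝ} (hT : 0 ≤ T) :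
    ‖Y T‖ ^ 2 ≤ 3 * ‖Y 0‖ ^ 2 + 14 * δ₀ ^ 2 / S.c ^ 2 := by
  have hc := S.c_pos
  -- `γ` spends half of the coercivity `2 c`, since the energy is at most `3/2 ‖Y‖²`. Of the other
  -- half, `3 δ₁ ‖Y‖²` takes at most `c / 2`, and completing the square for `3 δ₀ ‖Y‖` takes `c / 2`
  -- and leaves the constant `k`.
  set γ := 2 * S.c / 3 with hγ
  have hγ0 : 0 < γ := by positivity
  have key := S.energy_integral_le hY γ hT
  set k := 9 * δ₀ ^ 2 / (2 * S.c) with hk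
  have hpt : ∀ t ∈ Icc 0 T, Real.exp (γ * t) * (γ * S.energy (Y t)
      - 2 * (⟪Y t + S.A (Y t), S.G (Y t) + ξ t⟫_ℂ).re) ≤ Real.exp (γ * t) * k := fun t ht => by
    refine mul_le_mul_of_nonneg_left ?_ (Real.exp_pos _).le
    have h1 := S.coercive (Y t) (horth t ht.1)
    have h2 : |(⟪Y t + S.A (Y t), ξ t⟫_ℂ).re| ≤ 3 / 2 * ‖Y t‖ * (δ₀ + δ₁ * ‖Y t‖) :=
      (Complex.abs_re_le_norm _).trans ((norm_inner_le_norm _ _).trans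
        (mul_le_mul (S.norm_add_A_le _) (hξ t ht.1) (norm_nonneg _) (by positivity)))
    have h3 := (abs_le.mp h2).1
    have h4 := S.energy_le (Y t)
    rw [inner_add_right, Complex.add_re]
    set y := ‖Y t‖ with hy
    have hy0 : 0 ≤ y := norm_nonneg _
    have h5 : γ * S.energy (Y t) ≤ S.c * y ^ 2 := by
      calc γ * S.energy (Y t) ≤ γ * (3 / 2 * y ^ 2) := by gcongr
        _ = S.c * y ^ 2 := by rw [hγ]; ring
    have h6 : δ₁ * y ^ 2 ≤ S.c / 6 * y ^ 2 := by gcongr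
    have h7 : 3 * y * δ₀ ≤ S.c / 2 * y ^ 2 + k := by
      have : k = (3 * δ₀) ^ 2 / (2 * S.c) := by rw [hk]; ring
      rw [this]
      have h8 : S.c / 2 * y ^ 2 + (3 * δ₀) ^ 2 / (2 * S.c) - 3 * y * δ₀ =
        (S.c * y - 3 * δ₀) ^ 2 / (2 * S.c) := by field_simp; ring
      have : 0 ≤ (S.c * y - 3 * δ₀) ^ 2 / (2 * S.c) := by positivity
      linarith
    nlinarith
  have hint : ∫ t in (0 : ℝ)..T, Real.exp (γ * t) * k = (Real.exp (γ * T) - 1) / γ * k := by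
    rw [intervalIntegral.integral_mul_const,
      intervalIntegral.integral_comp_mul_left (fun x => Real.exp x) hγ0.ne', integral_exp]
    simp only [smul_eq_mul, mul_zero, Real.exp_zero]
    ring
  have hmain : Real.exp (γ * T) * S.energy (Y T) - S.energy (Y 0) ≤
      (Real.exp (γ * T) - 1) / γ * k := by
    rw [← hint]
    refine key.trans ?_
    have hi2 : IntervalIntegrable (fun t => Real.exp (γ * t) * k) volume 0 T :=
      Continuous.intervalIntegrable (by fun_prop) _ _
    -- Without integrability the integral is `0` by convention, and the bound holds because its
    -- right-hand side is nonnegative.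
    by_cases hi : IntervalIntegrable (fun t => Real.exp (γ * t) * (γ * S.energy (Y t)
      - 2 * (⟪Y t + S.A (Y t), S.G (Y t) + ξ t⟫_ℂ).re)) volume 0 T
    · exact intervalIntegral.integral_mono_on hT hi hi2 hpt
    · rw [intervalIntegral.integral_undef hi, hint]
      have : 1 ≤ Real.exp (γ * T) := Real.one_le_exp (by positivity)
      have h0 : 0 ≤ k := by positivity
      have : 0 ≤ Real.exp (γ * T) - 1 := by linarith
      positivity
  have h1 := S.energy_le (Y 0)
  have h2 := S.le_energy (Y T)
  have h3 : 1 ≤ Real.exp (γ * T) := Real.one_le_exp (by positivity)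
  have h0 : 0 ≤ k / γ := by positivity
  have h4 : (Real.exp (γ * T) - 1) / γ * k ≤ Real.exp (γ * T) * (k / γ) := by
    have : (Real.exp (γ * T) - 1) / γ * k = (Real.exp (γ * T) - 1) * (k / γ) := by ring
    rw [this]
    gcongr
    linarith
  have h5 : S.energy (Y T) ≤ 3 / 2 * ‖Y 0‖ ^ 2 + k / γ := by
    have h6 : Real.exp (γ * T) * S.energy (Y T) ≤
        Real.exp (γ * T) * (3 / 2 * ‖Y 0‖ ^ 2 + k / γ) := by
      have : 3 / 2 * ‖Y 0‖ ^ 2 ≤ Real.exp (γ * T) * (3 / 2 * ‖Y 0‖ ^ 2) :=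
        le_mul_of_one_le_left (by positivity) h3
      nlinarith
    exact le_of_mul_le_mul_left h6 (Real.exp_pos _)
  have h7 : 2 * (k / γ) ≤ 14 * δ₀ ^ 2 / S.c ^ 2 := by
    have : 2 * (k / γ) = 27 / 2 * δ₀ ^ 2 / S.c ^ 2 := by
      rw [hk, hγ]; field_simp; ring
    rw [this]
    gcongr
    norm_num
  linarith

end HypocoerciveGenerator

end Energy

/-! ### Perturbation of the stationary eigenvalue. -/

section Perturbation

open scoped InnerProductSpace
open Set

variable {ι : Type*}

/-- The weak equation says nothing at time zero, so this mean value inequality uses derivatives in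
the open interval only and reaches the left end by continuity. -/
theorem norm_image_sub_le_of_hasDerivAt_Ioo {E : Type*} [NormedAddCommGroup E] [NormedSpace ℝ E]
    {f f' : ℝ → E} {a b C : ℝ} (hab : a ≤ b) (hc : ContinuousOn f (Icc a b))
    (hd : ∀ t ∈ Ioo a b, HasDerivAt f (f' t) t) (hb : ∀ t ∈ Ioo a b, ‖f' t‖ ≤ C) :
    ‖f b - f a‖ ≤ C * (b - a) := by
  rcases hab.eq_or_lt with rfl | hab'
  · simp
  have h1 : ∀ t ∈ Ioo a b, ‖f b - f t‖ ≤ C * (b - t) := fun t ht =>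
    norm_image_sub_le_of_norm_deriv_right_le_segment (hc.mono (Icc_subset_Icc_left ht.1.le))
      (fun τ hτ => (hd τ ⟨ht.1.trans_le hτ.1, hτ.2⟩).hasDerivWithinAt)
      (fun τ hτ => hb τ ⟨ht.1.trans_le hτ.1, hτ.2⟩) b ⟨ht.2.le, le_rfl⟩
  have h2 : ContinuousWithinAt f (Ioo a b) a :=
    (hc a ⟨le_rfl, hab⟩).mono Ioo_subset_Icc_self
  have : (𝓝[Ioo a b] a).NeBot := left_nhdsWithin_Ioo_neBot hab'
  refine le_of_tendsto_of_tendsto (b := 𝓝[Ioo a b] a) (tendsto_const_nhds.sub h2).norm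
    (ContinuousWithinAt.tendsto (f := fun t => C * (b - t)) (by fun_prop)) ?_
  filter_upwards [self_mem_nhdsWithin] with t ht using h1 t ht

namespace IsWeakSolution

variable {G : Ell2 ℂ ι →L[ℂ] Ell2 ℂ ι} {b : ι → ℝ} {ξ R : ℝ → Ell2 ℂ ι}

/-- A change of the bounded part of the generator can be moved to the source term. -/
theorem change_generator (hR : IsWeakSolution G b ξ R) (G' : Ell2 ℂ ι →L[ℂ] Ell2 ℂ ι) :
    IsWeakSolution G' b (fun t => (G - G') (R t) + ξ t) R where
  cont := hR.cont
  bdd := hR.bdd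
  source_cont j := (hR.continuousOn_clm_apply (G - G') j).add (hR.source_cont j)
  source_bdd T := by
    obtain ⟨M, hM⟩ := hR.bdd T
    obtain ⟨M', hM'⟩ := hR.source_bdd T
    refine ⟨‖G - G'‖ * M + M', fun t ht => (norm_add_le _ _).trans (add_le_add ?_ (hM' t ht))⟩
    exact ((G - G').le_opNorm _).trans (by gcongr; exact hM t ht)
  deriv j t ht := by
    convert! hR.deriv j t ht using 1
    simp only [_root_.sub_apply, lp.coeFn_add, lp.coeFn_sub, Pi.add_apply,
      Pi.sub_apply]
    ring

theorem sub {ξ' R' : ℝ → Ell2 ℂ ι} (hR : IsWeakSolution G b ξ R) (hR' : IsWeakSolution G b ξ' R') :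
    IsWeakSolution G b (fun t => ξ t - ξ' t) (fun t => R t - R' t) where
  cont j := (hR.cont j).sub (hR'.cont j)
  bdd T := by
    obtain ⟨M, hM⟩ := hR.bdd T
    obtain ⟨M', hM'⟩ := hR'.bdd T
    exact ⟨M + M', fun t ht => (norm_sub_le _ _).trans (add_le_add (hM t ht) (hM' t ht))⟩
  source_cont j := (hR.source_cont j).sub (hR'.source_cont j)
  source_bdd T := by
    obtain ⟨M, hM⟩ := hR.source_bdd T
    obtain ⟨M', hM'⟩ := hR'.source_bdd T
    exact ⟨M + M', fun t ht => (norm_sub_le _ _).trans (add_le_add (hM t ht) (hM' t ht))⟩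
  deriv j t ht := by
    convert! (hR.deriv j t ht).sub (hR'.deriv j t ht) using 1
    simp only [map_sub, lp.coeFn_sub, Pi.sub_apply]
    ring

end IsWeakSolution

/-- The projection commutes with the generator, because `e` is annihilated by `G`, by its adjoint
and by `b`; only the source gets projected. -/
theorem IsWeakSolution.proj {S : HypocoerciveGenerator ι} {ξ R : ℝ → Ell2 ℂ ι}
    (hR : IsWeakSolution S.G S.b ξ R) :
    IsWeakSolution S.G S.b (fun t => S.proj (ξ t)) (fun t => S.proj (R t)) where
  cont j := (hR.cont j).sub ((hR.continuousOn_inner S.e).mul continuousOn_const)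
  bdd T := by
    obtain ⟨M, hM⟩ := hR.bdd T
    exact ⟨M, fun t ht => (S.norm_proj_le _).trans (hM t ht)⟩
  source_cont j := (hR.source_cont j).sub ((hR.continuousOn_source_inner S.e).mul continuousOn_const)
  source_bdd T := by
    obtain ⟨M, hM⟩ := hR.source_bdd T
    exact ⟨M, fun t ht => (S.norm_proj_le _).trans (hM t ht)⟩
  deriv j t ht := by
    have h0 : ∀ k, (0 : Ell2 ℂ ι) k = S.b k * S.e k := fun k => by
      by_cases hb : S.b k = 0
      · simp [hb]
      · simp [S.e_apply k hb]
    have h1 := ((hR.hasDerivAt_inner h0 ht).mul_const (S.e j))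
    convert! (hR.deriv j t ht).sub h1 using 1
    have h2 : (S.b j : ℂ) * S.proj (R t) j = S.b j * R t j := by
      by_cases hb : S.b j = 0
      · simp [hb]
      · simp [S.proj_apply, S.e_apply j hb]
    rw [S.G_proj, h2, S.proj_apply, S.e_G, inner_zero_left]
    ring

/-- A hypocoercive generator with a three times differentiable perturbation of its bounded part,
and a solution `w₁` of the corrector equation. -/
structure PerturbedGenerator (ι : Type*) extends HypocoerciveGenerator ι where
  Gs : ℝ → Ell2 ℂ ι →L[ℂ] Ell2 ℂ ι
  G₁ : Ell2 ℂ ι →L[ℂ] Ell2 ℂ ι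
  G₂ : Ell2 ℂ ι →L[ℂ] Ell2 ℂ ι
  K : ℝ
  taylor : ∀ s, |s| ≤ 1 → ‖Gs s - G - ((s : ℂ) • G₁ + (s : ℂ) ^ 2 • G₂)‖ ≤ K * |s| ^ 3
  e_G₁_e : ⟪e, G₁ e⟫_ℂ = 0
  e_G₂_e : ⟪e, G₂ e⟫_ℂ = 0
  w₁ : Ell2 ℂ ι
  h₁ : Ell2 ℂ ι
  e_w₁ : ⟪e, w₁⟫_ℂ = 0
  h₁_apply : ∀ j, h₁ j = b j * w₁ j
  corrector : ContinuousLinearMap.adjoint G w₁ + h₁ = -ContinuousLinearMap.adjoint G₁ e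
  re_nonneg : 0 ≤ (⟪w₁, G₁ e⟫_ℂ).re

namespace PerturbedGenerator

variable (S : PerturbedGenerator ι)

/-- The second order coefficient of the perturbed eigenvalue. -/
def ν : ℂ := ⟪S.w₁, S.G₁ S.e⟫_ℂ

theorem K_nonneg : 0 ≤ S.K := by
  have := (norm_nonneg _).trans (S.taylor 1 (by simp))
  simpa using this

/-- A bound on `(Gs s - G) / s`. -/
def L : ℝ := ‖S.G₁‖ + ‖S.G₂‖ + S.K

theorem L_nonneg : 0 ≤ S.L := by
  have := S.K_nonneg
  unfold L; positivity

theorem norm_Gs_sub_le {s : ℝ} (hs : |s| ≤ 1) : ‖S.Gs s - S.G‖ ≤ S.L * |s| := by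
  have h1 := S.taylor s hs
  have h2 : S.Gs s - S.G = (S.Gs s - S.G - ((s : ℂ) • S.G₁ + (s : ℂ) ^ 2 • S.G₂)) +
    ((s : ℂ) • S.G₁ + (s : ℂ) ^ 2 • S.G₂) := by abel
  rw [h2]
  have h3 : ‖(s : ℂ) • S.G₁‖ = |s| * ‖S.G₁‖ := by rw [norm_smul]; simp
  have h4 : ‖(s : ℂ) ^ 2 • S.G₂‖ = |s| ^ 2 * ‖S.G₂‖ := by rw [norm_smul]; simp
  have hK := S.K_nonneg
  have h5 : |s| ^ 2 ≤ |s| := by nlinarith [abs_nonneg s]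
  have h6 : |s| ^ 3 ≤ |s| := by nlinarith [abs_nonneg s, sq_nonneg |s|]
  calc _ ≤ S.K * |s| ^ 3 + (|s| * ‖S.G₁‖ + |s| ^ 2 * ‖S.G₂‖) := by
        refine (norm_add_le _ _).trans (add_le_add h1 ((norm_add_le _ _).trans ?_))
        rw [h3, h4]
    _ ≤ S.K * |s| + (|s| * ‖S.G₁‖ + |s| * ‖S.G₂‖) := by gcongr
    _ = S.L * |s| := by unfold L; ring

theorem norm_le_proj_add (f : Ell2 ℂ ι) (h : ‖⟪S.e, f⟫_ℂ‖ ≤ 1) : ‖f‖ ≤ 1 + ‖S.proj f‖ := by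
  have h1 : f = ⟪S.e, f⟫_ℂ • S.e + S.proj f := by simp [HypocoerciveGenerator.proj]
  have h2 : ‖⟪S.e, f⟫_ℂ • S.e‖ ≤ 1 := by rw [norm_smul, S.norm_e]; simpa using h
  calc ‖f‖ = ‖⟪S.e, f⟫_ℂ • S.e + S.proj f‖ := by rw [← h1]
    _ ≤ _ := (norm_add_le _ _).trans (by gcongr)

/-- The range of parameters for which the perturbed dynamics is controlled. -/
def s₀ : ℝ := min 1 (S.c / (6 * (S.L + 1)))

theorem s₀_pos : 0 < S.s₀ := by
  have := S.c_pos
  have := S.L_nonneg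
  unfold s₀; positivity

/-- The perturbation is treated as a source of size `L |s| (1 + ‖proj R‖)`: the stationary component
is bounded by assumption, and `s₀` is chosen so that the part proportional to `‖proj R‖` is absorbed
by coercivity. The bound is uniform in time. -/
theorem norm_le_of_isWeakSolution [Countable ι] {s : ℝ} (hs : |s| ≤ S.s₀) {R : ℝ → Ell2 ℂ ι}
    (hR : IsWeakSolution (S.Gs s) S.b 0 R) (hφ : ∀ t ≥ 0, ‖⟪S.e, R t⟫_ℂ‖ ≤ 1) {t : ℝ}
    (ht : 0 ≤ t) : ‖R t‖ ≤ 2 + 2 * ‖R 0‖ := by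
  have hc := S.c_pos
  have hL := S.L_nonneg
  have hs1 : |s| ≤ 1 := hs.trans (min_le_left _ _)
  have hs2 : S.L * |s| ≤ S.c / 6 := by
    have h1 : |s| ≤ S.c / (6 * (S.L + 1)) := hs.trans (min_le_right _ _)
    rw [le_div_iff₀ (by positivity)] at h1
    nlinarith [abs_nonneg s]
  have hY := (hR.change_generator S.G).proj
  have key := S.norm_sq_le_of_orthogonal hY (fun t _ => S.inner_e_proj _) (δ₀ := S.L * |s|)
    (δ₁ := S.L * |s|) hs2 (fun t ht => by
      refine (S.norm_proj_le _).trans ?_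
      simp only [Pi.zero_apply, add_zero]
      have h1 := S.norm_le_proj_add (R t) (hφ t ht)
      calc ‖(S.Gs s - S.G) (R t)‖ ≤ S.L * |s| * ‖R t‖ :=
            (S.Gs s - S.G).le_of_opNorm_le (S.norm_Gs_sub_le hs1) _
        _ ≤ S.L * |s| * (1 + ‖S.proj (R t)‖) := by gcongr
        _ = _ := by ring) ht
  have h3 : 14 * (S.L * |s|) ^ 2 / S.c ^ 2 ≤ 1 := by
    rw [div_le_one (by positivity)]
    have : (S.L * |s|) ^ 2 ≤ (S.c / 6) ^ 2 := by gcongr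
    nlinarith
  have h4 := S.norm_proj_le (R 0)
  have h5 : ‖S.proj (R t)‖ ≤ 1 + 2 * ‖R 0‖ := by
    refine le_of_sq_le_sq ?_ (by positivity)
    have : ‖S.proj (R 0)‖ ^ 2 ≤ ‖R 0‖ ^ 2 := by gcongr
    nlinarith [norm_nonneg (R 0)]
  linarith [S.norm_le_proj_add (R t) (hφ t ht)]

/-- Both perturbations are sources acting on uniformly bounded solutions, so they enter through `δ₀`
alone. Applied to `s` and `-s`, this supplies the additional factor `s` that the second moment
needs. -/
theorem norm_proj_sub_le [Countable ι] {s s' : ℝ} (hs : |s| ≤ S.s₀) (hs' : |s'| ≤ S.s₀) {R R' : ℝ → Ell2 ℂ ι}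
    (hR : IsWeakSolution (S.Gs s) S.b 0 R) (hφ : ∀ t ≥ 0, ‖⟪S.e, R t⟫_ℂ‖ ≤ 1)
    (hR' : IsWeakSolution (S.Gs s') S.b 0 R') (hφ' : ∀ t ≥ 0, ‖⟪S.e, R' t⟫_ℂ‖ ≤ 1)
    {M : ℝ} (hM : ‖R 0‖ ≤ M) (hM' : ‖R' 0‖ ≤ M) {t : ℝ} (ht : 0 ≤ t) :
    ‖S.proj (R t - R' t)‖ ≤
      2 * ‖R 0 - R' 0‖ + 4 / S.c * (S.L * (|s| + |s'|) * (2 + 2 * M)) := by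
  have hc := S.c_pos
  have hL := S.L_nonneg
  have hM0 : 0 ≤ M := (norm_nonneg _).trans hM
  have hs1 : |s| ≤ 1 := hs.trans (min_le_left _ _)
  have hs1' : |s'| ≤ 1 := hs'.trans (min_le_left _ _)
  have hY := ((hR.change_generator S.G).sub (hR'.change_generator S.G)).proj
  set δ := S.L * (|s| + |s'|) * (2 + 2 * M) with hδ
  have hδ0 : 0 ≤ δ := by positivity
  have key := S.norm_sq_le_of_orthogonal hY (fun t _ => S.inner_e_proj _) (δ₀ := δ)
    (δ₁ := 0) (by positivity) (fun t ht => by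
      refine (S.norm_proj_le _).trans ?_
      simp only [Pi.zero_apply, add_zero, zero_mul]
      refine (norm_sub_le _ _).trans ?_
      have h1 := S.norm_le_of_isWeakSolution hs hR hφ ht
      have h2 := S.norm_le_of_isWeakSolution hs' hR' hφ' ht
      calc ‖(S.Gs s - S.G) (R t)‖ + ‖(S.Gs s' - S.G) (R' t)‖
          ≤ S.L * |s| * ‖R t‖ + S.L * |s'| * ‖R' t‖ :=
            add_le_add ((S.Gs s - S.G).le_of_opNorm_le (S.norm_Gs_sub_le hs1) _)
              ((S.Gs s' - S.G).le_of_opNorm_le (S.norm_Gs_sub_le hs1') _)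
        _ ≤ S.L * |s| * (2 + 2 * M) + S.L * |s'| * (2 + 2 * M) := by gcongr <;> linarith
        _ = _ := by rw [hδ]; ring) ht
  clear_value δ
  refine le_of_sq_le_sq (key.trans ?_) (by positivity)
  have h4 := S.norm_proj_le (R 0 - R' 0)
  have h5 : ‖S.proj (R 0 - R' 0)‖ ^ 2 ≤ ‖R 0 - R' 0‖ ^ 2 := by gcongr
  have h6 : 14 * δ ^ 2 / S.c ^ 2 ≤ (4 / S.c * δ) ^ 2 := by
    have : (4 / S.c * δ) ^ 2 = 16 * δ ^ 2 / S.c ^ 2 := by ring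
    rw [this]
    gcongr
    norm_num
  have h7 : 0 ≤ ‖R 0 - R' 0‖ * (4 / S.c * δ) := by positivity
  nlinarith [sq_nonneg ‖R 0 - R' 0‖]

/-- The second order corrector. -/
theorem exists_second_corrector : ∃ w₂ h₂ : Ell2 ℂ ι, (∀ j, h₂ j = S.b j * w₂ j) ∧
    ∀ f, ⟪w₂, S.G f⟫_ℂ + ⟪h₂, f⟫_ℂ + ⟪S.w₁, S.G₁ f⟫_ℂ + ⟪S.e, S.G₂ f⟫_ℂ = S.ν * ⟪S.e, f⟫_ℂ := by
  set q := ContinuousLinearMap.adjoint S.G₁ S.w₁ + ContinuousLinearMap.adjoint S.G₂ S.e with hq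
  have hν : ⟪S.e, q⟫_ℂ = starRingEnd ℂ S.ν := by
    rw [hq, inner_add_right, ContinuousLinearMap.adjoint_inner_right,
      ContinuousLinearMap.adjoint_inner_right, ν, inner_conj_symm, ← inner_conj_symm (S.G₂ S.e),
      S.e_G₂_e]
    simp
  -- `ν` is exactly the coefficient that makes the right-hand side orthogonal to `e`; this
  -- solvability condition determines the second order of the eigenvalue.
  obtain ⟨w₂, h₂, -, hh, heq⟩ := S.exists_adjoint_solution (starRingEnd ℂ S.ν • S.e - q) (by
    rw [inner_sub_right, inner_smul_right, S.inner_e_e, hν]; ring)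
  refine ⟨w₂, h₂, hh, fun f => ?_⟩
  have := congrArg (fun v => ⟪v, f⟫_ℂ) heq
  simp only [inner_add_left, inner_sub_left, inner_smul_left, ContinuousLinearMap.adjoint_inner_left,
    hq, Complex.conj_conj] at this
  linear_combination this

/-- Order one in `s` cancels by the corrector equation and order two by the second corrector; what
is left carries a factor `s³` or comes from the Taylor remainder. -/
theorem exists_approximate_eigenvector : ∃ w₂ h₂ : Ell2 ℂ ι, ∃ C : ℝ, 0 ≤ C ∧
    (∀ j, h₂ j = S.b j * w₂ j) ∧ ∀ s : ℝ, |s| ≤ 1 → ∀ f,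
      ‖⟪S.e + (s : ℂ) • S.w₁ + (s : ℂ) ^ 2 • w₂, S.Gs s f⟫_ℂ
        + ⟪(s : ℂ) • S.h₁ + (s : ℂ) ^ 2 • h₂, f⟫_ℂ
        - s ^ 2 * S.ν * ⟪S.e + (s : ℂ) • S.w₁ + (s : ℂ) ^ 2 • w₂, f⟫_ℂ‖ ≤ C * |s| ^ 3 * ‖f‖ := by
  obtain ⟨w₂, h₂, hh, heq⟩ := S.exists_second_corrector
  have hK := S.K_nonneg
  refine ⟨w₂, h₂, (1 + ‖S.w₁‖ + ‖w₂‖) * S.K + ‖w₂‖ * ‖S.G₁‖ + ‖S.w₁‖ * ‖S.G₂‖ + ‖w₂‖ * ‖S.G₂‖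
    + ‖S.ν‖ * ‖S.w₁‖ + ‖S.ν‖ * ‖w₂‖, by positivity, hh, fun s hs f => ?_⟩
  set E := S.Gs s - S.G - ((s : ℂ) • S.G₁ + (s : ℂ) ^ 2 • S.G₂) with hE
  have hGs : S.Gs s f = S.G f + (s : ℂ) • S.G₁ f + (s : ℂ) ^ 2 • S.G₂ f + E f := by
    simp only [hE, _root_.sub_apply, _root_.add_apply,
      _root_.smul_apply]
    abel
  set w := S.e + (s : ℂ) • S.w₁ + (s : ℂ) ^ 2 • w₂ with hw
  have hc : ⟪S.w₁, S.G f⟫_ℂ + ⟪S.h₁, f⟫_ℂ = -⟪S.e, S.G₁ f⟫_ℂ := by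
    have := congrArg (fun v => ⟪v, f⟫_ℂ) S.corrector
    simpa only [inner_add_left, inner_neg_left, ContinuousLinearMap.adjoint_inner_left] using this
  have hid : ⟪w, S.Gs s f⟫_ℂ + ⟪(s : ℂ) • S.h₁ + (s : ℂ) ^ 2 • h₂, f⟫_ℂ - s ^ 2 * S.ν * ⟪w, f⟫_ℂ
      = ⟪w, E f⟫_ℂ + (s : ℂ) ^ 3 * (⟪w₂, S.G₁ f⟫_ℂ + ⟪S.w₁, S.G₂ f⟫_ℂ + s * ⟪w₂, S.G₂ f⟫_ℂ
        - S.ν * ⟪S.w₁, f⟫_ℂ - s * (S.ν * ⟪w₂, f⟫_ℂ)) := by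
    rw [hGs]
    simp only [hw, inner_add_left, inner_add_right, inner_smul_left, inner_smul_right, map_pow,
      Complex.conj_ofReal, S.e_G]
    linear_combination (s : ℂ) * hc + (s : ℂ) ^ 2 * heq f
  rw [hid]
  have hs0 := abs_nonneg s
  have hE' : ‖E f‖ ≤ S.K * |s| ^ 3 * ‖f‖ := E.le_of_opNorm_le (S.taylor s hs) f
  have hwn : ‖w‖ ≤ 1 + ‖S.w₁‖ + ‖w₂‖ := by
    refine norm_add₃_le.trans ?_
    rw [S.norm_e, norm_smul, norm_smul]
    have h1 : ‖(s : ℂ)‖ ≤ 1 := by simpa using hs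
    have h2 : ‖(s : ℂ) ^ 2‖ ≤ 1 := by rw [norm_pow]; exact pow_le_one₀ (norm_nonneg _) h1
    exact add_le_add (add_le_add_right (mul_le_of_le_one_left (norm_nonneg _) h1) _)
      (mul_le_of_le_one_left (norm_nonneg _) h2)
  have b1 : ‖⟪w, E f⟫_ℂ‖ ≤ (1 + ‖S.w₁‖ + ‖w₂‖) * (S.K * |s| ^ 3 * ‖f‖) :=
    (norm_inner_le_norm _ _).trans (by gcongr)
  have hb : ∀ (v : Ell2 ℂ ι) (B : Ell2 ℂ ι →L[ℂ] Ell2 ℂ ι), ‖⟪v, B f⟫_ℂ‖ ≤ ‖v‖ * (‖B‖ * ‖f‖) :=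
    fun v B => (norm_inner_le_norm _ _).trans (by gcongr; exact B.le_opNorm f)
  have hs' : ∀ z : ℂ, ‖(s : ℂ) * z‖ ≤ ‖z‖ := fun z => by
    rw [norm_mul]
    exact mul_le_of_le_one_left (norm_nonneg _) (by simpa using hs)
  have b2 : ‖⟪w₂, S.G₁ f⟫_ℂ + ⟪S.w₁, S.G₂ f⟫_ℂ + s * ⟪w₂, S.G₂ f⟫_ℂ
        - S.ν * ⟪S.w₁, f⟫_ℂ - s * (S.ν * ⟪w₂, f⟫_ℂ)‖ ≤ ‖w₂‖ * (‖S.G₁‖ * ‖f‖)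
        + ‖S.w₁‖ * (‖S.G₂‖ * ‖f‖) + ‖w₂‖ * (‖S.G₂‖ * ‖f‖) + ‖S.ν‖ * (‖S.w₁‖ * ‖f‖)
        + ‖S.ν‖ * (‖w₂‖ * ‖f‖) := by
    refine (norm_sub_le _ _).trans (add_le_add ((norm_sub_le _ _).trans
      (add_le_add (norm_add₃_le.trans ?_) ?_)) ((hs' _).trans ?_))
    · exact add_le_add (add_le_add (hb _ _) (hb _ _)) ((hs' _).trans (hb _ _))
    · rw [norm_mul]; gcongr; exact norm_inner_le_norm _ _
    · rw [norm_mul]; gcongr; exact norm_inner_le_norm _ _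
  have b3 := mul_le_mul_of_nonneg_left b2 (norm_nonneg ((s : ℂ) ^ 3))
  rw [← norm_mul, norm_pow (s : ℂ), Complex.norm_real, Real.norm_eq_abs] at b3
  refine (norm_add_le _ _).trans ((add_le_add b1 b3).trans_eq ?_)
  ring

/-- After multiplication by the integrating factor `exp (ν s² τ)` the pairing has a derivative of
order `|s|³`. As `Re ν ≥ 0`, the factor is largest in modulus at the final time, where it cancels,
so the error grows only linearly in time. -/
theorem norm_pairing_sub_le [Countable ι] {w₂ h₂ : Ell2 ℂ ι} {C : ℝ} (hC : 0 ≤ C)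
    (hh : ∀ j, h₂ j = S.b j * w₂ j) {s : ℝ} (herr : ∀ f,
      ‖⟪S.e + (s : ℂ) • S.w₁ + (s : ℂ) ^ 2 • w₂, S.Gs s f⟫_ℂ
        + ⟪(s : ℂ) • S.h₁ + (s : ℂ) ^ 2 • h₂, f⟫_ℂ
        - s ^ 2 * S.ν * ⟪S.e + (s : ℂ) • S.w₁ + (s : ℂ) ^ 2 • w₂, f⟫_ℂ‖ ≤ C * |s| ^ 3 * ‖f‖)
    (hs : |s| ≤ S.s₀) {R : ℝ → Ell2 ℂ ι}
    (hR : IsWeakSolution (S.Gs s) S.b 0 R) (hφ : ∀ t ≥ 0, ‖⟪S.e, R t⟫_ℂ‖ ≤ 1) {t : ℝ}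
    (ht : 0 ≤ t) :
    ‖⟪S.e + (s : ℂ) • S.w₁ + (s : ℂ) ^ 2 • w₂, R t⟫_ℂ - Complex.exp (-(S.ν * s ^ 2 * t)) *
      ⟪S.e + (s : ℂ) • S.w₁ + (s : ℂ) ^ 2 • w₂, R 0⟫_ℂ‖ ≤
      C * |s| ^ 3 * (2 + 2 * ‖R 0‖) * t := by
  set w := S.e + (s : ℂ) • S.w₁ + (s : ℂ) ^ 2 • w₂ with hw
  set h := (s : ℂ) • S.h₁ + (s : ℂ) ^ 2 • h₂ with hh'
  have hwh : ∀ j, h j = S.b j * w j := fun j => by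
    have h0 : (S.b j : ℂ) * S.e j = 0 := by
      by_cases hb : S.b j = 0
      · simp [hb]
      · simp [S.e_apply j hb]
    simp only [hw, hh', lp.coeFn_add, Pi.add_apply, lp.coeFn_smul, Pi.smul_apply, smul_eq_mul, hh,
      S.h₁_apply]
    linear_combination -h0
  let a : ℂ := S.ν * s ^ 2
  have hare : 0 ≤ a.re := by
    have : a = ((s ^ 2 : ℝ) : ℂ) * S.ν := by simp only [a]; push_cast; ring
    rw [this, Complex.re_ofReal_mul]
    exact mul_nonneg (sq_nonneg s) S.re_nonneg
  let f : ℝ → ℂ := fun τ => Complex.exp (a * τ) * ⟪w, R τ⟫_ℂ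
  have hfc : ContinuousOn f (Icc 0 t) := by
    refine ContinuousOn.mul (by fun_prop) ((hR.continuousOn_inner w).mono Icc_subset_Ici_self)
  have hfd : ∀ τ ∈ Ioo 0 t, HasDerivAt f (Complex.exp (a * τ) *
      -(⟪w, S.Gs s (R τ)⟫_ℂ + ⟪h, R τ⟫_ℂ - s ^ 2 * S.ν * ⟪w, R τ⟫_ℂ)) τ := fun τ hτ => by
    have h1 : HasDerivAt (fun τ : ℝ => Complex.exp (a * τ)) (Complex.exp (a * τ) * a) τ := by
      have := ((hasDerivAt_id (τ : ℂ)).const_mul a).cexp.comp_ofReal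
      simpa using this
    convert! h1.mul (hR.hasDerivAt_inner hwh hτ.1) using 1
    simp only [a, Pi.zero_apply, inner_zero_right]
    ring
  have hbound : ∀ τ ∈ Ioo 0 t, ‖Complex.exp (a * τ) *
      -(⟪w, S.Gs s (R τ)⟫_ℂ + ⟪h, R τ⟫_ℂ - s ^ 2 * S.ν * ⟪w, R τ⟫_ℂ)‖ ≤
      Real.exp (a.re * t) * (C * |s| ^ 3 * (2 + 2 * ‖R 0‖)) := fun τ hτ => by
    rw [norm_mul, norm_neg, Complex.norm_exp]
    have h1 : (a * τ).re ≤ a.re * t := by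
      rw [Complex.re_mul_ofReal]; gcongr; exact hτ.2.le
    have h2 := S.norm_le_of_isWeakSolution hs hR hφ hτ.1.le
    gcongr
    exact (herr (R τ)).trans (by gcongr)
  have hmv : ‖f t - f 0‖ ≤ Real.exp (a.re * t) * (C * |s| ^ 3 * (2 + 2 * ‖R 0‖)) * (t - 0) :=
    norm_image_sub_le_of_hasDerivAt_Ioo ht hfc hfd hbound
  have hfin : ⟪w, R t⟫_ℂ - Complex.exp (-(S.ν * s ^ 2 * t)) * ⟪w, R 0⟫_ℂ =
      Complex.exp (-(a * t)) * (f t - f 0) := by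
    simp only [f, mul_sub, ← mul_assoc, ← Complex.exp_add]
    simp [a]
  rw [hfin, norm_mul, Complex.norm_exp]
  calc _ ≤ Real.exp (-(a * t) : ℂ).re *
        (Real.exp (a.re * t) * (C * |s| ^ 3 * (2 + 2 * ‖R 0‖)) * (t - 0)) := by gcongr
    _ = C * |s| ^ 3 * (2 + 2 * ‖R 0‖) * t := by
      rw [Complex.neg_re, Complex.re_mul_ofReal, sub_zero, ← mul_assoc, ← mul_assoc,
        ← Real.exp_add]
      simp

/-- Asymptotics of the stationary component of a solution of the perturbed equation. -/
theorem exists_norm_inner_sub_le [Countable ι] (M : ℝ) : ∃ C, 0 ≤ C ∧ ∀ s : ℝ, |s| ≤ S.s₀ →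
    ∀ R : ℝ → Ell2 ℂ ι, IsWeakSolution (S.Gs s) S.b 0 R → (∀ t ≥ 0, ‖⟪S.e, R t⟫_ℂ‖ ≤ 1) →
    ‖R 0‖ ≤ M → ∀ t ≥ 0,
    ‖⟪S.e, R t⟫_ℂ - Complex.exp (-(S.ν * s ^ 2 * t)) * ⟪S.e, R 0⟫_ℂ‖ ≤ C * (|s| + |s| ^ 3 * t) := by
  obtain ⟨w₂, h₂, C, hC, hh, herr⟩ := S.exists_approximate_eigenvector
  rcases lt_or_ge M 0 with hM | hM
  · exact ⟨0, le_rfl, fun s _ R _ _ h0 => absurd ((norm_nonneg _).trans h0) (not_le.mpr hM)⟩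
  set Cw := ‖S.w₁‖ + ‖w₂‖ with hCw
  refine ⟨max (Cw * (2 + 2 * M) + Cw * M) (C * (2 + 2 * M)), by positivity,
    fun s hs R hR hφ h0 t ht => ?_⟩
  have hs1 : |s| ≤ 1 := hs.trans (min_le_left _ _)
  have key := S.norm_pairing_sub_le hC hh (herr s hs1) hs hR hφ ht
  have hRt := S.norm_le_of_isWeakSolution hs hR hφ ht
  have hrest : ∀ f : Ell2 ℂ ι, ‖⟪(s : ℂ) • S.w₁ + (s : ℂ) ^ 2 • w₂, f⟫_ℂ‖ ≤ Cw * |s| * ‖f‖ :=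
    fun f => by
      refine (norm_inner_le_norm _ _).trans ?_
      gcongr
      refine (norm_add_le _ _).trans ?_
      rw [norm_smul, norm_smul, norm_pow, Complex.norm_real, Real.norm_eq_abs, hCw]
      have : |s| ^ 2 ≤ |s| := by nlinarith [abs_nonneg s]
      calc _ ≤ |s| * ‖S.w₁‖ + |s| * ‖w₂‖ := by gcongr
        _ = _ := by ring
  have hexp : ‖Complex.exp (-(S.ν * s ^ 2 * t))‖ ≤ 1 := by
    rw [Complex.norm_exp, Real.exp_le_one_iff, Complex.neg_re, neg_nonpos]
    have : S.ν * s ^ 2 * t = ((s ^ 2 * t : ℝ) : ℂ) * S.ν := by push_cast; ring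
    rw [this, Complex.re_ofReal_mul]
    exact mul_nonneg (by positivity) S.re_nonneg
  have hid : ⟪S.e, R t⟫_ℂ - Complex.exp (-(S.ν * s ^ 2 * t)) * ⟪S.e, R 0⟫_ℂ =
      (⟪S.e + (s : ℂ) • S.w₁ + (s : ℂ) ^ 2 • w₂, R t⟫_ℂ - Complex.exp (-(S.ν * s ^ 2 * t)) *
      ⟪S.e + (s : ℂ) • S.w₁ + (s : ℂ) ^ 2 • w₂, R 0⟫_ℂ)
      - ⟪(s : ℂ) • S.w₁ + (s : ℂ) ^ 2 • w₂, R t⟫_ℂ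
      + Complex.exp (-(S.ν * s ^ 2 * t)) * ⟪(s : ℂ) • S.w₁ + (s : ℂ) ^ 2 • w₂, R 0⟫_ℂ := by
    simp only [inner_add_left]; ring
  rw [hid]
  have hRt' : ‖R t‖ ≤ 2 + 2 * M := by linarith
  calc _ ≤ C * |s| ^ 3 * (2 + 2 * ‖R 0‖) * t + Cw * |s| * ‖R t‖ + 1 * (Cw * |s| * ‖R 0‖) := by
        refine (norm_add_le _ _).trans (add_le_add ((norm_sub_le _ _).trans
          (add_le_add key (hrest _))) ?_)
        rw [norm_mul]
        exact mul_le_mul hexp (hrest _) (norm_nonneg _) zero_le_one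
    _ ≤ C * |s| ^ 3 * (2 + 2 * M) * t + Cw * |s| * (2 + 2 * M) + 1 * (Cw * |s| * M) := by gcongr
    _ = (Cw * (2 + 2 * M) + Cw * M) * |s| + C * (2 + 2 * M) * (|s| ^ 3 * t) := by ring
    _ ≤ _ := by
        refine le_of_le_of_eq ?_ (mul_add _ _ _).symm
        exact add_le_add (mul_le_mul_of_nonneg_right (le_max_left _ _) (by positivity))
          (mul_le_mul_of_nonneg_right (le_max_right _ _) (by positivity))

/-- The sum of the stationary components for opposite parameters is known to higher order. -/
theorem exists_norm_inner_add_sub_le [Countable ι] (M M' : ℝ) : ∃ C, ∀ s : ℝ, |s| ≤ S.s₀ →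
    ∀ R R' : ℝ → Ell2 ℂ ι, IsWeakSolution (S.Gs s) S.b 0 R → IsWeakSolution (S.Gs (-s)) S.b 0 R' →
    (∀ t ≥ 0, ‖⟪S.e, R t⟫_ℂ‖ ≤ 1) → (∀ t ≥ 0, ‖⟪S.e, R' t⟫_ℂ‖ ≤ 1) →
    ‖R 0‖ ≤ M → ‖R' 0‖ ≤ M → ‖R 0 - R' 0‖ ≤ M' * |s| → ∀ t ≥ 0,
    ‖⟪S.e, R t⟫_ℂ + ⟪S.e, R' t⟫_ℂ -
      Complex.exp (-(S.ν * s ^ 2 * t)) * (⟪S.e, R 0⟫_ℂ + ⟪S.e, R' 0⟫_ℂ)‖ ≤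
      C * (s ^ 2 + |s| ^ 3 * t) := by
  obtain ⟨w₂, h₂, C, hC, hh, herr⟩ := S.exists_approximate_eigenvector
  have hc := S.c_pos
  have hL := S.L_nonneg
  rcases lt_or_ge M 0 with hM | hM
  · exact ⟨0, fun s _ R R' _ _ _ _ h0 => absurd ((norm_nonneg _).trans h0) (not_le.mpr hM)⟩
  set a := ‖S.w₁‖ * (2 * M' + 4 / S.c * (S.L * 2 * (2 + 2 * M))) + 2 * ‖w₂‖ * (2 + 2 * M)
    + (‖S.w₁‖ * M' + 2 * ‖w₂‖ * M) with ha
  refine ⟨max a (2 * (C * (2 + 2 * M))), fun s hs R R' hR hR' hφ hφ' h0 h0' hd t ht => ?_⟩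
  have hs1 : |s| ≤ 1 := hs.trans (min_le_left _ _)
  have hsm : |-s| ≤ S.s₀ := by rwa [abs_neg]
  have key := S.norm_pairing_sub_le hC hh (herr s hs1) hs hR hφ ht
  have key' := S.norm_pairing_sub_le hC hh (herr (-s) (by rwa [abs_neg])) hsm hR' hφ' ht
  have hRt := S.norm_le_of_isWeakSolution hs hR hφ ht
  have hRt' := S.norm_le_of_isWeakSolution hsm hR' hφ' ht
  have hdt := S.norm_proj_sub_le hs hsm hR hφ hR' hφ' h0 h0' ht
  have hexp : ‖Complex.exp (-(S.ν * s ^ 2 * t))‖ ≤ 1 := by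
    rw [Complex.norm_exp, Real.exp_le_one_iff, Complex.neg_re, neg_nonpos]
    have : S.ν * s ^ 2 * t = ((s ^ 2 * t : ℝ) : ℂ) * S.ν := by push_cast; ring
    rw [this, Complex.re_ofReal_mul]
    exact mul_nonneg (by positivity) S.re_nonneg
  -- The first order terms for `s` and `-s` combine to `s ⟪w₁, R t - R' t⟫`. As `w₁ ⊥ e`, only the
  -- projected difference enters; it is `O(|s|)`, so the combination is `O(s²)`.
  have hw₁ : ∀ f, ⟪S.w₁, S.proj f⟫_ℂ = ⟪S.w₁, f⟫_ℂ := fun f => by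
    have : ⟪S.w₁, S.e⟫_ℂ = 0 := by rw [← inner_conj_symm, S.e_w₁]; simp
    simp [HypocoerciveGenerator.proj, this]
  have hid : ⟪S.e, R t⟫_ℂ + ⟪S.e, R' t⟫_ℂ -
      Complex.exp (-(S.ν * s ^ 2 * t)) * (⟪S.e, R 0⟫_ℂ + ⟪S.e, R' 0⟫_ℂ) =
      (⟪S.e + (s : ℂ) • S.w₁ + (s : ℂ) ^ 2 • w₂, R t⟫_ℂ - Complex.exp (-(S.ν * s ^ 2 * t)) *
        ⟪S.e + (s : ℂ) • S.w₁ + (s : ℂ) ^ 2 • w₂, R 0⟫_ℂ)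
      + (⟪S.e + ((-s : ℝ) : ℂ) • S.w₁ + ((-s : ℝ) : ℂ) ^ 2 • w₂, R' t⟫_ℂ -
        Complex.exp (-(S.ν * ((-s : ℝ) : ℂ) ^ 2 * t)) *
        ⟪S.e + ((-s : ℝ) : ℂ) • S.w₁ + ((-s : ℝ) : ℂ) ^ 2 • w₂, R' 0⟫_ℂ)
      - (s * ⟪S.w₁, S.proj (R t - R' t)⟫_ℂ + s ^ 2 * (⟪w₂, R t⟫_ℂ + ⟪w₂, R' t⟫_ℂ))
      + Complex.exp (-(S.ν * s ^ 2 * t)) *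
        (s * ⟪S.w₁, R 0 - R' 0⟫_ℂ + s ^ 2 * (⟪w₂, R 0⟫_ℂ + ⟪w₂, R' 0⟫_ℂ)) := by
    rw [hw₁]
    simp only [inner_add_left, inner_sub_right, inner_smul_left, map_pow, Complex.conj_ofReal]
    push_cast
    simp only [neg_sq]
    ring
  rw [hid]
  have b1 : ‖s * ⟪S.w₁, S.proj (R t - R' t)⟫_ℂ + s ^ 2 * (⟪w₂, R t⟫_ℂ + ⟪w₂, R' t⟫_ℂ)‖ ≤
      s ^ 2 * (‖S.w₁‖ * (2 * M' + 4 / S.c * (S.L * 2 * (2 + 2 * M))) + 2 * ‖w₂‖ * (2 + 2 * M)) := by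
    have e1 : ‖⟪S.w₁, S.proj (R t - R' t)⟫_ℂ‖ ≤
        ‖S.w₁‖ * (|s| * (2 * M' + 4 / S.c * (S.L * 2 * (2 + 2 * M)))) := by
      refine (norm_inner_le_norm _ _).trans ?_
      gcongr
      refine hdt.trans ?_
      rw [abs_neg]
      calc _ ≤ 2 * (M' * |s|) + 4 / S.c * (S.L * (|s| + |s|) * (2 + 2 * M)) := by gcongr
        _ = _ := by ring
    have e2 : ‖⟪w₂, R t⟫_ℂ + ⟪w₂, R' t⟫_ℂ‖ ≤ 2 * ‖w₂‖ * (2 + 2 * M) := by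
      refine (norm_add_le _ _).trans ((add_le_add (norm_inner_le_norm _ _)
        (norm_inner_le_norm _ _)).trans ?_)
      calc _ ≤ ‖w₂‖ * (2 + 2 * M) + ‖w₂‖ * (2 + 2 * M) := by gcongr <;> linarith
        _ = _ := by ring
    refine (norm_add_le _ _).trans ?_
    rw [norm_mul, norm_mul, norm_pow, Complex.norm_real, Real.norm_eq_abs]
    calc _ ≤ |s| * (‖S.w₁‖ * (|s| * (2 * M' + 4 / S.c * (S.L * 2 * (2 + 2 * M)))))
          + |s| ^ 2 * (2 * ‖w₂‖ * (2 + 2 * M)) := by gcongr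
      _ = _ := by rw [← sq_abs s]; ring
  have b2 : ‖s * ⟪S.w₁, R 0 - R' 0⟫_ℂ + s ^ 2 * (⟪w₂, R 0⟫_ℂ + ⟪w₂, R' 0⟫_ℂ)‖ ≤
      s ^ 2 * (‖S.w₁‖ * M' + 2 * ‖w₂‖ * M) := by
    have e1 : ‖⟪S.w₁, R 0 - R' 0⟫_ℂ‖ ≤ ‖S.w₁‖ * (M' * |s|) :=
      (norm_inner_le_norm _ _).trans (by gcongr)
    have e2 : ‖⟪w₂, R 0⟫_ℂ + ⟪w₂, R' 0⟫_ℂ‖ ≤ 2 * ‖w₂‖ * M := by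
      refine (norm_add_le _ _).trans ((add_le_add (norm_inner_le_norm _ _)
        (norm_inner_le_norm _ _)).trans ?_)
      calc _ ≤ ‖w₂‖ * M + ‖w₂‖ * M := by gcongr
        _ = _ := by ring
    refine (norm_add_le _ _).trans ?_
    rw [norm_mul, norm_mul, norm_pow, Complex.norm_real, Real.norm_eq_abs]
    calc _ ≤ |s| * (‖S.w₁‖ * (M' * |s|)) + |s| ^ 2 * (2 * ‖w₂‖ * M) := by gcongr
      _ = _ := by rw [← sq_abs s]; ring
  rw [abs_neg] at key'
  calc _ ≤ C * |s| ^ 3 * (2 + 2 * ‖R 0‖) * t + C * |s| ^ 3 * (2 + 2 * ‖R' 0‖) * t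
        + s ^ 2 * (‖S.w₁‖ * (2 * M' + 4 / S.c * (S.L * 2 * (2 + 2 * M))) + 2 * ‖w₂‖ * (2 + 2 * M))
        + 1 * (s ^ 2 * (‖S.w₁‖ * M' + 2 * ‖w₂‖ * M)) := by
        refine (norm_add_le _ _).trans (add_le_add ((norm_sub_le _ _).trans
          (add_le_add ((norm_add_le _ _).trans (add_le_add key key')) b1)) ?_)
        rw [norm_mul]
        exact mul_le_mul hexp b2 (norm_nonneg _) zero_le_one
    _ ≤ C * |s| ^ 3 * (2 + 2 * M) * t + C * |s| ^ 3 * (2 + 2 * M) * t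
        + s ^ 2 * (‖S.w₁‖ * (2 * M' + 4 / S.c * (S.L * 2 * (2 + 2 * M))) + 2 * ‖w₂‖ * (2 + 2 * M))
        + 1 * (s ^ 2 * (‖S.w₁‖ * M' + 2 * ‖w₂‖ * M)) := by gcongr
    _ = a * s ^ 2 + 2 * (C * (2 + 2 * M)) * (|s| ^ 3 * t) := by rw [ha]; ring
    _ ≤ _ := by
        refine le_of_le_of_eq ?_ (mul_add _ _ _).symm
        exact add_le_add (mul_le_mul_of_nonneg_right (le_max_left _ _) (by positivity))
          (mul_le_mul_of_nonneg_right (le_max_right _ _) (by positivity))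

end PerturbedGenerator

end Perturbation

/-! ### The fiber model: indices, hopping, flips and the generator. -/

section FiberModel

open scoped InnerProductSpace

variable {d : ℕ}

/-- The `2d` oriented nearest neighbour directions. -/
abbrev LatticeDir (d : ℕ) : Type := Fin d × Bool

namespace LatticeDir

/-- The unit vector of a direction. -/
def vec (q : LatticeDir d) : CubicLattice d := if q.2 then Pi.single q.1 1 else -Pi.single q.1 1

/-- The opposite direction. -/
def opp : LatticeDir d ≃ LatticeDir d := (Equiv.refl _).prodCongr Equiv.boolNot

theorem vec_opp (q : LatticeDir d) : (opp q).vec = -q.vec := by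
  rcases q with ⟨j, b⟩
  cases b <;> simp [opp, vec]

theorem opp_opp (q : LatticeDir d) : opp (opp q) = q := by
  rcases q with ⟨j, b⟩
  simp [opp]

theorem vec_ne_zero (q : LatticeDir d) : q.vec ≠ 0 := by
  rcases q with ⟨j, b⟩
  cases b <;> simp [vec]

theorem vec_injective : Function.Injective (vec : LatticeDir d → CubicLattice d) := by
  rintro ⟨i, b⟩ ⟨j, b'⟩ h
  have h1 := congrFun h i
  have h2 := congrFun h j
  by_cases hij : i = j
  · subst hij
    cases b <;> cases b' <;> simp [vec] at h1 ⊢ <;> omega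
  · exfalso
    cases b <;> cases b' <;> simp [vec, Pi.single_apply, hij] at h1

theorem sum_eq {M : Type*} [AddCommMonoid M] (f : CubicLattice d → M) :
    ∑ q : LatticeDir d, f q.vec = ∑ j : Fin d, (f (Pi.single j 1) + f (-Pi.single j 1)) := by
  rw [Fintype.sum_prod_type]
  simp [vec]

/-- The component of a momentum in a direction. -/
def comp (κ : Fin d → ℝ) (q : LatticeDir d) : ℝ := if q.2 then κ q.1 else -κ q.1

theorem comp_opp (κ : Fin d → ℝ) (q : LatticeDir d) : comp κ (opp q) = -comp κ q := by
  rcases q with ⟨j, b⟩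
  cases b <;> simp [opp, comp]

theorem comp_eq_sum (κ : Fin d → ℝ) (q : LatticeDir d) : comp κ q = ∑ j, κ j * (q.vec j : ℝ) := by
  rcases q with ⟨j, b⟩
  cases b <;> simp [vec, comp, Pi.single_apply]

theorem comp_linear (κ : Fin d → ℝ) (q : LatticeDir d) :
    comp κ q = ∑ j, κ j * comp (Pi.single j 1) q := by
  rcases q with ⟨j, b⟩
  cases b <;> simp [comp, Pi.single_apply]

end LatticeDir

/-- Translation of finite subsets of the lattice. -/
def shiftFinset (e : CubicLattice d) : Finset (CubicLattice d) ≃ Finset (CubicLattice d) :=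
  (Equiv.addRight e).finsetCongr

theorem mem_shiftFinset {e x : CubicLattice d} {A : Finset (CubicLattice d)} :
    x ∈ shiftFinset e A ↔ x - e ∈ A := by
  simp [shiftFinset, Equiv.finsetCongr, sub_eq_add_neg]

theorem card_shiftFinset (e : CubicLattice d) (A : Finset (CubicLattice d)) :
    (shiftFinset e A).card = A.card := by
  simp [shiftFinset, Equiv.finsetCongr]

theorem shiftFinset_eq_empty {e : CubicLattice d} {A : Finset (CubicLattice d)} :
    shiftFinset e A = ∅ ↔ A = ∅ := by
  simp [shiftFinset, Equiv.finsetCongr]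

@[simp]
theorem shiftFinset_empty (e : CubicLattice d) : shiftFinset e ∅ = ∅ :=
  shiftFinset_eq_empty.mpr rfl

theorem shiftFinset_shiftFinset (e e' : CubicLattice d) (A : Finset (CubicLattice d)) :
    shiftFinset e (shiftFinset e' A) = shiftFinset (e + e') A := by
  ext x
  simp only [mem_shiftFinset]
  rw [sub_sub, add_comm]

theorem shiftFinset_zero (A : Finset (CubicLattice d)) : shiftFinset 0 A = A := by
  ext x
  simp [mem_shiftFinset]

theorem shiftFinset_symmDiff (e x : CubicLattice d) (A : Finset (CubicLattice d)) :
    shiftFinset e (symmDiff A {x}) = symmDiff (shiftFinset e A) {x + e} := by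
  ext y
  simp only [mem_shiftFinset, Finset.mem_symmDiff, Finset.mem_singleton, sub_eq_iff_eq_add]

variable (p : Fin d → ℕ)

/-- The torus of residue classes of lattice points modulo the periods. -/
abbrev PeriodCell : Type := (j : Fin d) → ZMod (p j)

/-- The residue class of a lattice point. -/
def cellOf (x : CubicLattice d) : PeriodCell p := fun j => (x j : ZMod (p j))

theorem cellOf_add (x y : CubicLattice d) : cellOf p (x + y) = cellOf p x + cellOf p y := by
  ext j; simp [cellOf]

theorem cellOf_neg (x : CubicLattice d) : cellOf p (-x) = -cellOf p x := by
  ext j; simp [cellOf]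

@[simp]
theorem cellOf_zero : cellOf p (0 : CubicLattice d) = 0 := by
  ext j; simp [cellOf]

/-- The index set of the fibers: a residue class of a point `x`, the relative position `y - x`,
and a finite set of sites relative to `x`. -/
abbrev FiberIndex : Type := PeriodCell p × CubicLattice d × Finset (CubicLattice d)

namespace FiberIndex

/-- Hopping of the first point. -/
def hopX (e : CubicLattice d) : FiberIndex p ≃ FiberIndex p where
  -- The first point moves by `e` while the second point and the absolute positions of the sites
  -- stay, so relative positions change by `-e`.
  toFun i := (i.1 + cellOf p e, i.2.1 - e, shiftFinset (-e) i.2.2)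
  invFun i := (i.1 - cellOf p e, i.2.1 + e, shiftFinset e i.2.2)
  left_inv i := by simp [shiftFinset_shiftFinset, shiftFinset_zero]
  right_inv i := by simp [shiftFinset_shiftFinset, shiftFinset_zero]

/-- Hopping of the second point. -/
def hopY (e : CubicLattice d) : FiberIndex p ≃ FiberIndex p where
  toFun i := (i.1, i.2.1 + e, i.2.2)
  invFun i := (i.1, i.2.1 - e, i.2.2)
  left_inv i := by simp
  right_inv i := by simp

/-- Flip at the first point. -/
def flipX : FiberIndex p ≃ FiberIndex p where
  toFun i := (i.1, i.2.1, symmDiff i.2.2 {0})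
  invFun i := (i.1, i.2.1, symmDiff i.2.2 {0})
  left_inv i := by simp
  right_inv i := by simp

/-- Flip at the second point. -/
def flipY : FiberIndex p ≃ FiberIndex p where
  toFun i := (i.1, i.2.1, symmDiff i.2.2 {i.2.1})
  invFun i := (i.1, i.2.1, symmDiff i.2.2 {i.2.1})
  left_inv i := by simp
  right_inv i := by simp

end FiberIndex

/-- The `ℓ¹` length of a lattice vector. -/
def latticeLen (z : CubicLattice d) : ℝ := ∑ j, |(z j : ℝ)|

theorem latticeLen_nonneg (z : CubicLattice d) : 0 ≤ latticeLen z :=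
  Finset.sum_nonneg fun _ _ => abs_nonneg _

theorem latticeLen_add_le (z e : CubicLattice d) : latticeLen (z + e) ≤ latticeLen z + latticeLen e := by
  unfold latticeLen
  rw [← Finset.sum_add_distrib]
  refine Finset.sum_le_sum fun j _ => ?_
  simp only [Pi.add_apply, Int.cast_add]
  exact abs_add_le _ _

theorem latticeLen_neg (z : CubicLattice d) : latticeLen (-z) = latticeLen z := by
  simp [latticeLen]

theorem latticeLen_vec (q : LatticeDir d) : latticeLen q.vec = 1 := by
  rcases q with ⟨j, b⟩
  cases b <;> simp [LatticeDir.vec, latticeLen, Pi.single_apply, apply_ite abs]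

/-- An exponential weight. -/
def expWeight (η : ℝ) (z : CubicLattice d) : ℝ := Real.exp (-(η * latticeLen z))

theorem expWeight_pos (η : ℝ) (z : CubicLattice d) : 0 < expWeight η z := Real.exp_pos _

@[simp]
theorem expWeight_zero_left (z : CubicLattice d) : expWeight 0 z = 1 := by simp [expWeight]

@[simp]
theorem expWeight_zero_right (η : ℝ) : expWeight η (0 : CubicLattice d) = 1 := by
  simp [expWeight, latticeLen]

/-- By the triangle inequality the exponent of the quotient lies in `[-η, η]`. The lower bound then
amounts to `1 - exp (-η) ≤ exp η - 1`, that is, to `1 ≤ cosh η`. -/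
theorem abs_expWeight_div_sub_one_le {η : ℝ} (hη : 0 ≤ η) (z e : CubicLattice d)
    (he : latticeLen e = 1) :
    |expWeight η z / expWeight η (z + e) - 1| ≤ Real.exp η - 1 := by
  have h1 := latticeLen_add_le z e
  have h2 := latticeLen_add_le (z + e) (-e)
  rw [latticeLen_neg, add_neg_cancel_right] at h2
  rw [expWeight, expWeight, ← Real.exp_sub, abs_le]
  set x := -(η * latticeLen z) - -(η * latticeLen (z + e)) with hx
  have hx1 : x ≤ η := by rw [hx]; nlinarith
  have hx2 : -η ≤ x := by rw [hx]; nlinarith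
  have h3 := Real.exp_le_exp.mpr hx1
  have h4 := Real.exp_le_exp.mpr hx2
  refine ⟨?_, by linarith⟩
  have h5 : 2 ≤ Real.exp η + Real.exp (-η) := by
    have := Real.one_le_cosh η
    rw [Real.cosh_eq] at this
    linarith
  linarith

theorem expWeight_div_le {η : ℝ} (hη : 0 ≤ η) (z e : CubicLattice d) (he : latticeLen e = 1) :
    |expWeight η z / expWeight η (z + e)| ≤ Real.exp η := by
  have := abs_expWeight_div_sub_one_le hη z e he
  have h := abs_add_le (expWeight η z / expWeight η (z + e) - 1) 1
  rw [sub_add_cancel, abs_one] at h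
  linarith

section Operators

variable {p} [∀ j, NeZero (p j)] {η : ℝ} (hη : 0 ≤ η) (U : PeriodCell p → ℝ) (lam rate : ℝ)

/-- Weighted hopping of the first point. -/
def opX (q : LatticeDir d) : Ell2 ℂ (FiberIndex p) →L[ℂ] Ell2 ℂ (FiberIndex p) :=
  wcomp (fun i => ((expWeight η i.2.1 / expWeight η (i.2.1 + -q.vec) : ℝ) : ℂ))
    ⟨Real.exp η, fun i => by
      rw [Complex.norm_real]
      exact expWeight_div_le hη _ _ (by rw [latticeLen_neg, latticeLen_vec])⟩
    (FiberIndex.hopX p q.vec)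

/-- Weighted hopping of the second point. -/
def opY (q : LatticeDir d) : Ell2 ℂ (FiberIndex p) →L[ℂ] Ell2 ℂ (FiberIndex p) :=
  wcomp (fun i => ((expWeight η i.2.1 / expWeight η (i.2.1 + q.vec) : ℝ) : ℂ))
    ⟨Real.exp η, fun i => by
      rw [Complex.norm_real]
      exact expWeight_div_le hη _ _ (latticeLen_vec q)⟩
    (FiberIndex.hopY p q.vec)

/-- Difference of the periodic potentials at the two points. -/
def opU : Ell2 ℂ (FiberIndex p) →L[ℂ] Ell2 ℂ (FiberIndex p) :=
  wcomp (fun i => ((U i.1 - U (i.1 + cellOf p i.2.1) : ℝ) : ℂ))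
    ⟨2 * ∑ a, |U a|, fun i => by
      rw [Complex.norm_real, Real.norm_eq_abs]
      have h : ∀ a, |U a| ≤ ∑ a, |U a| := fun a =>
        Finset.single_le_sum (f := fun a => |U a|) (fun _ _ => abs_nonneg _) (Finset.mem_univ a)
      refine (abs_sub _ _).trans ?_
      linarith [h i.1, h (i.1 + cellOf p i.2.1)]⟩
    (Equiv.refl _)

/-- Flip at the first point. -/
def opFlipX : Ell2 ℂ (FiberIndex p) →L[ℂ] Ell2 ℂ (FiberIndex p) :=
  wcomp (fun _ => 1) ⟨1, fun _ => by simp⟩ (FiberIndex.flipX p)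

/-- Flip at the second point. -/
def opFlipY : Ell2 ℂ (FiberIndex p) →L[ℂ] Ell2 ℂ (FiberIndex p) :=
  wcomp (fun _ => 1) ⟨1, fun _ => by simp⟩ (FiberIndex.flipY p)

/-- Multiplication by the indicator function of a set. -/
def opInd {ι : Type*} (s : Set ι) : Ell2 ℂ ι →L[ℂ] Ell2 ℂ ι :=
  wcomp (s.indicator 1) ⟨1, fun i => by by_cases h : i ∈ s <;> simp [h]⟩ (Equiv.refl _)

/-- The sites carrying a nonempty set of spins. -/
def excited (p : Fin d → ℕ) : Set (FiberIndex p) := {i | i.2.2 ≠ ∅}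

/-- The bounded part of the generator of the dynamics in the fiber with momentum `s κ`. -/
def fiberGen (κ : Fin d → ℝ) (s : ℝ) : Ell2 ℂ (FiberIndex p) →L[ℂ] Ell2 ℂ (FiberIndex p) :=
  Complex.I • ∑ q : LatticeDir d,
      (Complex.exp (-(Complex.I * (s * LatticeDir.comp κ q : ℝ))) • opX hη q - opY hη q)
    + Complex.I • opU U + (Complex.I * lam) • (opFlipX - opFlipY)
    -- Of the decay rate `2 r |A|` only `2 r` on nonempty sets belongs to the bounded part. The
    -- rest, `fiberRate`, uses truncated subtraction and vanishes when `|A| ≤ 1`, which is where the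
    -- hypocoercive correction lives.
    + ((2 * rate : ℝ) : ℂ) • opInd (excited p)

/-- The unbounded part of the generator. -/
def fiberRate (rate : ℝ) (i : FiberIndex p) : ℝ := 2 * rate * ((i.2.2.card - 1 : ℕ) : ℝ)

/-- The normalization of the stationary vector. -/
def cellNorm (p : Fin d → ℕ) [∀ j, NeZero (p j)] : ℝ := Real.sqrt (Fintype.card (PeriodCell p))

theorem cellNorm_pos : 0 < cellNorm p := by
  unfold cellNorm
  have : 0 < Fintype.card (PeriodCell p) := Fintype.card_pos
  positivity

theorem cellNorm_sq : cellNorm p ^ 2 = Fintype.card (PeriodCell p) := by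
  unfold cellNorm
  rw [Real.sq_sqrt]
  positivity

open Classical in
/-- The stationary unit vector of the fiber at momentum zero. -/
def fiberStat (p : Fin d → ℕ) [∀ j, NeZero (p j)] : Ell2 ℂ (FiberIndex p) :=
  ∑ a : PeriodCell p, lp.single 2 ((a, 0, ∅) : FiberIndex p) (((cellNorm p)⁻¹ : ℝ) : ℂ)

@[simp]
theorem opInd_apply {ι : Type*} (s : Set ι) (f : Ell2 ℂ ι) (i : ι) :
    opInd s f i = s.indicator 1 i * f i := rfl

@[simp]
theorem opX_apply (q : LatticeDir d) (f : Ell2 ℂ (FiberIndex p)) (i : FiberIndex p) :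
    opX hη q f i = (expWeight η i.2.1 / expWeight η (i.2.1 + -q.vec) : ℝ) *
      f (i.1 + cellOf p q.vec, i.2.1 - q.vec, shiftFinset (-q.vec) i.2.2) := rfl

@[simp]
theorem opY_apply (q : LatticeDir d) (f : Ell2 ℂ (FiberIndex p)) (i : FiberIndex p) :
    opY hη q f i = (expWeight η i.2.1 / expWeight η (i.2.1 + q.vec) : ℝ) *
      f (i.1, i.2.1 + q.vec, i.2.2) := rfl

@[simp]
theorem opU_apply (f : Ell2 ℂ (FiberIndex p)) (i : FiberIndex p) :
    opU U f i = (U i.1 - U (i.1 + cellOf p i.2.1) : ℝ) * f i := rfl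

@[simp]
theorem opFlipX_apply (f : Ell2 ℂ (FiberIndex p)) (i : FiberIndex p) :
    opFlipX f i = f (i.1, i.2.1, symmDiff i.2.2 {0}) := one_mul _

@[simp]
theorem opFlipY_apply (f : Ell2 ℂ (FiberIndex p)) (i : FiberIndex p) :
    opFlipY f i = f (i.1, i.2.1, symmDiff i.2.2 {i.2.1}) := one_mul _

theorem fiberGen_apply (κ : Fin d → ℝ) (s : ℝ) (f : Ell2 ℂ (FiberIndex p)) (i : FiberIndex p) :
    fiberGen hη U lam rate κ s f i =
      Complex.I * ∑ q : LatticeDir d,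
        (Complex.exp (-(Complex.I * (s * LatticeDir.comp κ q : ℝ))) *
          ((expWeight η i.2.1 / expWeight η (i.2.1 + -q.vec) : ℝ) *
            f (i.1 + cellOf p q.vec, i.2.1 - q.vec, shiftFinset (-q.vec) i.2.2)) -
          (expWeight η i.2.1 / expWeight η (i.2.1 + q.vec) : ℝ) * f (i.1, i.2.1 + q.vec, i.2.2))
      + Complex.I * ((U i.1 - U (i.1 + cellOf p i.2.1) : ℝ) * f i)
      + Complex.I * lam * (f (i.1, i.2.1, symmDiff i.2.2 {0})
          - f (i.1, i.2.1, symmDiff i.2.2 {i.2.1}))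
      + (2 * rate : ℝ) * ((excited p).indicator 1 i * f i) := by
  have hsum : ∀ g : LatticeDir d → Ell2 ℂ (FiberIndex p), (∑ q, g q) i = ∑ q, g q i := fun g => by
    rw [lp.coeFn_sum, Finset.sum_apply]
  simp only [fiberGen, _root_.add_apply, _root_.smul_apply, _root_.sub_apply,
    _root_.sum_apply, lp.coeFn_add, lp.coeFn_smul, lp.coeFn_sub, Pi.add_apply,
    Pi.smul_apply, Pi.sub_apply, smul_eq_mul, hsum, opX_apply, opY_apply, opU_apply,
    opFlipX_apply, opFlipY_apply, opInd_apply]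

theorem fiberStat_apply (i : FiberIndex p) :
    fiberStat p i = if i.2.1 = 0 ∧ i.2.2 = ∅ then (((cellNorm p)⁻¹ : ℝ) : ℂ) else 0 := by
  classical
  rcases i with ⟨a, z, A⟩
  simp only [fiberStat, lp.coeFn_sum, Finset.sum_apply, lp.single_apply, Pi.single_apply,
    Prod.mk.injEq]
  by_cases h : z = 0 ∧ A = ∅
  · simp [h]
  · simp [h]

theorem inner_fiberStat (f : Ell2 ℂ (FiberIndex p)) :
    ⟪fiberStat p, f⟫_ℂ = ((cellNorm p)⁻¹ : ℝ) * ∑ a : PeriodCell p, f (a, 0, ∅) := by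
  classical
  simp only [fiberStat, sum_inner, lp.inner_single_left, RCLike.inner_apply, Complex.conj_ofReal,
    Finset.mul_sum]
  exact Finset.sum_congr rfl fun a _ => mul_comm _ _

theorem norm_fiberStat : ‖fiberStat p‖ = 1 := by
  have h1 : ⟪fiberStat p, fiberStat p⟫_ℂ = 1 := by
    rw [inner_fiberStat]
    simp only [fiberStat_apply, and_self, if_true, Finset.sum_const, Finset.card_univ,
      nsmul_eq_mul]
    have h2 := cellNorm_sq (p := p)
    have h3 := (cellNorm_pos (p := p)).ne'
    have : ((cellNorm p)⁻¹ : ℝ) * ((Fintype.card (PeriodCell p) : ℝ) * (cellNorm p)⁻¹) = 1 := by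
      rw [← h2]; field_simp
    exact_mod_cast this
  rw [inner_self_eq_norm_sq_to_K] at h1
  have h4 : ‖fiberStat p‖ ^ 2 = 1 := by
    have := congrArg Complex.re h1
    rw [← Complex.ofReal_one, Complex.ofReal_re] at this
    rw [← this]
    norm_cast
  exact (pow_eq_one_iff_of_nonneg (norm_nonneg _) two_ne_zero).mp h4

end Operators

end FiberModel

/-! ### Abstract hypocoercivity: one commutator, and the choice of weights. -/

section Hypocoercivity

open scoped InnerProductSpace
open ContinuousLinearMap (adjoint)

/-- The contribution of one commutator to a hypocoercivity estimate. -/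
theorem le_re_inner_commutator {H : Type*} [NormedAddCommGroup H] [InnerProductSpace ℂ H]
    [CompleteSpace H] (G X P R : H →L[ℂ] H) (z : ℝ) (hP : ∀ f g, ⟪P f, g⟫_ℂ = ⟪f, P g⟫_ℂ)
    (hPX : ∀ f, P (X f) = X f) (hG : ∀ f, P (G (f - R f)) = (Complex.I * z) • X f) (f : H) :
    z * ‖X f‖ ^ 2 - ‖X f‖ * (‖G‖ * ‖R f‖) - ‖X‖ * ‖P f‖ * (‖G‖ * ‖f‖) ≤
      (⟪Complex.I • X f + (-Complex.I) • adjoint X f, G f⟫_ℂ).re := by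
  -- `X` takes values in the range of `P`, so its adjoint sees only `P f`: the adjoint half of the
  -- symmetrized operator costs no more than a multiple of `‖P f‖`.
  have hXP : ∀ f, adjoint X f = adjoint X (P f) := fun f => by
    refine ext_inner_right ℂ fun g => ?_
    rw [ContinuousLinearMap.adjoint_inner_left, ContinuousLinearMap.adjoint_inner_left, hP, hPX]
  -- `P` extracts from `G f` the main term `i z X f`; the factor `i` on the left turns its pairing
  -- into `z ‖X f‖²`.
  have h1 : ⟪Complex.I • X f, G f⟫_ℂ =
      z * (‖X f‖ : ℂ) ^ 2 + ⟪Complex.I • X f, P (G (R f))⟫_ℂ := by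
    have e1 : P (G f) = (Complex.I * z) • X f + P (G (R f)) := by
      rw [← hG, ← map_add, ← map_add, sub_add_cancel]
    have e2 : ⟪Complex.I • X f, G f⟫_ℂ = ⟪Complex.I • X f, P (G f)⟫_ℂ := by
      rw [← hP, map_smul, hPX]
    rw [e2, e1, inner_add_right, inner_smul_left, inner_smul_right, inner_self_eq_norm_sq_to_K]
    congr 1
    simp only [Complex.conj_I]
    linear_combination (-(z : ℂ) * (‖X f‖ : ℂ) ^ 2) * Complex.I_sq
  have h2 : ⟪Complex.I • X f, P (G (R f))⟫_ℂ = ⟪Complex.I • X f, G (R f)⟫_ℂ := by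
    rw [← hP, map_smul, hPX]
  have h3 : ‖⟪Complex.I • X f, G (R f)⟫_ℂ‖ ≤ ‖X f‖ * (‖G‖ * ‖R f‖) := by
    refine (norm_inner_le_norm _ _).trans ?_
    rw [norm_smul, Complex.norm_I, one_mul]
    gcongr
    exact G.le_opNorm _
  have h4 : ‖⟪(-Complex.I) • adjoint X f, G f⟫_ℂ‖ ≤ ‖X‖ * ‖P f‖ * (‖G‖ * ‖f‖) := by
    refine (norm_inner_le_norm _ _).trans ?_
    rw [norm_smul, norm_neg, Complex.norm_I, one_mul]
    gcongr
    · rw [hXP]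
      exact (adjoint X).le_of_opNorm_le (LinearIsometryEquiv.norm_map _ _).le _
    · exact G.le_opNorm _
  rw [inner_add_left, h1, h2, Complex.add_re, Complex.add_re]
  have h5 : ((z : ℂ) * (‖X f‖ : ℂ) ^ 2).re = z * ‖X f‖ ^ 2 := by norm_cast
  rw [h5]
  have h6 := (abs_le.mp ((Complex.abs_re_le_norm _).trans h3)).1
  have h7 := (abs_le.mp ((Complex.abs_re_le_norm _).trans h4)).1
  linarith

/-- Choice of the weights in the hypocoercivity estimate. -/
theorem exists_hypocoercive_weights {r l k C₁ C₂ B : ℝ} (hr : 0 < r) (hl : 0 < l) (hk : 0 < k)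
    (hC₁ : 0 ≤ C₁) (hC₂ : 0 ≤ C₂) (hB : 0 ≤ B) :
    ∃ δ c : ℝ, 0 < δ ∧ 0 < c ∧ (δ ^ 2 + δ ^ 3) * B ≤ 1 / 2 ∧ ∀ q o g N T₁ T₂ : ℝ,
      N ^ 2 = q ^ 2 + o ^ 2 + g ^ 2 →
      l * o ^ 2 - C₁ * q * N ≤ T₁ → k * g ^ 2 - C₂ * (q + o) * N ≤ T₂ →
      c * N ^ 2 ≤ r * q ^ 2 + δ ^ 2 * T₁ + δ ^ 3 * T₂ := by
  -- In the application `q`, `o`, `g` are the norms of the excited, off-diagonal and diagonal parts;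
  -- their gains have order `1`, `δ²`, `δ³`. Young's inequality pays for every cross term with a
  -- fraction of these gains and at most `δ⁴ K N²` in total. The unspent gains are at least `δ³ m
  -- N²`, so `δ K ≤ m / 2` suffices.
  set m := min (r / 2) (min (l / 2) k) with hm
  have hm0 : 0 < m := by positivity
  set K := C₁ ^ 2 / r + C₂ ^ 2 / r + C₂ ^ 2 / (2 * l) with hK
  have hK0 : 0 ≤ K := by positivity
  set δ := min (min 1 (m / (2 * (K + 1)))) (1 / (4 * (B + 1))) with hδ
  have hδ0 : 0 < δ := by positivity
  have hδ1 : δ ≤ 1 := (min_le_left _ _).trans (min_le_left _ _)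
  have hδ2 : δ * (K + 1) ≤ m / 2 := by
    have : δ ≤ m / (2 * (K + 1)) := (min_le_left _ _).trans (min_le_right _ _)
    rw [le_div_iff₀ (by positivity)] at this
    linarith
  have hδ3 : δ * (B + 1) ≤ 1 / 4 := by
    have : δ ≤ 1 / (4 * (B + 1)) := min_le_right _ _
    rw [le_div_iff₀ (by positivity)] at this
    linarith
  have hδ4 : δ ^ 2 ≤ δ := by nlinarith
  have hδ5 : δ ^ 3 ≤ δ ^ 2 := pow_le_pow_of_le_one hδ0.le hδ1 (by norm_num)
  have hδ6 : δ ^ 3 ≤ 1 := pow_le_one₀ hδ0.le hδ1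
  refine ⟨δ, δ ^ 3 * (m / 2), hδ0, by positivity, by nlinarith, ?_⟩
  intro q o g N T₁ T₂ hN h1 h2
  have a1 : δ ^ 2 * (C₁ * q * N) ≤ r / 4 * q ^ 2 + C₁ ^ 2 / r * (δ ^ 4 * N ^ 2) := by
    have h : 0 ≤ (r * q - 2 * (C₁ * (δ ^ 2 * N))) ^ 2 / (4 * r) := by positivity
    have e : (r * q - 2 * (C₁ * (δ ^ 2 * N))) ^ 2 / (4 * r) =
        r / 4 * q ^ 2 + C₁ ^ 2 / r * (δ ^ 4 * N ^ 2) - δ ^ 2 * (C₁ * q * N) := by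
      field_simp; ring
    linarith
  have a2 : δ ^ 3 * (C₂ * q * N) ≤ r / 4 * q ^ 2 + C₂ ^ 2 / r * (δ ^ 6 * N ^ 2) := by
    have h : 0 ≤ (r * q - 2 * (C₂ * (δ ^ 3 * N))) ^ 2 / (4 * r) := by positivity
    have e : (r * q - 2 * (C₂ * (δ ^ 3 * N))) ^ 2 / (4 * r) =
        r / 4 * q ^ 2 + C₂ ^ 2 / r * (δ ^ 6 * N ^ 2) - δ ^ 3 * (C₂ * q * N) := by
      field_simp; ring
    linarith
  -- The ratio of the two weights matters here: `δ³ o N` is split between `δ² o²` and `δ⁴ N²`.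
  have a3 : δ ^ 3 * (C₂ * o * N) ≤ δ ^ 2 * (l / 2 * o ^ 2) + C₂ ^ 2 / (2 * l) * (δ ^ 4 * N ^ 2) := by
    have h : 0 ≤ δ ^ 2 * (l * o - C₂ * (δ * N)) ^ 2 / (2 * l) := by positivity
    have e : δ ^ 2 * (l * o - C₂ * (δ * N)) ^ 2 / (2 * l) =
        δ ^ 2 * (l / 2 * o ^ 2) + C₂ ^ 2 / (2 * l) * (δ ^ 4 * N ^ 2) - δ ^ 3 * (C₂ * o * N) := by
      field_simp; ring
    linarith
  have a4 : C₂ ^ 2 / r * (δ ^ 6 * N ^ 2) ≤ C₂ ^ 2 / r * (δ ^ 4 * N ^ 2) := by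
    have : δ ^ 6 ≤ δ ^ 4 := pow_le_pow_of_le_one hδ0.le hδ1 (by norm_num)
    gcongr
  have a5 : δ ^ 4 * N ^ 2 * K ≤ δ ^ 3 * N ^ 2 * (m / 2) := by
    calc δ ^ 4 * N ^ 2 * K = δ ^ 3 * N ^ 2 * (δ * K) := by ring
      _ ≤ δ ^ 3 * N ^ 2 * (m / 2) := by
        gcongr
        linarith
  have a6 : δ ^ 2 * (l * o ^ 2 - C₁ * q * N) ≤ δ ^ 2 * T₁ := by gcongr
  have a7 : δ ^ 3 * (k * g ^ 2 - C₂ * (q + o) * N) ≤ δ ^ 3 * T₂ := by gcongr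
  have b1 : δ ^ 3 * m * q ^ 2 ≤ r / 2 * q ^ 2 := by
    have : m ≤ r / 2 := min_le_left _ _
    have : δ ^ 3 * m ≤ 1 * (r / 2) := mul_le_mul hδ6 this hm0.le zero_le_one
    gcongr
    linarith
  have b2 : δ ^ 3 * m * o ^ 2 ≤ δ ^ 2 * (l / 2 * o ^ 2) := by
    have : m ≤ l / 2 := (min_le_right _ _).trans (min_le_left _ _)
    have : δ ^ 3 * m ≤ δ ^ 2 * (l / 2) := mul_le_mul hδ5 this hm0.le (by positivity)
    calc δ ^ 3 * m * o ^ 2 ≤ δ ^ 2 * (l / 2) * o ^ 2 := by gcongr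
      _ = _ := by ring
  have b3 : δ ^ 3 * m * g ^ 2 ≤ δ ^ 3 * (k * g ^ 2) := by
    have : m ≤ k := (min_le_right _ _).trans (min_le_right _ _)
    rw [mul_assoc]
    gcongr
  have b4 : δ ^ 3 * m * N ^ 2 = δ ^ 3 * m * q ^ 2 + δ ^ 3 * m * o ^ 2 + δ ^ 3 * m * g ^ 2 := by
    rw [hN]; ring
  have c1 : δ ^ 4 * N ^ 2 * K = C₁ ^ 2 / r * (δ ^ 4 * N ^ 2) + C₂ ^ 2 / r * (δ ^ 4 * N ^ 2)
      + C₂ ^ 2 / (2 * l) * (δ ^ 4 * N ^ 2) := by rw [hK]; ring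
  have c2 : δ ^ 2 * (l * o ^ 2 - C₁ * q * N) =
      2 * (δ ^ 2 * (l / 2 * o ^ 2)) - δ ^ 2 * (C₁ * q * N) := by ring
  have c3 : δ ^ 3 * (k * g ^ 2 - C₂ * (q + o) * N) = δ ^ 3 * (k * g ^ 2)
      - δ ^ 3 * (C₂ * q * N) - δ ^ 3 * (C₂ * o * N) := by ring
  have c4 : δ ^ 3 * (m / 2) * N ^ 2 = δ ^ 3 * m * N ^ 2 - δ ^ 3 * N ^ 2 * (m / 2) := by ring
  have c5 : r * q ^ 2 = r / 4 * q ^ 2 + r / 4 * q ^ 2 + r / 2 * q ^ 2 := by ring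
  rw [c1] at a5
  rw [c2] at a6
  rw [c3] at a7
  rw [c4, c5, b4]
  clear_value K m δ
  clear c1 c2 c3 c4 c5 hK hm hδ
  linarith only [a1, a2, a3, a4, a5, a6, a7, b1, b2, b3, b4]

end Hypocoercivity

/-! ### Parts of the fiber space and the symmetric part of the generator. -/

section FiberHypocoercivity

open scoped InnerProductSpace
open ContinuousLinearMap (adjoint)

variable {d : ℕ} {p : Fin d → ℕ}

theorem inner_opInd_left {ι : Type*} (s : Set ι) (f g : Ell2 ℂ ι) :
    ⟪opInd s f, g⟫_ℂ = ⟪f, opInd s g⟫_ℂ :=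
  inner_wcomp_left (fun _ => rfl) (fun i => by by_cases h : i ∈ s <;> simp [h]) f g

theorem inner_opInd_self {ι : Type*} (s : Set ι) (f : Ell2 ℂ ι) :
    ⟪f, opInd s f⟫_ℂ = (‖opInd s f‖ ^ 2 : ℝ) := by
  have h : opInd s (opInd s f) = opInd s f := by
    ext i
    by_cases h : i ∈ s <;> simp [h]
  rw [← h, ← inner_opInd_left, h, inner_self_eq_norm_sq_to_K]
  norm_cast

theorem norm_opInd_apply_le {ι : Type*} (s : Set ι) (f : Ell2 ℂ ι) : ‖opInd s f‖ ≤ ‖f‖ := by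
  refine Ell2.norm_le_of_le _ _ fun i => ?_
  by_cases h : i ∈ s <;> simp [h]

theorem norm_opInd_le_of_subset {ι : Type*} {s t : Set ι} (h : s ⊆ t) (f : Ell2 ℂ ι) :
    ‖opInd s f‖ ≤ ‖opInd t f‖ := by
  refine Ell2.norm_le_of_le _ _ fun i => ?_
  by_cases hs : i ∈ s
  · simp [hs, h hs]
  · rw [opInd_apply, Set.indicator_of_notMem hs, zero_mul, norm_zero]
    exact norm_nonneg _

theorem norm_sq_add_of_opInd_disjoint {ι : Type*} {s t : Set ι} (h : Disjoint s t) (f : Ell2 ℂ ι) :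
    ‖opInd s f‖ ^ 2 + ‖opInd t f‖ ^ 2 = ‖opInd (s ∪ t) f‖ ^ 2 := by
  rw [Ell2.norm_sq_eq, Ell2.norm_sq_eq, Ell2.norm_sq_eq,
    ← (Ell2.summable_norm_sq _).tsum_add (Ell2.summable_norm_sq _)]
  refine tsum_congr fun i => ?_
  by_cases hs : i ∈ s
  · have ht := Set.disjoint_left.mp h hs
    simp [hs, ht]
  · by_cases ht : i ∈ t <;> simp [hs, ht]

/-- Sites off the diagonal that carry no spins. -/
def offDiagonal (p : Fin d → ℕ) : Set (FiberIndex p) := {i | i.2.2 = ∅ ∧ i.2.1 ≠ 0}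

/-- Sites on the diagonal that carry no spins. -/
def onDiagonal (p : Fin d → ℕ) : Set (FiberIndex p) := {i | i.2.2 = ∅ ∧ i.2.1 = 0}

theorem norm_sq_eq_parts (f : Ell2 ℂ (FiberIndex p)) : ‖f‖ ^ 2 =
    ‖opInd (excited p) f‖ ^ 2 + ‖opInd (offDiagonal p) f‖ ^ 2 + ‖opInd (onDiagonal p) f‖ ^ 2 := by
  rw [norm_sq_add_of_opInd_disjoint, norm_sq_add_of_opInd_disjoint]
  · have : excited p ∪ offDiagonal p ∪ onDiagonal p = Set.univ := by
      ext i
      simp only [excited, offDiagonal, onDiagonal, Set.mem_union, Set.mem_ofPred_eq, Set.mem_univ]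
      tauto
    rw [this]
    congr 2
    ext i
    simp
  · rw [Set.disjoint_left]
    rintro i (h | h) h' <;> simp_all [excited, offDiagonal, onDiagonal]
  · rw [Set.disjoint_left]
    rintro i h h'
    simp_all [excited, offDiagonal]

variable [∀ j, NeZero (p j)]

theorem sub_opInd_excited (f : Ell2 ℂ (FiberIndex p)) (i : FiberIndex p) :
    (f - opInd (excited p) f) i = if i.2.2 = ∅ then f i else 0 := by
  rw [lp.coeFn_sub, Pi.sub_apply, opInd_apply]
  by_cases h : i.2.2 = ∅ <;> simp [excited, h]

theorem opInd_onDiagonal (f : Ell2 ℂ (FiberIndex p)) (i : FiberIndex p) :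
    opInd (onDiagonal p) f i = if i.2.2 = ∅ ∧ i.2.1 = 0 then f i else 0 := by
  rw [opInd_apply]
  by_cases h : i.2.2 = ∅ ∧ i.2.1 = 0
  · have : i ∈ onDiagonal p := h
    simp [this, h]
  · have : i ∉ onDiagonal p := h
    simp [this, h]

/-- The single spin sites on which the flip acts from the spinless off-diagonal sites. -/
def spinSites (p : Fin d → ℕ) : Set (FiberIndex p) := {i | i.2.2 = {0} ∧ i.2.1 ≠ 0}

/-- The spinless sites next to the diagonal. -/
def neighborSites (p : Fin d → ℕ) (q : LatticeDir d) : Set (FiberIndex p) :=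
  {i | i.2.2 = ∅ ∧ i.2.1 = q.vec}

/-- The transition from the spinless off-diagonal sites to the sites with one spin. -/
def opSpin (p : Fin d → ℕ) : Ell2 ℂ (FiberIndex p) →L[ℂ] Ell2 ℂ (FiberIndex p) :=
  opInd (spinSites p) ∘L opFlipX

/-- The transition from the diagonal to its neighbors. -/
def opStep (p : Fin d → ℕ) (q : LatticeDir d) :
    Ell2 ℂ (FiberIndex p) →L[ℂ] Ell2 ℂ (FiberIndex p) :=
  opInd (neighborSites p q) ∘L (opX le_rfl q - opY le_rfl (LatticeDir.opp q))

theorem opSpin_apply (f : Ell2 ℂ (FiberIndex p)) (i : FiberIndex p) :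
    opSpin p f i = if i.2.2 = {0} ∧ i.2.1 ≠ 0 then f (i.1, i.2.1, ∅) else 0 := by
  rw [opSpin, ContinuousLinearMap.comp_apply, opInd_apply, opFlipX_apply]
  by_cases h : i.2.2 = {0} ∧ i.2.1 ≠ 0
  · have : i ∈ spinSites p := h
    rw [Set.indicator_of_mem this, if_pos h, h.1]
    simp
  · have : i ∉ spinSites p := h
    rw [Set.indicator_of_notMem this, if_neg h, zero_mul]

theorem opStep_apply (q : LatticeDir d) (f : Ell2 ℂ (FiberIndex p)) (i : FiberIndex p) :
    opStep p q f i = if i.2.2 = ∅ ∧ i.2.1 = q.vec then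
      f (i.1 + cellOf p q.vec, 0, ∅) - f (i.1, 0, ∅) else 0 := by
  rw [opStep, ContinuousLinearMap.comp_apply, opInd_apply, _root_.sub_apply, lp.coeFn_sub,
    Pi.sub_apply, opX_apply, opY_apply]
  by_cases h : i.2.2 = ∅ ∧ i.2.1 = q.vec
  · have : i ∈ neighborSites p q := h
    rw [Set.indicator_of_mem this, if_pos h, h.1, h.2]
    simp [LatticeDir.vec_opp]
  · have : i ∉ neighborSites p q := h
    rw [Set.indicator_of_notMem this, if_neg h, zero_mul]

/-- The flip at the first point is an isometry that exchanges the spinless off-diagonal sites with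
the sites of spin set `{0}` and `z ≠ 0`; the transition loses nothing. -/
theorem norm_opSpin_apply (f : Ell2 ℂ (FiberIndex p)) :
    ‖opSpin p f‖ = ‖opInd (offDiagonal p) f‖ := by
  have : opInd (offDiagonal p) f = opFlipX (opSpin p f) := by
    ext i
    rcases i with ⟨a, z, A⟩
    rw [opInd_apply, opFlipX_apply, opSpin_apply]
    have h : symmDiff A {0} = {0} ↔ A = ∅ := by
      constructor
      · intro h
        have := congrArg (fun B => symmDiff B {0}) h
        simpa using this
      · rintro rfl; simp
    by_cases h' : A = ∅ ∧ z ≠ 0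
    · have h2 : (a, z, A) ∈ offDiagonal p := h'
      rw [Set.indicator_of_mem h2]
      simp [h'.1, h'.2]
    · have h2 : (a, z, A) ∉ offDiagonal p := h'
      rw [Set.indicator_of_notMem h2]
      simp only [h]
      rw [if_neg h', zero_mul]
  rw [this]
  have hF : ∀ g : Ell2 ℂ (FiberIndex p), ‖opFlipX g‖ = ‖g‖ := fun g => by
    refine (sq_eq_sq₀ (norm_nonneg _) (norm_nonneg _)).mp ?_
    rw [Ell2.norm_sq_eq, Ell2.norm_sq_eq]
    simp only [opFlipX_apply]
    exact (FiberIndex.flipX p).tsum_eq (fun i => ‖g i‖ ^ 2)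
  exact (hF _).symm

theorem inner_opX_left (q : LatticeDir d) (f g : Ell2 ℂ (FiberIndex p)) :
    ⟪opX le_rfl q f, g⟫_ℂ = ⟪f, opX le_rfl (LatticeDir.opp q) g⟫_ℂ := by
  refine inner_wcomp_left (fun i => ?_) (fun i => by simp) f g
  rw [LatticeDir.vec_opp]
  exact Prod.ext (by simp [FiberIndex.hopX, cellOf_neg])
    (Prod.ext (by simp [FiberIndex.hopX])
      (by simp [FiberIndex.hopX, shiftFinset_shiftFinset, shiftFinset_zero]))

theorem inner_opY_left (q : LatticeDir d) (f g : Ell2 ℂ (FiberIndex p)) :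
    ⟪opY le_rfl q f, g⟫_ℂ = ⟪f, opY le_rfl (LatticeDir.opp q) g⟫_ℂ := by
  refine inner_wcomp_left (fun i => ?_) (fun i => by simp) f g
  rw [LatticeDir.vec_opp]
  simp [FiberIndex.hopY]

/-- The adjoint of the generator. -/
theorem inner_fiberGen_left (U : PeriodCell p → ℝ) (lam rate : ℝ) (κ : Fin d → ℝ)
    (f g : Ell2 ℂ (FiberIndex p)) :
    ⟪fiberGen le_rfl U lam rate κ 0 f, g⟫_ℂ =
      ⟪f, ((4 * rate : ℝ) : ℂ) • opInd (excited p) g - fiberGen le_rfl U lam rate κ 0 g⟫_ℂ := by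
  have hU : ∀ f g : Ell2 ℂ (FiberIndex p), ⟪opU U f, g⟫_ℂ = ⟪f, opU U g⟫_ℂ := fun f g => by
    refine inner_wcomp_left (fun i => rfl) (fun i => ?_) f g
    exact (Complex.conj_ofReal _).symm
  have hFX : ∀ f g : Ell2 ℂ (FiberIndex p), ⟪opFlipX f, g⟫_ℂ = ⟪f, opFlipX g⟫_ℂ := fun f g => by
    refine inner_wcomp_left (fun i => ?_) (fun i => by simp) f g
    exact (FiberIndex.flipX p).left_inv i
  have hFY : ∀ f g : Ell2 ℂ (FiberIndex p), ⟪opFlipY f, g⟫_ℂ = ⟪f, opFlipY g⟫_ℂ := fun f g => by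
    refine inner_wcomp_left (fun i => ?_) (fun i => by simp) f g
    exact (FiberIndex.flipY p).left_inv i
  have hdec : fiberGen le_rfl U lam rate κ 0 = Complex.I • ((∑ q : LatticeDir d,
      (opX le_rfl q - opY le_rfl q)) + opU U + (lam : ℂ) • (opFlipX - opFlipY))
      + ((2 * rate : ℝ) : ℂ) • opInd (excited p) := by
    simp only [fiberGen, zero_mul, Complex.ofReal_zero, mul_zero, neg_zero, Complex.exp_zero,
      one_smul, smul_add, smul_smul]
  have hsum : ∑ q : LatticeDir d, (⟪f, opX le_rfl (LatticeDir.opp q) g⟫_ℂ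
      - ⟪f, opY le_rfl (LatticeDir.opp q) g⟫_ℂ) =
      ∑ q : LatticeDir d, (⟪f, opX le_rfl q g⟫_ℂ - ⟪f, opY le_rfl q g⟫_ℂ) :=
    LatticeDir.opp.sum_comp (fun q => ⟪f, opX le_rfl q g⟫_ℂ - ⟪f, opY le_rfl q g⟫_ℂ)
  rw [hdec]
  simp only [_root_.add_apply, _root_.smul_apply, _root_.sum_apply, _root_.sub_apply,
    inner_add_left, inner_add_right, inner_smul_left, inner_smul_right, sum_inner, inner_sum,
    inner_sub_left, inner_sub_right, hU, hFX, hFY, inner_opX_left, inner_opY_left,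
    Complex.conj_ofReal, inner_opInd_left, Complex.conj_I, hsum]
  push_cast
  ring

/-- The symmetric part of the generator. -/
theorem re_inner_fiberGen (U : PeriodCell p → ℝ) (lam rate : ℝ) (κ : Fin d → ℝ)
    (f : Ell2 ℂ (FiberIndex p)) :
    (⟪f, fiberGen le_rfl U lam rate κ 0 f⟫_ℂ).re = 2 * rate * ‖opInd (excited p) f‖ ^ 2 := by
  have h := inner_fiberGen_left U lam rate κ f f
  rw [inner_sub_right, inner_smul_right, inner_opInd_self, ← Complex.ofReal_mul] at h
  have h1 := congrArg Complex.re h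
  have h2 : (⟪fiberGen le_rfl U lam rate κ 0 f, f⟫_ℂ).re =
      (⟪f, fiberGen le_rfl U lam rate κ 0 f⟫_ℂ).re := by
    rw [← inner_conj_symm, Complex.conj_re]
  rw [h2, Complex.sub_re, Complex.ofReal_re] at h1
  linarith

end FiberHypocoercivity

/-! ### Transitions out of the undamped sites, and the Poincaré inequality. -/

section FiberHypocoercivity

open scoped InnerProductSpace
open ContinuousLinearMap (adjoint)

variable {d : ℕ} {p : Fin d → ℕ} [∀ j, NeZero (p j)]

theorem fiberGen_zero_apply (U : PeriodCell p → ℝ) (lam rate : ℝ) (κ : Fin d → ℝ)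
    (f : Ell2 ℂ (FiberIndex p)) (i : FiberIndex p) :
    fiberGen le_rfl U lam rate κ 0 f i =
      Complex.I * ∑ q : LatticeDir d,
        (f (i.1 + cellOf p q.vec, i.2.1 - q.vec, shiftFinset (-q.vec) i.2.2) -
          f (i.1, i.2.1 + q.vec, i.2.2))
      + Complex.I * ((U i.1 - U (i.1 + cellOf p i.2.1) : ℝ) * f i)
      + Complex.I * lam * (f (i.1, i.2.1, symmDiff i.2.2 {0})
          - f (i.1, i.2.1, symmDiff i.2.2 {i.2.1}))
      + (2 * rate : ℝ) * ((excited p).indicator 1 i * f i) := by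
  rw [fiberGen_apply]
  simp

/-- From spinless sites, a site with spin set `{0}` and `z ≠ 0` is reached by the flip at the first
point alone: hopping keeps the spin set empty, and the flip at the second point creates `{z} ≠ {0}`.
At `z = 0` the two flips would cancel. -/
theorem opInd_spinSites_fiberGen (U : PeriodCell p → ℝ) (lam rate : ℝ) (κ : Fin d → ℝ)
    (f : Ell2 ℂ (FiberIndex p)) :
    opInd (spinSites p) (fiberGen le_rfl U lam rate κ 0 (f - opInd (excited p) f)) =
      (Complex.I * lam) • opSpin p f := by
  ext ⟨a, z, A⟩
  rw [opInd_apply, lp.coeFn_smul, Pi.smul_apply, opSpin_apply]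
  by_cases h : A = {0} ∧ z ≠ 0
  · have hm : (a, z, A) ∈ spinSites p := h
    obtain ⟨rfl, hz⟩ := h
    have h2 : symmDiff ({0} : Finset (CubicLattice d)) {z} ≠ ∅ := by
      intro h
      have := Finset.symmDiff_eq_empty.mp h
      exact hz (Finset.singleton_injective this).symm
    rw [Set.indicator_of_mem hm, fiberGen_zero_apply]
    simp only [sub_opInd_excited, shiftFinset_eq_empty]
    simp [h2, hz]
  · have hm : (a, z, A) ∉ spinSites p := h
    rw [Set.indicator_of_notMem hm, if_neg h]
    simp

/-- A neighbor of the diagonal is connected to it by moving the first point along `q` or the second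
one against it. The two hops enter with opposite signs and read the diagonal at residue classes that
differ by `q`, which produces a discrete gradient. -/
theorem opInd_neighborSites_fiberGen (U : PeriodCell p → ℝ) (lam rate : ℝ) (κ : Fin d → ℝ)
    (q : LatticeDir d) (f : Ell2 ℂ (FiberIndex p)) :
    opInd (neighborSites p q) (fiberGen le_rfl U lam rate κ 0 (opInd (onDiagonal p) f)) =
      Complex.I • opStep p q f := by
  ext ⟨a, z, A⟩
  rw [opInd_apply, lp.coeFn_smul, Pi.smul_apply, opStep_apply]
  by_cases h : A = ∅ ∧ z = q.vec
  · have hm : (a, z, A) ∈ neighborSites p q := h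
    obtain ⟨rfl, rfl⟩ := h
    rw [Set.indicator_of_mem hm, fiberGen_zero_apply]
    simp only [opInd_onDiagonal, shiftFinset_empty, Finset.sum_sub_distrib]
    have e1 : ∀ q' : LatticeDir d, (q.vec - q'.vec = 0) ↔ q' = q := fun q' => by
      rw [sub_eq_zero]
      exact ⟨fun h => (LatticeDir.vec_injective h).symm, fun h => by rw [h]⟩
    have e2 : ∀ q' : LatticeDir d, (q.vec + q'.vec = 0) ↔ q' = LatticeDir.opp q := fun q' => by
      rw [← sub_neg_eq_add, ← LatticeDir.vec_opp, e1]
      constructor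
      · intro h; rw [← h, LatticeDir.opp_opp]
      · rintro rfl; rw [LatticeDir.opp_opp]
    simp only [true_and, e1, e2, Finset.sum_ite_eq', Finset.mem_univ, if_true]
    simp [LatticeDir.vec_ne_zero, LatticeDir.vec_opp, excited]
  · have hm : (a, z, A) ∉ neighborSites p q := h
    rw [Set.indicator_of_notMem hm, if_neg h]
    simp

/-- The unit vectors generate the lattice and the lattice covers the torus, so an invariant function
is constant, and a constant with sum zero vanishes. -/
theorem eq_zero_of_cell_shift_invariant (h : PeriodCell p → ℂ)
    (h1 : ∀ (q : LatticeDir d) a, h (a + cellOf p q.vec) = h a) (h2 : ∑ a, h a = 0) : h = 0 := by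
  let H : AddSubgroup (CubicLattice d) :=
    { carrier := {x | ∀ a, h (a + cellOf p x) = h a}
      add_mem' := fun {x y} hx hy a => by rw [cellOf_add, ← add_assoc, hy, hx]
      zero_mem' := fun a => by simp
      neg_mem' := fun {x} hx a => by
        rw [cellOf_neg, ← hx (a + -cellOf p x), neg_add_cancel_right] }
  have hH : ∀ x : CubicLattice d, x ∈ H := fun x => by
    have hx : x = ∑ j, x j • (Pi.single j 1 : CubicLattice d) := by
      ext k
      simp [Finset.sum_apply, Pi.single_apply]
    rw [hx]
    refine sum_mem fun j _ => zsmul_mem (fun a => ?_) _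
    have := h1 (j, true) a
    simpa [LatticeDir.vec] using this
  have hconst : ∀ a, h a = h 0 := fun a => by
    have := hH (fun j => ((a j).val : ℤ)) 0
    rw [← this]
    congr 1
    ext j
    simp [cellOf]
  simp only [hconst, Finset.sum_const, Finset.card_univ, nsmul_eq_mul, mul_eq_zero,
    Nat.cast_eq_zero, Fintype.card_ne_zero, false_or] at h2
  ext a
  rw [hconst, h2]; rfl

/-- The Poincaré inequality on the torus of residue classes. -/
theorem exists_poincare_cell (p : Fin d → ℕ) [∀ j, NeZero (p j)] :
    ∃ C : ℝ, 0 < C ∧ ∀ h : PeriodCell p → ℂ, ∑ a, h a = 0 →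
      ∑ a, ‖h a‖ ^ 2 ≤ C * ∑ q : LatticeDir d, ∑ a, ‖h (a + cellOf p q.vec) - h a‖ ^ 2 := by
  let L : (PeriodCell p → ℂ) →ₗ[ℂ] (LatticeDir d × PeriodCell p → ℂ) × ℂ :=
    { toFun := fun h => (fun i => h (i.2 + cellOf p i.1.vec) - h i.2, ∑ a, h a)
      map_add' := fun f g => by
        refine Prod.ext (funext fun i => ?_) ?_
        · simp only [Pi.add_apply, Prod.mk_add_mk]; ring
        · simp only [Pi.add_apply, Prod.mk_add_mk, Finset.sum_add_distrib]
      map_smul' := fun c f => by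
        refine Prod.ext (funext fun i => ?_) ?_
        · simp [mul_sub]
        · simp [Finset.mul_sum] }
  have hL : LinearMap.ker L = ⊥ := by
    rw [LinearMap.ker_eq_bot']
    intro h hh
    refine eq_zero_of_cell_shift_invariant h (fun q a => ?_) (congrArg Prod.snd hh)
    exact sub_eq_zero.mp (congrFun (congrArg Prod.fst hh) (q, a))
  -- An injective linear map on a finite dimensional space is bounded below; this is the Poincaré
  -- inequality with an inexplicit constant. The passage from the supremum norm to sums of squares
  -- costs the number of cells.
  obtain ⟨K, hK, hKL⟩ := L.exists_antilipschitzWith hL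
  refine ⟨Fintype.card (PeriodCell p) * (K : ℝ) ^ 2, by positivity, fun h hsum => ?_⟩
  have h1 : ‖h‖ ≤ K * ‖L h‖ := by
    have := hKL.le_mul_dist h 0
    simpa using this
  set E := ∑ q : LatticeDir d, ∑ a, ‖h (a + cellOf p q.vec) - h a‖ ^ 2 with hE
  have hE0 : 0 ≤ E := by positivity
  have h2 : ‖L h‖ ≤ Real.sqrt E := by
    refine max_le ?_ ?_
    · refine (pi_norm_le_iff_of_nonneg (Real.sqrt_nonneg _)).mpr fun i => ?_
      refine Real.le_sqrt_of_sq_le ?_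
      rw [hE, ← Fintype.sum_prod_type']
      exact Finset.single_le_sum
        (f := fun i : LatticeDir d × PeriodCell p => ‖h (i.2 + cellOf p i.1.vec) - h i.2‖ ^ 2)
        (fun _ _ => by positivity) (Finset.mem_univ i)
    · change ‖∑ a, h a‖ ≤ _
      rw [hsum, norm_zero]
      exact Real.sqrt_nonneg _
  have h3 : ‖h‖ ^ 2 ≤ (K : ℝ) ^ 2 * E := by
    rw [← Real.sq_sqrt hE0, ← mul_pow]
    gcongr
    exact h1.trans (by gcongr)
  calc ∑ a, ‖h a‖ ^ 2 ≤ ∑ _a : PeriodCell p, (K : ℝ) ^ 2 * E := by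
        refine Finset.sum_le_sum fun a _ => le_trans ?_ h3
        gcongr
        exact norm_le_pi_norm h a
    _ = _ := by rw [Finset.sum_const, Finset.card_univ, nsmul_eq_mul, mul_assoc]

theorem norm_sq_eq_sum_of_support (f : Ell2 ℂ (FiberIndex p)) (z : CubicLattice d)
    (h : ∀ i : FiberIndex p, ¬ (i.2.2 = ∅ ∧ i.2.1 = z) → f i = 0) :
    ‖f‖ ^ 2 = ∑ a, ‖f (a, z, ∅)‖ ^ 2 := by
  classical
  rw [f.norm_sq_eq]
  let em : PeriodCell p ↪ FiberIndex p := ⟨fun a => (a, z, ∅), fun a b hab => congrArg Prod.fst hab⟩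
  rw [tsum_eq_sum (s := Finset.univ.map em)]
  · rw [Finset.sum_map]; rfl
  · intro i hi
    rw [h i, norm_zero, zero_pow two_ne_zero]
    rintro ⟨h1, h2⟩
    refine hi (Finset.mem_map.mpr ⟨i.1, Finset.mem_univ _, ?_⟩)
    exact Prod.ext rfl (Prod.ext h2.symm h1.symm)

theorem norm_sq_opStep_apply (q : LatticeDir d) (f : Ell2 ℂ (FiberIndex p)) :
    ‖opStep p q f‖ ^ 2 = ∑ a, ‖f (a + cellOf p q.vec, 0, ∅) - f (a, 0, ∅)‖ ^ 2 := by
  rw [norm_sq_eq_sum_of_support _ q.vec]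
  · simp [opStep_apply]
  · intro i hi
    rw [opStep_apply, if_neg hi]

theorem norm_sq_opInd_onDiagonal (f : Ell2 ℂ (FiberIndex p)) :
    ‖opInd (onDiagonal p) f‖ ^ 2 = ∑ a, ‖f (a, 0, ∅)‖ ^ 2 := by
  rw [norm_sq_eq_sum_of_support _ 0]
  · simp only [opInd_onDiagonal, and_self, if_true]
  · intro i hi
    rw [opInd_onDiagonal, if_neg hi]

/-- The generator annihilates the stationary vector. -/
theorem fiberGen_fiberStat {η : ℝ} (hη : 0 ≤ η) (U : PeriodCell p → ℝ) (lam rate : ℝ)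
    (κ : Fin d → ℝ) : fiberGen hη U lam rate κ 0 (fiberStat p) = 0 := by
  ext ⟨a, z, A⟩
  rw [fiberGen_apply]
  have h1 : ∑ q : LatticeDir d,
      (Complex.exp (-(Complex.I * ((0 : ℝ) * LatticeDir.comp κ q : ℝ))) *
          ((expWeight η z / expWeight η (z + -q.vec) : ℝ) *
            fiberStat p (a + cellOf p q.vec, z - q.vec, shiftFinset (-q.vec) A)) -
          (expWeight η z / expWeight η (z + q.vec) : ℝ) * fiberStat p (a, z + q.vec, A)) = 0 := by
    -- On the stationary vector, a hop of the first point has the same effect as the opposite hop of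
    -- the second one, so the hopping terms cancel in pairs.
    rw [Finset.sum_sub_distrib, sub_eq_zero]
    refine Eq.trans ?_ (LatticeDir.opp.sum_comp _)
    refine Finset.sum_congr rfl fun q _ => ?_
    simp [fiberStat_apply, LatticeDir.vec_opp, shiftFinset_eq_empty, sub_eq_add_neg]
  rw [h1]
  have h2 : ((U a - U (a + cellOf p z) : ℝ) : ℂ) * fiberStat p (a, z, A) = 0 := by
    by_cases hz : z = 0
    · simp [hz]
    · simp [fiberStat_apply, hz]
  have h3 : fiberStat p (a, z, symmDiff A {0}) - fiberStat p (a, z, symmDiff A {z}) = 0 := by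
    by_cases hz : z = 0
    · simp [hz]
    · simp [fiberStat_apply, hz]
  have h4 : (excited p).indicator 1 (a, z, A) * fiberStat p (a, z, A) = 0 := by
    by_cases hA : A = ∅
    · simp [excited, hA]
    · simp [fiberStat_apply, hA]
  simp only [h2, h3, h4]
  simp

/-- The generator preserves the functional given by the stationary vector. -/
theorem inner_fiberStat_fiberGen {η : ℝ} (hη : 0 ≤ η) (U : PeriodCell p → ℝ) (lam rate : ℝ)
    (κ : Fin d → ℝ) (f : Ell2 ℂ (FiberIndex p)) :
    ⟪fiberStat p, fiberGen hη U lam rate κ 0 f⟫_ℂ = 0 := by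
  rw [inner_fiberStat]
  have h1 : ∀ a : PeriodCell p, fiberGen hη U lam rate κ 0 f (a, 0, ∅) = Complex.I *
      ∑ q : LatticeDir d, (((expWeight η (-q.vec))⁻¹ : ℝ) * f (a + cellOf p q.vec, -q.vec, ∅)
        - ((expWeight η q.vec)⁻¹ : ℝ) * f (a, q.vec, ∅)) := fun a => by
    rw [fiberGen_apply]
    simp [excited]
  simp only [h1]
  rw [← Finset.mul_sum, Finset.sum_comm]
  have h2 : ∑ q : LatticeDir d, ∑ a : PeriodCell p,
      (((expWeight η (-q.vec))⁻¹ : ℝ) * f (a + cellOf p q.vec, -q.vec, ∅)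
        - ((expWeight η q.vec)⁻¹ : ℝ) * f (a, q.vec, ∅)) = 0 := by
    simp only [Finset.sum_sub_distrib]
    rw [sub_eq_zero]
    -- The sum over all residue classes removes the shift by `cellOf p q.vec`; then opposite
    -- directions cancel.
    refine Eq.trans ?_ (LatticeDir.opp.sum_comp _)
    refine Finset.sum_congr rfl fun q _ => ?_
    rw [LatticeDir.vec_opp]
    exact Equiv.sum_comp (Equiv.addRight (cellOf p q.vec))
      (fun a => (((expWeight η (-q.vec))⁻¹ : ℝ) : ℂ) * f (a, -q.vec, ∅))
  rw [h2]
  simp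

theorem norm_opX_sub_le {η : ℝ} (hη : 0 ≤ η) (q : LatticeDir d) :
    ‖(opX hη q : Ell2 ℂ (FiberIndex p) →L[ℂ] _) - opX le_rfl q‖ ≤ Real.exp η - 1 := by
  have h0 : 0 ≤ Real.exp η - 1 := by linarith [Real.one_le_exp hη]
  have hb : ∀ i : FiberIndex p,
      ‖((expWeight η i.2.1 / expWeight η (i.2.1 + -q.vec) - 1 : ℝ) : ℂ)‖ ≤ Real.exp η - 1 :=
    fun i => by
      rw [Complex.norm_real]
      exact abs_expWeight_div_sub_one_le hη _ _ (by rw [latticeLen_neg, latticeLen_vec])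
  refine le_of_eq_of_le (congrArg norm ?_)
    (wcomp_norm_le (hc := ⟨_, hb⟩) (σ := FiberIndex.hopX p q.vec) h0 hb)
  ext f i
  rw [_root_.sub_apply, lp.coeFn_sub, Pi.sub_apply, opX_apply, opX_apply, wcomp_apply]
  simp [FiberIndex.hopX, sub_mul]

theorem norm_opY_sub_le {η : ℝ} (hη : 0 ≤ η) (q : LatticeDir d) :
    ‖(opY hη q : Ell2 ℂ (FiberIndex p) →L[ℂ] _) - opY le_rfl q‖ ≤ Real.exp η - 1 := by
  have h0 : 0 ≤ Real.exp η - 1 := by linarith [Real.one_le_exp hη]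
  have hb : ∀ i : FiberIndex p,
      ‖((expWeight η i.2.1 / expWeight η (i.2.1 + q.vec) - 1 : ℝ) : ℂ)‖ ≤ Real.exp η - 1 :=
    fun i => by
      rw [Complex.norm_real]
      exact abs_expWeight_div_sub_one_le hη _ _ (latticeLen_vec q)
  refine le_of_eq_of_le (congrArg norm ?_)
    (wcomp_norm_le (hc := ⟨_, hb⟩) (σ := FiberIndex.hopY p q.vec) h0 hb)
  ext f i
  rw [_root_.sub_apply, lp.coeFn_sub, Pi.sub_apply, opY_apply, opY_apply, wcomp_apply]
  simp [FiberIndex.hopY, sub_mul]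

/-- The weight enters only the `2d` hoppings of either point, each of which changes by at most `exp
η - 1` in norm; so coercivity survives small weights. -/
theorem norm_fiberGen_sub_le {η : ℝ} (hη : 0 ≤ η) (U : PeriodCell p → ℝ) (lam rate : ℝ)
    (κ : Fin d → ℝ) : ‖fiberGen hη U lam rate κ 0 - fiberGen le_rfl U lam rate κ 0‖ ≤
      4 * d * (Real.exp η - 1) := by
  have h : fiberGen hη U lam rate κ 0 - fiberGen le_rfl U lam rate κ 0 =
      Complex.I • ∑ q : LatticeDir d, ((opX hη q - opX le_rfl q) - (opY hη q - opY le_rfl q)) := by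
    simp only [fiberGen, zero_mul, Complex.ofReal_zero, mul_zero, neg_zero, Complex.exp_zero,
      one_smul, Finset.sum_sub_distrib, smul_sub]
    abel
  rw [h, norm_smul, Complex.norm_I, one_mul]
  refine (norm_sum_le _ _).trans ?_
  have h2 : ∀ q : LatticeDir d, ‖((opX hη q : Ell2 ℂ (FiberIndex p) →L[ℂ] _) - opX le_rfl q)
      - (opY hη q - opY le_rfl q)‖ ≤ 2 * (Real.exp η - 1) := fun q => by
    refine (norm_sub_le _ _).trans ?_
    linarith [norm_opX_sub_le (p := p) hη q, norm_opY_sub_le (p := p) hη q]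
  refine (Finset.sum_le_sum fun q _ => h2 q).trans (le_of_eq ?_)
  simp
  ring

end FiberHypocoercivity

/-! ### Hypocoercivity of the fiber generator. -/

section FiberHypocoercivity

open scoped InnerProductSpace
open ContinuousLinearMap (adjoint)

variable {d : ℕ} {p : Fin d → ℕ} [∀ j, NeZero (p j)]

/-- The symmetric operator `i X + (i X)†`. -/
def twistedSymm {H : Type*} [NormedAddCommGroup H] [InnerProductSpace ℂ H]
    [CompleteSpace H] (X : H →L[ℂ] H) : H →L[ℂ] H :=
  Complex.I • X + (-Complex.I) • adjoint X

section TwistedSymm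

variable {H : Type*} [NormedAddCommGroup H] [InnerProductSpace ℂ H] [CompleteSpace H]

theorem inner_twistedSymm_left (X : H →L[ℂ] H) (f g : H) :
    ⟪twistedSymm X f, g⟫_ℂ = ⟪f, twistedSymm X g⟫_ℂ := by
  simp only [twistedSymm, _root_.add_apply, _root_.smul_apply, inner_add_left, inner_add_right,
    inner_smul_left, inner_smul_right, ContinuousLinearMap.adjoint_inner_left,
    ContinuousLinearMap.adjoint_inner_right, map_neg, Complex.conj_I]
  ring

theorem norm_twistedSymm_le (X : H →L[ℂ] H) : ‖twistedSymm X‖ ≤ 2 * ‖X‖ := by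
  refine (norm_add_le _ _).trans ?_
  rw [norm_smul, norm_smul, norm_neg, Complex.norm_I, LinearIsometryEquiv.norm_map]
  linarith

end TwistedSymm

/-- The operators `opSpin` and `opStep` do not see sites with more than one spin. -/
theorem twistedSymm_apply_eq_zero (X : Ell2 ℂ (FiberIndex p) →L[ℂ] Ell2 ℂ (FiberIndex p))
    (s : Set (FiberIndex p)) (h1 : ∀ f, opInd s (X f) = X f) (h2 : ∀ f, X (opInd s f) = X f)
    (f : Ell2 ℂ (FiberIndex p)) {i : FiberIndex p} (hi : i ∉ s) : twistedSymm X f i = 0 := by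
  have h3 : opInd s (adjoint X f) = adjoint X f := by
    refine ext_inner_right ℂ fun g => ?_
    rw [inner_opInd_left, ContinuousLinearMap.adjoint_inner_left,
      ContinuousLinearMap.adjoint_inner_left, h2]
  have h4 : ∀ g : Ell2 ℂ (FiberIndex p), opInd s g i = 0 := fun g => by
    rw [opInd_apply, Set.indicator_of_notMem hi, zero_mul]
  change (Complex.I • X f + (-Complex.I) • adjoint X f : Ell2 ℂ (FiberIndex p)) i = 0
  rw [← h1, ← h3, lp.coeFn_add, lp.coeFn_smul, lp.coeFn_smul]
  simp only [Pi.add_apply, Pi.smul_apply, h4, smul_zero, add_zero]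

theorem twistedSymm_eq_zero_of_opInd (X : Ell2 ℂ (FiberIndex p) →L[ℂ] Ell2 ℂ (FiberIndex p))
    (s : Set (FiberIndex p)) (h1 : ∀ f, opInd s (X f) = X f) {f : Ell2 ℂ (FiberIndex p)}
    (hf : X f = 0) (hf' : opInd s f = 0) : twistedSymm X f = 0 := by
  have h3 : adjoint X f = 0 := by
    refine ext_inner_right ℂ fun g => ?_
    rw [ContinuousLinearMap.adjoint_inner_left, ← h1, ← inner_opInd_left, hf', inner_zero_left,
      inner_zero_left]
  simp [twistedSymm, hf, h3]

/-- The sites carrying at most one spin. -/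
def fewSpins (p : Fin d → ℕ) : Set (FiberIndex p) := {i | i.2.2.card ≤ 1}

theorem opInd_opInd_of_subset {ι : Type*} {s t : Set ι} (h : s ⊆ t) (f : Ell2 ℂ ι) :
    opInd t (opInd s f) = opInd s f := by
  ext i
  by_cases hs : i ∈ s
  · simp [hs, h hs]
  · simp [hs]

theorem spinSites_subset_fewSpins : spinSites p ⊆ fewSpins p := fun i hi => by
  change i.2.2.card ≤ 1
  rw [hi.1]; simp

theorem neighborSites_subset_fewSpins (q : LatticeDir d) : neighborSites p q ⊆ fewSpins p :=
  fun i hi => by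
    change i.2.2.card ≤ 1
    rw [hi.1]; simp

theorem spinSites_subset_excited : spinSites p ⊆ excited p := fun i hi => by
  change i.2.2 ≠ ∅
  rw [hi.1]; simp

theorem neighborSites_subset_offDiagonal (q : LatticeDir d) :
    neighborSites p q ⊆ offDiagonal p := fun i hi => by
  refine ⟨hi.1, ?_⟩
  rw [hi.2]
  exact q.vec_ne_zero

theorem opSpin_fewSpins (f : Ell2 ℂ (FiberIndex p)) : opSpin p (opInd (fewSpins p) f) = opSpin p f := by
  ext i
  simp only [opSpin_apply, opInd_apply]
  have : (i.1, i.2.1, (∅ : Finset (CubicLattice d))) ∈ fewSpins p := by simp [fewSpins]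
  simp [this]

theorem opStep_fewSpins (q : LatticeDir d) (f : Ell2 ℂ (FiberIndex p)) :
    opStep p q (opInd (fewSpins p) f) = opStep p q f := by
  ext i
  simp only [opStep_apply, opInd_apply]
  have : ∀ a, (a, 0, (∅ : Finset (CubicLattice d))) ∈ fewSpins p := fun a => by simp [fewSpins]
  simp [this]

theorem opSpin_fiberStat : opSpin p (fiberStat p) = 0 := by
  ext i
  simp only [opSpin_apply, fiberStat_apply]
  by_cases h : i.2.1 = 0 <;> simp [h]

theorem opStep_fiberStat (q : LatticeDir d) : opStep p q (fiberStat p) = 0 := by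
  ext i
  simp only [opStep_apply, fiberStat_apply]
  simp

theorem opInd_fiberStat_eq_zero {s : Set (FiberIndex p)}
    (hs : ∀ i ∈ s, ¬ (i.2.1 = 0 ∧ i.2.2 = ∅)) : opInd s (fiberStat p) = 0 := by
  ext i
  rw [opInd_apply, fiberStat_apply]
  by_cases hi : i ∈ s
  · rw [if_neg (hs i hi)]; simp
  · rw [Set.indicator_of_notMem hi]; simp

theorem norm_sq_opInd_onDiagonal_le (p : Fin d → ℕ) [∀ j, NeZero (p j)] : ∃ C : ℝ, 0 < C ∧
    ∀ f : Ell2 ℂ (FiberIndex p), ⟪fiberStat p, f⟫_ℂ = 0 →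
      ‖opInd (onDiagonal p) f‖ ^ 2 ≤ C * ∑ q, ‖opStep p q f‖ ^ 2 := by
  obtain ⟨C, hC, h⟩ := exists_poincare_cell p
  refine ⟨C, hC, fun f hf => ?_⟩
  rw [inner_fiberStat] at hf
  have hne : (((cellNorm p)⁻¹ : ℝ) : ℂ) ≠ 0 := by
    exact_mod_cast (inv_pos.mpr cellNorm_pos).ne'
  simp only [norm_sq_opInd_onDiagonal, norm_sq_opStep_apply]
  exact h (fun a => f (a, 0, ∅)) ((mul_eq_zero.mp hf).resolve_left hne)

/-- Hypocoercivity of the generator without exponential weight. -/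
theorem exists_hypocoercive_unweighted (U : PeriodCell p → ℝ) {lam rate : ℝ} (hlam : 0 < lam)
    (hrate : 0 < rate) (κ : Fin d → ℝ) :
    ∃ (A : Ell2 ℂ (FiberIndex p) →L[ℂ] Ell2 ℂ (FiberIndex p)) (c : ℝ), 0 < c ∧
      (∀ f g, ⟪A f, g⟫_ℂ = ⟪f, A g⟫_ℂ) ∧ ‖A‖ ≤ 1 / 2 ∧
      (∀ f i, i ∉ fewSpins p → A f i = 0) ∧ A (fiberStat p) = 0 ∧
      ∀ Y, ⟪fiberStat p, Y⟫_ℂ = 0 →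
        c * ‖Y‖ ^ 2 ≤ (⟪Y + A Y, fiberGen le_rfl U lam rate κ 0 Y⟫_ℂ).re := by
  obtain ⟨C, hC, hP⟩ := norm_sq_opInd_onDiagonal_le p
  set G : Ell2 ℂ (FiberIndex p) →L[ℂ] Ell2 ℂ (FiberIndex p) := fiberGen le_rfl U lam rate κ 0
    with hG
  set B₂ := ∑ q, ‖opStep p q‖ with hB₂
  have hB₂0 : 0 ≤ B₂ := by positivity
  obtain ⟨δ, c, hδ, hc, hδB, hcomb⟩ := exists_hypocoercive_weights (r := 2 * rate) (l := lam)
    (k := C⁻¹) (C₁ := ‖opSpin p‖ * ‖G‖ + ‖opSpin p‖ * ‖G‖) (C₂ := 2 * B₂ * ‖G‖)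
    (B := 2 * ‖opSpin p‖ + 2 * B₂) (by positivity) hlam (by positivity) (by positivity)
    (by positivity) (by positivity)
  set A₁ := twistedSymm (opSpin p) with hA₁
  set A₂ : Ell2 ℂ (FiberIndex p) →L[ℂ] Ell2 ℂ (FiberIndex p) :=
    ∑ q, twistedSymm (opStep p q) with hA₂
  have hA₂_apply : ∀ f, A₂ f = ∑ q, twistedSymm (opStep p q) f := fun f => by
    rw [hA₂, _root_.sum_apply]
  have hs1 : ∀ f, opInd (spinSites p) (opSpin p f) = opSpin p f := fun f =>
    opInd_opInd_of_subset subset_rfl _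
  have hs2 : ∀ q f, opInd (neighborSites p q) (opStep p q f) = opStep p q f := fun q f =>
    opInd_opInd_of_subset subset_rfl _
  have hδ2 : ‖((δ ^ 2 : ℝ) : ℂ)‖ = δ ^ 2 := by rw [Complex.norm_real]; simp
  have hδ3 : ‖((δ ^ 3 : ℝ) : ℂ)‖ = δ ^ 3 := by
    rw [Complex.norm_real, Real.norm_of_nonneg (by positivity)]
  -- The correction couples each undamped part to the part it feeds. The smaller weight `δ³` goes to
  -- the transition from the diagonal, which is two steps away from the dissipation.
  refine ⟨((δ ^ 2 : ℝ) : ℂ) • A₁ + ((δ ^ 3 : ℝ) : ℂ) • A₂, c, hc, fun f g => ?_, ?_, fun f i hi => ?_,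
    ?_, fun Y hY => ?_⟩
  · simp only [_root_.add_apply, _root_.smul_apply, inner_add_left, inner_add_right,
      inner_smul_left, inner_smul_right, Complex.conj_ofReal, hA₁, inner_twistedSymm_left,
      hA₂_apply, sum_inner, inner_sum]
  · refine (norm_add_le _ _).trans ?_
    rw [norm_smul, norm_smul, hδ2, hδ3]
    have h1 : ‖A₁‖ ≤ 2 * ‖opSpin p‖ := norm_twistedSymm_le _
    have h2 : ‖A₂‖ ≤ 2 * B₂ := by
      rw [hB₂, Finset.mul_sum]
      exact (norm_sum_le _ _).trans (Finset.sum_le_sum fun q _ => norm_twistedSymm_le _)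
    have h3 : δ ^ 2 * ‖A₁‖ ≤ δ ^ 2 * (2 * ‖opSpin p‖ + 2 * B₂) := by gcongr; linarith
    have h4 : δ ^ 3 * ‖A₂‖ ≤ δ ^ 3 * (2 * ‖opSpin p‖ + 2 * B₂) := by
      gcongr
      linarith [norm_nonneg (opSpin p)]
    linarith
  · rw [_root_.add_apply, lp.coeFn_add, Pi.add_apply, _root_.smul_apply, _root_.smul_apply,
      lp.coeFn_smul, lp.coeFn_smul, Pi.smul_apply, Pi.smul_apply, hA₂_apply, lp.coeFn_sum,
      Finset.sum_apply,
      twistedSymm_apply_eq_zero (opSpin p) (fewSpins p)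
        (fun f => opInd_opInd_of_subset spinSites_subset_fewSpins _) opSpin_fewSpins f hi,
      Finset.sum_eq_zero fun q _ => twistedSymm_apply_eq_zero (opStep p q) (fewSpins p)
        (fun f => opInd_opInd_of_subset (neighborSites_subset_fewSpins q) _) (opStep_fewSpins q)
        f hi]
    simp
  · rw [_root_.add_apply, _root_.smul_apply, _root_.smul_apply, hA₂_apply, hA₁,
      twistedSymm_eq_zero_of_opInd _ _ hs1 opSpin_fiberStat
        (opInd_fiberStat_eq_zero fun i hi h => hi.2 h.1),
      Finset.sum_eq_zero fun q _ => twistedSymm_eq_zero_of_opInd _ _ (hs2 q) (opStep_fiberStat q)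
        (opInd_fiberStat_eq_zero fun i hi h => q.vec_ne_zero (hi.2.symm.trans h.1))]
    simp
  · have hYN : ∀ s, ‖opInd s Y‖ ≤ ‖Y‖ := fun s => norm_opInd_apply_le s Y
    -- All remainders of this commutator are paid by the excited part, which the generator damps
    -- directly.
    have hT1 : lam * ‖opInd (offDiagonal p) Y‖ ^ 2 - (‖opSpin p‖ * ‖G‖ + ‖opSpin p‖ * ‖G‖) *
        ‖opInd (excited p) Y‖ * ‖Y‖ ≤ (⟪A₁ Y, G Y⟫_ℂ).re := by
      have := le_re_inner_commutator G (opSpin p) (opInd (spinSites p)) (opInd (excited p)) lam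
        (inner_opInd_left _) hs1 (opInd_spinSites_fiberGen U lam rate κ) Y
      refine le_trans ?_ this
      have a1 : ‖opSpin p Y‖ ≤ ‖opSpin p‖ * ‖Y‖ := (opSpin p).le_opNorm Y
      have a2 : ‖opInd (spinSites p) Y‖ ≤ ‖opInd (excited p) Y‖ :=
        norm_opInd_le_of_subset spinSites_subset_excited Y
      have a3 : ‖opSpin p Y‖ * (‖G‖ * ‖opInd (excited p) Y‖) ≤
          ‖opSpin p‖ * ‖Y‖ * (‖G‖ * ‖opInd (excited p) Y‖) := by gcongr
      have a4 : ‖opSpin p‖ * ‖opInd (spinSites p) Y‖ * (‖G‖ * ‖Y‖) ≤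
          ‖opSpin p‖ * ‖opInd (excited p) Y‖ * (‖G‖ * ‖Y‖) := by gcongr
      rw [norm_opSpin_apply] at a3 ⊢
      linarith
    -- Here the remainders involve everything off the diagonal. The discrete gradients bound the
    -- diagonal part because `Y ⊥ fiberStat` makes its mean over the cells vanish.
    have hT2 : C⁻¹ * ‖opInd (onDiagonal p) Y‖ ^ 2 - 2 * B₂ * ‖G‖ *
        (‖opInd (excited p) Y‖ + ‖opInd (offDiagonal p) Y‖) * ‖Y‖ ≤ (⟪A₂ Y, G Y⟫_ℂ).re := by
      have hRQ : ‖Y - opInd (onDiagonal p) Y‖ ≤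
          ‖opInd (excited p) Y‖ + ‖opInd (offDiagonal p) Y‖ := by
        have : Y - opInd (onDiagonal p) Y = opInd (excited p) Y + opInd (offDiagonal p) Y := by
          ext i
          rw [lp.coeFn_sub, lp.coeFn_add, Pi.sub_apply, Pi.add_apply]
          simp only [opInd_apply]
          by_cases h : i.2.2 = ∅
          · by_cases h' : i.2.1 = 0 <;> simp [onDiagonal, offDiagonal, excited, h, h']
          · simp [onDiagonal, offDiagonal, excited, h]
        rw [this]
        exact norm_add_le _ _
      have hq : ∀ q, ‖opStep p q Y‖ ^ 2 - ‖opStep p q‖ * (2 * ‖G‖ *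
          (‖opInd (excited p) Y‖ + ‖opInd (offDiagonal p) Y‖) * ‖Y‖) ≤
            (⟪twistedSymm (opStep p q) Y, G Y⟫_ℂ).re := fun q => by
        have := le_re_inner_commutator G (opStep p q) (opInd (neighborSites p q))
          (ContinuousLinearMap.id ℂ _ - opInd (onDiagonal p)) 1
          (inner_opInd_left _) (hs2 q) (fun f => by
            rw [_root_.sub_apply, ContinuousLinearMap.id_apply, sub_sub_cancel, hG,
              opInd_neighborSites_fiberGen, Complex.ofReal_one, mul_one]) Y
        refine le_trans ?_ this
        rw [_root_.sub_apply, ContinuousLinearMap.id_apply, one_mul]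
        have a1 : ‖opStep p q Y‖ ≤ ‖opStep p q‖ * ‖Y‖ := (opStep p q).le_opNorm Y
        have a2 : ‖opInd (neighborSites p q) Y‖ ≤
            ‖opInd (excited p) Y‖ + ‖opInd (offDiagonal p) Y‖ :=
          (norm_opInd_le_of_subset (neighborSites_subset_offDiagonal q) Y).trans
            (le_add_of_nonneg_left (norm_nonneg _))
        have a3 : ‖opStep p q Y‖ * (‖G‖ * ‖Y - opInd (onDiagonal p) Y‖) ≤ ‖opStep p q‖ * ‖Y‖ *
          (‖G‖ * (‖opInd (excited p) Y‖ + ‖opInd (offDiagonal p) Y‖)) := by gcongr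
        have a4 : ‖opStep p q‖ * ‖opInd (neighborSites p q) Y‖ * (‖G‖ * ‖Y‖) ≤ ‖opStep p q‖ *
          (‖opInd (excited p) Y‖ + ‖opInd (offDiagonal p) Y‖) * (‖G‖ * ‖Y‖) := by gcongr
        linarith
      have hsum := Finset.sum_le_sum fun q (_ : q ∈ Finset.univ) => hq q
      rw [Finset.sum_sub_distrib, ← Finset.sum_mul, ← hB₂] at hsum
      rw [hA₂_apply, sum_inner, Complex.re_sum]
      have h1 : C⁻¹ * ‖opInd (onDiagonal p) Y‖ ^ 2 ≤ ∑ q, ‖opStep p q Y‖ ^ 2 := by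
        rw [inv_mul_le_iff₀ hC]
        exact hP Y hY
      linarith
    have := hcomb _ _ _ _ _ _ (norm_sq_eq_parts Y) hT1 hT2
    refine this.trans (le_of_eq ?_)
    rw [inner_add_left, Complex.add_re, hG, re_inner_fiberGen, ← hG, _root_.add_apply,
      _root_.smul_apply, _root_.smul_apply, inner_add_left, inner_smul_left, inner_smul_left,
      Complex.conj_ofReal, Complex.conj_ofReal, Complex.add_re, Complex.re_ofReal_mul,
      Complex.re_ofReal_mul]
    ring

/-- The generator of the fiber dynamics is hypocoercive, if the exponential weight is chosen small
enough. -/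
theorem exists_hypocoerciveGenerator (U : PeriodCell p → ℝ) {lam rate : ℝ} (hlam : 0 < lam)
    (hrate : 0 < rate) : ∃ (η : ℝ) (hη : 0 < η) (S : HypocoerciveGenerator (FiberIndex p)),
      (∀ κ, S.G = fiberGen hη.le U lam rate κ 0) ∧ S.b = fiberRate rate ∧ S.e = fiberStat p := by
  obtain ⟨A, c, hc, hA, hA', hA0, hAe, hco⟩ :=
    exists_hypocoercive_unweighted (p := p) U hlam hrate 0
  -- With `exp η - 1 = x` the weight perturbs the generator by at most `4 d x ≤ c / 3`. As `‖Y + A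
  -- Y‖ ≤ 3/2 ‖Y‖`, this costs `c / 2`, half of the coercivity.
  set x := c / (12 * d + 1) with hx
  have hx0 : 0 < x := by positivity
  have hη : 0 < Real.log (1 + x) := Real.log_pos (by linarith)
  have hexp : Real.exp (Real.log (1 + x)) - 1 = x := by
    rw [Real.exp_log (by linarith)]; ring
  have hb : ∀ i : FiberIndex p, fiberRate rate i ≠ 0 → 2 ≤ i.2.2.card := fun i hi => by
    by_contra h
    refine hi ?_
    have : i.2.2.card - 1 = 0 := by omega
    simp [fiberRate, this]
  refine ⟨Real.log (1 + x), hη,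
    { G := fiberGen hη.le U lam rate 0 0
      b := fiberRate rate
      A := A
      e := fiberStat p
      c := c / 2
      b_nonneg := fun i => by unfold fiberRate; positivity
      norm_e := norm_fiberStat
      c_pos := by positivity
      A_symm := hA
      norm_A := hA'
      A_apply := fun f i hi => hA0 f i fun h => by
        have h1 : i.2.2.card ≤ 1 := h
        have := hb i hi
        omega
      e_apply := fun i hi => by
        rw [fiberStat_apply, if_neg]
        rintro ⟨-, h⟩
        have := hb i hi
        simp [h] at this
      A_e := hAe
      G_e := fiberGen_fiberStat _ _ _ _ _
      e_G := inner_fiberStat_fiberGen _ _ _ _ _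
      coercive := fun Y hY => ?_ }, fun κ => ?_, rfl, rfl⟩
  · have h1 := hco Y hY
    set D := fiberGen hη.le U lam rate 0 0 - fiberGen le_rfl U lam rate 0 0 with hD
    have hDn : ‖D‖ ≤ c / 3 := by
      refine (norm_fiberGen_sub_le hη.le U lam rate 0).trans ?_
      rw [hexp, hx]
      rw [mul_div_assoc', div_le_div_iff₀ (by positivity) (by positivity)]
      nlinarith
    have h2 : fiberGen hη.le U lam rate 0 0 Y = fiberGen le_rfl U lam rate 0 0 Y + D Y := by
      rw [hD, _root_.sub_apply, add_sub_cancel]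
    rw [h2, inner_add_right, Complex.add_re]
    have h3 : ‖⟪Y + A Y, D Y⟫_ℂ‖ ≤ c / 2 * ‖Y‖ ^ 2 := by
      have a1 : ‖Y + A Y‖ ≤ 3 / 2 * ‖Y‖ := by
        linarith [norm_add_le Y (A Y), A.le_of_opNorm_le hA' Y]
      have a2 : ‖D Y‖ ≤ c / 3 * ‖Y‖ := D.le_of_opNorm_le hDn Y
      calc ‖⟪Y + A Y, D Y⟫_ℂ‖ ≤ ‖Y + A Y‖ * ‖D Y‖ := norm_inner_le_norm _ _
        _ ≤ (3 / 2 * ‖Y‖) * (c / 3 * ‖Y‖) := by gcongr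
        _ = _ := by ring
    have h4 := (abs_le.mp ((Complex.abs_re_le_norm _).trans h3)).1
    linarith
  · simp [fiberGen]

end FiberHypocoercivity

/-! ### The diffusion matrix. -/

section Diffusion

open scoped InnerProductSpace Matrix
open ContinuousLinearMap (adjoint)

variable {d : ℕ} {p : Fin d → ℕ} [∀ j, NeZero (p j)]

/-- The first order coefficient of the generator in the momentum. -/
def fiberGen₁ {η : ℝ} (hη : 0 ≤ η) (κ : Fin d → ℝ) :
    Ell2 ℂ (FiberIndex p) →L[ℂ] Ell2 ℂ (FiberIndex p) :=
  ∑ q : LatticeDir d, (LatticeDir.comp κ q : ℂ) • opX hη q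

/-- The second order coefficient of the generator in the momentum. -/
def fiberGen₂ {η : ℝ} (hη : 0 ≤ η) (κ : Fin d → ℝ) :
    Ell2 ℂ (FiberIndex p) →L[ℂ] Ell2 ℂ (FiberIndex p) :=
  ∑ q : LatticeDir d, (-(Complex.I / 2) * (LatticeDir.comp κ q : ℂ) ^ 2) • opX hη q

theorem norm_opX_le {η : ℝ} (hη : 0 ≤ η) (q : LatticeDir d) :
    ‖(opX hη q : Ell2 ℂ (FiberIndex p) →L[ℂ] _)‖ ≤ Real.exp η :=
  wcomp_norm_le (Real.exp_pos _).le fun i => by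
    rw [Complex.norm_real]
    exact expWeight_div_le hη _ _ (by rw [latticeLen_neg, latticeLen_vec])

theorem norm_exp_sub_taylor_le {s c : ℝ} (hs : |s| ≤ 1) :
    ‖Complex.exp (-(Complex.I * (s * c : ℝ))) - 1 + Complex.I * (s * c) + (s * c : ℂ) ^ 2 / 2‖ ≤
      |c| ^ 3 * Real.exp |c| * |s| ^ 3 := by
  have h := Complex.norm_exp_sub_sum_le_norm_mul_exp (-(Complex.I * (s * c : ℝ))) 3
  have hn : ‖-(Complex.I * ((s * c : ℝ) : ℂ))‖ = |s| * |c| := by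
    rw [norm_neg, norm_mul, Complex.norm_I, one_mul, Complex.norm_real, Real.norm_eq_abs, abs_mul]
  rw [hn] at h
  have e : Complex.exp (-(Complex.I * (s * c : ℝ))) -
      ∑ m ∈ Finset.range 3, (-(Complex.I * ((s * c : ℝ) : ℂ))) ^ m / (m.factorial : ℂ) =
      Complex.exp (-(Complex.I * (s * c : ℝ))) - 1 + Complex.I * (s * c) + (s * c : ℂ) ^ 2 / 2 := by
    simp [Finset.sum_range_succ, mul_pow]
    ring
  rw [e] at h
  refine h.trans ?_
  have : Real.exp (|s| * |c|) ≤ Real.exp |c| := by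
    refine Real.exp_le_exp.mpr ?_
    exact mul_le_of_le_one_left (abs_nonneg c) hs
  calc (|s| * |c|) ^ 3 * Real.exp (|s| * |c|) ≤ (|s| * |c|) ^ 3 * Real.exp |c| := by gcongr
    _ = _ := by ring

theorem fiberGen_taylor {η : ℝ} (hη : 0 ≤ η) (U : PeriodCell p → ℝ) (lam rate : ℝ)
    (κ : Fin d → ℝ) (s : ℝ) (hs : |s| ≤ 1) :
    ‖fiberGen hη U lam rate κ s - fiberGen hη U lam rate κ 0 -
      ((s : ℂ) • fiberGen₁ hη κ + (s : ℂ) ^ 2 • fiberGen₂ hη κ)‖ ≤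
      (∑ q : LatticeDir d, |LatticeDir.comp κ q| ^ 3 * Real.exp |LatticeDir.comp κ q| * Real.exp η)
        * |s| ^ 3 := by
  have e : fiberGen hη U lam rate κ s - fiberGen hη U lam rate κ 0 -
      ((s : ℂ) • fiberGen₁ hη κ + (s : ℂ) ^ 2 • fiberGen₂ hη κ) =
      ∑ q : LatticeDir d, (Complex.I * (Complex.exp (-(Complex.I * (s * LatticeDir.comp κ q : ℝ)))
        - 1 + Complex.I * (s * LatticeDir.comp κ q) + (s * LatticeDir.comp κ q : ℂ) ^ 2 / 2)) •
          opX hη q := by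
    have : fiberGen hη U lam rate κ s - fiberGen hη U lam rate κ 0 =
        ∑ q : LatticeDir d, (Complex.I * (Complex.exp (-(Complex.I * (s * LatticeDir.comp κ q : ℝ)))
        - 1)) • opX hη q := by
      simp only [fiberGen, zero_mul, Complex.ofReal_zero, mul_zero, neg_zero, Complex.exp_zero,
        one_smul, Finset.sum_sub_distrib, smul_sub, mul_sub, sub_smul, Finset.smul_sum, smul_smul,
        mul_one]
      abel
    rw [this, fiberGen₁, fiberGen₂, Finset.smul_sum, Finset.smul_sum, ← Finset.sum_add_distrib,
      ← Finset.sum_sub_distrib]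
    refine Finset.sum_congr rfl fun q _ => ?_
    rw [smul_smul, smul_smul, ← add_smul, ← sub_smul]
    congr 1
    linear_combination -((s : ℂ) * LatticeDir.comp κ q) * Complex.I_sq
  rw [e, Finset.sum_mul]
  refine (norm_sum_le _ _).trans (Finset.sum_le_sum fun q _ => ?_)
  rw [norm_smul, norm_mul, Complex.norm_I, one_mul]
  calc _ ≤ (|LatticeDir.comp κ q| ^ 3 * Real.exp |LatticeDir.comp κ q| * |s| ^ 3) * Real.exp η := by
        gcongr
        · exact norm_exp_sub_taylor_le hs
        · exact norm_opX_le hη q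
    _ = _ := by ring

/-- One hop leaves the diagonal, where the stationary vector lives. Hence there is no drift, and no
direct contribution of second order either. -/
theorem inner_fiberStat_opX {η : ℝ} (hη : 0 ≤ η) (q : LatticeDir d) :
    ⟪fiberStat p, opX hη q (fiberStat p)⟫_ℂ = 0 := by
  rw [inner_fiberStat]
  simp [fiberStat_apply, LatticeDir.vec_ne_zero]

theorem inner_fiberStat_fiberGen₁ {η : ℝ} (hη : 0 ≤ η) (κ : Fin d → ℝ) :
    ⟪fiberStat p, fiberGen₁ hη κ (fiberStat p)⟫_ℂ = 0 := by
  rw [fiberGen₁, _root_.sum_apply, inner_sum]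
  refine Finset.sum_eq_zero fun q _ => ?_
  rw [_root_.smul_apply, inner_smul_right, inner_fiberStat_opX, mul_zero]

theorem inner_fiberStat_fiberGen₂ {η : ℝ} (hη : 0 ≤ η) (κ : Fin d → ℝ) :
    ⟪fiberStat p, fiberGen₂ hη κ (fiberStat p)⟫_ℂ = 0 := by
  simp [fiberGen₂, _root_.sum_apply, inner_sum, inner_smul_right, inner_fiberStat_opX]

theorem fiberGen₁_eq_sum {η : ℝ} (hη : 0 ≤ η) (κ : Fin d → ℝ) :
    (fiberGen₁ hη κ : Ell2 ℂ (FiberIndex p) →L[ℂ] _) =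
      ∑ j, (κ j : ℂ) • fiberGen₁ hη (Pi.single j 1) := by
  simp only [fiberGen₁, Finset.smul_sum, smul_smul]
  rw [Finset.sum_comm]
  refine Finset.sum_congr rfl fun q _ => ?_
  rw [← Finset.sum_smul, LatticeDir.comp_linear]
  push_cast
  rfl

/-- Multiplication by the exponential weight. -/
def opWeight {η : ℝ} (hη : 0 ≤ η) : Ell2 ℂ (FiberIndex p) →L[ℂ] Ell2 ℂ (FiberIndex p) :=
  wcomp (fun i => (expWeight η i.2.1 : ℂ))
    ⟨1, fun i => by
      rw [Complex.norm_real, Real.norm_of_nonneg (expWeight_pos _ _).le]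
      exact Real.exp_le_one_iff.mpr
        (neg_nonpos.mpr (mul_nonneg hη (latticeLen_nonneg _)))⟩ (Equiv.refl _)

theorem opWeight_apply {η : ℝ} (hη : 0 ≤ η) (f : Ell2 ℂ (FiberIndex p)) (i : FiberIndex p) :
    opWeight hη f i = expWeight η i.2.1 * f i := rfl

theorem inner_opWeight_left {η : ℝ} (hη : 0 ≤ η) (f g : Ell2 ℂ (FiberIndex p)) :
    ⟪opWeight hη f, g⟫_ℂ = ⟪f, opWeight hη g⟫_ℂ := by
  refine inner_wcomp_left (fun i => rfl) (fun i => ?_) f g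
  exact (Complex.conj_ofReal _).symm

/-- The weighted hopping is the unweighted one conjugated by the weight. This intertwining carries
questions about the corrector back to the unweighted generator, whose symmetric part is explicit. -/
theorem opX_opWeight {η : ℝ} (hη : 0 ≤ η) (q : LatticeDir d) (f : Ell2 ℂ (FiberIndex p)) :
    opX hη q (opWeight hη f) = opWeight hη (opX le_rfl q f) := by
  ext i
  rw [opX_apply, opWeight_apply, opWeight_apply, opX_apply, ← sub_eq_add_neg]
  have := (expWeight_pos η (i.2.1 - q.vec)).ne'
  have h2 : (expWeight η (i.2.1 - q.vec) : ℂ) ≠ 0 := by exact_mod_cast this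
  push_cast
  simp only [expWeight_zero_left]
  field_simp

theorem fiberGen₁_opWeight {η : ℝ} (hη : 0 ≤ η) (κ : Fin d → ℝ) (f : Ell2 ℂ (FiberIndex p)) :
    fiberGen₁ hη κ (opWeight hη f) = opWeight hη (fiberGen₁ le_rfl κ f) := by
  simp only [fiberGen₁, _root_.sum_apply, _root_.smul_apply, opX_opWeight, map_sum, map_smul]

theorem fiberGen_opWeight {η : ℝ} (hη : 0 ≤ η) (U : PeriodCell p → ℝ) (lam rate : ℝ)
    (κ : Fin d → ℝ) (f : Ell2 ℂ (FiberIndex p)) :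
    fiberGen hη U lam rate κ 0 (opWeight hη f) =
      opWeight hη (fiberGen le_rfl U lam rate κ 0 f) := by
  ext i
  rw [opWeight_apply, fiberGen_apply, fiberGen_zero_apply]
  simp only [opWeight_apply]
  have e1 : ∀ q : LatticeDir d, Complex.exp (-(Complex.I * ((0 : ℝ) * LatticeDir.comp κ q : ℝ))) *
      ((expWeight η i.2.1 / expWeight η (i.2.1 + -q.vec) : ℝ) * (expWeight η (i.2.1 - q.vec) *
        f (i.1 + cellOf p q.vec, i.2.1 - q.vec, shiftFinset (-q.vec) i.2.2))) -
      (expWeight η i.2.1 / expWeight η (i.2.1 + q.vec) : ℝ) *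
        (expWeight η (i.2.1 + q.vec) * f (i.1, i.2.1 + q.vec, i.2.2)) =
      expWeight η i.2.1 * (f (i.1 + cellOf p q.vec, i.2.1 - q.vec, shiftFinset (-q.vec) i.2.2) -
          f (i.1, i.2.1 + q.vec, i.2.2)) := fun q => by
    have h1 : (expWeight η (i.2.1 - q.vec) : ℂ) ≠ 0 := by
      exact_mod_cast (expWeight_pos η (i.2.1 - q.vec)).ne'
    have h2 : (expWeight η (i.2.1 + q.vec) : ℂ) ≠ 0 := by
      exact_mod_cast (expWeight_pos η (i.2.1 + q.vec)).ne'
    rw [← sub_eq_add_neg]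
    push_cast
    rw [zero_mul, mul_zero, neg_zero, Complex.exp_zero]
    field_simp
  simp only [e1, ← Finset.mul_sum]
  ring

theorem opWeight_fiberStat {η : ℝ} (hη : 0 ≤ η) : opWeight hη (fiberStat p) = fiberStat p := by
  ext i
  rw [opWeight_apply, fiberStat_apply]
  by_cases h : i.2.1 = 0 <;> simp [h]

/-- Reversing a direction changes the sign of the momentum component, which makes the unweighted
first order coefficient antisymmetric. -/
theorem inner_fiberGen₁_left (κ : Fin d → ℝ) (f g : Ell2 ℂ (FiberIndex p)) :
    ⟪fiberGen₁ le_rfl κ f, g⟫_ℂ = ⟪f, -fiberGen₁ le_rfl κ g⟫_ℂ := by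
  simp only [fiberGen₁, _root_.sum_apply, _root_.smul_apply, sum_inner, inner_neg_right, inner_sum,
    inner_smul_left, inner_smul_right, inner_opX_left, Complex.conj_ofReal]
  rw [← LatticeDir.opp.sum_comp, ← Finset.sum_neg_distrib]
  refine Finset.sum_congr rfl fun q _ => ?_
  rw [LatticeDir.comp_opp, LatticeDir.opp_opp]
  push_cast
  ring

/-- The corrector equation, transformed by the exponential weight. -/
theorem inner_corrector {η : ℝ} (hη : 0 ≤ η) (U : PeriodCell p → ℝ) (lam rate : ℝ)
    (κ : Fin d → ℝ) {w h : Ell2 ℂ (FiberIndex p)}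
    (hw : adjoint (fiberGen hη U lam rate κ 0) w + h =
      -adjoint (fiberGen₁ hη κ) (fiberStat p)) (g : Ell2 ℂ (FiberIndex p)) :
    ⟪opWeight hη w, fiberGen le_rfl U lam rate κ 0 g⟫_ℂ + ⟪opWeight hη h, g⟫_ℂ =
      ⟪fiberGen₁ le_rfl κ (fiberStat p), g⟫_ℂ := by
  have h1 := congrArg (fun x => ⟪x, opWeight hη g⟫_ℂ) hw
  simp only [inner_add_left, inner_neg_left, ContinuousLinearMap.adjoint_inner_left] at h1
  rw [fiberGen_opWeight, fiberGen₁_opWeight, ← inner_opWeight_left, ← inner_opWeight_left,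
    ← inner_opWeight_left, opWeight_fiberStat] at h1
  rw [h1, inner_fiberGen₁_left, inner_neg_right]

theorem inner_corrector_fiberGen₁ {η : ℝ} (hη : 0 ≤ η) (κ : Fin d → ℝ)
    (w : Ell2 ℂ (FiberIndex p)) : ⟪w, fiberGen₁ hη κ (fiberStat p)⟫_ℂ =
      ⟪opWeight hη w, fiberGen₁ le_rfl κ (fiberStat p)⟫_ℂ := by
  conv_lhs => rw [← opWeight_fiberStat hη, fiberGen₁_opWeight, ← inner_opWeight_left]

/-- Tested with `V = opWeight w` itself, the corrector equation writes the right-hand side as the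
symmetric part of the generator at `V`, which is the damping of the excited part, plus the
nonnegative sum of `b |V|²`. -/
theorem le_re_inner_corrector {η : ℝ} (hη : 0 ≤ η) (U : PeriodCell p → ℝ) (lam rate : ℝ)
    (hrate : 0 ≤ rate) (κ : Fin d → ℝ) {w h : Ell2 ℂ (FiberIndex p)}
    (hw : adjoint (fiberGen hη U lam rate κ 0) w + h = -adjoint (fiberGen₁ hη κ) (fiberStat p))
    (hh : ∀ i, h i = fiberRate rate i * w i) :
    2 * rate * ‖opInd (excited p) (opWeight hη w)‖ ^ 2 ≤
      (⟪w, fiberGen₁ hη κ (fiberStat p)⟫_ℂ).re := by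
  rw [inner_corrector_fiberGen₁, ← inner_conj_symm, Complex.conj_re,
    ← inner_corrector hη U lam rate κ hw, Complex.add_re, re_inner_fiberGen]
  refine le_add_of_nonneg_right ?_
  have h1 := (Ell2.hasSum_inner (opWeight hη h) (opWeight hη w)).mapL Complex.reCLM
  refine h1.nonneg fun i => ?_
  simp only [opWeight_apply, hh, RCLike.inner_apply, Complex.reCLM_apply, map_mul,
    Complex.conj_ofReal]
  have e : (expWeight η i.2.1 : ℂ) * w i * (expWeight η i.2.1 * (fiberRate rate i *
      starRingEnd ℂ (w i))) = ((expWeight η i.2.1 ^ 2 * fiberRate rate i * ‖w i‖ ^ 2 : ℝ) : ℂ) := by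
    have := Complex.mul_conj' (w i)
    push_cast
    rw [← this]; ring
  rw [e, Complex.ofReal_re]
  have : 0 ≤ fiberRate rate i := by unfold fiberRate; positivity
  positivity

/-- The corrector has a nontrivial part carrying spins. -/
theorem eq_zero_of_corrector {η : ℝ} (hη : 0 ≤ η) (U : PeriodCell p → ℝ) {lam rate : ℝ}
    (hlam : 0 < lam) (κ : Fin d → ℝ) {w h : Ell2 ℂ (FiberIndex p)}
    (hw : adjoint (fiberGen hη U lam rate κ 0) w + h = -adjoint (fiberGen₁ hη κ) (fiberStat p))
    (hh : ∀ i, h i = fiberRate rate i * w i) (hQ : opInd (excited p) (opWeight hη w) = 0) :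
    κ = 0 := by
  set V := opWeight hη w with hV
  set y := fiberGen₁ le_rfl κ (fiberStat p) with hy
  -- `b` vanishes on spinless sites, and on the others the weighted corrector vanishes by
  -- assumption.
  have hh0 : opWeight hη h = 0 := by
    ext i
    rw [opWeight_apply, hh]
    by_cases hi : i ∈ excited p
    · have : opInd (excited p) V i = 0 := by rw [hQ]; rfl
      rw [opInd_apply, Set.indicator_of_mem hi, Pi.one_apply, one_mul, hV, opWeight_apply] at this
      rw [mul_left_comm, this]
      exact mul_zero _
    · have hi' : i.2.2 = ∅ := not_not.mp hi
      simp [fiberRate, hi']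
  -- Without excited part the adjoint of the generator acts on `V` as minus the generator, so the
  -- corrector equation becomes an equation for the image of `V`.
  have hG : fiberGen le_rfl U lam rate κ 0 V = -y := by
    refine ext_inner_left ℂ fun g => ?_
    have h1 := inner_corrector hη U lam rate κ hw g
    rw [hh0, inner_zero_left, add_zero, ← hV, ← hy] at h1
    have h2 := inner_fiberGen_left U lam rate κ g V
    rw [hQ, smul_zero, zero_sub, inner_neg_right] at h2
    have h3 : ⟪fiberGen le_rfl U lam rate κ 0 g, V⟫_ℂ = ⟪g, y⟫_ℂ := by
      rw [← inner_conj_symm, h1, inner_conj_symm]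
    rw [inner_neg_right, ← h3, h2, neg_neg]
  have hyapp : ∀ i : FiberIndex p, y i = ∑ q : LatticeDir d, (LatticeDir.comp κ q : ℂ) *
      if i.2.1 = q.vec ∧ i.2.2 = ∅ then (((cellNorm p)⁻¹ : ℝ) : ℂ) else 0 := fun i => by
    rw [hy, fiberGen₁, _root_.sum_apply, lp.coeFn_sum, Finset.sum_apply]
    refine Finset.sum_congr rfl fun q _ => ?_
    rw [_root_.smul_apply, lp.coeFn_smul, Pi.smul_apply, smul_eq_mul, opX_apply, fiberStat_apply]
    simp [sub_eq_zero, shiftFinset_eq_empty]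
  have hspin : opInd (spinSites p) y = 0 := by
    ext i
    rw [opInd_apply]
    by_cases hi : i ∈ spinSites p
    · have : i.2.2 ≠ ∅ := spinSites_subset_excited hi
      rw [hyapp]
      simp [this]
    · rw [Set.indicator_of_notMem hi, zero_mul]; rfl
  -- `y` carries no spins, so the transition of `V` to the single spin sites vanishes; as `lam ≠ 0`,
  -- nothing is left off the diagonal.
  have hO : opInd (offDiagonal p) V = 0 := by
    have h1 := opInd_spinSites_fiberGen U lam rate κ V
    rw [hQ, sub_zero, hG, map_neg, hspin, neg_zero] at h1
    have h2 : opSpin p V = 0 := by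
      refine (smul_eq_zero.mp h1.symm).resolve_left ?_
      have : (lam : ℂ) ≠ 0 := by exact_mod_cast hlam.ne'
      simp [this]
    rw [← norm_eq_zero, ← norm_opSpin_apply, h2, norm_zero]
  have hD : opInd (onDiagonal p) V = V := by
    have h1 := norm_sq_eq_parts (V - opInd (onDiagonal p) V)
    have h2 : ∀ s, Disjoint s (onDiagonal p) → opInd s V = 0 →
        opInd s (V - opInd (onDiagonal p) V) = 0 := fun s hs h => by
      rw [map_sub, h, zero_sub, neg_eq_zero]
      ext i
      rw [opInd_apply, opInd_apply]
      by_cases hi : i ∈ s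
      · rw [Set.indicator_of_notMem (Set.disjoint_left.mp hs hi)]; simp
      · rw [Set.indicator_of_notMem hi]; simp
    have h3 : opInd (onDiagonal p) (V - opInd (onDiagonal p) V) = 0 := by
      rw [map_sub, opInd_opInd_of_subset subset_rfl, sub_self]
    rw [h2 (excited p) (Set.disjoint_left.mpr fun i hi hi' => hi hi'.1) hQ,
      h2 (offDiagonal p) (Set.disjoint_left.mpr fun i hi hi' => hi.2 hi'.2) hO, h3] at h1
    simp only [norm_zero, ne_eq, OfNat.ofNat_ne_zero, not_false_eq_true, zero_pow, add_zero,
      pow_eq_zero_iff, norm_eq_zero, sub_eq_zero] at h1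
    exact h1.symm
  -- At the neighbors of the diagonal the equation prescribes the same increment of `V` in direction
  -- `q` for every residue class. Increments sum to zero over the torus, so this component of `κ`
  -- vanishes.
  have hcomp : ∀ q : LatticeDir d, LatticeDir.comp κ q = 0 := fun q => by
    have h1 := opInd_neighborSites_fiberGen U lam rate κ q V
    rw [hD, hG] at h1
    have h2 : ∀ a : PeriodCell p, -((LatticeDir.comp κ q : ℂ) * ((cellNorm p)⁻¹ : ℝ)) =
        Complex.I * (V (a + cellOf p q.vec, 0, ∅) - V (a, 0, ∅)) := fun a => by
      have h3 := congrArg (fun f : Ell2 ℂ (FiberIndex p) => f (a, q.vec, ∅)) h1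
      simp only [opInd_apply] at h3
      rw [lp.coeFn_smul, Pi.smul_apply, opStep_apply, lp.coeFn_neg, Pi.neg_apply, hyapp,
        Set.indicator_of_mem (by exact ⟨rfl, rfl⟩)] at h3
      simp only [LatticeDir.vec_injective.eq_iff, and_true, mul_ite, mul_zero,
        Finset.sum_ite_eq, Finset.mem_univ, if_true, Pi.one_apply, one_mul, and_self,
        smul_eq_mul] at h3
      exact h3
    have h3 : ∑ a : PeriodCell p, -((LatticeDir.comp κ q : ℂ) * ((cellNorm p)⁻¹ : ℝ)) = 0 := by
      rw [Finset.sum_congr rfl fun a _ => h2 a, ← Finset.mul_sum, Finset.sum_sub_distrib]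
      have := Equiv.sum_comp (Equiv.addRight (cellOf p q.vec)) (fun a => V (a, 0, ∅))
      simp only [Equiv.coe_addRight] at this
      rw [this, sub_self, mul_zero]
    rw [Finset.sum_const, Finset.card_univ, nsmul_eq_mul] at h3
    have h4 := (cellNorm_pos (p := p)).ne'
    have h5 : (Fintype.card (PeriodCell p)) ≠ 0 := Fintype.card_ne_zero
    have h6 : (((cellNorm p)⁻¹ : ℝ) : ℂ) ≠ 0 := by exact_mod_cast inv_ne_zero h4
    rw [mul_eq_zero, neg_eq_zero, mul_eq_zero, or_iff_right (by exact_mod_cast h5),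
      or_iff_left h6] at h3
    exact_mod_cast h3
  ext j
  simpa [LatticeDir.comp] using hcomp (j, true)

/-- The diffusion matrix, together with the perturbed generators whose eigenvalues it describes. -/
theorem exists_diffusion_matrix (U : PeriodCell p → ℝ) {lam rate : ℝ} (hlam : 0 < lam)
    (hrate : 0 < rate) : ∃ D : Matrix (Fin d) (Fin d) ℝ, D.PosDef ∧ ∃ (η : ℝ) (hη : 0 < η),
      ∀ κ : Fin d → ℝ, ∃ S : PerturbedGenerator (FiberIndex p),
        S.Gs = fiberGen hη.le U lam rate κ ∧ S.b = fiberRate rate ∧ S.e = fiberStat p ∧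
          S.ν.re = κ ⬝ᵥ D *ᵥ κ / 2 := by
  obtain ⟨η, hη, S, hSG, hSb, hSe⟩ := exists_hypocoerciveGenerator (p := p) U hlam hrate
  have hw : ∀ j, ∃ w h : Ell2 ℂ (FiberIndex p), ⟪S.e, w⟫_ℂ = 0 ∧ (∀ i, h i = S.b i * w i) ∧
      adjoint S.G w + h = -adjoint (fiberGen₁ hη.le (Pi.single j 1)) (fiberStat p) := fun j => by
    refine S.exists_adjoint_solution _ ?_
    rw [hSe, inner_neg_right, ContinuousLinearMap.adjoint_inner_right, ← inner_conj_symm,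
      inner_fiberStat_fiberGen₁]
    simp
  choose w h hw1 hw2 hw3 using hw
  -- The bilinear form of the correctors need not be symmetric. Only its quadratic form matters, and
  -- `D` is twice its symmetrization, in accordance with `Re ν = ⟨κ, D κ⟩ / 2`.
  let m : Fin d → Fin d → ℝ := fun i j =>
    (⟪w i, fiberGen₁ hη.le (Pi.single j 1) (fiberStat p)⟫_ℂ).re
  let D : Matrix (Fin d) (Fin d) ℝ := fun i j => m i j + m j i
  -- The correctors for general `κ` are linear combinations of those for the unit vectors, so that
  -- `Re ν` is a quadratic form in `κ`.
  let W : (Fin d → ℝ) → Ell2 ℂ (FiberIndex p) := fun κ => ∑ j, (κ j : ℂ) • w j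
  let H : (Fin d → ℝ) → Ell2 ℂ (FiberIndex p) := fun κ => ∑ j, (κ j : ℂ) • h j
  have hν : ∀ κ, (⟪W κ, fiberGen₁ hη.le κ (fiberStat p)⟫_ℂ).re = κ ⬝ᵥ D *ᵥ κ / 2 := fun κ => by
    have e1 : (⟪W κ, fiberGen₁ hη.le κ (fiberStat p)⟫_ℂ).re = ∑ i, ∑ j, κ i * (κ j * m i j) := by
      rw [fiberGen₁_eq_sum, _root_.sum_apply, sum_inner, Complex.re_sum]
      refine Finset.sum_congr rfl fun i _ => ?_
      rw [inner_smul_left, Complex.conj_ofReal, Complex.re_ofReal_mul, inner_sum, Complex.re_sum,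
        Finset.mul_sum]
      refine Finset.sum_congr rfl fun j _ => ?_
      rw [_root_.smul_apply, inner_smul_right, Complex.re_ofReal_mul]
    have e2 : κ ⬝ᵥ D *ᵥ κ = ∑ i, ∑ j, κ i * (κ j * m i j) + ∑ i, ∑ j, κ i * (κ j * m j i) := by
      simp only [dotProduct, Matrix.mulVec, Finset.mul_sum, ← Finset.sum_add_distrib, D]
      refine Finset.sum_congr rfl fun i _ => Finset.sum_congr rfl fun j _ => ?_
      ring
    have e3 : ∑ i, ∑ j, κ i * (κ j * m j i) = ∑ i, ∑ j, κ i * (κ j * m i j) := by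
      rw [Finset.sum_comm]
      refine Finset.sum_congr rfl fun i _ => Finset.sum_congr rfl fun j _ => ?_
      ring
    rw [e1, e2, e3]
    ring
  have hWH : ∀ κ i, H κ i = S.b i * W κ i := fun κ i => by
    simp only [H, W, lp.coeFn_sum, Finset.sum_apply, lp.coeFn_smul, Pi.smul_apply, smul_eq_mul,
      hw2, Finset.mul_sum]
    exact Finset.sum_congr rfl fun j _ => by ring
  have hcor : ∀ κ, adjoint S.G (W κ) + H κ = -adjoint (fiberGen₁ hη.le κ) (fiberStat p) := fun κ => by
    have e : adjoint (fiberGen₁ hη.le κ) (fiberStat p) =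
        ∑ j, (κ j : ℂ) • adjoint (fiberGen₁ hη.le (Pi.single j 1)) (fiberStat p) := by
      refine ext_inner_right ℂ fun g => ?_
      rw [ContinuousLinearMap.adjoint_inner_left, fiberGen₁_eq_sum, _root_.sum_apply, sum_inner,
        inner_sum]
      refine Finset.sum_congr rfl fun j _ => ?_
      rw [_root_.smul_apply, inner_smul_right, inner_smul_left, Complex.conj_ofReal,
        ContinuousLinearMap.adjoint_inner_left]
    rw [e]
    simp only [W, H, map_sum, map_smul]
    rw [← Finset.sum_add_distrib, ← Finset.sum_neg_distrib]
    refine Finset.sum_congr rfl fun j _ => ?_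
    rw [← smul_add, hw3, smul_neg]
  have hcor' : ∀ κ, adjoint (fiberGen hη.le U lam rate κ 0) (W κ) + H κ =
      -adjoint (fiberGen₁ hη.le κ) (fiberStat p) := fun κ => by rw [← hSG]; exact hcor κ
  have hWH' : ∀ κ i, H κ i = fiberRate rate i * W κ i := fun κ i => by rw [← hSb]; exact hWH κ i
  have hlow := fun κ => le_re_inner_corrector hη.le U lam rate hrate.le κ (hcor' κ) (hWH' κ)
  refine ⟨D, ?_, η, hη, fun κ => ⟨{
    toHypocoerciveGenerator := S
    Gs := fiberGen hη.le U lam rate κ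
    G₁ := fiberGen₁ hη.le κ
    G₂ := fiberGen₂ hη.le κ
    K := _
    taylor := fun s hs => by
      rw [hSG κ]
      exact fiberGen_taylor hη.le U lam rate κ s hs
    e_G₁_e := by rw [hSe]; exact inner_fiberStat_fiberGen₁ _ _
    e_G₂_e := by rw [hSe]; exact inner_fiberStat_fiberGen₂ _ _
    w₁ := W κ
    h₁ := H κ
    e_w₁ := by simp [W, inner_sum, inner_smul_right, hw1]
    h₁_apply := hWH κ
    corrector := by rw [hSe]; exact hcor κ
    re_nonneg := by
      rw [hSe]
      exact le_trans (by positivity) (hlow κ) }, rfl, hSb, hSe, ?_⟩⟩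
  · refine Matrix.PosDef.of_dotProduct_mulVec_pos ?_ fun κ hκ => ?_
    · ext i j
      simp only [Matrix.conjTranspose_apply, D, star_trivial]
      exact add_comm _ _
    · rw [star_trivial]
      have h1 := hlow κ
      rw [hν] at h1
      by_contra hneg
      have h2 : ‖opInd (excited p) (opWeight hη.le (W κ))‖ ^ 2 ≤ 0 := by
        by_contra h3
        have : 0 < 2 * rate * ‖opInd (excited p) (opWeight hη.le (W κ))‖ ^ 2 := by
          have := not_le.mp h3
          positivity
        linarith
      have h3 : ‖opInd (excited p) (opWeight hη.le (W κ))‖ = 0 := by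
        nlinarith [norm_nonneg (opInd (excited p) (opWeight hη.le (W κ)))]
      exact hκ (eq_zero_of_corrector hη.le U hlam κ (hcor' κ) (hWH' κ) (norm_eq_zero.mp h3))
  · rw [← hν κ]
    exact congrArg (fun e => (⟪W κ, fiberGen₁ hη.le κ e⟫_ℂ).re) hSe

end Diffusion

/-! ### Dyson series of the Schrödinger equation with a bounded time dependent potential. -/

section Schrodinger

variable {d : ℕ}

/-- The Schrödinger operator with a potential. -/
def schrodingerOp (v : CubicLattice d → ℝ) (φ : CubicLattice d → ℂ) (x : CubicLattice d) : ℂ :=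
  hopping φ x + v x * φ x

theorem hopping_eq_sum (φ : CubicLattice d → ℂ) (x : CubicLattice d) :
    hopping φ x = ∑ q : LatticeDir d, φ (x + q.vec) := by
  rw [LatticeDir.sum_eq (fun e => φ (x + e)), hopping]
  simp [sub_eq_add_neg]

theorem schrodingerOp_eq (v : CubicLattice d → ℝ) (φ : CubicLattice d → ℂ) (x : CubicLattice d) :
    schrodingerOp v φ x = ∑ q : LatticeDir d, φ (x + q.vec) + v x * φ x := by
  rw [schrodingerOp, hopping_eq_sum]

/-- The terms of the Dyson series of the Schrödinger equation with time dependent potential. -/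
def dyson (V : ℝ → CubicLattice d → ℝ) (ψ₀ : CubicLattice d → ℂ) : ℕ → ℝ → CubicLattice d → ℂ
  | 0, _, x => ψ₀ x
  | n + 1, t, x => -Complex.I * ∫ s in (0 : ℝ)..t, schrodingerOp (V s) (dyson V ψ₀ n s) x

/-- The positive operator dominating the Schrödinger operators with potentials bounded by `K`. -/
def majorantOp (d : ℕ) (K : ℝ) : Ell2 ℝ (CubicLattice d) →L[ℝ] Ell2 ℝ (CubicLattice d) :=
  ∑ q : LatticeDir d, wcomp (fun _ => (1 : ℝ)) ⟨1, fun _ => by simp⟩ (Equiv.addRight q.vec)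
    + K • ContinuousLinearMap.id ℝ _

theorem majorantOp_apply (K : ℝ) (g : Ell2 ℝ (CubicLattice d)) (x : CubicLattice d) :
    majorantOp d K g x = ∑ q : LatticeDir d, g (x + q.vec) + K * g x := by
  rw [majorantOp, _root_.add_apply, _root_.sum_apply, lp.coeFn_add, Pi.add_apply, lp.coeFn_sum,
    Finset.sum_apply]
  simp

/-- The absolute value of an element of `ℓ²`. -/
def Ell2.abs {ι : Type*} (f : Ell2 ℂ ι) : Ell2 ℝ ι :=
  ⟨fun i => ‖f i‖, memℓp_two_iff.mpr (by simpa using f.summable_norm_sq)⟩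

theorem Ell2.abs_apply {ι : Type*} (f : Ell2 ℂ ι) (i : ι) : f.abs i = ‖f i‖ := rfl

/-- The Taylor coefficients of the majorant. -/
def majorantCoeff (K : ℝ) (ψ₀ : L2Lattice d) (n : ℕ) : Ell2 ℝ (CubicLattice d) :=
  (majorantOp d K ^ n) (Ell2.abs ψ₀)

theorem majorantCoeff_zero (K : ℝ) (ψ₀ : L2Lattice d) (x : CubicLattice d) :
    majorantCoeff K ψ₀ 0 x = ‖ψ₀ x‖ := rfl

theorem majorantCoeff_succ (K : ℝ) (ψ₀ : L2Lattice d) (n : ℕ) (x : CubicLattice d) :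
    majorantCoeff K ψ₀ (n + 1) x =
      ∑ q : LatticeDir d, majorantCoeff K ψ₀ n (x + q.vec) + K * majorantCoeff K ψ₀ n x := by
  rw [majorantCoeff, pow_succ', mul_apply_eq_comp, majorantOp_apply]
  rfl

theorem majorantCoeff_nonneg {K : ℝ} (hK : 0 ≤ K) (ψ₀ : L2Lattice d) (n : ℕ) (x : CubicLattice d) :
    0 ≤ majorantCoeff K ψ₀ n x := by
  induction n generalizing x with
  | zero => rw [majorantCoeff_zero]; positivity
  | succ n ih =>
    rw [majorantCoeff_succ]
    exact add_nonneg (Finset.sum_nonneg fun q _ => ih _) (mul_nonneg hK (ih x))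

/-- The majorant of the solutions of Schrödinger equations with potentials bounded by `K`. -/
def majorant (K : ℝ) (ψ₀ : L2Lattice d) (t : ℝ) : Ell2 ℝ (CubicLattice d) :=
  ∑' n : ℕ, (t ^ n / n.factorial) • majorantCoeff K ψ₀ n

theorem summable_majorant (K : ℝ) (ψ₀ : L2Lattice d) (t : ℝ) :
    Summable fun n : ℕ => (t ^ n / n.factorial) • majorantCoeff K ψ₀ n := by
  refine Summable.of_norm_bounded
    (g := fun n => (|t| * ‖majorantOp d K‖) ^ n / n.factorial * ‖Ell2.abs ψ₀‖) ?_ fun n => ?_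
  · exact (Real.summable_pow_div_factorial _).mul_right _
  · rw [norm_smul, Real.norm_eq_abs, abs_div, abs_pow, Nat.abs_cast, mul_pow]
    have h1 : ‖majorantCoeff K ψ₀ n‖ ≤ ‖majorantOp d K‖ ^ n * ‖Ell2.abs ψ₀‖ := by
      induction n with
      | zero => simp [majorantCoeff]
      | succ n ih =>
        rw [majorantCoeff, pow_succ', pow_succ', mul_apply_eq_comp, mul_assoc]
        exact (majorantOp d K).le_opNorm_of_le ih
    calc |t| ^ n / n.factorial * ‖majorantCoeff K ψ₀ n‖ ≤
          |t| ^ n / n.factorial * (‖majorantOp d K‖ ^ n * ‖Ell2.abs ψ₀‖) := by gcongr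
      _ = _ := by ring

theorem hasSum_majorant_apply (K : ℝ) (ψ₀ : L2Lattice d) (t : ℝ) (x : CubicLattice d) :
    HasSum (fun n : ℕ => t ^ n / n.factorial * majorantCoeff K ψ₀ n x) (majorant K ψ₀ t x) :=
  (summable_majorant K ψ₀ t).hasSum.mapL
    (lp.evalCLM ℝ (fun _ : CubicLattice d => ℝ) 2 x)

theorem majorant_nonneg {K : ℝ} (hK : 0 ≤ K) (ψ₀ : L2Lattice d) {t : ℝ} (ht : 0 ≤ t)
    (x : CubicLattice d) : 0 ≤ majorant K ψ₀ t x :=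
  (hasSum_majorant_apply K ψ₀ t x).nonneg fun n =>
    mul_nonneg (by positivity) (majorantCoeff_nonneg hK ψ₀ n x)

theorem majorant_mono {K : ℝ} (hK : 0 ≤ K) (ψ₀ : L2Lattice d) {s t : ℝ} (hs : 0 ≤ s) (hst : s ≤ t)
    (x : CubicLattice d) : majorant K ψ₀ s x ≤ majorant K ψ₀ t x := by
  refine hasSum_le (fun n => ?_) (hasSum_majorant_apply K ψ₀ s x) (hasSum_majorant_apply K ψ₀ t x)
  have := majorantCoeff_nonneg hK ψ₀ n x
  gcongr

variable {V : ℝ → CubicLattice d → ℝ} {K : ℝ}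

theorem norm_schrodingerOp_le {v : CubicLattice d → ℝ} (hv : ∀ x, |v x| ≤ K)
    {φ : CubicLattice d → ℂ} {g : CubicLattice d → ℝ} (h : ∀ x, ‖φ x‖ ≤ g x) (x : CubicLattice d) :
    ‖schrodingerOp v φ x‖ ≤ ∑ q : LatticeDir d, g (x + q.vec) + K * g x := by
  rw [schrodingerOp_eq]
  refine (norm_add_le _ _).trans (add_le_add ((norm_sum_le _ _).trans
    (Finset.sum_le_sum fun q _ => h _)) ?_)
  rw [norm_mul, Complex.norm_real]
  exact mul_le_mul (hv x) (h x) (norm_nonneg _) ((abs_nonneg _).trans (hv x))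

/-- By positivity the Dyson terms are dominated pointwise by the Taylor terms of `exp (t
majorantOp)` applied to `|ψ₀|`. The majorant is square summable and independent of the potential,
which makes later estimates uniform in the realization. -/
theorem norm_dyson_le (hK : 0 ≤ K) (hV : ∀ s x, |V s x| ≤ K) (ψ₀ : L2Lattice d) (n : ℕ) {t : ℝ}
    (ht : 0 ≤ t) (x : CubicLattice d) :
    ‖dyson V ψ₀ n t x‖ ≤ t ^ n / n.factorial * majorantCoeff K ψ₀ n x := by
  induction n generalizing t x with
  | zero => simp [dyson, majorantCoeff_zero]
  | succ n ih =>
    rw [dyson, norm_mul, norm_neg, Complex.norm_I, one_mul]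
    have h1 : ∀ s, 0 ≤ s → ‖schrodingerOp (V s) (dyson V ψ₀ n s) x‖ ≤
        s ^ n / n.factorial * majorantCoeff K ψ₀ (n + 1) x := fun s hs => by
      refine (norm_schrodingerOp_le (hV s) (fun x => ih hs x) x).trans (le_of_eq ?_)
      rw [majorantCoeff_succ, ← Finset.mul_sum]
      ring
    refine (intervalIntegral.norm_integral_le_of_norm_le
      (g := fun s => s ^ n / n.factorial * majorantCoeff K ψ₀ (n + 1) x) ht
      (Eventually.of_forall fun s hs => h1 s hs.1.le) ?_).trans (le_of_eq ?_)
    · exact (by fun_prop : Continuous fun s : ℝ =>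
        s ^ n / n.factorial * majorantCoeff K ψ₀ (n + 1) x).intervalIntegrable _ _
    · rw [intervalIntegral.integral_mul_const, intervalIntegral.integral_div, integral_pow]
      rw [Nat.factorial_succ]
      push_cast
      have : (n.factorial : ℝ) ≠ 0 := by positivity
      have h2 : (n : ℝ) + 1 ≠ 0 := by positivity
      field_simp
      simp

theorem intervalIntegrable_schrodingerOp (hV : ∀ s x, |V s x| ≤ K)
    (hVm : ∀ x, Measurable fun s => V s x) {φ : ℝ → CubicLattice d → ℂ}
    (hφ : ∀ x, Continuous fun s => φ s x) (x : CubicLattice d) (a b : ℝ) :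
    IntervalIntegrable (fun s => schrodingerOp (V s) (φ s) x) volume a b := by
  simp only [schrodingerOp_eq]
  refine IntervalIntegrable.add ?_ ?_
  · exact (continuous_finsetSum _ fun q _ => hφ _).intervalIntegrable _ _
  · refine IntervalIntegrable.mul_continuousOn ?_ (hφ x).continuousOn
    refine (intervalIntegrable_const (c := K)).mono_fun ?_ (Eventually.of_forall fun s => ?_)
    · exact (Complex.measurable_ofReal.comp (hVm x)).aestronglyMeasurable
    · change ‖(V s x : ℂ)‖ ≤ ‖K‖
      rw [Complex.norm_real]
      exact (hV s x).trans (le_abs_self K)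

theorem continuous_dyson (hV : ∀ s x, |V s x| ≤ K) (hVm : ∀ x, Measurable fun s => V s x)
    (ψ₀ : CubicLattice d → ℂ) (n : ℕ) (x : CubicLattice d) :
    Continuous fun t => dyson V ψ₀ n t x := by
  induction n generalizing x with
  | zero => exact continuous_const
  | succ n ih =>
    simp only [dyson]
    exact continuous_const.mul (intervalIntegral.continuous_primitive
      (fun a b => intervalIntegrable_schrodingerOp hV hVm ih x a b) 0)

/-- The sum of the Dyson series. -/
def dysonSum (V : ℝ → CubicLattice d → ℝ) (ψ₀ : CubicLattice d → ℂ) (t : ℝ) (x : CubicLattice d) :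
    ℂ := ∑' n, dyson V ψ₀ n t x

theorem hasSum_dyson (hK : 0 ≤ K) (hV : ∀ s x, |V s x| ≤ K) (ψ₀ : L2Lattice d) {t : ℝ}
    (ht : 0 ≤ t) (x : CubicLattice d) :
    HasSum (fun n => dyson V ψ₀ n t x) (dysonSum V ψ₀ t x) :=
  (Summable.of_norm_bounded (hasSum_majorant_apply K ψ₀ t x).summable
    fun n => norm_dyson_le hK hV ψ₀ n ht x).hasSum

theorem norm_dysonSum_le (hK : 0 ≤ K) (hV : ∀ s x, |V s x| ≤ K) (ψ₀ : L2Lattice d) {t : ℝ}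
    (ht : 0 ≤ t) (x : CubicLattice d) : ‖dysonSum V ψ₀ t x‖ ≤ majorant K ψ₀ t x :=
  tsum_of_norm_bounded (hasSum_majorant_apply K ψ₀ t x)
    fun n => norm_dyson_le hK hV ψ₀ n ht x

theorem norm_schrodingerOp_dysonSum_le (hK : 0 ≤ K) (hV : ∀ s x, |V s x| ≤ K) (ψ₀ : L2Lattice d)
    {s t : ℝ} (hs : 0 ≤ s) (hst : s ≤ t) (x : CubicLattice d) :
    ‖schrodingerOp (V s) (dysonSum V ψ₀ s) x‖ ≤ majorantOp d K (majorant K ψ₀ t) x := by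
  rw [majorantOp_apply]
  exact norm_schrodingerOp_le (hV s) (fun x => (norm_dysonSum_le hK hV ψ₀ hs x).trans
    (majorant_mono hK ψ₀ hs hst x)) x

/-- The sum of the Dyson series solves the Schrödinger equation. -/
theorem dysonSum_eq (hK : 0 ≤ K) (hV : ∀ s x, |V s x| ≤ K) (hVm : ∀ x, Measurable fun s => V s x)
    (ψ₀ : L2Lattice d) {t : ℝ} (ht : 0 ≤ t) (x : CubicLattice d) :
    dysonSum V ψ₀ t x =
      ψ₀ x - Complex.I * ∫ s in (0 : ℝ)..t, schrodingerOp (V s) (dysonSum V ψ₀ s) x := by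
  have h1 : HasSum (fun n => dyson V ψ₀ (n + 1) t x) (dysonSum V ψ₀ t x - ψ₀ x) := by
    have := (hasSum_nat_add_iff' 1).mpr (hasSum_dyson hK hV ψ₀ ht x)
    simpa [dyson] using this
  have hop : ∀ s, 0 ≤ s → HasSum (fun n => schrodingerOp (V s) (dyson V ψ₀ n s) x)
      (schrodingerOp (V s) (dysonSum V ψ₀ s) x) := fun s hs => by
    simp only [schrodingerOp_eq]
    exact (hasSum_sum fun q _ => hasSum_dyson hK hV ψ₀ hs _).add
      ((hasSum_dyson hK hV ψ₀ hs x).mul_left _)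
  have hb : ∀ n, ∀ s ∈ Set.Ioc 0 t, ‖schrodingerOp (V s) (dyson V ψ₀ n s) x‖ ≤
      t ^ n / n.factorial * majorantCoeff K ψ₀ (n + 1) x := fun n s hs => by
    refine (norm_schrodingerOp_le (hV s) (fun x => norm_dyson_le hK hV ψ₀ n hs.1.le x) x).trans ?_
    rw [← Finset.mul_sum, mul_left_comm, ← mul_add, ← majorantCoeff_succ]
    have := majorantCoeff_nonneg hK ψ₀ (n + 1) x
    have := hs.1.le
    have := hs.2
    gcongr
  have hsum : Summable fun n : ℕ => t ^ n / n.factorial * majorantCoeff K ψ₀ (n + 1) x := by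
    simp only [majorantCoeff_succ, mul_add, Finset.mul_sum]
    refine Summable.add (summable_sum fun q _ => (hasSum_majorant_apply K ψ₀ t _).summable) ?_
    simp only [mul_left_comm _ K]
    exact (hasSum_majorant_apply K ψ₀ t _).summable.mul_left K
  have h2 : HasSum (fun n => ∫ s in (0 : ℝ)..t, schrodingerOp (V s) (dyson V ψ₀ n s) x)
      (∫ s in (0 : ℝ)..t, schrodingerOp (V s) (dysonSum V ψ₀ s) x) := by
    refine intervalIntegral.hasSum_integral_of_dominated_convergence
      (fun n _ => t ^ n / n.factorial * majorantCoeff K ψ₀ (n + 1) x) (fun n => ?_)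
      (fun n => Eventually.of_forall fun s hs => hb n s (by rwa [Set.uIoc_of_le ht] at hs))
      (Eventually.of_forall fun s _ => hsum) intervalIntegrable_const
      (Eventually.of_forall fun s hs => hop s ?_)
    · exact (intervalIntegrable_iff.mp (intervalIntegrable_schrodingerOp hV hVm
        (fun x => continuous_dyson hV hVm ψ₀ n x) x 0 t)).aestronglyMeasurable
    · rw [Set.uIoc_of_le ht] at hs
      exact hs.1.le
  have h3 := h1.unique (h2.mul_left (-Complex.I))
  rw [sub_eq_iff_eq_add] at h3
  rw [h3]
  ring

theorem memℓp_dysonSum (hK : 0 ≤ K) (hV : ∀ s x, |V s x| ≤ K) (ψ₀ : L2Lattice d) {t : ℝ}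
    (ht : 0 ≤ t) : Memℓp (dysonSum V ψ₀ t) 2 := by
  refine memℓp_two_iff.mpr (Summable.of_nonneg_of_le (fun x => by positivity) (fun x => ?_)
    (majorant K ψ₀ t).summable_norm_sq)
  gcongr
  exact (norm_dysonSum_le hK hV ψ₀ ht x).trans (le_abs_self _)

theorem intervalIntegrable_schrodingerOp_dysonSum (hK : 0 ≤ K) (hV : ∀ s x, |V s x| ≤ K)
    (hVm : ∀ x, Measurable fun s => V s x) (ψ₀ : L2Lattice d) (x : CubicLattice d) {a b : ℝ}
    (ha : 0 ≤ a) (hb : 0 ≤ b) :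
    IntervalIntegrable (fun s => schrodingerOp (V s) (dysonSum V ψ₀ s) x) volume a b := by
  -- The series is controlled at nonnegative times only, hence the cutoff of the argument at `0`.
  have hm : ∀ x, Measurable fun s => dysonSum V ψ₀ (max s 0) x := fun x => by
    refine measurable_of_tendsto_metrizable
      (f := fun n s => ∑ m ∈ Finset.range n, dyson V ψ₀ m (max s 0) x) (fun n => ?_) ?_
    · exact Finset.measurable_fun_sum _ fun m _ =>
        ((continuous_dyson hV hVm ψ₀ m x).comp (by fun_prop)).measurable
    · exact tendsto_pi_nhds.mpr fun s =>
        (hasSum_dyson hK hV ψ₀ (le_max_right s 0) x).tendsto_sum_nat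
  have hI : IntervalIntegrable (fun s => schrodingerOp (V s) (dysonSum V ψ₀ (max s 0)) x)
      volume a b := by
    refine (intervalIntegrable_const (c := majorantOp d K (majorant K ψ₀ (max a b)) x)).mono_fun
      ?_ ?_
    · simp only [schrodingerOp_eq]
      exact ((Finset.measurable_fun_sum _ fun q _ => hm _).add
        ((Complex.measurable_ofReal.comp (hVm x)).mul (hm x))).aestronglyMeasurable
    · refine (ae_restrict_mem measurableSet_uIoc).mono fun s hs => ?_
      have hs0 : 0 ≤ s := (le_min ha hb).trans hs.1.le
      beta_reduce
      rw [max_eq_left hs0]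
      exact (norm_schrodingerOp_dysonSum_le hK hV ψ₀ hs0 hs.2 x).trans (le_abs_self _)
  refine hI.congr fun s hs => ?_
  have hs0 : 0 ≤ s := (le_min ha hb).trans hs.1.le
  simp only [max_eq_left hs0]

theorem norm_dysonSum_sub_le (hK : 0 ≤ K) (hV : ∀ s x, |V s x| ≤ K)
    (hVm : ∀ x, Measurable fun s => V s x) (ψ₀ : L2Lattice d) {s t T : ℝ} (hs : 0 ≤ s) (ht : 0 ≤ t)
    (hsT : s ≤ T) (htT : t ≤ T) (x : CubicLattice d) :
    ‖dysonSum V ψ₀ t x - dysonSum V ψ₀ s x‖ ≤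
      majorantOp d K (majorant K ψ₀ T) x * |t - s| := by
  rw [dysonSum_eq hK hV hVm ψ₀ ht, dysonSum_eq hK hV hVm ψ₀ hs, sub_sub_sub_cancel_left, ← mul_sub,
    norm_mul, Complex.norm_I, one_mul, intervalIntegral.integral_interval_sub_left
      (intervalIntegrable_schrodingerOp_dysonSum hK hV hVm ψ₀ x le_rfl hs)
      (intervalIntegrable_schrodingerOp_dysonSum hK hV hVm ψ₀ x le_rfl ht), abs_sub_comm]
  refine intervalIntegral.norm_integral_le_of_norm_le_const fun r hr => ?_
  exact norm_schrodingerOp_dysonSum_le hK hV ψ₀ ((le_min ht hs).trans hr.1.le)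
    (hr.2.trans (max_le htT hsT)) x

/-- The solution of the Schrödinger equation as a curve in `ℓ²`. -/
def schrodingerCurve (hK : 0 ≤ K) (hV : ∀ s x, |V s x| ≤ K) (ψ₀ : L2Lattice d) (t : ℝ≥0) :
    L2Lattice d := ⟨dysonSum V ψ₀ t, memℓp_dysonSum hK hV ψ₀ t.2⟩

/-- Near a given time each coordinate is Lipschitz, with constants that form a square summable
function; this gives continuity in norm. -/
theorem continuous_schrodingerCurve (hK : 0 ≤ K) (hV : ∀ s x, |V s x| ≤ K)
    (hVm : ∀ x, Measurable fun s => V s x) (ψ₀ : L2Lattice d) :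
    Continuous (schrodingerCurve hK hV ψ₀) := by
  rw [continuous_iff_continuousAt]
  intro t
  set T : ℝ := t + 1 with hT
  have hlip : ∀ s : ℝ≥0, s < t + 1 → ‖schrodingerCurve hK hV ψ₀ s - schrodingerCurve hK hV ψ₀ t‖ ≤
      |(s : ℝ) - t| * ‖majorantOp d K (majorant K ψ₀ T)‖ := fun s hs => by
    have : ‖schrodingerCurve hK hV ψ₀ s - schrodingerCurve hK hV ψ₀ t‖ ≤
        ‖((s : ℝ) - t) • majorantOp d K (majorant K ψ₀ T)‖ := by
      refine Ell2.norm_le_of_le _ _ fun x => ?_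
      rw [lp.coeFn_smul, Pi.smul_apply, norm_smul, lp.coeFn_sub, Pi.sub_apply]
      have hs' : (s : ℝ) ≤ T := by rw [hT]; exact_mod_cast hs.le
      refine (norm_dysonSum_sub_le hK hV hVm ψ₀ t.2 s.2 (by rw [hT]; simp) hs' x).trans ?_
      rw [mul_comm]
      exact mul_le_mul_of_nonneg_left (le_abs_self _) (abs_nonneg _)
    rwa [norm_smul, Real.norm_eq_abs] at this
  rw [ContinuousAt, tendsto_iff_norm_sub_tendsto_zero]
  have hlim : Tendsto (fun s : ℝ≥0 => |(s : ℝ) - t| * ‖majorantOp d K (majorant K ψ₀ T)‖) (𝓝 t)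
      (𝓝 0) := by
    have : Continuous fun s : ℝ≥0 => |(s : ℝ) - t| * ‖majorantOp d K (majorant K ψ₀ T)‖ := by
      fun_prop
    have := this.tendsto t
    simpa using this
  refine squeeze_zero' (Eventually.of_forall fun s => norm_nonneg _) ?_ hlim
  filter_upwards [eventually_lt_nhds (show t < t + 1 from lt_add_one t)] with s hs
  exact hlip s hs

/-- Uniqueness for the Schrödinger equation. -/
theorem eq_zero_of_schrodinger (hV : ∀ s x, |V s x| ≤ K) (hK : 0 ≤ K)
    {δ : ℝ → CubicLattice d → ℂ} {T M : ℝ} (hM : ∀ s ∈ Set.Icc 0 T, ∀ x, ‖δ s x‖ ≤ M)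
    (h : ∀ t ∈ Set.Icc 0 T, ∀ x,
      δ t x = -Complex.I * ∫ s in (0 : ℝ)..t, schrodingerOp (V s) (δ s) x) :
    ∀ t ∈ Set.Icc 0 T, ∀ x, δ t x = 0 := by
  set c : ℝ := Fintype.card (LatticeDir d) + K with hc
  -- Iteration of the integral equation: in the supremum norm the operator costs a factor `c`, and
  -- each integration improves `t ^ n / n!` to the next such term.
  have hb : ∀ n : ℕ, ∀ t ∈ Set.Icc 0 T, ∀ x, ‖δ t x‖ ≤ t ^ n / n.factorial * (c ^ n * M) := by
    intro n
    induction n with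
    | zero => intro t ht x; simpa using hM t ht x
    | succ n ih =>
      intro t ht x
      rw [h t ht x, norm_mul, norm_neg, Complex.norm_I, one_mul]
      refine (intervalIntegral.norm_integral_le_of_norm_le
        (g := fun s => s ^ n / n.factorial * (c ^ (n + 1) * M)) ht.1
        (Eventually.of_forall fun s hs => ?_) ?_).trans (le_of_eq ?_)
      · refine (norm_schrodingerOp_le (hV s) (fun x => ih s ⟨hs.1.le, hs.2.trans ht.2⟩ x) x).trans
          (le_of_eq ?_)
        rw [Finset.sum_const, Finset.card_univ, nsmul_eq_mul, hc]
        ring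
      · exact (by fun_prop : Continuous fun s : ℝ =>
          s ^ n / n.factorial * (c ^ (n + 1) * M)).intervalIntegrable _ _
      · rw [intervalIntegral.integral_mul_const, intervalIntegral.integral_div, integral_pow]
        rw [Nat.factorial_succ]
        push_cast
        have : (n.factorial : ℝ) ≠ 0 := by positivity
        have h2 : (n : ℝ) + 1 ≠ 0 := by positivity
        field_simp
        simp
  intro t ht x
  have h1 : Tendsto (fun n : ℕ => t ^ n / n.factorial * (c ^ n * M)) atTop (𝓝 0) := by
    have := (FloorSemiring.tendsto_pow_div_factorial_atTop (t * c)).mul_const M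
    rw [zero_mul] at this
    refine this.congr fun n => ?_
    rw [mul_pow]; ring
  exact norm_le_zero_iff.mp (ge_of_tendsto h1 (Eventually.of_forall fun n => hb n t ht x))

end Schrodinger

/-! ### The product rule for primitives of bounded integrable functions. -/

section ProductRule

open Set

theorem lipschitzOnWith_primitive {a : ℝ → ℂ} {T : ℝ} (hT : 0 ≤ T)
    (ha : IntervalIntegrable a volume 0 T) {M : ℝ≥0} (hM : ∀ s ∈ Ioc 0 T, ‖a s‖ ≤ M) (c : ℂ) :
    LipschitzOnWith M (fun t => c + ∫ s in (0 : ℝ)..t, a s) (uIcc 0 T) := by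
  rw [uIcc_of_le hT]
  refine LipschitzOnWith.of_dist_le_mul fun t ht s hs => ?_
  have hi : ∀ t ∈ Icc 0 T, IntervalIntegrable a volume 0 t := fun t ht =>
    ha.mono_set (by rw [uIcc_of_le hT, uIcc_of_le ht.1]; exact Icc_subset_Icc_right ht.2)
  rw [dist_add_left, dist_eq_norm, Real.dist_eq,
    intervalIntegral.integral_interval_sub_left (hi t ht) (hi s hs)]
  refine intervalIntegral.norm_integral_le_of_norm_le_const fun r hr => hM r ?_
  exact ⟨(le_min hs.1 ht.1).trans_lt hr.1, hr.2.trans (max_le hs.2 ht.2)⟩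

/-- The product rule for functions given by integrals. -/
theorem mul_eq_add_integral {f g a b : ℝ → ℂ} {T : ℝ} (hT : 0 ≤ T)
    (ha : IntervalIntegrable a volume 0 T) (hb : IntervalIntegrable b volume 0 T) {M : ℝ≥0}
    (haM : ∀ s ∈ Ioc 0 T, ‖a s‖ ≤ M) (hbM : ∀ s ∈ Ioc 0 T, ‖b s‖ ≤ M) {f₀ g₀ : ℂ}
    (hf : ∀ t ∈ Icc 0 T, f t = f₀ + ∫ s in (0 : ℝ)..t, a s)
    (hg : ∀ t ∈ Icc 0 T, g t = g₀ + ∫ s in (0 : ℝ)..t, b s) :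
    f T * g T = f₀ * g₀ + ∫ s in (0 : ℝ)..T, (a s * g s + f s * b s) := by
  set F : ℝ → ℂ := fun t => f₀ + ∫ s in (0 : ℝ)..t, a s with hF
  set H : ℝ → ℂ := fun t => g₀ + ∫ s in (0 : ℝ)..t, b s with hH
  have hFl := lipschitzOnWith_primitive hT ha haM f₀
  have hHl := lipschitzOnWith_primitive hT hb hbM g₀
  have hFc : ContinuousOn F (uIcc 0 T) := hFl.continuousOn
  have hHc : ContinuousOn H (uIcc 0 T) := hHl.continuousOn
  have hpi : IntervalIntegrable (fun s => a s * H s + F s * b s) volume 0 T :=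
    (ha.mul_continuousOn hHc).add (hb.continuousOn_mul hFc)
  obtain ⟨B, hB⟩ := isCompact_uIcc.exists_bound_of_continuousOn hHc
  obtain ⟨B', hB'⟩ := isCompact_uIcc.exists_bound_of_continuousOn hFc
  have hsub : Ioc 0 T ⊆ uIcc 0 T := by
    rw [uIcc_of_le hT]; exact Ioc_subset_Icc_self
  have hpM : ∀ s ∈ Ioc 0 T, ‖a s * H s + F s * b s‖ ≤ (M * B.toNNReal + B'.toNNReal * M : ℝ≥0) :=
    fun s hs => by
      refine (norm_add_le _ _).trans ?_
      rw [norm_mul, norm_mul]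
      push_cast
      refine add_le_add (mul_le_mul (haM s hs) ?_ (norm_nonneg _) M.2)
        (mul_le_mul ?_ (hbM s hs) (norm_nonneg _) (NNReal.coe_nonneg _))
      · exact (hB s (hsub hs)).trans (Real.le_coe_toNNReal _)
      · exact (hB' s (hsub hs)).trans (Real.le_coe_toNNReal _)
  have hPl := lipschitzOnWith_primitive hT hpi hpM 0
  -- The potential jumps, so derivatives exist almost everywhere only. The difference of the two
  -- sides is absolutely continuous with derivative zero almost everywhere, hence constant.
  have hac : AbsolutelyContinuousOnInterval
      (F • H - fun t => 0 + ∫ s in (0 : ℝ)..t, (a s * H s + F s * b s)) 0 T :=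
    (hFl.absolutelyContinuousOnInterval.smul hHl.absolutelyContinuousOnInterval).sub
      hPl.absolutelyContinuousOnInterval
  have h0 : (0 : ℝ) ∈ uIcc 0 T := left_mem_uIcc
  obtain ⟨C, hC⟩ := hac.const_of_ae_hasDerivAt_zero (by
    filter_upwards [ha.ae_hasDerivAt_integral, hb.ae_hasDerivAt_integral,
      hpi.ae_hasDerivAt_integral] with t h1 h2 h3 ht
    have d1 : HasDerivAt F (a t) t := (h1 ht 0 h0).const_add _
    have d2 : HasDerivAt H (b t) t := (h2 ht 0 h0).const_add _
    have d3 := (h3 ht 0 h0).const_add (0 : ℂ)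
    have := (d1.mul d2).sub d3
    rw [sub_self] at this
    exact this)
  have e0 := hC 0 h0
  have eT := hC T right_mem_uIcc
  rw [← e0] at eT
  simp only [Pi.sub_apply, smul_eq_mul, zero_add, intervalIntegral.integral_same,
    sub_zero] at eT
  rw [sub_eq_iff_eq_add] at eT
  rw [hf T ⟨hT, le_rfl⟩, hg T ⟨hT, le_rfl⟩]
  refine eT.trans ?_
  congr 1
  · simp [hF, hH]
  · refine intervalIntegral.integral_congr fun s hs => ?_
    rw [uIcc_of_le hT] at hs
    simp only [hf s hs, hg s hs, hF, hH]

end ProductRule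

/-! ### Existence, uniqueness and the density matrix. -/

section Schrodinger

variable {d : ℕ}

/-- The potential of the Schrödinger equation with a random part. -/
def totalPotential (u : CubicLattice d → ℝ) (lam : ℝ) (v : ℝ≥0 → CubicLattice d → ℝ) (s : ℝ)
    (x : CubicLattice d) : ℝ := u x + lam * v s.toNNReal x

theorem abs_totalPotential_le {u : CubicLattice d → ℝ} {lam : ℝ} {v : ℝ≥0 → CubicLattice d → ℝ}
    {K : ℝ} (hu : ∀ x, |u x| + |lam| ≤ K) (hv : ∀ s x, |v s x| ≤ 1) (s : ℝ) (x : CubicLattice d) :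
    |totalPotential u lam v s x| ≤ K := by
  refine (abs_add_le _ _).trans (le_trans ?_ (hu x))
  rw [abs_mul]
  have := mul_le_mul_of_nonneg_left (hv s.toNNReal x) (abs_nonneg lam)
  linarith

theorem measurable_totalPotential {u : CubicLattice d → ℝ} {lam : ℝ}
    {v : ℝ≥0 → CubicLattice d → ℝ} (hv : ∀ x, Measurable fun s => v s x) (x : CubicLattice d) :
    Measurable fun s => totalPotential u lam v s x :=
  measurable_const.add (measurable_const.mul ((hv x).comp measurable_real_toNNReal))

variable {u : CubicLattice d → ℝ} {lam : ℝ} {v : ℝ≥0 → CubicLattice d → ℝ} {K : ℝ}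

theorem schrodinger_integrand_eq (φ : CubicLattice d → ℂ) (s : ℝ) (x : CubicLattice d) :
    hopping φ x + (u x : ℂ) * φ x + (lam : ℂ) * (v s.toNNReal x : ℂ) * φ x =
      schrodingerOp (totalPotential u lam v s) φ x := by
  rw [schrodingerOp, totalPotential]
  push_cast
  ring

theorem isSchrodingerSolution_curve (hK : 0 ≤ K) (hu : ∀ x, |u x| + |lam| ≤ K)
    (hv : ∀ s x, |v s x| ≤ 1) (hvm : ∀ x, Measurable fun s => v s x) (ψ₀ : L2Lattice d) :
    IsSchrodingerSolution u lam v ψ₀ (schrodingerCurve hK (abs_totalPotential_le hu hv) ψ₀) where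
  continuous := continuous_schrodingerCurve hK _ (measurable_totalPotential hvm) ψ₀
  integral_eq t x := by
    have h := dysonSum_eq hK (abs_totalPotential_le hu hv) (measurable_totalPotential hvm) ψ₀ t.2 x
    refine h.trans ?_
    congr 2
    refine intervalIntegral.integral_congr fun s hs => ?_
    rw [Set.uIcc_of_le t.2] at hs
    beta_reduce
    rw [schrodinger_integrand_eq]
    have : ∀ y, schrodingerCurve hK (abs_totalPotential_le hu hv) ψ₀ s.toNNReal y =
        dysonSum (totalPotential u lam v) ψ₀ s y := fun y => by
      change dysonSum (totalPotential u lam v) ψ₀ (s.toNNReal : ℝ) y = _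
      rw [Real.coe_toNNReal s hs.1]
    simp only [schrodingerOp_eq, this]

/-- The difference to the Dyson series solves the equation with zero initial value. On `[0, t]` it
is bounded, by continuity in `ℓ²` and by the majorant, so it vanishes. -/
theorem IsSchrodingerSolution.apply_eq (hK : 0 ≤ K) (hu : ∀ x, |u x| + |lam| ≤ K)
    (hv : ∀ s x, |v s x| ≤ 1) (hvm : ∀ x, Measurable fun s => v s x) {ψ₀ : L2Lattice d}
    {φ : ℝ≥0 → L2Lattice d} (hφ : IsSchrodingerSolution u lam v ψ₀ φ) (t : ℝ≥0)
    (x : CubicLattice d) : φ t x = dysonSum (totalPotential u lam v) ψ₀ t x := by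
  have hV := abs_totalPotential_le (lam := lam) hu hv
  have hVm := measurable_totalPotential (u := u) (lam := lam) hvm
  have hcont : ∀ y, Continuous fun s : ℝ => φ s.toNNReal y := fun y =>
    (lp.evalCLM ℂ (fun _ : CubicLattice d => ℂ) 2 y).continuous.comp
      (hφ.continuous.comp continuous_real_toNNReal)
  obtain ⟨M, hM⟩ := (isCompact_Icc (a := (0 : ℝ)) (b := t)).exists_bound_of_continuousOn
    (f := fun s : ℝ => φ s.toNNReal) (hφ.continuous.comp continuous_real_toNNReal).continuousOn
  have key := eq_zero_of_schrodinger (V := totalPotential u lam v) (K := K)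
    (δ := fun s y => φ s.toNNReal y - dysonSum (totalPotential u lam v) ψ₀ s y) (T := t)
    (M := M + ‖majorant K ψ₀ t‖) hV hK (fun s hs y => ?_) (fun s hs y => ?_) t ⟨t.2, le_rfl⟩ x
  · simpa [sub_eq_zero] using key
  · refine (norm_sub_le _ _).trans (add_le_add ((Ell2.norm_apply_le _ _).trans (hM s hs)) ?_)
    refine (norm_dysonSum_le hK hV ψ₀ hs.1 y).trans ((majorant_mono hK ψ₀ hs.1 hs.2 y).trans ?_)
    exact (le_abs_self _).trans
      ((Real.norm_eq_abs _).symm.le.trans (Ell2.norm_apply_le (majorant K ψ₀ t) y))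
  · have h1 := hφ.integral_eq s.toNNReal y
    simp only [schrodinger_integrand_eq] at h1
    rw [Real.coe_toNNReal s hs.1] at h1
    rw [h1, dysonSum_eq hK hV hVm ψ₀ hs.1]
    rw [sub_sub_sub_cancel_left, ← mul_sub, neg_mul, ← mul_neg, ← intervalIntegral.integral_sub
      (intervalIntegrable_schrodingerOp_dysonSum hK hV hVm ψ₀ y le_rfl hs.1)
      (intervalIntegrable_schrodingerOp hV hVm hcont y 0 s), ← intervalIntegral.integral_neg]
    congr 2
    ext r
    simp only [schrodingerOp_eq, mul_sub, Finset.sum_sub_distrib]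
    ring

/-- Existence and uniqueness of solutions of the Schrödinger equation. -/
theorem existsUnique_isSchrodingerSolution (hK : 0 ≤ K) (hu : ∀ x, |u x| + |lam| ≤ K)
    (hv : ∀ s x, |v s x| ≤ 1) (hvm : ∀ x, Measurable fun s => v s x) (ψ₀ : L2Lattice d) :
    ∃! φ : ℝ≥0 → L2Lattice d, IsSchrodingerSolution u lam v ψ₀ φ := by
  refine ⟨_, isSchrodingerSolution_curve hK hu hv hvm ψ₀, fun φ hφ => ?_⟩
  ext t x
  exact hφ.apply_eq hK hu hv hvm t x

/-- The evolution equation of the density matrix. -/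
theorem dysonSum_mul_conj_eq {V : ℝ → CubicLattice d → ℝ} (hK : 0 ≤ K) (hV : ∀ s x, |V s x| ≤ K)
    (hVm : ∀ x, Measurable fun s => V s x) (ψ₀ : L2Lattice d) {t : ℝ} (ht : 0 ≤ t)
    (x y : CubicLattice d) :
    dysonSum V ψ₀ t x * starRingEnd ℂ (dysonSum V ψ₀ t y) = ψ₀ x * starRingEnd ℂ (ψ₀ y) +
      ∫ s in (0 : ℝ)..t,
        (-Complex.I * schrodingerOp (V s) (dysonSum V ψ₀ s) x * starRingEnd ℂ (dysonSum V ψ₀ s y) +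
          dysonSum V ψ₀ s x *
            (Complex.I * starRingEnd ℂ (schrodingerOp (V s) (dysonSum V ψ₀ s) y))) := by
  have hi := fun (x : CubicLattice d) {b : ℝ} (hb : 0 ≤ b) =>
    intervalIntegrable_schrodingerOp_dysonSum hK hV hVm ψ₀ x le_rfl hb
  have hconj : ∀ (a : ℝ → ℂ) (b : ℝ), ∫ s in (0 : ℝ)..b, starRingEnd ℂ (a s) =
      starRingEnd ℂ (∫ s in (0 : ℝ)..b, a s) := fun a b => by
    simp only [intervalIntegral, map_sub, integral_conj]
  have hic : ∀ x, IntervalIntegrable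
      (fun s => starRingEnd ℂ (schrodingerOp (V s) (dysonSum V ψ₀ s) x)) volume 0 t := fun x => by
    have := hi x ht
    rw [intervalIntegrable_iff] at this ⊢
    exact Complex.conjCLE.toContinuousLinearMap.integrable_comp this
  set m : CubicLattice d → ℝ := fun x => majorantOp d K (majorant K ψ₀ t) x with hm
  have hb : ∀ x, ∀ s ∈ Set.Ioc 0 t, ‖schrodingerOp (V s) (dysonSum V ψ₀ s) x‖ ≤ m x :=
    fun x s hs => norm_schrodingerOp_dysonSum_le hK hV ψ₀ hs.1.le hs.2 x
  refine mul_eq_add_integral (f := fun t => dysonSum V ψ₀ t x)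
    (g := fun t => starRingEnd ℂ (dysonSum V ψ₀ t y))
    (M := (max (m x) (m y)).toNNReal) ht ((hi x ht).const_mul _) ((hic y).const_mul _)
    (fun s hs => ?_) (fun s hs => ?_) (fun s hs => ?_) (fun s hs => ?_)
  · rw [norm_mul, norm_neg, Complex.norm_I, one_mul]
    exact (hb x s hs).trans ((le_max_left _ _).trans (Real.le_coe_toNNReal _))
  · rw [norm_mul, Complex.norm_I, one_mul, RCLike.norm_conj]
    exact (hb y s hs).trans ((le_max_right _ _).trans (Real.le_coe_toNNReal _))
  · rw [dysonSum_eq hK hV hVm ψ₀ hs.1, intervalIntegral.integral_const_mul]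
    ring
  · rw [dysonSum_eq hK hV hVm ψ₀ hs.1, intervalIntegral.integral_const_mul, hconj, map_sub,
      map_mul, Complex.conj_I]
    ring

end Schrodinger

/-! ### Joint measurability in the realization and in time. -/

section Measurability

variable {d : ℕ} {Ω : Type*} [MeasurableSpace Ω]

/-- The moving interval is written as an indicator function, once for each orientation, so that the
measurability of partial integrals applies. -/
theorem measurable_intervalIntegral_uncurry {f : Ω → ℝ → ℂ} (hf : Measurable (Function.uncurry f)) :
    Measurable fun q : Ω × ℝ => ∫ s in (0 : ℝ)..q.2, f q.1 s := by
  have h : ∀ A : ℝ × ℝ → Set ℝ, MeasurableSet {r : ℝ × ℝ | r.2 ∈ A (0, r.1)} →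
      Measurable fun q : Ω × ℝ => ∫ s in A (0, q.2), f q.1 s := fun A hA => by
    have h1 : ∀ q : Ω × ℝ, MeasurableSet (A (0, q.2)) := fun q =>
      measurable_prodMk_left (x := q.2) hA
    have h2 : (fun q : Ω × ℝ => ∫ s in A (0, q.2), f q.1 s) =
        fun q : Ω × ℝ => ∫ s, (A (0, q.2)).indicator (f q.1) s := by
      ext q
      rw [integral_indicator (h1 q)]
    rw [h2]
    refine (StronglyMeasurable.integral_prod_right'
      (f := fun r : (Ω × ℝ) × ℝ => (A (0, r.1.2)).indicator (f r.1.1) r.2) ?_).measurable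
    have h3 : (fun r : (Ω × ℝ) × ℝ => (A (0, r.1.2)).indicator (f r.1.1) r.2) =
        {r : (Ω × ℝ) × ℝ | r.2 ∈ A (0, r.1.2)}.indicator (fun r => f r.1.1 r.2) := by
      ext r
      by_cases hr : r.2 ∈ A (0, r.1.2)
      · rw [Set.indicator_of_mem hr, Set.indicator_of_mem (by exact hr)]
      · rw [Set.indicator_of_notMem hr, Set.indicator_of_notMem (by exact hr)]
    rw [h3]
    refine Measurable.stronglyMeasurable (Measurable.indicator ?_ ?_)
    · exact hf.comp (measurable_fst.fst.prodMk measurable_snd)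
    · exact (measurable_fst.snd.prodMk measurable_snd :
        Measurable fun r : (Ω × ℝ) × ℝ => (r.1.2, r.2)) hA
  simp only [intervalIntegral]
  refine (h (fun r => Set.Ioc r.1 r.2) ?_).sub (h (fun r => Set.Ioc r.2 r.1) ?_)
  · exact (measurableSet_lt measurable_const measurable_snd).inter
      (measurableSet_le measurable_snd measurable_fst)
  · exact (measurableSet_lt measurable_fst measurable_snd).inter
      (measurableSet_le measurable_snd measurable_const)

variable {V : Ω → ℝ → CubicLattice d → ℝ}

theorem measurable_schrodingerOp {φ : Ω × ℝ → CubicLattice d → ℂ}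
    (hV : ∀ x, Measurable fun q : Ω × ℝ => V q.1 q.2 x) (hφ : ∀ x, Measurable fun q => φ q x)
    (x : CubicLattice d) : Measurable fun q : Ω × ℝ => schrodingerOp (V q.1 q.2) (φ q) x := by
  simp only [schrodingerOp_eq]
  exact (Finset.measurable_fun_sum _ fun q _ => hφ _).add
    ((Complex.measurable_ofReal.comp (hV x)).mul (hφ x))

theorem measurable_dyson (hV : ∀ x, Measurable fun q : Ω × ℝ => V q.1 q.2 x)
    (ψ₀ : CubicLattice d → ℂ) (n : ℕ) (x : CubicLattice d) :
    Measurable fun q : Ω × ℝ => dyson (V q.1) ψ₀ n q.2 x := by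
  induction n generalizing x with
  | zero => exact measurable_const
  | succ n ih =>
    simp only [dyson]
    exact measurable_const.mul (measurable_intervalIntegral_uncurry
      (f := fun ω s => schrodingerOp (V ω s) (dyson (V ω) ψ₀ n s) x)
      (measurable_schrodingerOp (φ := fun q => dyson (V q.1) ψ₀ n q.2) hV ih x))

end Measurability

/-! ### The parity of a Poisson process. -/

section PoissonFlip

/-- The generating function of the Poisson distribution at `-1`; this is the origin of the decay
rate `2 r` per spin. -/
theorem integral_neg_one_pow_poissonMeasure (m : ℝ≥0) :
    ∫ k, (-1 : ℝ) ^ k ∂(poissonMeasure m) = Real.exp (-(2 * m)) := by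
  rw [integral_poissonMeasure]
  have h : HasSum (fun n : ℕ => (Real.exp (-(m : ℝ)) * (m : ℝ) ^ n / n.factorial) • (-1 : ℝ) ^ n)
      (Real.exp (-(m : ℝ)) * Real.exp (-(m : ℝ))) := by
    have h1 := (NormedSpace.expSeries_div_hasSum_exp (𝔸 := ℝ) (-(m : ℝ))).mul_left
      (Real.exp (-(m : ℝ)))
    rw [← Real.exp_eq_exp_ℝ] at h1
    convert! h1 using 2 with n
    rw [smul_eq_mul, neg_pow (m : ℝ)]
    ring
  rw [h.tsum_eq, ← Real.exp_add]
  ring_nf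

variable {Ω : Type*} [MeasurableSpace Ω] {P : Measure Ω} {r : ℝ≥0}

theorem IsPoissonProcess.integral_increment {N : ℝ≥0 → Ω → ℕ} (hN : IsPoissonProcess P r N)
    {s t : ℝ≥0} (hst : s ≤ t) :
    ∫ ω, (-1 : ℝ) ^ (N t ω - N s ω) ∂P = Real.exp (-(2 * (r * ((t : ℝ) - s)))) := by
  have h := integral_map (μ := P) (φ := fun ω => N t ω - N s ω) (f := fun k : ℕ => (-1 : ℝ) ^ k)
    ((hN.measurable t).sub (hN.measurable s)).aemeasurable
    Measurable.of_discrete.aestronglyMeasurable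
  rw [← h, hN.law_increment s t hst, integral_neg_one_pow_poissonMeasure]
  push_cast [NNReal.coe_sub hst]
  rfl

/-- The Markov property of the parity of a Poisson process. -/
theorem IsPoissonProcess.integral_prod_mul [IsProbabilityMeasure P] {N : ℝ≥0 → Ω → ℕ}
    (hN : IsPoissonProcess P r N) {ι : Type*} (I : Finset ι) (τ : ι → ℝ≥0) {s t : ℝ≥0}
    (hτ : ∀ i ∈ I, τ i ≤ s) (hst : s ≤ t) :
    ∫ ω, (∏ i ∈ I, (-1 : ℝ) ^ N (τ i) ω) * (-1) ^ N t ω ∂P =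
      Real.exp (-(2 * (r * ((t : ℝ) - s)))) *
        ∫ ω, (∏ i ∈ I, (-1 : ℝ) ^ N (τ i) ω) * (-1) ^ N s ω ∂P := by
  classical
  -- All past times are put on one ordered grid that ends with `s`, and `t` is appended, so that the
  -- parities become functions of finitely many independent increments. The time `0` belongs to the
  -- grid because the process vanishes there almost surely.
  set S : Finset ℝ≥0 := insert 0 (insert s (I.image τ)) with hS
  have hSs : ∀ a ∈ S, a ≤ s := fun a ha => by
    simp only [hS, Finset.mem_insert, Finset.mem_image] at ha
    rcases ha with rfl | rfl | ⟨i, hi, rfl⟩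
    · exact zero_le
    · exact le_rfl
    · exact hτ i hi
  obtain ⟨n, hn⟩ : ∃ n, S.card = n + 1 :=
    Nat.exists_eq_succ_of_ne_zero (Finset.card_ne_zero_of_mem (Finset.mem_insert_self _ _))
  let e := S.orderEmbOfFin hn
  have he : ∀ a ∈ S, ∃ k, e k = a := fun a ha => by
    have : a ∈ Set.range e := by rw [Finset.range_orderEmbOfFin]; exact ha
    exact this
  have heS : ∀ k, e k ∈ S := fun k => Finset.orderEmbOfFin_mem _ _ _
  -- Constant equal to `t` beyond the grid, which keeps the sequence monotone on all of `ℕ`.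
  let T : ℕ → ℝ≥0 := fun k => if h : k < n + 1 then e ⟨k, h⟩ else t
  have hTk : ∀ k : Fin (n + 1), T k = e k := fun k => by
    simp only [T]
    rw [dif_pos k.2]
  have hT : Monotone T := by
    intro a b hab
    by_cases hb : b < n + 1
    · have ha : a < n + 1 := hab.trans_lt hb
      simp only [T, ha, hb, dif_pos]
      exact e.monotone hab
    · by_cases ha : a < n + 1
      · simp only [T, ha, hb, dif_pos, dif_neg, not_false_eq_true]
        exact (hSs _ (heS _)).trans hst
      · simp only [T]
        rw [dif_neg ha, dif_neg hb]
  have hT0 : T 0 = 0 := by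
    obtain ⟨k, hk⟩ := he 0 (Finset.mem_insert_self _ _)
    have : T 0 ≤ T k := hT (Nat.zero_le _)
    rw [hTk, hk] at this
    exact le_antisymm this zero_le
  have hTn : T n = s := by
    obtain ⟨k, hk⟩ := he s (by simp [hS])
    have h1 : T k ≤ T n := hT (by omega)
    rw [hTk, hk] at h1
    refine le_antisymm ?_ h1
    simp only [T, Nat.lt_succ_self, dif_pos]
    exact hSs _ (heS _)
  have hTn1 : T (n + 1) = t := by simp [T]
  have hk : ∀ i, ∃ k, i ∈ I → k ≤ n ∧ T k = τ i := fun i => by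
    by_cases hi : i ∈ I
    · obtain ⟨k, hk⟩ := he (τ i) (by
        simp only [hS, Finset.mem_insert, Finset.mem_image]
        exact Or.inr (Or.inr ⟨i, hi, rfl⟩))
      exact ⟨k, fun _ => ⟨by omega, by rw [hTk, hk]⟩⟩
    · exact ⟨0, fun h => absurd h hi⟩
  choose k hk using hk
  set D : ℕ → Ω → ℕ := fun j ω => N (T (j + 1)) ω - N (T j) ω with hD
  have hDm : ∀ j, Measurable (D j) := fun j => (hN.measurable _).sub (hN.measurable _)
  have hind : iIndepFun D P := hN.indep_increments.nat hT
  have hsum : ∀ᵐ ω ∂P, ∀ m, N (T m) ω = ∑ j ∈ Finset.range m, D j ω := by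
    filter_upwards [hN.zero, hN.monotone] with ω h0 hmono m
    induction m with
    | zero => simp [hT0, h0]
    | succ m ih =>
      rw [Finset.sum_range_succ, ← ih]
      have : N (T m) ω ≤ N (T (m + 1)) ω := hmono (hT (Nat.le_succ m))
      simp only [hD]
      omega
  let ext : (↥(Finset.range n) → ℕ) → ℕ → ℕ := fun f j =>
    if h : j ∈ Finset.range n then f ⟨j, h⟩ else 0
  let g : (↥(Finset.range n) → ℕ) → ℝ := fun f =>
    (∏ i ∈ I, (-1 : ℝ) ^ (∑ j ∈ Finset.range (k i), ext f j)) *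
      (-1) ^ (∑ j ∈ Finset.range n, ext f j)
  let X : Ω → (↥(Finset.range n) → ℕ) := fun ω j => D j ω
  have hX : Measurable X := measurable_pi_lambda _ fun j => hDm j
  have hext : ∀ ω, ∀ m ≤ n, ∑ j ∈ Finset.range m, ext (X ω) j = ∑ j ∈ Finset.range m, D j ω :=
    fun ω m hm => Finset.sum_congr rfl fun j hj => by
      have : j < n := (Finset.mem_range.mp hj).trans_le hm
      simp [ext, X, this]
  have hgX : ∀ᵐ ω ∂P, (∏ i ∈ I, (-1 : ℝ) ^ N (τ i) ω) * (-1) ^ N s ω = g (X ω) := by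
    filter_upwards [hsum] with ω hω
    simp only [g]
    rw [hext ω n le_rfl, ← hω, hTn]
    congr 1
    refine Finset.prod_congr rfl fun i hi => ?_
    rw [hext ω _ (hk i hi).1, ← hω, (hk i hi).2]
  have hgX' : ∀ᵐ ω ∂P, (∏ i ∈ I, (-1 : ℝ) ^ N (τ i) ω) * (-1) ^ N t ω =
      g (X ω) * (-1) ^ (D n ω) := by
    filter_upwards [hgX, hN.monotone] with ω hω hmono
    rw [← hω, mul_assoc, ← pow_add]
    have h1 : N s ω ≤ N t ω := hmono hst
    simp only [hD, hTn, hTn1]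
    rw [Nat.add_sub_cancel' h1]
  -- The increment from `s` to `t` is independent of all earlier ones; it contributes the
  -- exponential factor.
  have hXD : IndepFun X (D n) P := by
    have := hind.indepFun_finset (Finset.range n) {n} (by simp) hDm
    exact this.comp measurable_id (measurable_pi_apply ⟨n, Finset.mem_singleton_self n⟩)
  rw [integral_congr_ae hgX', integral_congr_ae hgX, hXD.integral_fun_comp_mul_comp (f := g)
    (g := fun k : ℕ => (-1 : ℝ) ^ k) hX.aemeasurable (hDm n).aemeasurable
    Measurable.of_discrete.aestronglyMeasurable Measurable.of_discrete.aestronglyMeasurable]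
  simp only [hD, hTn, hTn1]
  rw [hN.integral_increment hst, mul_comm]

end PoissonFlip

/-! ### The Markov property of the flip process. -/

section FlipProcess

variable {d : ℕ} {Ω : Type*} [MeasurableSpace Ω] {P : Measure Ω} [IsProbabilityMeasure P]
  {r : ℝ≥0} {σ : CubicLattice d → Ω → ℝ} {N : CubicLattice d → ℝ≥0 → Ω → ℕ}

theorem iIndepFun.integral_finset_prod_comp {ι 𝓧 : Type*} [MeasurableSpace 𝓧] {X : ι → Ω → 𝓧}
    (hX : iIndepFun X P) (mX : ∀ i, Measurable (X i)) {f : ι → 𝓧 → ℝ} (hf : ∀ i, Measurable (f i))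
    (B : Finset ι) : ∫ ω, ∏ i ∈ B, f i (X i ω) ∂P = ∏ i ∈ B, ∫ ω, f i (X i ω) ∂P := by
  have h := (hX.precomp (g := ((↑) : B → ι)) Subtype.val_injective).integral_fun_prod_comp
    (f := fun i : B => f i) (fun i => (mX _).aemeasurable)
    (fun i => (hf i).aestronglyMeasurable)
  rw [← Finset.prod_coe_sort B fun i => ∫ ω, f i (X i ω) ∂P, ← h]
  congr with ω
  exact (Finset.prod_coe_sort B fun i => f i (X i ω)).symm

/-- The expectations of monomials of spins factorize. -/
theorem IsFlipProcessData.integral_monomial (h : IsFlipProcessData P r σ N) {ι : Type*}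
    (I : Finset ι) (τ : ι → ℝ≥0) (x : ι → CubicLattice d) :
    ∫ ω, ∏ i ∈ I, flipSpin σ N ω (τ i) (x i) ∂P =
      (∫ ω, ∏ i ∈ I, σ (x i) ω ∂P) * ∫ ω, ∏ i ∈ I, (-1 : ℝ) ^ N (x i) (τ i) ω ∂P := by
  have h1 := h.indep.integral_fun_comp_mul_comp
    (f := fun s : CubicLattice d → ℝ => ∏ i ∈ I, s (x i))
    (g := fun n : CubicLattice d → ℝ≥0 → ℕ => ∏ i ∈ I, (-1 : ℝ) ^ n (x i) (τ i))
    (measurable_pi_lambda _ h.measurable_spin).aemeasurable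
    (measurable_pi_lambda _ fun x => measurable_pi_lambda _ fun t =>
      (h.poisson x).measurable t).aemeasurable
    (Finset.measurable_fun_prod _ fun i _ => measurable_pi_apply (x i)).aestronglyMeasurable
    (Finset.measurable_fun_prod _ fun i _ => (Measurable.of_discrete (f := fun k : ℕ =>
      (-1 : ℝ) ^ k)).comp ((measurable_pi_apply (τ i)).comp
        (measurable_pi_apply (x i)))).aestronglyMeasurable
  rw [← h1]
  simp only [flipSpin, Finset.prod_mul_distrib]

/-- Collecting the factors by site and using the independence of the sites reduces this to single
Poisson processes. Each site of `A` contributes one exponential factor and the others none, whence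
the cardinality in the exponent. -/
theorem IsFlipProcessData.integral_prod_mul_parity (h : IsFlipProcessData P r σ N) {ι : Type*}
    (I : Finset ι) (τ : ι → ℝ≥0) (x : ι → CubicLattice d) (A : Finset (CubicLattice d))
    {s t : ℝ≥0} (hτ : ∀ i ∈ I, τ i ≤ s) (hst : s ≤ t) :
    ∫ ω, (∏ i ∈ I, (-1 : ℝ) ^ N (x i) (τ i) ω) * ∏ z ∈ A, (-1) ^ N z t ω ∂P =
      Real.exp (-(2 * r * A.card * ((t : ℝ) - s))) *
        ∫ ω, (∏ i ∈ I, (-1 : ℝ) ^ N (x i) (τ i) ω) * ∏ z ∈ A, (-1) ^ N z s ω ∂P := by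
  classical
  set B := I.image x ∪ A with hB
  let f : ℝ≥0 → CubicLattice d → (ℝ≥0 → ℕ) → ℝ := fun t z n =>
    (∏ i ∈ I with x i = z, (-1 : ℝ) ^ n (τ i)) * if z ∈ A then (-1) ^ n t else 1
  have hpar : ∀ t : ℝ≥0, Measurable fun n : ℝ≥0 → ℕ => (-1 : ℝ) ^ n t := fun t =>
    (Measurable.of_discrete (f := fun k : ℕ => (-1 : ℝ) ^ k)).comp (measurable_pi_apply t)
  have hf : ∀ t z, Measurable (f t z) := fun t z => by
    refine (Finset.measurable_fun_prod _ fun i _ => hpar _).mul ?_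
    split_ifs
    · exact hpar t
    · exact measurable_const
  have hprod : ∀ t ω, (∏ i ∈ I, (-1 : ℝ) ^ N (x i) (τ i) ω) * ∏ z ∈ A, (-1) ^ N z t ω =
      ∏ z ∈ B, f t z (fun t => N z t ω) := fun t ω => by
    simp only [f, Finset.prod_mul_distrib]
    congr 1
    · rw [← Finset.prod_fiberwise_of_maps_to (t := B) (g := x)
        (fun i hi => Finset.mem_union_left _ (Finset.mem_image_of_mem x hi))]
      refine Finset.prod_congr rfl fun z _ => Finset.prod_congr rfl fun i hi => ?_
      rw [(Finset.mem_filter.mp hi).2]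
    · rw [Finset.prod_ite_mem, Finset.inter_eq_right.mpr Finset.subset_union_right]
  have hmeas : ∀ z, Measurable fun ω => fun t => N z t ω := fun z =>
    measurable_pi_lambda _ fun t => (h.poisson z).measurable t
  have hint : ∀ t, ∫ ω, ∏ z ∈ B, f t z (fun t => N z t ω) ∂P =
      ∏ z ∈ B, ∫ ω, f t z (fun t => N z t ω) ∂P := fun t =>
    iIndepFun.integral_finset_prod_comp h.indep_poisson hmeas (hf t) B
  simp only [hprod]
  rw [hint, hint]
  have hz : ∀ z ∈ B, ∫ ω, f t z (fun t => N z t ω) ∂P =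
      (if z ∈ A then Real.exp (-(2 * (r * ((t : ℝ) - s)))) else 1) *
        ∫ ω, f s z (fun t => N z t ω) ∂P := fun z _ => by
    by_cases hzA : z ∈ A
    · simp only [f, hzA, if_true]
      exact (h.poisson z).integral_prod_mul _ τ (fun i hi => hτ i (Finset.mem_filter.mp hi).1) hst
    · simp [f, hzA]
  rw [Finset.prod_congr rfl hz, Finset.prod_mul_distrib, Finset.prod_ite_mem,
    Finset.inter_eq_right.mpr Finset.subset_union_right, Finset.prod_const, ← Real.exp_nat_mul]
  congr 2
  ring

/-- The Markov property of the flip process, tested on monomials. -/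
theorem IsFlipProcessData.integral_prod_mul (h : IsFlipProcessData P r σ N) {ι : Type*}
    (I : Finset ι) (τ : ι → ℝ≥0) (x : ι → CubicLattice d) (A : Finset (CubicLattice d))
    {s t : ℝ≥0} (hτ : ∀ i ∈ I, τ i ≤ s) (hst : s ≤ t) :
    ∫ ω, (∏ i ∈ I, flipSpin σ N ω (τ i) (x i)) * ∏ z ∈ A, flipSpin σ N ω t z ∂P =
      Real.exp (-(2 * r * A.card * ((t : ℝ) - s))) *
        ∫ ω, (∏ i ∈ I, flipSpin σ N ω (τ i) (x i)) * ∏ z ∈ A, flipSpin σ N ω s z ∂P := by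
  -- The initial spins do not depend on time and split off as a common factor.
  have key : ∀ t, ∫ ω, (∏ i ∈ I, flipSpin σ N ω (τ i) (x i)) * ∏ z ∈ A, flipSpin σ N ω t z ∂P =
      (∫ ω, (∏ i ∈ I, σ (x i) ω) * ∏ z ∈ A, σ z ω ∂P) *
        ∫ ω, (∏ i ∈ I, (-1 : ℝ) ^ N (x i) (τ i) ω) * ∏ z ∈ A, (-1) ^ N z t ω ∂P := fun t => by
    have := h.integral_monomial (I.disjSum A) (Sum.elim τ fun _ => t) (Sum.elim x id)
    simpa only [Finset.prod_disjSum, Sum.elim_inl, Sum.elim_inr, id] using this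
  rw [key, key, h.integral_prod_mul_parity I τ x A hτ hst]
  ring

/-- Independence factors out the mean of the initial spin at a site of `A`, which is zero by
symmetry. -/
theorem IsFlipProcessData.integral_prod_eq_zero (h : IsFlipProcessData P r σ N)
    {A : Finset (CubicLattice d)} (hA : A.Nonempty) (t : ℝ≥0) :
    ∫ ω, ∏ z ∈ A, flipSpin σ N ω t z ∂P = 0 := by
  have h1 := h.integral_monomial A (fun _ => t) id
  simp only [id] at h1
  have h2 := iIndepFun.integral_finset_prod_comp h.indep_spin h.measurable_spin
    (f := fun _ a => a) (fun _ => measurable_id) A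
  obtain ⟨z, hz⟩ := hA
  have h3 : ∫ ω, σ z ω ∂P = 0 := by
    have h4 := integral_map (μ := P) (φ := σ z) (f := fun a : ℝ => a)
      (h.measurable_spin z).aemeasurable measurable_id.aestronglyMeasurable
    rw [← h4, h.law_spin z, integral_smul_measure, integral_add_measure]
    · simp
    · exact integrable_dirac (by simp)
    · exact integrable_dirac (by simp)
  rw [h1, h2, Finset.prod_eq_zero hz h3, zero_mul]

end FlipProcess

/-! ### Spin fields: an everywhere regular modification and its correlation functions. -/

section SpinField

variable {d : ℕ} {Ω : Type*} [MeasurableSpace Ω]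

/-- A field of independent spin flip processes with rate `r`, described by the properties of its
correlation functions. -/
structure IsSpinField (P : Measure Ω) (r : ℝ) (v : Ω → ℝ≥0 → CubicLattice d → ℝ) : Prop where
  sq_eq_one : ∀ ω t x, v ω t x ^ 2 = 1
  measurable : ∀ x, Measurable fun q : Ω × ℝ≥0 => v q.1 q.2 x
  markov : ∀ (l : List (ℝ≥0 × CubicLattice d)) (A : Finset (CubicLattice d)) (s t : ℝ≥0),
    (∀ q ∈ l, q.1 ≤ s) → s ≤ t →
    ∫ ω, (l.map fun q => v ω q.1 q.2).prod * ∏ z ∈ A, v ω t z ∂P =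
      Real.exp (-(2 * r * A.card * ((t : ℝ) - s))) *
        ∫ ω, (l.map fun q => v ω q.1 q.2).prod * ∏ z ∈ A, v ω s z ∂P
  integral_eq_zero : ∀ (A : Finset (CubicLattice d)) (t : ℝ≥0), A.Nonempty →
    ∫ ω, ∏ z ∈ A, v ω t z ∂P = 0

/-- A right continuous process is jointly measurable. -/
theorem measurable_uncurry_of_continuousWithinAt {f : Ω → ℝ≥0 → ℝ} (hf : ∀ t, Measurable fun ω => f ω t)
    (hc : ∀ ω t, ContinuousWithinAt (f ω) (Set.Ici t) t) :
    Measurable fun q : Ω × ℝ≥0 => f q.1 q.2 := by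
  -- The first point of the grid of mesh `1 / (n + 1)` strictly to the right of `t`: it takes
  -- countably many values and tends to `t` from the right.
  let a : ℕ → ℝ≥0 → ℝ≥0 := fun n t => ((⌊t * (n + 1)⌋₊ + 1 : ℕ) : ℝ≥0) / (n + 1)
  have ha1 : ∀ n t, t ≤ a n t := fun n t => by
    simp only [a]
    rw [le_div_iff₀ (by positivity)]
    push_cast
    exact (Nat.lt_floor_add_one _).le
  have ha2 : ∀ n t, a n t ≤ t + 1 / ((n : ℝ≥0) + 1) := fun n t => by
    simp only [a]
    rw [div_le_iff₀ (by positivity), add_mul, one_div_mul_cancel (by positivity)]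
    push_cast
    have := Nat.floor_le (show (0 : ℝ≥0) ≤ t * (n + 1) from zero_le)
    gcongr
  have ha : ∀ t, Tendsto (fun n => a n t) atTop (𝓝[Set.Ici t] t) := fun t => by
    refine tendsto_nhdsWithin_iff.mpr ⟨?_, Eventually.of_forall fun n => ha1 n t⟩
    refine tendsto_of_tendsto_of_tendsto_of_le_of_le (h := fun n : ℕ => t + 1 / ((n : ℝ≥0) + 1))
      tendsto_const_nhds ?_ (fun n => ha1 n t) (fun n => ha2 n t)
    have h := (tendsto_one_div_add_atTop_nhds_zero_nat (𝕜 := ℝ≥0)).const_add t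
    rwa [add_zero] at h
  refine measurable_of_tendsto_metrizable (f := fun n (q : Ω × ℝ≥0) => f q.1 (a n q.2))
    (fun n => ?_) (tendsto_pi_nhds.mpr fun q => (hc q.1 q.2).tendsto.comp (ha q.2))
  have h1 : Measurable fun q : Ω × ℕ => f q.1 (((q.2 + 1 : ℕ) : ℝ≥0) / (n + 1)) :=
    measurable_from_prod_countable_left fun k => hf (((k + 1 : ℕ) : ℝ≥0) / (n + 1))
  have h2 : Measurable fun q : Ω × ℝ≥0 => (q.1, ⌊q.2 * (n + 1)⌋₊) :=
    measurable_fst.prodMk (Nat.measurable_floor.comp (measurable_snd.mul_const _))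
  exact h1.comp h2

variable {P : Measure Ω} [IsProbabilityMeasure P]
  {r : ℝ≥0} {σ : CubicLattice d → Ω → ℝ} {N : CubicLattice d → ℝ≥0 → Ω → ℕ}

theorem IsFlipProcessData.ae_spin (h : IsFlipProcessData P r σ N) (x : CubicLattice d) :
    ∀ᵐ ω ∂P, σ x ω ^ 2 = 1 := by
  have h1 : ∀ᵐ a ∂(P.map (σ x)), a ^ 2 = 1 := by
    rw [h.law_spin x]
    refine Measure.ae_smul_measure ?_ _
    rw [ae_add_measure_iff, ae_dirac_eq, ae_dirac_eq]
    exact ⟨by simp, by simp⟩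
  exact ae_of_ae_map (h.measurable_spin x).aemeasurable h1

theorem IsFlipProcessData.measurable_flipSpin (h : IsFlipProcessData P r σ N) (t : ℝ≥0)
    (x : CubicLattice d) : Measurable fun ω => flipSpin σ N ω t x :=
  (h.measurable_spin x).mul ((Measurable.of_discrete (f := fun k : ℕ => (-1 : ℝ) ^ k)).comp
    ((h.poisson x).measurable t))

/-- The flip process has a modification that is a spin field. -/
theorem IsFlipProcessData.exists_isSpinField (h : IsFlipProcessData P r σ N) :
    ∃ v : Ω → ℝ≥0 → CubicLattice d → ℝ, IsSpinField P r v ∧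
      ∀ᵐ ω ∂P, ∀ t x, v ω t x = flipSpin σ N ω t x := by
  classical
  have hae : ∀ᵐ ω ∂P, ∀ x, σ x ω ^ 2 = 1 ∧
      ∀ t, ContinuousWithinAt (fun s => N x s ω) (Set.Ici t) t :=
    ae_all_iff.mpr fun x => (h.ae_spin x).and (h.poisson x).right_continuous
  obtain ⟨G, hG, hGm, hGp⟩ := hae.exists_measurable_mem
  -- Off a measurable set of full measure the spins are frozen to `1`; then `v² = 1` and the right
  -- continuity of paths hold for every realization.
  let v : Ω → ℝ≥0 → CubicLattice d → ℝ := fun ω t x => if ω ∈ G then flipSpin σ N ω t x else 1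
  have hv : ∀ᵐ ω ∂P, ∀ t x, v ω t x = flipSpin σ N ω t x := by
    filter_upwards [hG] with ω hω t x
    simp [v, hω]
  refine ⟨v, ⟨fun ω t x => ?_, fun x => ?_, fun l A s t hl hst => ?_, fun A t hA => ?_⟩, hv⟩
  · by_cases hω : ω ∈ G
    · simp only [v, hω, if_true, flipSpin, mul_pow, (hGp ω hω x).1, one_mul]
      rw [← pow_mul, mul_comm, pow_mul]
      simp
    · simp [v, hω]
  · refine measurable_uncurry_of_continuousWithinAt (f := fun ω t => v ω t x) (fun t => ?_)
      fun ω t => ?_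
    · exact Measurable.ite hGm (h.measurable_flipSpin t x) measurable_const
    · by_cases hω : ω ∈ G
      · simp only [v, hω, if_true, flipSpin]
        have h1 := (hGp ω hω x).2 t
        have h2 : Continuous fun k : ℕ => σ x ω * (-1 : ℝ) ^ k := continuous_of_discreteTopology
        exact h2.continuousAt.comp_continuousWithinAt h1
      · simp only [v, hω, if_false]
        exact continuousWithinAt_const
  · have e : ∀ t : ℝ≥0, ∫ ω, (l.map fun q => v ω q.1 q.2).prod * ∏ z ∈ A, v ω t z ∂P =
        ∫ ω, (∏ i : Fin l.length, flipSpin σ N ω (l.get i).1 (l.get i).2) *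
          ∏ z ∈ A, flipSpin σ N ω t z ∂P := fun t => by
      refine integral_congr_ae ?_
      filter_upwards [hv] with ω hω
      simp only [hω]
      congr 1
      rw [← List.prod_ofFn]
      congr 1
      exact List.ext_get (by simp) fun i h1 h2 => by simp
    rw [e, e]
    exact h.integral_prod_mul Finset.univ (fun i => (l.get i).1) (fun i => (l.get i).2) A
      (fun i _ => hl _ (List.get_mem l i)) hst
  · rw [← h.integral_prod_eq_zero hA t]
    refine integral_congr_ae ?_
    filter_upwards [hv] with ω hω
    simp only [hω]

end SpinField

/-! ### Nonanticipating random variables. -/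

section Nonanticipating

variable {d : ℕ} {Ω : Type*} [MeasurableSpace Ω] {P : Measure Ω} [IsProbabilityMeasure P] {r : ℝ}
  {v : Ω → ℝ≥0 → CubicLattice d → ℝ}

/-- The product of the spins at time `t` over a finite set. -/
def spinChar (v : Ω → ℝ≥0 → CubicLattice d → ℝ) (A : Finset (CubicLattice d)) (t : ℝ≥0) (ω : Ω) : ℂ :=
  ∏ z ∈ A, (v ω t z : ℂ)

/-- A monomial of spins at different times. -/
def spinMonomial (v : Ω → ℝ≥0 → CubicLattice d → ℝ) (l : List (ℝ≥0 × CubicLattice d)) (ω : Ω) : ℂ :=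
  (l.map fun q => (v ω q.1 q.2 : ℂ)).prod

theorem spinChar_eq (A : Finset (CubicLattice d)) (t : ℝ≥0) (ω : Ω) :
    spinChar v A t ω = ((∏ z ∈ A, v ω t z : ℝ) : ℂ) := by
  rw [spinChar]; push_cast; rfl

theorem spinMonomial_eq (l : List (ℝ≥0 × CubicLattice d)) (ω : Ω) :
    spinMonomial v l ω = (((l.map fun q => v ω q.1 q.2).prod : ℝ) : ℂ) := by
  induction l with
  | nil => simp [spinMonomial]
  | cons q l ih =>
    rw [spinMonomial] at ih ⊢
    rw [List.map_cons, List.prod_cons, ih, List.map_cons, List.prod_cons]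
    push_cast
    rfl

theorem IsSpinField.abs_eq_one (hv : IsSpinField P r v) (ω : Ω) (t : ℝ≥0) (x : CubicLattice d) :
    |v ω t x| = 1 := by
  have := hv.sq_eq_one ω t x
  rw [← sq_abs] at this
  exact (pow_eq_one_iff_of_nonneg (abs_nonneg _) two_ne_zero).mp this

theorem IsSpinField.norm_eq_one (hv : IsSpinField P r v) (ω : Ω) (t : ℝ≥0) (x : CubicLattice d) :
    ‖(v ω t x : ℂ)‖ = 1 := by
  rw [Complex.norm_real]; exact hv.abs_eq_one ω t x

theorem IsSpinField.norm_spinChar (hv : IsSpinField P r v) (A : Finset (CubicLattice d)) (t : ℝ≥0)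
    (ω : Ω) : ‖spinChar v A t ω‖ = 1 := by
  rw [spinChar, norm_prod]
  exact Finset.prod_eq_one fun z _ => hv.norm_eq_one ω t z

theorem IsSpinField.norm_spinMonomial (hv : IsSpinField P r v) (l : List (ℝ≥0 × CubicLattice d))
    (ω : Ω) : ‖spinMonomial v l ω‖ = 1 := by
  induction l with
  | nil => simp [spinMonomial]
  | cons q l ih =>
    rw [spinMonomial] at ih ⊢
    rw [List.map_cons, List.prod_cons, norm_mul, ih, hv.norm_eq_one, one_mul]

theorem IsSpinField.measurable_spin (hv : IsSpinField P r v) (t : ℝ≥0) (x : CubicLattice d) :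
    Measurable fun ω => (v ω t x : ℂ) :=
  Complex.measurable_ofReal.comp ((hv.measurable x).comp (measurable_id.prodMk measurable_const))

theorem IsSpinField.measurable_spinChar (hv : IsSpinField P r v) (A : Finset (CubicLattice d))
    (t : ℝ≥0) : Measurable (spinChar v A t) :=
  Finset.measurable_fun_prod _ fun z _ => hv.measurable_spin t z

theorem IsSpinField.measurable_spinChar_uncurry (hv : IsSpinField P r v)
    (A : Finset (CubicLattice d)) : Measurable fun q : Ω × ℝ => spinChar v A q.2.toNNReal q.1 :=
  Finset.measurable_fun_prod _ fun z _ => Complex.measurable_ofReal.comp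
    ((hv.measurable z).comp (measurable_fst.prodMk (measurable_real_toNNReal.comp measurable_snd)))

theorem IsSpinField.measurable_spinMonomial (hv : IsSpinField P r v)
    (l : List (ℝ≥0 × CubicLattice d)) : Measurable (spinMonomial v l) := by
  induction l with
  | nil => exact measurable_const
  | cons q l ih => exact (hv.measurable_spin q.1 q.2).mul ih

theorem IsSpinField.mul_spinChar (hv : IsSpinField P r v) (A : Finset (CubicLattice d)) (t : ℝ≥0)
    (x : CubicLattice d) (ω : Ω) :
    (v ω t x : ℂ) * spinChar v A t ω = spinChar v (symmDiff A {x}) t ω := by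
  have hsq : (v ω t x : ℂ) * v ω t x = 1 := by
    rw [← sq]; exact_mod_cast hv.sq_eq_one ω t x
  by_cases hx : x ∈ A
  · have h1 : symmDiff A {x} = A.erase x := by
      ext y
      simp only [Finset.mem_symmDiff, Finset.mem_singleton, Finset.mem_erase]
      constructor
      · rintro (⟨h, h'⟩ | ⟨rfl, h'⟩)
        · exact ⟨h', h⟩
        · exact absurd hx h'
      · rintro ⟨h, h'⟩; exact Or.inl ⟨h', h⟩
    rw [h1, spinChar, spinChar, ← Finset.mul_prod_erase A _ hx, ← mul_assoc, hsq, one_mul]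
  · have h1 : symmDiff A {x} = insert x A := by
      ext y
      simp only [Finset.mem_symmDiff, Finset.mem_singleton, Finset.mem_insert]
      constructor
      · rintro (⟨h, h'⟩ | ⟨rfl, h'⟩)
        · exact Or.inr h
        · exact Or.inl rfl
      · rintro (rfl | h)
        · exact Or.inr ⟨rfl, hx⟩
        · exact Or.inl ⟨h, fun h' => hx (h' ▸ h)⟩
    rw [h1, spinChar, spinChar, Finset.prod_insert hx]

/-- A bounded random variable that does not anticipate the spin flips after time `s`, expressed by
the Markov property of the correlations with the spins. -/
structure IsNonanticipating (P : Measure Ω) (r : ℝ) (v : Ω → ℝ≥0 → CubicLattice d → ℝ) (s : ℝ≥0)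
    (W : Ω → ℂ) : Prop where
  measurable : Measurable W
  bounded : ∃ C, ∀ ω, ‖W ω‖ ≤ C
  markov : ∀ (l : List (ℝ≥0 × CubicLattice d)) (A : Finset (CubicLattice d)) (t : ℝ≥0),
    (∀ q ∈ l, q.1 ≤ s) → s ≤ t →
    ∫ ω, W ω * (spinMonomial v l ω * spinChar v A t ω) ∂P =
      Real.exp (-(2 * r * A.card * ((t : ℝ) - s))) *
        ∫ ω, W ω * (spinMonomial v l ω * spinChar v A s ω) ∂P

namespace IsNonanticipating

variable {s : ℝ≥0} {W W' : Ω → ℂ}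

theorem integrable_mul (hv : IsSpinField P r v) (hm : Measurable W) (hb : ∃ C, ∀ ω, ‖W ω‖ ≤ C)
    (l : List (ℝ≥0 × CubicLattice d)) (A : Finset (CubicLattice d)) (t : ℝ≥0) :
    Integrable (fun ω => W ω * (spinMonomial v l ω * spinChar v A t ω)) P := by
  obtain ⟨C, hC⟩ := hb
  refine Integrable.of_bound (hm.mul ((hv.measurable_spinMonomial l).mul
    (hv.measurable_spinChar A t))).aestronglyMeasurable C (Eventually.of_forall fun ω => ?_)
  rw [norm_mul, norm_mul, hv.norm_spinMonomial, hv.norm_spinChar, mul_one, mul_one]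
  exact hC ω

theorem const (hv : IsSpinField P r v) (s : ℝ≥0) (c : ℂ) : IsNonanticipating P r v s fun _ => c where
  measurable := measurable_const
  bounded := ⟨‖c‖, fun _ => le_rfl⟩
  markov l A t hl hst := by
    rw [integral_const_mul, integral_const_mul]
    simp only [spinMonomial_eq, spinChar_eq, ← Complex.ofReal_mul]
    rw [integral_complex_ofReal, integral_complex_ofReal, hv.markov l A s t hl hst]
    push_cast
    ring

theorem add (hv : IsSpinField P r v) (h : IsNonanticipating P r v s W)
    (h' : IsNonanticipating P r v s W') : IsNonanticipating P r v s fun ω => W ω + W' ω where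
  measurable := h.measurable.add h'.measurable
  bounded := by
    obtain ⟨C, hC⟩ := h.bounded
    obtain ⟨C', hC'⟩ := h'.bounded
    exact ⟨C + C', fun ω => (norm_add_le _ _).trans (add_le_add (hC ω) (hC' ω))⟩
  markov l A t hl hst := by
    simp only [add_mul]
    rw [integral_add (integrable_mul hv h.measurable h.bounded l A t)
      (integrable_mul hv h'.measurable h'.bounded l A t),
      integral_add (integrable_mul hv h.measurable h.bounded l A s)
      (integrable_mul hv h'.measurable h'.bounded l A s), h.markov l A t hl hst,
      h'.markov l A t hl hst, mul_add]

theorem const_mul (h : IsNonanticipating P r v s W) (c : ℂ) :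
    IsNonanticipating P r v s fun ω => c * W ω where
  measurable := h.measurable.const_mul c
  bounded := by
    obtain ⟨C, hC⟩ := h.bounded
    refine ⟨‖c‖ * C, fun ω => ?_⟩
    rw [norm_mul]
    exact mul_le_mul_of_nonneg_left (hC ω) (norm_nonneg _)
  markov l A t hl hst := by
    simp only [mul_assoc c]
    rw [integral_const_mul, integral_const_mul, h.markov l A t hl hst]
    ring

theorem sum (hv : IsSpinField P r v) {ι : Type*} (S : Finset ι) {W : ι → Ω → ℂ}
    (h : ∀ i ∈ S, IsNonanticipating P r v s (W i)) :
    IsNonanticipating P r v s fun ω => ∑ i ∈ S, W i ω := by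
  classical
  induction S using Finset.induction_on with
  | empty => simpa using const hv s 0
  | insert i S hi ih =>
    simp only [Finset.sum_insert hi]
    exact (h i (Finset.mem_insert_self i S)).add hv
      (ih fun j hj => h j (Finset.mem_insert_of_mem hj))

/-- An earlier spin is absorbed into the monomial of past spins; the definition quantifies over such
monomials for the sake of this closure property. -/
theorem spin_mul (hv : IsSpinField P r v) (h : IsNonanticipating P r v s W) {τ : ℝ≥0} (hτ : τ ≤ s)
    (x : CubicLattice d) : IsNonanticipating P r v s fun ω => v ω τ x * W ω where
  measurable := (hv.measurable_spin τ x).mul h.measurable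
  bounded := by
    obtain ⟨C, hC⟩ := h.bounded
    refine ⟨C, fun ω => ?_⟩
    rw [norm_mul, hv.norm_eq_one, one_mul]
    exact hC ω
  markov l A t hl hst := by
    have e : ∀ t ω, v ω τ x * W ω * (spinMonomial v l ω * spinChar v A t ω) =
        W ω * (spinMonomial v ((τ, x) :: l) ω * spinChar v A t ω) := fun t ω => by
      simp only [spinMonomial, List.map_cons, List.prod_cons]
      ring
    simp only [e]
    refine h.markov _ A t (fun q hq => ?_) hst
    rcases List.mem_cons.mp hq with rfl | hq
    · exact hτ
    · exact hl q hq

theorem conj (h : IsNonanticipating P r v s W) :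
    IsNonanticipating P r v s fun ω => starRingEnd ℂ (W ω) where
  measurable := Complex.continuous_conj.measurable.comp h.measurable
  bounded := by
    obtain ⟨C, hC⟩ := h.bounded
    exact ⟨C, fun ω => by rw [RCLike.norm_conj]; exact hC ω⟩
  markov l A t hl hst := by
    have e : ∀ t ω, starRingEnd ℂ (W ω) * (spinMonomial v l ω * spinChar v A t ω) =
        starRingEnd ℂ (W ω * (spinMonomial v l ω * spinChar v A t ω)) := fun t ω => by
      rw [map_mul, spinMonomial_eq, spinChar_eq, ← Complex.ofReal_mul, Complex.conj_ofReal]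
    simp only [e]
    rw [integral_conj, integral_conj, h.markov l A t hl hst, map_mul, Complex.conj_ofReal]

theorem of_tendsto (hv : IsSpinField P r v) {W : ℕ → Ω → ℂ} {W' : Ω → ℂ}
    (h : ∀ n, IsNonanticipating P r v s (W n)) {C : ℝ} (hC : ∀ n ω, ‖W n ω‖ ≤ C)
    (hlim : ∀ ω, Tendsto (fun n => W n ω) atTop (𝓝 (W' ω))) : IsNonanticipating P r v s W' where
  measurable := measurable_of_tendsto_metrizable (fun n => (h n).measurable)
    (tendsto_pi_nhds.mpr hlim)
  bounded := ⟨C, fun ω => le_of_tendsto (hlim ω).norm (Eventually.of_forall fun n => hC n ω)⟩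
  markov l A t hl hst := by
    have ht : ∀ t, Tendsto (fun n => ∫ ω, W n ω * (spinMonomial v l ω * spinChar v A t ω) ∂P) atTop
        (𝓝 (∫ ω, W' ω * (spinMonomial v l ω * spinChar v A t ω) ∂P)) := fun t => by
      refine tendsto_integral_of_dominated_convergence (fun _ => C)
        (fun n => (integrable_mul hv (h n).measurable (h n).bounded l A t).aestronglyMeasurable)
        (integrable_const C) (fun n => Eventually.of_forall fun ω => ?_)
        (Eventually.of_forall fun ω => (hlim ω).mul_const _)
      rw [norm_mul, norm_mul, hv.norm_spinMonomial, hv.norm_spinChar, mul_one, mul_one]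
      exact hC n ω
    refine tendsto_nhds_unique (ht t) ?_
    simp only [(h _).markov l A t hl hst]
    exact (ht s).const_mul _

theorem integral_swap (hv : IsSpinField P r v) {τ : ℝ} (hτ : 0 ≤ τ) {g : Ω → ℝ → ℂ}
    (hg : Measurable (Function.uncurry g)) {C : ℝ} (hC : ∀ ω, ∀ ρ ∈ Set.Ioc 0 τ, ‖g ω ρ‖ ≤ C)
    {X : Ω → ℂ} (hX : Measurable X) (hX1 : ∀ ω, ‖X ω‖ = 1) :
    ∫ ω, (∫ ρ in (0 : ℝ)..τ, g ω ρ) * X ω ∂P = ∫ ρ in (0 : ℝ)..τ, ∫ ω, g ω ρ * X ω ∂P := by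
  simp only [← intervalIntegral.integral_mul_const]
  simp only [intervalIntegral.integral_of_le hτ]
  refine integral_integral_swap ?_
  have hm : Measurable (Function.uncurry fun ω ρ => g ω ρ * X ω) := hg.mul (hX.comp measurable_fst)
  refine Integrable.of_bound hm.aestronglyMeasurable C ?_
  rw [Measure.ae_prod_iff_ae_ae]
  · refine Eventually.of_forall fun ω => (ae_restrict_mem measurableSet_Ioc).mono fun ρ hρ => ?_
    change ‖g ω ρ * X ω‖ ≤ C
    rw [norm_mul, hX1, mul_one]
    exact hC ω ρ hρ
  · exact measurableSet_le hm.norm measurable_const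

theorem integral (hv : IsSpinField P r v) {τ : ℝ} (hτ : 0 ≤ τ) {g : Ω → ℝ → ℂ}
    (hg : Measurable (Function.uncurry g)) {C : ℝ} (hC : ∀ ω, ∀ ρ ∈ Set.Ioc 0 τ, ‖g ω ρ‖ ≤ C)
    (h : ∀ ρ ∈ Set.Ioc 0 τ, IsNonanticipating P r v s fun ω => g ω ρ) :
    IsNonanticipating P r v s fun ω => ∫ ρ in (0 : ℝ)..τ, g ω ρ where
  measurable := (measurable_intervalIntegral_uncurry hg).comp (measurable_id.prodMk measurable_const)
  bounded := ⟨C * |τ - 0|, fun ω => intervalIntegral.norm_integral_le_of_norm_le_const fun ρ hρ => by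
    rw [Set.uIoc_of_le hτ] at hρ; exact hC ω ρ hρ⟩
  markov l A t hl hst := by
    have e : ∀ t, ∫ ω, (∫ ρ in (0 : ℝ)..τ, g ω ρ) * (spinMonomial v l ω * spinChar v A t ω) ∂P =
        ∫ ρ in (0 : ℝ)..τ, ∫ ω, g ω ρ * (spinMonomial v l ω * spinChar v A t ω) ∂P := fun t =>
      integral_swap hv hτ hg hC ((hv.measurable_spinMonomial l).mul (hv.measurable_spinChar A t))
        fun ω => by rw [norm_mul, hv.norm_spinMonomial, hv.norm_spinChar, mul_one]
    rw [e, e, ← intervalIntegral.integral_const_mul]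
    refine intervalIntegral.integral_congr_ae (Eventually.of_forall fun ρ hρ => ?_)
    rw [Set.uIoc_of_le hτ] at hρ
    exact (h ρ hρ).markov l A t hl hst

end IsNonanticipating

end Nonanticipating

/-! ### Solutions do not anticipate later flips. -/

section SchrodingerNonanticipating

variable {d : ℕ} {Ω : Type*} [MeasurableSpace Ω] {P : Measure Ω} [IsProbabilityMeasure P] {r : ℝ}
  {v : Ω → ℝ≥0 → CubicLattice d → ℝ} {u : CubicLattice d → ℝ} {lam K : ℝ}

theorem IsSpinField.abs_potential_le (hv : IsSpinField P r v) (hu : ∀ x, |u x| + |lam| ≤ K) (ω : Ω) :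
    ∀ s x, |totalPotential u lam (v ω) s x| ≤ K :=
  abs_totalPotential_le hu fun s x => (hv.abs_eq_one ω s x).le

theorem IsSpinField.measurable_time (hv : IsSpinField P r v) (ω : Ω) (x : CubicLattice d) :
    Measurable fun s => v ω s x :=
  (hv.measurable x).comp (measurable_const.prodMk measurable_id)

theorem IsSpinField.measurable_potential (hv : IsSpinField P r v) (x : CubicLattice d) :
    Measurable fun q : Ω × ℝ => totalPotential u lam (v q.1) q.2 x :=
  measurable_const.add (measurable_const.mul ((hv.measurable x).comp
    (measurable_fst.prodMk (measurable_real_toNNReal.comp measurable_snd))))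

theorem IsNonanticipating.schrodingerOp_mul (hv : IsSpinField P r v) {s : ℝ≥0} {ρ : ℝ}
    (hρs : ρ.toNNReal ≤ s) {φ : Ω → CubicLattice d → ℂ} {Z : Ω → ℂ}
    (h : ∀ x, IsNonanticipating P r v s fun ω => φ ω x * Z ω) (x : CubicLattice d) :
    IsNonanticipating P r v s fun ω =>
      schrodingerOp (totalPotential u lam (v ω) ρ) (φ ω) x * Z ω := by
  have e : (fun ω => schrodingerOp (totalPotential u lam (v ω) ρ) (φ ω) x * Z ω) = fun ω =>
      (∑ q : LatticeDir d, φ ω (x + q.vec) * Z ω + (u x : ℂ) * (φ ω x * Z ω)) +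
        (lam : ℂ) * (v ω ρ.toNNReal x * (φ ω x * Z ω)) := by
    ext ω
    rw [schrodingerOp_eq, totalPotential, add_mul, Finset.sum_mul]
    push_cast
    ring
  rw [e]
  exact ((IsNonanticipating.sum hv _ fun q _ => h (x + q.vec)).add hv ((h x).const_mul _)).add hv
    (((h x).spin_mul hv hρs x).const_mul _)

/-- The factor `Z` is carried along because nonanticipation, as defined, is not evidently stable
under products; conjugated components put in place of `Z` yield the products in the density matrix.
The induction follows the Dyson recursion, which uses spins at times up to `s` only. -/
theorem IsNonanticipating.dyson_mul (hv : IsSpinField P r v) (hK : 0 ≤ K)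
    (hu : ∀ x, |u x| + |lam| ≤ K) (ψ₀ : L2Lattice d) {s : ℝ≥0} {Z : Ω → ℂ}
    (hZ : IsNonanticipating P r v s Z) (n : ℕ) {τ : ℝ} (hτ : τ ∈ Set.Icc 0 (s : ℝ))
    (x : CubicLattice d) :
    IsNonanticipating P r v s fun ω => dyson (totalPotential u lam (v ω)) ψ₀ n τ x * Z ω := by
  induction n generalizing τ x with
  | zero => exact hZ.const_mul _
  | succ n ih =>
    obtain ⟨C, hC⟩ := hZ.bounded
    have e : (fun ω => dyson (totalPotential u lam (v ω)) ψ₀ (n + 1) τ x * Z ω) = fun ω =>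
        -Complex.I * ∫ ρ in (0 : ℝ)..τ, schrodingerOp (totalPotential u lam (v ω) ρ)
          (dyson (totalPotential u lam (v ω)) ψ₀ n ρ) x * Z ω := by
      ext ω
      rw [dyson, intervalIntegral.integral_mul_const, mul_assoc]
    rw [e]
    refine IsNonanticipating.const_mul (IsNonanticipating.integral hv hτ.1
      (C := τ ^ n / n.factorial * majorantCoeff K ψ₀ (n + 1) x * C)
      (g := fun ω ρ => schrodingerOp (totalPotential u lam (v ω) ρ)
          (dyson (totalPotential u lam (v ω)) ψ₀ n ρ) x * Z ω) ?_ (fun ω ρ hρ => ?_)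
      fun ρ hρ => ?_) _
    · exact (measurable_schrodingerOp (V := fun ω => totalPotential u lam (v ω))
        (φ := fun q => dyson (totalPotential u lam (v q.1)) ψ₀ n q.2)
        hv.measurable_potential (fun x => measurable_dyson (V := fun ω => totalPotential u lam (v ω))
          hv.measurable_potential ψ₀ n x) x).mul (hZ.measurable.comp measurable_fst)
    · rw [norm_mul]
      have hm := majorantCoeff_nonneg hK ψ₀ (n + 1) x
      have h1 := norm_schrodingerOp_le (hv.abs_potential_le hu ω ρ)
        (fun x => norm_dyson_le hK (hv.abs_potential_le hu ω) ψ₀ n hρ.1.le x) x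
      rw [← Finset.mul_sum, mul_left_comm, ← mul_add, ← majorantCoeff_succ] at h1
      have h2 : ρ ^ n / n.factorial * majorantCoeff K ψ₀ (n + 1) x ≤
          τ ^ n / n.factorial * majorantCoeff K ψ₀ (n + 1) x := by
        have := hρ.1.le
        have := hρ.2
        gcongr
      exact mul_le_mul (h1.trans h2) (hC ω) (norm_nonneg _)
        (mul_nonneg (div_nonneg (pow_nonneg hτ.1 _) (by positivity)) hm)
    · exact IsNonanticipating.schrodingerOp_mul hv
        (Real.toNNReal_le_iff_le_coe.mpr (hρ.2.trans hτ.2))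
        (fun y => ih ⟨hρ.1.le, hρ.2.trans hτ.2⟩ y) x

theorem IsNonanticipating.dysonSum_mul (hv : IsSpinField P r v) (hK : 0 ≤ K)
    (hu : ∀ x, |u x| + |lam| ≤ K) (ψ₀ : L2Lattice d) {s : ℝ≥0} {Z : Ω → ℂ}
    (hZ : IsNonanticipating P r v s Z) {τ : ℝ} (hτ : τ ∈ Set.Icc 0 (s : ℝ)) (x : CubicLattice d) :
    IsNonanticipating P r v s fun ω => dysonSum (totalPotential u lam (v ω)) ψ₀ τ x * Z ω := by
  obtain ⟨C, hC⟩ := hZ.bounded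
  refine IsNonanticipating.of_tendsto hv (C := majorant K ψ₀ τ x * C)
    (W := fun n ω => ∑ m ∈ Finset.range n, dyson (totalPotential u lam (v ω)) ψ₀ m τ x * Z ω)
    (fun n => IsNonanticipating.sum hv _ fun m _ => hZ.dyson_mul hv hK hu ψ₀ m hτ x)
    (fun n ω => ?_) fun ω => ?_
  · rw [← Finset.sum_mul, norm_mul]
    refine mul_le_mul ((norm_sum_le _ _).trans ?_) (hC ω) (norm_nonneg _)
      (majorant_nonneg hK ψ₀ hτ.1 x)
    refine (Finset.sum_le_sum fun m _ =>
      norm_dyson_le hK (hv.abs_potential_le hu ω) ψ₀ m hτ.1 x).trans ?_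
    exact sum_le_hasSum _ (fun m _ => mul_nonneg (div_nonneg (pow_nonneg hτ.1 _) (by positivity))
      (majorantCoeff_nonneg hK ψ₀ m x)) (hasSum_majorant_apply K ψ₀ τ x)
  · simp only [← Finset.sum_mul]
    exact (hasSum_dyson hK (hv.abs_potential_le hu ω) ψ₀ hτ.1 x).tendsto_sum_nat.mul_const _

end SchrodingerNonanticipating

/-! ### Orthogonality of the spin products. -/

section Bessel

variable {d : ℕ} {Ω : Type*} [MeasurableSpace Ω] {P : Measure Ω} [IsProbabilityMeasure P] {r : ℝ}
  {v : Ω → ℝ≥0 → CubicLattice d → ℝ}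

theorem IsSpinField.integral_spinChar (hv : IsSpinField P r v) (A : Finset (CubicLattice d))
    (t : ℝ≥0) : ∫ ω, spinChar v A t ω ∂P = if A = ∅ then 1 else 0 := by
  split_ifs with h
  · simp [h, spinChar]
  · simp only [spinChar_eq]
    rw [integral_complex_ofReal, hv.integral_eq_zero A t (Finset.nonempty_iff_ne_empty.mpr h),
      Complex.ofReal_zero]

/-- As spins square to one, repeated sites cancel: the products multiply like a group under
symmetric difference. -/
theorem IsSpinField.spinChar_mul_spinChar (hv : IsSpinField P r v) (A B : Finset (CubicLattice d))
    (t : ℝ≥0) (ω : Ω) : spinChar v A t ω * spinChar v B t ω = spinChar v (symmDiff A B) t ω := by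
  induction A using Finset.induction_on generalizing B with
  | empty =>
    have : symmDiff ∅ B = B := bot_symmDiff B
    rw [this, spinChar, Finset.prod_empty, one_mul]
  | insert x A hx ih =>
    have h1 : insert x A = symmDiff A {x} := by
      ext y
      simp only [Finset.mem_symmDiff, Finset.mem_singleton, Finset.mem_insert]
      constructor
      · rintro (rfl | h)
        · exact Or.inr ⟨rfl, hx⟩
        · exact Or.inl ⟨h, fun h' => hx (h' ▸ h)⟩
      · rintro (⟨h, h'⟩ | ⟨rfl, h'⟩)
        · exact Or.inr h
        · exact Or.inl rfl
    have h2 : spinChar v (insert x A) t ω = v ω t x * spinChar v A t ω := by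
      rw [spinChar, Finset.prod_insert hx, spinChar]
    rw [h2, mul_assoc, ih, hv.mul_spinChar, h1, symmDiff_assoc, symmDiff_assoc, symmDiff_comm B]

/-- Bessel's inequality for the correlations with the products of spins. -/
theorem IsSpinField.sum_norm_sq_integral_le (hv : IsSpinField P r v) {F : Ω → ℂ}
    (hF : Measurable F) {C : ℝ} (hC : ∀ ω, ‖F ω‖ ≤ C) (t : ℝ≥0)
    (𝒜 : Finset (Finset (CubicLattice d))) :
    ∑ A ∈ 𝒜, ‖∫ ω, F ω * spinChar v A t ω ∂P‖ ^ 2 ≤ C ^ 2 := by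
  have hχ : ∀ A, MemLp (spinChar v A t) 2 P := fun A =>
    MemLp.of_bound (hv.measurable_spinChar A t).aestronglyMeasurable 1
      (Eventually.of_forall fun ω => (hv.norm_spinChar A t ω).le)
  have hFm : MemLp F 2 P := MemLp.of_bound hF.aestronglyMeasurable C (Eventually.of_forall hC)
  have hconj : ∀ A ω, starRingEnd ℂ (spinChar v A t ω) = spinChar v A t ω := fun A ω => by
    rw [spinChar_eq, Complex.conj_ofReal]
  have hin : ∀ {G : Ω → ℂ} (hG : MemLp G 2 P) (A : Finset (CubicLattice d)),
      inner ℂ ((hχ A).toLp) (hG.toLp) = ∫ ω, G ω * spinChar v A t ω ∂P := fun hG A => by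
    rw [L2.inner_def]
    refine integral_congr_ae ?_
    filter_upwards [(hχ A).coeFn_toLp, hG.coeFn_toLp] with ω h1 h2
    rw [h1, h2, RCLike.inner_apply, hconj]
  have horth : Orthonormal ℂ fun A => (hχ A).toLp := by
    rw [orthonormal_iff_ite]
    intro A B
    rw [hin]
    simp only [hv.spinChar_mul_spinChar]
    rw [hv.integral_spinChar]
    have : symmDiff B A = ∅ ↔ A = B := by
      rw [← Finset.bot_eq_empty, symmDiff_eq_bot, eq_comm]
    simp only [this]
  have h := horth.sum_inner_products_le (s := 𝒜) hFm.toLp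
  simp only [hin] at h
  have hn : ‖hFm.toLp‖ ≤ C := by
    have hC0 : 0 ≤ C := by
      have : Nonempty Ω := by
        by_contra hne
        rw [not_nonempty_iff] at hne
        exact IsProbabilityMeasure.ne_zero P (Measure.eq_zero_of_isEmpty P)
      exact (norm_nonneg _).trans (hC this.some)
    refine (Lp.norm_le_of_ae_bound (C := C) hC0 ?_).trans ?_
    · filter_upwards [hFm.coeFn_toLp] with ω h1
      rw [h1]; exact hC ω
    · simp [measureUnivNNReal]
  exact h.trans (by gcongr)

end Bessel

/-! ### The evolution equation of the correlations. -/

section DensityMoment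

variable {d : ℕ} {Ω : Type*} [MeasurableSpace Ω]

/-- The correlations of the density matrix with the products of spins. -/
def densityMoment (P : Measure Ω) (v : Ω → ℝ≥0 → CubicLattice d → ℝ) (u : CubicLattice d → ℝ)
    (lam : ℝ) (ψ₀ : L2Lattice d) (t : ℝ) (x y : CubicLattice d) (A : Finset (CubicLattice d)) : ℂ :=
  ∫ ω, dysonSum (totalPotential u lam (v ω)) ψ₀ t.toNNReal x *
    starRingEnd ℂ (dysonSum (totalPotential u lam (v ω)) ψ₀ t.toNNReal y) *
      spinChar v A t.toNNReal ω ∂P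

/-- The Hamiltonian part of the evolution of the correlations. -/
def momentGen (u : CubicLattice d → ℝ) (lam : ℝ)
    (R : CubicLattice d → CubicLattice d → Finset (CubicLattice d) → ℂ)
    (x y : CubicLattice d) (A : Finset (CubicLattice d)) : ℂ :=
  -Complex.I * (∑ q : LatticeDir d, R (x + q.vec) y A + u x * R x y A +
      lam * R x y (symmDiff A {x})) +
    Complex.I * (∑ q : LatticeDir d, R x (y + q.vec) A + u y * R x y A +
      lam * R x y (symmDiff A {y}))

variable {P : Measure Ω} [IsProbabilityMeasure P] {r : ℝ}
  {v : Ω → ℝ≥0 → CubicLattice d → ℝ} {u : CubicLattice d → ℝ} {lam K : ℝ}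

theorem IsSpinField.measurable_dysonSum (hv : IsSpinField P r v) (hK : 0 ≤ K)
    (hu : ∀ x, |u x| + |lam| ≤ K) (ψ₀ : L2Lattice d) (x : CubicLattice d) :
    Measurable fun q : Ω × ℝ => dysonSum (totalPotential u lam (v q.1)) ψ₀ q.2.toNNReal x := by
  refine measurable_of_tendsto_metrizable (f := fun n (q : Ω × ℝ) => ∑ m ∈ Finset.range n,
    dyson (totalPotential u lam (v q.1)) ψ₀ m q.2.toNNReal x) (fun n => ?_) ?_
  · refine Finset.measurable_fun_sum _ fun m _ => ?_
    exact (measurable_dyson (V := fun ω => totalPotential u lam (v ω)) hv.measurable_potential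
      ψ₀ m x).comp (measurable_fst.prodMk (measurable_coe_nnreal_real.comp
        (measurable_real_toNNReal.comp measurable_snd)))
  · exact tendsto_pi_nhds.mpr fun q => (hasSum_dyson hK (hv.abs_potential_le hu q.1) ψ₀
      q.2.toNNReal.2 x).tendsto_sum_nat

theorem IsSpinField.norm_mul_conj_mul_le (hv : IsSpinField P r v) (hK : 0 ≤ K)
    (hu : ∀ x, |u x| + |lam| ≤ K) (ψ₀ : L2Lattice d) (t : ℝ≥0) (x y : CubicLattice d) (ω : Ω) :
    ‖dysonSum (totalPotential u lam (v ω)) ψ₀ t x *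
      starRingEnd ℂ (dysonSum (totalPotential u lam (v ω)) ψ₀ t y)‖ ≤
      majorant K ψ₀ t x * majorant K ψ₀ t y := by
  rw [norm_mul, RCLike.norm_conj]
  exact mul_le_mul (norm_dysonSum_le hK (hv.abs_potential_le hu ω) ψ₀ t.2 x)
    (norm_dysonSum_le hK (hv.abs_potential_le hu ω) ψ₀ t.2 y) (norm_nonneg _)
    (majorant_nonneg hK ψ₀ t.2 x)

theorem IsSpinField.measurable_mul_conj_mul (hv : IsSpinField P r v) (hK : 0 ≤ K)
    (hu : ∀ x, |u x| + |lam| ≤ K) (ψ₀ : L2Lattice d) (x y : CubicLattice d)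
    (A : Finset (CubicLattice d)) :
    Measurable fun q : Ω × ℝ => dysonSum (totalPotential u lam (v q.1)) ψ₀ q.2.toNNReal x *
      starRingEnd ℂ (dysonSum (totalPotential u lam (v q.1)) ψ₀ q.2.toNNReal y) *
        spinChar v A q.2.toNNReal q.1 :=
  ((hv.measurable_dysonSum hK hu ψ₀ x).mul (Complex.continuous_conj.measurable.comp
    (hv.measurable_dysonSum hK hu ψ₀ y))).mul (hv.measurable_spinChar_uncurry A)

theorem IsSpinField.integrable_mul_conj_mul (hv : IsSpinField P r v) (hK : 0 ≤ K)
    (hu : ∀ x, |u x| + |lam| ≤ K) (ψ₀ : L2Lattice d) (t : ℝ) (x y : CubicLattice d)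
    (A : Finset (CubicLattice d)) :
    Integrable (fun ω => dysonSum (totalPotential u lam (v ω)) ψ₀ t.toNNReal x *
      starRingEnd ℂ (dysonSum (totalPotential u lam (v ω)) ψ₀ t.toNNReal y) *
        spinChar v A t.toNNReal ω) P := by
  refine Integrable.of_bound ((hv.measurable_mul_conj_mul hK hu ψ₀ x y A).comp
    (measurable_id.prodMk (measurable_const (a := t)))).aestronglyMeasurable
    (majorant K ψ₀ t.toNNReal x * majorant K ψ₀ t.toNNReal y) (Eventually.of_forall fun ω => ?_)
  change ‖dysonSum (totalPotential u lam (v ω)) ψ₀ t.toNNReal x *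
    starRingEnd ℂ (dysonSum (totalPotential u lam (v ω)) ψ₀ t.toNNReal y) *
        spinChar v A t.toNNReal ω‖ ≤ _
  rw [norm_mul, hv.norm_spinChar, mul_one]
  exact hv.norm_mul_conj_mul_le hK hu ψ₀ _ x y ω

theorem IsSpinField.norm_densityMoment_le (hv : IsSpinField P r v) (hK : 0 ≤ K)
    (hu : ∀ x, |u x| + |lam| ≤ K) (ψ₀ : L2Lattice d) {t T : ℝ} (hT : 0 ≤ T) (htT : t ≤ T)
    (x y : CubicLattice d) (A : Finset (CubicLattice d)) :
    ‖densityMoment P v u lam ψ₀ t x y A‖ ≤ majorant K ψ₀ T x * majorant K ψ₀ T y := by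
  have h : ∀ ω, ‖dysonSum (totalPotential u lam (v ω)) ψ₀ t.toNNReal x *
      starRingEnd ℂ (dysonSum (totalPotential u lam (v ω)) ψ₀ t.toNNReal y) *
        spinChar v A t.toNNReal ω‖ ≤ majorant K ψ₀ T x * majorant K ψ₀ T y := fun ω => by
    have h0 : (t.toNNReal : ℝ) ≤ T := by rw [Real.coe_toNNReal']; exact max_le htT hT
    rw [norm_mul, hv.norm_spinChar, mul_one]
    refine (hv.norm_mul_conj_mul_le hK hu ψ₀ _ x y ω).trans ?_
    exact mul_le_mul (majorant_mono hK ψ₀ (NNReal.coe_nonneg _) h0 x)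
      (majorant_mono hK ψ₀ (NNReal.coe_nonneg _) h0 y)
      (majorant_nonneg hK ψ₀ (NNReal.coe_nonneg _) y) (majorant_nonneg hK ψ₀ hT x)
  refine (norm_integral_le_of_norm_le_const (Eventually.of_forall h)).trans ?_
  simp

/-- Bessel's inequality gives square summability in the spin set with the bound that already holds
for a single correlation. -/
theorem IsSpinField.sum_norm_sq_densityMoment_le (hv : IsSpinField P r v) (hK : 0 ≤ K)
    (hu : ∀ x, |u x| + |lam| ≤ K) (ψ₀ : L2Lattice d) {t T : ℝ} (hT : 0 ≤ T) (htT : t ≤ T)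
    (x y : CubicLattice d) (𝒜 : Finset (Finset (CubicLattice d))) :
    ∑ A ∈ 𝒜, ‖densityMoment P v u lam ψ₀ t x y A‖ ^ 2 ≤
      (majorant K ψ₀ T x * majorant K ψ₀ T y) ^ 2 := by
  refine hv.sum_norm_sq_integral_le ?_ (fun ω => ?_) _ 𝒜
  · exact ((hv.measurable_dysonSum hK hu ψ₀ x).mul (Complex.continuous_conj.measurable.comp
      (hv.measurable_dysonSum hK hu ψ₀ y))).comp (measurable_id.prodMk (measurable_const (a := t)))
  · have h0 : (t.toNNReal : ℝ) ≤ T := by rw [Real.coe_toNNReal']; exact max_le htT hT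
    refine (hv.norm_mul_conj_mul_le hK hu ψ₀ _ x y ω).trans ?_
    exact mul_le_mul (majorant_mono hK ψ₀ (NNReal.coe_nonneg _) h0 x)
      (majorant_mono hK ψ₀ (NNReal.coe_nonneg _) h0 y)
      (majorant_nonneg hK ψ₀ (NNReal.coe_nonneg _) y) (majorant_nonneg hK ψ₀ hT x)

theorem IsSpinField.measurable_densityMoment (hv : IsSpinField P r v) (hK : 0 ≤ K)
    (hu : ∀ x, |u x| + |lam| ≤ K) (ψ₀ : L2Lattice d) (x y : CubicLattice d)
    (A : Finset (CubicLattice d)) :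
    Measurable fun t => densityMoment P v u lam ψ₀ t x y A :=
  (StronglyMeasurable.integral_prod_left'
    (hv.measurable_mul_conj_mul hK hu ψ₀ x y A).stronglyMeasurable).measurable

theorem IsSpinField.densityMoment_zero (hv : IsSpinField P r v) (hK : 0 ≤ K)
    (hu : ∀ x, |u x| + |lam| ≤ K) (ψ₀ : L2Lattice d) (x y : CubicLattice d)
    (A : Finset (CubicLattice d)) :
    densityMoment P v u lam ψ₀ 0 x y A =
      if A = ∅ then ψ₀ x * starRingEnd ℂ (ψ₀ y) else 0 := by
  have h : ∀ ω x, dysonSum (totalPotential u lam (v ω)) ψ₀ ((0 : ℝ).toNNReal : ℝ) x = ψ₀ x := by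
    intro ω x
    rw [Real.toNNReal_zero, NNReal.coe_zero, dysonSum_eq hK (hv.abs_potential_le hu ω)
      (measurable_totalPotential (hv.measurable_time ω)) ψ₀ le_rfl]
    simp
  simp only [densityMoment, h]
  rw [integral_const_mul, hv.integral_spinChar]
  split_ifs <;> simp

/-- Duhamel's formula for the correlations. -/
theorem IsSpinField.densityMoment_eq (hv : IsSpinField P r v) (hK : 0 ≤ K)
    (hu : ∀ x, |u x| + |lam| ≤ K) (ψ₀ : L2Lattice d) {t : ℝ} (ht : 0 ≤ t) (x y : CubicLattice d)
    (A : Finset (CubicLattice d)) :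
    densityMoment P v u lam ψ₀ t x y A = Real.exp (-(2 * r * A.card * t)) *
      (densityMoment P v u lam ψ₀ 0 x y A + ∫ ρ in (0 : ℝ)..t, Real.exp (2 * r * A.card * ρ) *
        momentGen u lam (densityMoment P v u lam ψ₀ ρ) x y A) := by
  set ψ : Ω → ℝ → CubicLattice d → ℂ := fun ω ρ x =>
    dysonSum (totalPotential u lam (v ω)) ψ₀ ρ.toNNReal x with hψ
  set H : Ω → ℝ → CubicLattice d → ℂ := fun ω ρ x =>
    schrodingerOp (totalPotential u lam (v ω) ρ) (ψ ω ρ) x with hH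
  set g : Ω → ℝ → ℂ := fun ω ρ => -Complex.I * H ω ρ x * starRingEnd ℂ (ψ ω ρ y) +
    ψ ω ρ x * (Complex.I * starRingEnd ℂ (H ω ρ y)) with hg
  have hψm : ∀ x, Measurable fun q : Ω × ℝ => ψ q.1 q.2 x := fun x =>
    hv.measurable_dysonSum hK hu ψ₀ x
  have hHm : ∀ x, Measurable fun q : Ω × ℝ => H q.1 q.2 x := fun x =>
    measurable_schrodingerOp (V := fun ω => totalPotential u lam (v ω))
      (φ := fun q => ψ q.1 q.2) hv.measurable_potential hψm x
  have hcm := Complex.continuous_conj.measurable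
  have hgm : Measurable (Function.uncurry g) :=
    ((measurable_const.mul (hHm x)).mul (hcm.comp (hψm y))).add
      ((hψm x).mul (measurable_const.mul (hcm.comp (hHm y))))
  have hψb : ∀ ω, ∀ ρ ∈ Set.Icc 0 t, ∀ x, ‖ψ ω ρ x‖ ≤ majorant K ψ₀ t x := fun ω ρ hρ x =>
    (norm_dysonSum_le hK (hv.abs_potential_le hu ω) ψ₀ (NNReal.coe_nonneg _) x).trans
      (majorant_mono hK ψ₀ (NNReal.coe_nonneg _) (by rw [Real.coe_toNNReal _ hρ.1]; exact hρ.2) x)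
  have hHb : ∀ ω, ∀ ρ ∈ Set.Icc 0 t, ∀ x, ‖H ω ρ x‖ ≤ majorantOp d K (majorant K ψ₀ t) x :=
    fun ω ρ hρ x => by
      rw [majorantOp_apply]
      exact norm_schrodingerOp_le (hv.abs_potential_le hu ω ρ) (hψb ω ρ hρ) x
  have hgb : ∀ ω, ∀ ρ ∈ Set.Icc 0 t, ‖g ω ρ‖ ≤
      majorantOp d K (majorant K ψ₀ t) x * majorant K ψ₀ t y +
        majorant K ψ₀ t x * majorantOp d K (majorant K ψ₀ t) y := fun ω ρ hρ => by
    refine (norm_add_le _ _).trans ?_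
    simp only [norm_mul, norm_neg, Complex.norm_I, one_mul, RCLike.norm_conj]
    exact add_le_add (mul_le_mul (hHb ω ρ hρ x) (hψb ω ρ hρ y) (norm_nonneg _)
      ((norm_nonneg _).trans (hHb ω ρ hρ x))) (mul_le_mul (hψb ω ρ hρ x) (hHb ω ρ hρ y)
      (norm_nonneg _) ((norm_nonneg _).trans (hψb ω ρ hρ x)))
  have hF : ∀ ω, ψ ω t x * starRingEnd ℂ (ψ ω t y) = ψ₀ x * starRingEnd ℂ (ψ₀ y) +
      ∫ ρ in (0 : ℝ)..t, g ω ρ := fun ω => by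
    have h := dysonSum_mul_conj_eq hK (hv.abs_potential_le hu ω)
      (measurable_totalPotential (hv.measurable_time ω)) ψ₀ ht x y
    simp only [hψ, Real.coe_toNNReal t ht]
    rw [h]
    congr 1
    refine intervalIntegral.integral_congr fun ρ hρ => ?_
    rw [Set.uIcc_of_le ht] at hρ
    simp only [hg, hH, hψ, Real.coe_toNNReal ρ hρ.1]
  have hX : ∀ s : ℝ≥0, ∀ ω, ‖spinChar v A s ω‖ = 1 := fun s ω => hv.norm_spinChar A s ω
  -- The Markov property with the empty monomial.
  have hmark : ∀ {W : Ω → ℂ} {s : ℝ}, 0 ≤ s → s ≤ t → IsNonanticipating P r v s.toNNReal W →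
      ∫ ω, W ω * spinChar v A t.toNNReal ω ∂P = Real.exp (-(2 * r * A.card * (t - s))) *
        ∫ ω, W ω * spinChar v A s.toNNReal ω ∂P := fun {W s} hs hst hW => by
    have h := hW.markov [] A t.toNNReal (by simp) (Real.toNNReal_le_toNNReal hst)
    simp only [spinMonomial, List.map_nil, List.prod_nil, one_mul] at h
    rwa [Real.coe_toNNReal t ht, Real.coe_toNNReal s hs] at h
  -- The rate of change at time `ρ` involves the wave function and the spins at times up to `ρ`
  -- only.
  have hna : ∀ ρ, 0 ≤ ρ → IsNonanticipating P r v ρ.toNNReal fun ω => g ω ρ := fun ρ hρ => by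
    have hρ' : (ρ.toNNReal : ℝ) ∈ Set.Icc (0 : ℝ) ρ.toNNReal := ⟨NNReal.coe_nonneg _, le_rfl⟩
    have h1 : ∀ {Z : Ω → ℂ}, IsNonanticipating P r v ρ.toNNReal Z → ∀ x,
        IsNonanticipating P r v ρ.toNNReal fun ω => ψ ω ρ x * Z ω := fun hZ x =>
      hZ.dysonSum_mul hv hK hu ψ₀ hρ' x
    have h2 : ∀ {Z : Ω → ℂ}, IsNonanticipating P r v ρ.toNNReal Z → ∀ x,
        IsNonanticipating P r v ρ.toNNReal fun ω => H ω ρ x * Z ω := fun hZ x =>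
      IsNonanticipating.schrodingerOp_mul hv le_rfl (h1 hZ) x
    have h0 := IsNonanticipating.const hv ρ.toNNReal (1 : ℂ)
    have h3 : ∀ x, IsNonanticipating P r v ρ.toNNReal fun ω => starRingEnd ℂ (ψ ω ρ x) :=
      fun x => by simpa using (h1 h0 x).conj
    have h4 : ∀ x, IsNonanticipating P r v ρ.toNNReal fun ω => starRingEnd ℂ (H ω ρ x) :=
      fun x => by simpa using (h2 h0 x).conj
    have h5 := ((h2 (h3 y) x).const_mul (-Complex.I)).add hv (h1 ((h4 y).const_mul Complex.I) x)
    simpa only [hg, mul_assoc] using h5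
  -- At equal times, multiplication by the spin at `x` turns the product over `A` into that over the
  -- symmetric difference with `{x}`; so the equations close.
  have hgen : ∀ ρ, 0 ≤ ρ → ∫ ω, g ω ρ * spinChar v A ρ.toNNReal ω ∂P =
      momentGen u lam (densityMoment P v u lam ψ₀ ρ) x y A := fun ρ hρ => by
    set F : CubicLattice d → CubicLattice d → Finset (CubicLattice d) → Ω → ℂ := fun x y A ω =>
      ψ ω ρ x * starRingEnd ℂ (ψ ω ρ y) * spinChar v A ρ.toNNReal ω with hFdef
    have hFi : ∀ x y A, Integrable (F x y A) P := fun x y A =>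
      hv.integrable_mul_conj_mul hK hu ψ₀ ρ x y A
    have e : (fun ω => g ω ρ * spinChar v A ρ.toNNReal ω) = fun ω =>
        -Complex.I * (∑ q : LatticeDir d, F (x + q.vec) y A ω + u x * F x y A ω +
          lam * F x y (symmDiff A {x}) ω) +
        Complex.I * (∑ q : LatticeDir d, F x (y + q.vec) A ω + u y * F x y A ω +
          lam * F x y (symmDiff A {y}) ω) := by
      ext ω
      simp only [hg, hH, hFdef, ← hv.mul_spinChar, schrodingerOp_eq, totalPotential, map_add,
        map_mul, map_sum, Complex.conj_ofReal, ← Finset.sum_mul, ← Finset.mul_sum]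
      push_cast
      ring
    rw [e]
    have hs : ∀ f : LatticeDir d → Ω → ℂ, (∀ q, Integrable (f q) P) →
        Integrable (fun ω => ∑ q, f q ω) P := fun f hf => integrable_finsetSum _ fun q _ => hf q
    have i1 := hs _ fun q => hFi (x + q.vec) y A
    have i2 := hs _ fun q => hFi x (y + q.vec) A
    have j1 := (hFi x y A).const_mul (u x : ℂ)
    have j2 := (hFi x y A).const_mul (u y : ℂ)
    have k1 := (hFi x y (symmDiff A {x})).const_mul (lam : ℂ)
    have k2 := (hFi x y (symmDiff A {y})).const_mul (lam : ℂ)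
    have l1 : Integrable (fun ω => ∑ q : LatticeDir d, F (x + q.vec) y A ω + u x * F x y A ω) P :=
      i1.add j1
    have l2 : Integrable (fun ω => ∑ q : LatticeDir d, F x (y + q.vec) A ω + u y * F x y A ω) P :=
      i2.add j2
    have m1 : Integrable (fun ω => -Complex.I * (∑ q : LatticeDir d, F (x + q.vec) y A ω +
        u x * F x y A ω + lam * F x y (symmDiff A {x}) ω)) P := (l1.add k1).const_mul _
    have m2 : Integrable (fun ω => Complex.I * (∑ q : LatticeDir d, F x (y + q.vec) A ω +
        u y * F x y A ω + lam * F x y (symmDiff A {y}) ω)) P := (l2.add k2).const_mul _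
    rw [integral_add m1 m2, integral_const_mul, integral_const_mul, integral_add l1 k1,
      integral_add l2 k2, integral_add i1 j1, integral_add i2 j2,
      integral_const_mul, integral_const_mul, integral_const_mul, integral_const_mul,
      integral_finsetSum _ fun q _ => hFi _ _ _, integral_finsetSum _ fun q _ => hFi _ _ _]
    rfl
  -- Only the density matrix is written as an integral; the spin product stays at the final time and
  -- is brought back to `ρ` by the Markov property, so its jumps are never differentiated.
  have hR : densityMoment P v u lam ψ₀ t x y A =
      ∫ ω, (ψ₀ x * starRingEnd ℂ (ψ₀ y) + ∫ ρ in (0 : ℝ)..t, g ω ρ) *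
        spinChar v A t.toNNReal ω ∂P := by
    simp only [← hF]; rfl
  have hi0 : Integrable (fun ω => ψ₀ x * starRingEnd ℂ (ψ₀ y) * spinChar v A t.toNNReal ω) P :=
    Integrable.of_bound ((hv.measurable_spinChar A _).const_mul _).aestronglyMeasurable
      ‖ψ₀ x * starRingEnd ℂ (ψ₀ y)‖ (Eventually.of_forall fun ω => by
        rw [norm_mul, hX, mul_one])
  have hi1 : Integrable (fun ω => (∫ ρ in (0 : ℝ)..t, g ω ρ) * spinChar v A t.toNNReal ω) P := by
    have := (hv.integrable_mul_conj_mul hK hu ψ₀ t x y A).sub hi0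
    refine this.congr (Eventually.of_forall fun ω => ?_)
    have h := hF ω
    simp only [hψ] at h
    simp only [Pi.sub_apply, h]
    ring
  rw [hR]
  simp only [add_mul]
  rw [integral_add hi0 hi1, IsNonanticipating.integral_swap hv ht hgm
    (fun ω ρ hρ => hgb ω ρ ⟨hρ.1.le, hρ.2⟩) (hv.measurable_spinChar A _) (hX _), mul_add]
  congr 1
  · rw [hmark le_rfl ht (IsNonanticipating.const hv _ _), sub_zero, hv.densityMoment_zero hK hu,
      integral_const_mul, hv.integral_spinChar]
    split_ifs <;> simp
  · rw [← intervalIntegral.integral_const_mul]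
    refine intervalIntegral.integral_congr fun ρ hρ => ?_
    rw [Set.uIcc_of_le ht] at hρ
    beta_reduce
    rw [hmark hρ.1 hρ.2 (hna ρ hρ.1), hgen ρ hρ.1, ← mul_assoc, ← Complex.ofReal_mul,
      ← Real.exp_add]
    congr 3
    ring

theorem IsSpinField.norm_momentGen_le (hv : IsSpinField P r v) (hK : 0 ≤ K)
    (hu : ∀ x, |u x| + |lam| ≤ K) (ψ₀ : L2Lattice d) {t T : ℝ} (hT : 0 ≤ T) (htT : t ≤ T)
    (x y : CubicLattice d) (A : Finset (CubicLattice d)) :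
    ‖momentGen u lam (densityMoment P v u lam ψ₀ t) x y A‖ ≤
      majorantOp d K (majorant K ψ₀ T) x * majorant K ψ₀ T y +
        majorant K ψ₀ T x * majorantOp d K (majorant K ψ₀ T) y := by
  have hb := hv.norm_densityMoment_le hK hu ψ₀ (P := P) hT htT
  have hg := fun x => majorant_nonneg hK ψ₀ hT x
  have key : ∀ (x' : CubicLattice d) (S c e : ℂ) (M m : ℝ), ‖S‖ ≤ M → 0 ≤ m → ‖c‖ ≤ m → ‖e‖ ≤ m →
      ‖S + u x' * c + lam * e‖ ≤ M + K * m := fun x' S c e M m h1 h0 h2 h3 => by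
    refine (norm_add₃_le).trans ?_
    rw [norm_mul, norm_mul, Complex.norm_real, Complex.norm_real, Real.norm_eq_abs,
      Real.norm_eq_abs]
    have e1 := mul_le_mul_of_nonneg_left h2 (abs_nonneg (u x'))
    have e2 := mul_le_mul_of_nonneg_left h3 (abs_nonneg lam)
    have e3 := mul_le_mul_of_nonneg_right (hu x') h0
    linarith
  rw [momentGen]
  refine (norm_add_le _ _).trans ?_
  rw [norm_mul, norm_mul, norm_neg, Complex.norm_I, one_mul, one_mul]
  refine add_le_add ((key x _ _ _ (∑ q : LatticeDir d, majorant K ψ₀ T (x + q.vec) *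
      majorant K ψ₀ T y) _ ((norm_sum_le _ _).trans (Finset.sum_le_sum fun q _ => hb _ _ _))
      (mul_nonneg (hg x) (hg y)) (hb _ _ _) (hb _ _ _)).trans_eq ?_)
    ((key y _ _ _ (∑ q : LatticeDir d, majorant K ψ₀ T x *
      majorant K ψ₀ T (y + q.vec)) _ ((norm_sum_le _ _).trans (Finset.sum_le_sum fun q _ =>
      hb _ _ _)) (mul_nonneg (hg x) (hg y)) (hb _ _ _) (hb _ _ _)).trans_eq ?_)
  · rw [majorantOp_apply, ← Finset.sum_mul]; ring
  · rw [majorantOp_apply, ← Finset.mul_sum]; ring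

theorem momentGen_continuous {R : ℝ → CubicLattice d → CubicLattice d →
      Finset (CubicLattice d) → ℂ}
    (h : ∀ x y A, Continuous fun t => R t x y A) (x y : CubicLattice d)
    (A : Finset (CubicLattice d)) : Continuous fun t => momentGen u lam (R t) x y A := by
  simp only [momentGen]
  have h1 := continuous_finsetSum Finset.univ fun (q : LatticeDir d) _ => h (x + q.vec) y A
  have h2 := continuous_finsetSum Finset.univ fun (q : LatticeDir d) _ => h x (y + q.vec) A
  exact (continuous_const.mul ((h1.add (continuous_const.mul (h x y A))).add
    (continuous_const.mul (h x y _)))).add (continuous_const.mul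
      ((h2.add (continuous_const.mul (h x y A))).add (continuous_const.mul (h x y _))))

/-- At first the correlations are only known to be measurable and locally bounded in time; Duhamel's
formula upgrades this to continuity, and then to differentiability. -/
theorem IsSpinField.continuous_densityMoment (hv : IsSpinField P r v) (hK : 0 ≤ K)
    (hu : ∀ x, |u x| + |lam| ≤ K) (ψ₀ : L2Lattice d) (x y : CubicLattice d)
    (A : Finset (CubicLattice d)) : Continuous fun t => densityMoment P v u lam ψ₀ t x y A := by
  have hi : ∀ a b, IntervalIntegrable (fun ρ => Real.exp (2 * r * A.card * ρ) *
      momentGen u lam (densityMoment P v u lam ψ₀ ρ) x y A) volume a b := fun a b => by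
    refine IntervalIntegrable.continuousOn_mul ?_
      (by fun_prop : Continuous fun ρ : ℝ => (Real.exp (2 * r * A.card * ρ) : ℂ)).continuousOn
    have hm : Measurable fun ρ => momentGen u lam (densityMoment P v u lam ψ₀ ρ) x y A := by
      have h := hv.measurable_densityMoment hK hu ψ₀
      simp only [momentGen]
      have h1 := Finset.measurable_fun_sum Finset.univ fun (q : LatticeDir d) _ => h (x + q.vec) y A
      have h2 := Finset.measurable_fun_sum Finset.univ fun (q : LatticeDir d) _ => h x (y + q.vec) A
      exact (measurable_const.mul ((h1.add (measurable_const.mul (h x y A))).add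
        (measurable_const.mul (h x y _)))).add (measurable_const.mul
          ((h2.add (measurable_const.mul (h x y A))).add (measurable_const.mul (h x y _))))
    refine (intervalIntegrable_const (c := majorantOp d K (majorant K ψ₀ (max (max a b) 0)) x *
      majorant K ψ₀ (max (max a b) 0) y + majorant K ψ₀ (max (max a b) 0) x *
        majorantOp d K (majorant K ψ₀ (max (max a b) 0)) y)).mono_fun
      hm.aestronglyMeasurable ?_
    refine (ae_restrict_mem measurableSet_uIoc).mono fun ρ hρ => ?_
    exact (hv.norm_momentGen_le hK hu ψ₀ (le_max_right _ 0) (hρ.2.trans (le_max_left _ 0))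
      x y A).trans (le_abs_self _)
  have h1 : Continuous fun t : ℝ => (Real.exp (-(2 * r * A.card * t)) : ℂ) *
      (densityMoment P v u lam ψ₀ 0 x y A + ∫ ρ in (0 : ℝ)..t, Real.exp (2 * r * A.card * ρ) *
        momentGen u lam (densityMoment P v u lam ψ₀ ρ) x y A) :=
    (by fun_prop : Continuous fun t : ℝ => (Real.exp (-(2 * r * A.card * t)) : ℂ)).mul
      (continuous_const.add (intervalIntegral.continuous_primitive hi 0))
  -- The correlations depend on time through its nonnegative part, so the formula for nonnegative
  -- times covers all of `ℝ`.
  have h2 := h1.comp (NNReal.continuous_coe.comp continuous_real_toNNReal)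
  refine h2.congr fun t => ?_
  simp only [Function.comp_apply]
  rw [← hv.densityMoment_eq hK hu ψ₀ (NNReal.coe_nonneg _) x y A]
  simp only [densityMoment, Real.toNNReal_coe]

theorem IsSpinField.hasDerivAt_densityMoment (hv : IsSpinField P r v) (hK : 0 ≤ K)
    (hu : ∀ x, |u x| + |lam| ≤ K) (ψ₀ : L2Lattice d) {t : ℝ} (ht : 0 < t) (x y : CubicLattice d)
    (A : Finset (CubicLattice d)) :
    HasDerivAt (fun t => densityMoment P v u lam ψ₀ t x y A)
      (momentGen u lam (densityMoment P v u lam ψ₀ t) x y A -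
        2 * r * A.card * densityMoment P v u lam ψ₀ t x y A) t := by
  have hc : Continuous fun ρ : ℝ => (Real.exp (2 * r * A.card * ρ) : ℂ) *
      momentGen u lam (densityMoment P v u lam ψ₀ ρ) x y A :=
    (by fun_prop : Continuous fun ρ : ℝ => (Real.exp (2 * r * A.card * ρ) : ℂ)).mul
      (momentGen_continuous (hv.continuous_densityMoment hK hu ψ₀) x y A)
  have h1 := (hc.integral_hasStrictDerivAt 0 t).hasDerivAt.const_add
    (densityMoment P v u lam ψ₀ 0 x y A)
  have h2 : HasDerivAt (fun t : ℝ => (Real.exp (-(2 * r * A.card * t)) : ℂ))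
      ((Real.exp (-(2 * r * A.card * t)) * -(2 * r * A.card) : ℝ) : ℂ) t := by
    refine HasDerivAt.ofReal_comp ?_
    have h3 : HasDerivAt (fun t : ℝ => -(2 * r * A.card * t)) (-(2 * r * A.card)) t := by
      have := (hasDerivAt_id t).const_mul (-(2 * r * A.card))
      simpa only [id, neg_mul, mul_one] using this
    exact h3.exp
  have h4 := h2.mul h1
  refine (h4.congr_of_eventuallyEq ?_).congr_deriv ?_
  · filter_upwards [eventually_gt_nhds ht] with s hs
    exact hv.densityMoment_eq hK hu ψ₀ hs.le x y A
  · have e := hv.densityMoment_eq hK hu ψ₀ ht.le x y A (P := P)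
    have e2 : (Real.exp (-(2 * r * A.card * t)) : ℂ) * Real.exp (2 * r * A.card * t) = 1 := by
      rw [← Complex.ofReal_mul, ← Real.exp_add, neg_add_cancel, Real.exp_zero, Complex.ofReal_one]
    rw [← mul_assoc, e2, one_mul]
    rw [e]
    push_cast
    ring

end DensityMoment

/-! ### Bloch sums over the lattice. -/

section FiberSum

variable {d : ℕ}

theorem summable_pi_prod_of_nonneg {a : ℤ → ℝ} (ha : Summable a) (h0 : ∀ n, 0 ≤ a n) (d : ℕ) :
    Summable fun z : Fin d → ℤ => ∏ j, a (z j) := by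
  induction d with
  | zero => exact Summable.of_finite
  | succ n ih =>
    rw [← (Fin.consEquiv fun _ : Fin (n + 1) => ℤ).summable_iff]
    have h := ha.mul_of_nonneg ih h0 fun z => Finset.prod_nonneg fun j _ => h0 (z j)
    refine h.congr fun q => ?_
    simp [Fin.consEquiv, Fin.prod_univ_succ]

theorem summable_expWeight {η : ℝ} (hη : 0 < η) :
    Summable fun z : CubicLattice d => expWeight η z := by
  have h1 : Summable fun n : ℕ => Real.exp (-(η * n)) := by
    have := summable_geometric_of_lt_one (Real.exp_pos (-η)).le (Real.exp_lt_one_iff.mpr (by linarith))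
    refine this.congr fun n => ?_
    rw [← Real.exp_nat_mul]
    congr 1
    ring
  have h2 : Summable fun n : ℤ => Real.exp (-(η * |(n : ℝ)|)) := by
    refine Summable.of_nat_of_neg ?_ ?_ <;> simpa using h1
  refine (summable_pi_prod_of_nonneg h2 (fun n => (Real.exp_pos _).le) d).congr fun z => ?_
  rw [← Real.exp_sum, expWeight, latticeLen, Finset.mul_sum, Finset.sum_neg_distrib]

/-- The phase factor of momentum `k`. -/
def latticePhase (k : Fin d → ℝ) (x : CubicLattice d) : ℂ :=
  Complex.exp (Complex.I * ((∑ j, k j * x j : ℝ) : ℂ))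

theorem norm_latticePhase (k : Fin d → ℝ) (x : CubicLattice d) : ‖latticePhase k x‖ = 1 := by
  rw [latticePhase, mul_comm, Complex.norm_exp_ofReal_mul_I]

@[simp]
theorem latticePhase_zero (x : CubicLattice d) : latticePhase 0 x = 1 := by
  simp [latticePhase]

theorem latticePhase_add_vec (k : Fin d → ℝ) (x : CubicLattice d) (q : LatticeDir d) :
    latticePhase k (x + q.vec) =
      Complex.exp (Complex.I * (LatticeDir.comp k q : ℝ)) * latticePhase k x := by
  rw [latticePhase, latticePhase, LatticeDir.comp_eq_sum, ← Complex.exp_add]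
  congr 1
  simp only [Pi.add_apply, Int.cast_add, mul_add, Finset.sum_add_distrib]
  push_cast
  ring

theorem conj_latticePhase (k : Fin d → ℝ) (x : CubicLattice d) :
    starRingEnd ℂ (latticePhase k x) = latticePhase (-k) x := by
  rw [latticePhase, latticePhase, ← Complex.exp_conj, map_mul, Complex.conj_I, Complex.conj_ofReal]
  simp

/-- Functions of two lattice points and a finite set of sites. -/
abbrev LatticeKernel (d : ℕ) : Type :=
  CubicLattice d → CubicLattice d → Finset (CubicLattice d) → ℂ

/-- Multiplication by the phase factor of the first point. -/
def LatticeKernel.twist (k : Fin d → ℝ) (T : LatticeKernel d) : LatticeKernel d :=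
  fun x y A => latticePhase k x * T x y A

theorem LatticeKernel.norm_twist (k : Fin d → ℝ) (T : LatticeKernel d) (x y : CubicLattice d)
    (A : Finset (CubicLattice d)) : ‖T.twist k x y A‖ = ‖T x y A‖ := by
  rw [twist, norm_mul, norm_latticePhase, one_mul]

variable (p : Fin d → ℕ)

open Classical in
/-- The summands of the fiber components of a kernel. -/
def fiberTerm (T : LatticeKernel d) (i : FiberIndex p) (x : CubicLattice d) : ℂ :=
  if cellOf p x = i.1 then T x (x + i.2.1) (shiftFinset x i.2.2) else 0

/-- The fiber components of a kernel. -/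
def fiberSum (T : LatticeKernel d) (i : FiberIndex p) : ℂ := ∑' x, fiberTerm p T i x

variable {p}

theorem norm_fiberTerm_le {T : LatticeKernel d} {i : FiberIndex p} {x : CubicLattice d} {M : ℝ}
    (h : ‖T x (x + i.2.1) (shiftFinset x i.2.2)‖ ≤ M) : ‖fiberTerm p T i x‖ ≤ M := by
  unfold fiberTerm
  split_ifs
  · exact h
  · rw [norm_zero]; exact (norm_nonneg _).trans h

/-- A kernel that is dominated by a product of square summable functions. -/
def LatticeKernel.IsDominated (T : LatticeKernel d) (g g' : Ell2 ℝ (CubicLattice d)) : Prop :=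
  ∀ x y A, ‖T x y A‖ ≤ ‖g x‖ * ‖g' y‖

theorem LatticeKernel.IsDominated.twist {T : LatticeKernel d} {g g' : Ell2 ℝ (CubicLattice d)}
    (h : T.IsDominated g g') (k : Fin d → ℝ) : (T.twist k).IsDominated g g' := fun x y A => by
  rw [norm_twist]; exact h x y A

theorem LatticeKernel.IsDominated.hasSum {T : LatticeKernel d} {g g' : Ell2 ℝ (CubicLattice d)}
    (h : T.IsDominated g g') (i : FiberIndex p) : HasSum (fiberTerm p T i) (fiberSum p T i) :=
  (Summable.of_norm_bounded (g.summable_mul_comp g' (Equiv.addRight i.2.1)) fun x =>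
    norm_fiberTerm_le (h _ _ _)).hasSum

/-- A hop of the first point becomes a shift of all three index components, compensated by a phase
and by evaluation at `x + q.vec`; a hop of the second point shifts the relative position only. The
sites `x` and `y` become `0` and `z`, and the potential is a function of the residue class. -/
theorem fiberTerm_twist_momentGen {U : PeriodCell p → ℝ} {u : CubicLattice d → ℝ}
    (hU : ∀ x, u x = U (cellOf p x)) (lam : ℝ) (T : LatticeKernel d) (k : Fin d → ℝ)
    (i : FiberIndex p) (x : CubicLattice d) :
    fiberTerm p (LatticeKernel.twist k (momentGen u lam T)) i x =
      -Complex.I * (∑ q : LatticeDir d, Complex.exp (-(Complex.I * (LatticeDir.comp k q : ℝ))) *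
          fiberTerm p (T.twist k) (i.1 + cellOf p q.vec, i.2.1 - q.vec, shiftFinset (-q.vec) i.2.2)
            (x + q.vec) +
        U i.1 * fiberTerm p (T.twist k) i x +
        lam * fiberTerm p (T.twist k) (i.1, i.2.1, symmDiff i.2.2 {0}) x) +
      Complex.I * (∑ q : LatticeDir d, fiberTerm p (T.twist k) (i.1, i.2.1 + q.vec, i.2.2) x +
        U (i.1 + cellOf p i.2.1) * fiberTerm p (T.twist k) i x +
        lam * fiberTerm p (T.twist k) (i.1, i.2.1, symmDiff i.2.2 {i.2.1}) x) := by
  have hshift : ∀ q : LatticeDir d, shiftFinset (x + q.vec) (shiftFinset (-q.vec) i.2.2) =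
      shiftFinset x i.2.2 := fun q => by rw [shiftFinset_shiftFinset, add_neg_cancel_right]
  have hphase : ∀ q : LatticeDir d, Complex.exp (-(Complex.I * (LatticeDir.comp k q : ℝ))) *
      latticePhase k (x + q.vec) = latticePhase k x := fun q => by
    rw [latticePhase_add_vec, ← mul_assoc, ← Complex.exp_add, neg_add_cancel, Complex.exp_zero,
      one_mul]
  have hadd : ∀ q : LatticeDir d, x + q.vec + (i.2.1 - q.vec) = x + i.2.1 := fun q => by abel
  have hcell : ∀ q : LatticeDir d, cellOf p (x + q.vec) = i.1 + cellOf p q.vec ↔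
      cellOf p x = i.1 := fun q => by rw [cellOf_add, add_left_inj]
  have hx : ∀ q : LatticeDir d, Complex.exp (-(Complex.I * (LatticeDir.comp k q : ℝ))) *
      fiberTerm p (T.twist k) (i.1 + cellOf p q.vec, i.2.1 - q.vec, shiftFinset (-q.vec) i.2.2)
        (x + q.vec) = if cellOf p x = i.1 then
          latticePhase k x * T (x + q.vec) (x + i.2.1) (shiftFinset x i.2.2) else 0 := fun q => by
    rw [fiberTerm]
    simp only [hcell, LatticeKernel.twist, hshift, hadd]
    split_ifs
    · rw [← mul_assoc, hphase]
    · rw [mul_zero]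
  simp only [hx]
  simp only [fiberTerm]
  by_cases hc : cellOf p x = i.1
  · have hux : U i.1 = u x := by rw [hU, hc]
    have huy : U (i.1 + cellOf p i.2.1) = u (x + i.2.1) := by rw [hU, cellOf_add, hc]
    simp only [if_pos hc, LatticeKernel.twist, hux, huy, momentGen, shiftFinset_symmDiff, zero_add,
      add_comm i.2.1 x, ← add_assoc, ← Finset.mul_sum]
    ring
  · simp only [if_neg hc, Finset.sum_const_zero, mul_zero, add_zero]

/-- Summation over all `x` makes the shift by `q.vec` invisible, so the generator acts on the Bloch
sums of one momentum alone. -/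
theorem fiberSum_twist_momentGen {U : PeriodCell p → ℝ} {u : CubicLattice d → ℝ}
    (hU : ∀ x, u x = U (cellOf p x)) (lam : ℝ) {T : LatticeKernel d}
    {g g' : Ell2 ℝ (CubicLattice d)} (h : T.IsDominated g g') (k : Fin d → ℝ) (i : FiberIndex p) :
    HasSum (fiberTerm p (LatticeKernel.twist k (momentGen u lam T)) i)
      (-Complex.I * (∑ q : LatticeDir d, Complex.exp (-(Complex.I * (LatticeDir.comp k q : ℝ))) *
          fiberSum p (T.twist k) (i.1 + cellOf p q.vec, i.2.1 - q.vec, shiftFinset (-q.vec) i.2.2) +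
        U i.1 * fiberSum p (T.twist k) i +
        lam * fiberSum p (T.twist k) (i.1, i.2.1, symmDiff i.2.2 {0})) +
      Complex.I * (∑ q : LatticeDir d, fiberSum p (T.twist k) (i.1, i.2.1 + q.vec, i.2.2) +
        U (i.1 + cellOf p i.2.1) * fiberSum p (T.twist k) i +
        lam * fiberSum p (T.twist k) (i.1, i.2.1, symmDiff i.2.2 {i.2.1}))) := by
  have hs : ∀ i, HasSum (fiberTerm p (T.twist k) i) (fiberSum p (T.twist k) i) :=
    fun i => (h.twist k).hasSum i
  have ht := fun x => fiberTerm_twist_momentGen hU lam T k i x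
  generalize fiberTerm p (LatticeKernel.twist k (momentGen u lam T)) i = F at ht ⊢
  generalize fiberTerm p (T.twist k) = S at ht hs
  generalize fiberSum p (T.twist k) = J at hs ⊢
  have hx : ∀ (q : LatticeDir d) (j : FiberIndex p), HasSum (fun x => S j (x + q.vec)) (J j) :=
    fun q j => (Equiv.addRight q.vec).hasSum_iff.mpr (hs j)
  have h1 : HasSum (fun x => ∑ q : LatticeDir d,
      Complex.exp (-(Complex.I * (LatticeDir.comp k q : ℝ))) *
        S (i.1 + cellOf p q.vec, i.2.1 - q.vec, shiftFinset (-q.vec) i.2.2) (x + q.vec))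
      (∑ q : LatticeDir d, Complex.exp (-(Complex.I * (LatticeDir.comp k q : ℝ))) *
        J (i.1 + cellOf p q.vec, i.2.1 - q.vec, shiftFinset (-q.vec) i.2.2)) :=
    hasSum_sum fun q _ => (hx q _).mul_left _
  have h2 : HasSum (fun x => ∑ q : LatticeDir d, S (i.1, i.2.1 + q.vec, i.2.2) x)
      (∑ q : LatticeDir d, J (i.1, i.2.1 + q.vec, i.2.2)) := hasSum_sum fun q _ => hs _
  rw [funext ht]
  exact (((h1.add ((hs i).mul_left _)).add ((hs _).mul_left _)).mul_left _).add
    (((h2.add ((hs i).mul_left _)).add ((hs _).mul_left _)).mul_left _)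

theorem fiberSum_twist_sub {T : LatticeKernel d} {g g' h h' : Ell2 ℝ (CubicLattice d)}
    {T' : LatticeKernel d} (hT : T.IsDominated g g') (hT' : T'.IsDominated h h') (i : FiberIndex p) :
    fiberSum p (fun x y A => T x y A - T' x y A) i = fiberSum p T i - fiberSum p T' i := by
  refine HasSum.tsum_eq ?_
  convert! (hT.hasSum (p := p) i).sub (hT'.hasSum (p := p) i) using 1
  ext x
  unfold fiberTerm
  split_ifs <;> simp

/-- Square summability of the weighted fiber components. -/
theorem exists_fiberVector {η : ℝ} (hη : 0 < η) {T : LatticeKernel d}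
    {g g' : Ell2 ℝ (CubicLattice d)}
    (h : ∀ x y (𝒜 : Finset (Finset (CubicLattice d))),
      ∑ A ∈ 𝒜, ‖T x y A‖ ^ 2 ≤ (‖g x‖ * ‖g' y‖) ^ 2) :
    ∃ f : Ell2 ℂ (FiberIndex p), (∀ i, f i = expWeight η i.2.1 * fiberSum p T i) ∧
      ‖f‖ ≤ (∑' z : CubicLattice d, expWeight η z) * (‖g‖ * ‖g'‖) := by
  classical
  -- The vector is a sum of pieces indexed by `x` and the relative position `z`. Each piece lives on
  -- one residue class and one `z`, so its norm is a sum over spin sets, bounded by hypothesis. The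
  -- bounds `B` are summable by Cauchy–Schwarz in `x` and by the weight in `z`.
  set B : CubicLattice d × CubicLattice d → ℝ := fun q =>
    expWeight η q.2 * (‖g q.1‖ * ‖g' (q.1 + q.2)‖) with hB
  set F : CubicLattice d × CubicLattice d → FiberIndex p → ℂ := fun q i =>
    if cellOf p q.1 = i.1 ∧ q.2 = i.2.1 then
      expWeight η q.2 * T q.1 (q.1 + q.2) (shiftFinset q.1 i.2.2) else 0 with hF
  have hB0 : ∀ q, 0 ≤ B q := fun q => mul_nonneg (expWeight_pos _ _).le (by positivity)
  have hle : ∀ q (s : Finset (FiberIndex p)), ∑ i ∈ s, ‖F q i‖ ^ 2 ≤ B q ^ 2 := fun q s => by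
    have e1 : ∀ i, ‖F q i‖ ^ 2 = if cellOf p q.1 = i.1 ∧ q.2 = i.2.1 then
        expWeight η q.2 ^ 2 * ‖T q.1 (q.1 + q.2) (shiftFinset q.1 i.2.2)‖ ^ 2 else 0 := fun i => by
      simp only [hF]
      split_ifs
      · rw [norm_mul, Complex.norm_real, mul_pow, Real.norm_eq_abs, sq_abs]
      · simp
    simp only [e1]
    rw [← Finset.sum_filter, ← Finset.mul_sum, hB, mul_pow]
    refine mul_le_mul_of_nonneg_left ?_ (sq_nonneg _)
    set s' := s.filter fun i => cellOf p q.1 = i.1 ∧ q.2 = i.2.1 with hs'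
    have hinj : Set.InjOn (fun i : FiberIndex p => shiftFinset q.1 i.2.2) s' := by
      rintro ⟨a, z, A⟩ hi ⟨a', z', A'⟩ hi' hA
      simp only [hs', Finset.coe_filter, Set.mem_ofPred_eq] at hi hi'
      obtain ⟨-, rfl, rfl⟩ := hi
      obtain ⟨-, rfl, rfl⟩ := hi'
      have := (shiftFinset q.1).injective hA
      simp only at this
      rw [this]
    have h1 := h q.1 (q.1 + q.2) (s'.image fun i : FiberIndex p => shiftFinset q.1 i.2.2)
    rwa [Finset.sum_image hinj] at h1
  have hmem : ∀ q, Memℓp (F q) 2 := fun q =>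
    memℓp_two_iff.mpr (summable_of_sum_le (fun i => by positivity) (hle q))
  set f : CubicLattice d × CubicLattice d → Ell2 ℂ (FiberIndex p) := fun q => ⟨F q, hmem q⟩ with hf
  have hfn : ∀ q, ‖f q‖ ≤ B q := fun q => by
    refine le_of_sq_le_sq ?_ (hB0 q)
    rw [Ell2.norm_sq_eq]
    exact Real.tsum_le_of_sum_le (fun i => by positivity) (hle q)
  have hg : ∀ z : CubicLattice d, Summable fun x => ‖g x‖ * ‖g' (x + z)‖ := fun z =>
    g.summable_mul_comp g' (Equiv.addRight z)
  have hgle : ∀ z : CubicLattice d, ∑' x, ‖g x‖ * ‖g' (x + z)‖ ≤ ‖g‖ * ‖g'‖ := fun z => by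
    have h1 := Ell2.tsum_mul_le g (wcomp (fun _ => (1 : ℝ)) ⟨1, by simp⟩ (Equiv.addRight z) g')
    simp only [wcomp_apply, one_mul, Equiv.coe_addRight] at h1
    refine h1.trans (mul_le_mul_of_nonneg_left ?_ (norm_nonneg _))
    exact (ContinuousLinearMap.le_of_opNorm_le _
      (wcomp_norm_le zero_le_one (by simp)) g').trans_eq (one_mul _)
  have hθ := summable_expWeight (d := d) hη
  have hBs : Summable B ∧ ∑' q, B q ≤ (∑' z : CubicLattice d, expWeight η z) * (‖g‖ * ‖g'‖) := by
    have hsw : Summable (B ∘ Equiv.prodComm (CubicLattice d) (CubicLattice d)) := by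
      refine (summable_prod_of_nonneg fun q => hB0 _).mpr ⟨fun z => ?_, ?_⟩
      · exact (hg z).mul_left (expWeight η z)
      · refine Summable.of_nonneg_of_le (fun z => tsum_nonneg fun x => hB0 (x, z)) (fun z => ?_)
          (hθ.mul_right (‖g‖ * ‖g'‖))
        change ∑' x, expWeight η z * (‖g x‖ * ‖g' (x + z)‖) ≤ _
        rw [tsum_mul_left]
        exact mul_le_mul_of_nonneg_left (hgle z) (expWeight_pos _ _).le
    refine ⟨(Equiv.summable_iff _).mp hsw, ?_⟩
    rw [← (Equiv.prodComm (CubicLattice d) (CubicLattice d)).tsum_eq B, ← tsum_mul_right]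
    have h2 := hsw.tsum_prod
    simp only [Function.comp_apply] at h2
    rw [h2]
    refine Summable.tsum_le_tsum (fun z => ?_) hsw.prod (hθ.mul_right _)
    change ∑' x, expWeight η z * (‖g x‖ * ‖g' (x + z)‖) ≤ _
    rw [tsum_mul_left]
    exact mul_le_mul_of_nonneg_left (hgle z) (expWeight_pos _ _).le
  have hfs : Summable f := Summable.of_norm_bounded hBs.1 hfn
  refine ⟨∑' q, f q, fun i => ?_, (tsum_of_norm_bounded hBs.1.hasSum hfn).trans hBs.2⟩
  have h1 : HasSum (fun q => F q i) ((∑' q, f q : Ell2 ℂ (FiberIndex p)) i) :=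
    hfs.hasSum.mapL (lp.evalCLM ℂ (fun _ : FiberIndex p => ℂ) 2 i)
  rw [← h1.tsum_eq, fiberSum, ← tsum_mul_left]
  have hinj : Function.Injective fun x : CubicLattice d => (x, i.2.1) := fun x y hxy =>
    (Prod.mk.inj hxy).1
  rw [← hinj.tsum_eq]
  · refine tsum_congr fun x => ?_
    simp only [hF, fiberTerm, and_true]
    split_ifs <;> simp
  · intro q hq
    rw [Function.mem_support] at hq
    refine ⟨q.1, ?_⟩
    by_contra hne
    apply hq
    simp only [hF]
    rw [if_neg]
    rintro ⟨-, h2⟩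
    exact hne (by rw [← h2])

end FiberSum

/-! ### The Bloch sums as weak solutions in the fibers. -/

section FiberSolution

open scoped InnerProductSpace

variable {d : ℕ} {Ω : Type*} [MeasurableSpace Ω] {P : Measure Ω} [IsProbabilityMeasure P] {r : ℝ}
  {v : Ω → ℝ≥0 → CubicLattice d → ℝ} {u : CubicLattice d → ℝ} {lam K : ℝ} {p : Fin d → ℕ}
  [∀ j, NeZero (p j)]

theorem IsSpinField.isDominated_densityMoment (hv : IsSpinField P r v) (hK : 0 ≤ K)
    (hu : ∀ x, |u x| + |lam| ≤ K) (ψ₀ : L2Lattice d) {t T : ℝ} (hT : 0 ≤ T) (htT : t ≤ T) :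
    LatticeKernel.IsDominated (densityMoment P v u lam ψ₀ t) (majorant K ψ₀ T)
      (majorant K ψ₀ T) := fun x y A =>
  (hv.norm_densityMoment_le hK hu ψ₀ hT htT x y A).trans
    (mul_le_mul (le_abs_self _) (le_abs_self _) (majorant_nonneg hK ψ₀ hT y) (abs_nonneg _))

theorem IsSpinField.exists_fiberVector (hv : IsSpinField P r v) (hK : 0 ≤ K)
    (hu : ∀ x, |u x| + |lam| ≤ K) (ψ₀ : L2Lattice d) {η : ℝ} (hη : 0 < η) (k : Fin d → ℝ) {t T : ℝ}
    (hT : 0 ≤ T) (htT : t ≤ T) :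
    ∃ f : Ell2 ℂ (FiberIndex p), (∀ i, f i = expWeight η i.2.1 *
        fiberSum p (LatticeKernel.twist k (densityMoment P v u lam ψ₀ t)) i) ∧
      ‖f‖ ≤ (∑' z : CubicLattice d, expWeight η z) * (‖majorant K ψ₀ T‖ * ‖majorant K ψ₀ T‖) := by
  refine _root_.exists_fiberVector hη fun x y 𝒜 => ?_
  simp only [LatticeKernel.norm_twist]
  refine (hv.sum_norm_sq_densityMoment_le hK hu ψ₀ hT htT x y 𝒜).trans_eq ?_
  simp only [Real.norm_eq_abs, mul_pow, sq_abs]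

theorem norm_majorant_mono (hK : 0 ≤ K) (ψ₀ : L2Lattice d) {t T : ℝ} (ht : 0 ≤ t) (hT : t ≤ T) :
    ‖majorant K ψ₀ t‖ ≤ ‖majorant K ψ₀ T‖ :=
  Ell2.norm_le_of_le _ _ fun x => by
    rw [Real.norm_of_nonneg (majorant_nonneg hK ψ₀ ht x),
      Real.norm_of_nonneg (majorant_nonneg hK ψ₀ (ht.trans hT) x)]
    exact majorant_mono hK ψ₀ ht hT x

theorem IsSpinField.norm_fiberTerm_le (hv : IsSpinField P r v) (hK : 0 ≤ K)
    (hu : ∀ x, |u x| + |lam| ≤ K) (ψ₀ : L2Lattice d) (k : Fin d → ℝ) {t T : ℝ} (hT : 0 ≤ T)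
    (htT : t ≤ T) (i : FiberIndex p) (x : CubicLattice d) :
    ‖fiberTerm p (LatticeKernel.twist k (densityMoment P v u lam ψ₀ t)) i x‖ ≤
      ‖majorant K ψ₀ T x‖ * ‖majorant K ψ₀ T (x + i.2.1)‖ :=
  _root_.norm_fiberTerm_le (((hv.isDominated_densityMoment hK hu ψ₀ hT htT).twist _) _ _ _)

theorem IsSpinField.norm_fiberTerm_momentGen_le (hv : IsSpinField P r v) (hK : 0 ≤ K)
    (hu : ∀ x, |u x| + |lam| ≤ K) (ψ₀ : L2Lattice d) (k : Fin d → ℝ) {t T : ℝ} (hT : 0 ≤ T)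
    (htT : t ≤ T) (i : FiberIndex p) (x : CubicLattice d) :
    ‖fiberTerm p (LatticeKernel.twist k (momentGen u lam (densityMoment P v u lam ψ₀ t))) i x‖ ≤
      ‖majorantOp d K (majorant K ψ₀ T) x‖ * ‖majorant K ψ₀ T (x + i.2.1)‖ +
        ‖majorant K ψ₀ T x‖ * ‖majorantOp d K (majorant K ψ₀ T) (x + i.2.1)‖ := by
  refine _root_.norm_fiberTerm_le ?_
  rw [LatticeKernel.norm_twist]
  refine (hv.norm_momentGen_le hK hu ψ₀ hT htT _ _ _).trans (add_le_add ?_ ?_) <;>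
  · rw [← norm_mul]; exact le_abs_self _

theorem IsSpinField.continuous_fiberSum (hv : IsSpinField P r v) (hK : 0 ≤ K)
    (hu : ∀ x, |u x| + |lam| ≤ K) (ψ₀ : L2Lattice d) (k : Fin d → ℝ) (i : FiberIndex p) :
    Continuous fun t => fiberSum p (LatticeKernel.twist k (densityMoment P v u lam ψ₀ t)) i := by
  rw [continuous_iff_continuousAt]
  intro t
  have h1 : ContinuousOn (fun t => fiberSum p
      (LatticeKernel.twist k (densityMoment P v u lam ψ₀ t)) i) (Set.Iio (|t| + 1)) := by
    refine continuousOn_tsum (u := fun x => ‖majorant K ψ₀ (|t| + 1) x‖ *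
      ‖majorant K ψ₀ (|t| + 1) (x + i.2.1)‖) (fun x => ?_)
      (Ell2.summable_mul_comp _ _ (Equiv.addRight i.2.1))
      fun x τ hτ => hv.norm_fiberTerm_le hK hu ψ₀ k (by positivity) (le_of_lt hτ) i x
    unfold fiberTerm LatticeKernel.twist
    split_ifs
    · exact (continuous_const.mul (hv.continuous_densityMoment hK hu ψ₀ _ _ _)).continuousOn
    · exact continuousOn_const
  exact h1.continuousAt (Iio_mem_nhds (by linarith [le_abs_self t]))

/-- Termwise differentiation: up to time `t + 1` the derivatives of the terms are dominated by
products of square summable functions. -/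
theorem IsSpinField.hasDerivAt_fiberSum (hv : IsSpinField P r v) (hK : 0 ≤ K)
    (hu : ∀ x, |u x| + |lam| ≤ K) {U : PeriodCell p → ℝ} (hU : ∀ x, u x = U (cellOf p x))
    (ψ₀ : L2Lattice d) (k : Fin d → ℝ) (i : FiberIndex p) {t : ℝ} (ht : 0 < t)
    {J : FiberIndex p → ℂ}
    (hJ : J = fiberSum p (LatticeKernel.twist k (densityMoment P v u lam ψ₀ t))) :
    HasDerivAt (fun t => fiberSum p (LatticeKernel.twist k (densityMoment P v u lam ψ₀ t)) i)
      (-Complex.I * (∑ q : LatticeDir d, Complex.exp (-(Complex.I * (LatticeDir.comp k q : ℝ))) *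
          J (i.1 + cellOf p q.vec, i.2.1 - q.vec, shiftFinset (-q.vec) i.2.2) +
        U i.1 * J i + lam * J (i.1, i.2.1, symmDiff i.2.2 {0})) +
      Complex.I * (∑ q : LatticeDir d, J (i.1, i.2.1 + q.vec, i.2.2) +
        U (i.1 + cellOf p i.2.1) * J i + lam * J (i.1, i.2.1, symmDiff i.2.2 {i.2.1})) -
      (2 * r * i.2.2.card : ℝ) * J i) t := by
  set T : ℝ := t + 1 with hT
  have hT0 : 0 ≤ T := by linarith
  set g := majorant K ψ₀ T with hg
  set g' := majorantOp d K g with hg'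
  set N : ℝ := 2 * r * i.2.2.card with hN
  have hdom := hv.isDominated_densityMoment hK hu ψ₀ (P := P) hT0 (by linarith : t ≤ T)
  have hder : HasDerivAt (fun t => fiberSum p
      (LatticeKernel.twist k (densityMoment P v u lam ψ₀ t)) i)
      (∑' x, (fiberTerm p (LatticeKernel.twist k
        (momentGen u lam (densityMoment P v u lam ψ₀ t))) i x -
        N * fiberTerm p (LatticeKernel.twist k (densityMoment P v u lam ψ₀ t)) i x)) t := by
    refine hasDerivAt_tsum_of_isPreconnected (t := Set.Ioo 0 T) (y₀ := t)
      (g := fun x t => fiberTerm p (LatticeKernel.twist k (densityMoment P v u lam ψ₀ t)) i x)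
      (g' := fun x t => fiberTerm p (LatticeKernel.twist k
        (momentGen u lam (densityMoment P v u lam ψ₀ t))) i x -
        N * fiberTerm p (LatticeKernel.twist k (densityMoment P v u lam ψ₀ t)) i x)
      (u := fun x => ‖g' x‖ * ‖g (x + i.2.1)‖ + ‖g x‖ * ‖g' (x + i.2.1)‖ +
        |N| * (‖g x‖ * ‖g (x + i.2.1)‖)) ?_ isOpen_Ioo isPreconnected_Ioo (fun x τ hτ => ?_)
      (fun x τ hτ => ?_) ⟨ht, by linarith⟩ ((hdom.twist _).hasSum i).summable ⟨ht, by linarith⟩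
    · exact ((g'.summable_mul_comp g (Equiv.addRight i.2.1)).add
        (g.summable_mul_comp g' (Equiv.addRight i.2.1))).add
        ((g.summable_mul_comp g (Equiv.addRight i.2.1)).mul_left _)
    · simp only [fiberTerm, LatticeKernel.twist]
      split_ifs
      · refine ((hv.hasDerivAt_densityMoment hK hu ψ₀ hτ.1 _ _ _).const_mul _).congr_deriv ?_
        rw [card_shiftFinset, hN]
        push_cast
        ring
      · simpa using hasDerivAt_const τ (0 : ℂ)
    · refine (norm_sub_le _ _).trans (add_le_add ?_ ?_)
      · exact hv.norm_fiberTerm_momentGen_le hK hu ψ₀ k hT0 hτ.2.le i x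
      · rw [norm_mul, Complex.norm_real]
        exact mul_le_mul_of_nonneg_left (hv.norm_fiberTerm_le hK hu ψ₀ k hT0 hτ.2.le i x)
          (abs_nonneg _)
  rw [((fiberSum_twist_momentGen hU lam hdom k i).sub
    (((hdom.twist k).hasSum i).mul_left (N : ℂ))).tsum_eq, ← hJ] at hder
  exact hder

/-- The fibers of the correlations solve the fiber evolution equation. -/
theorem IsSpinField.exists_fiberSolution (hv : IsSpinField P r v) (hK : 0 ≤ K)
    (hu : ∀ x, |u x| + |lam| ≤ K) {U : PeriodCell p → ℝ} (hU : ∀ x, u x = U (cellOf p x))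
    (ψ₀ : L2Lattice d) {η : ℝ} (hη : 0 < η) (κ : Fin d → ℝ) (s : ℝ) :
    ∃ R : ℝ → Ell2 ℂ (FiberIndex p),
      IsWeakSolution (fiberGen hη.le U lam r κ s) (fiberRate r) 0 R ∧
      (∀ t i, R t i = expWeight η i.2.1 *
        fiberSum p (LatticeKernel.twist (s • κ) (densityMoment P v u lam ψ₀ t)) i) ∧
      ∀ T ≥ 0, ∀ t ≤ T, ‖R t‖ ≤
        (∑' z : CubicLattice d, expWeight η z) * (‖majorant K ψ₀ T‖ * ‖majorant K ψ₀ T‖) := by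
  have hex := fun t : ℝ => hv.exists_fiberVector (p := p) hK hu ψ₀ hη (s • κ)
    (le_max_right t 0) (le_max_left t 0)
  choose R hR hRn using hex
  have hRb : ∀ T ≥ 0, ∀ t ≤ T, ‖R t‖ ≤
      (∑' z : CubicLattice d, expWeight η z) * (‖majorant K ψ₀ T‖ * ‖majorant K ψ₀ T‖) :=
    fun T hT t ht => by
      refine (hRn t).trans ?_
      have hθ : 0 ≤ ∑' z : CubicLattice d, expWeight η z :=
        tsum_nonneg fun z => (expWeight_pos _ _).le
      have hm := norm_majorant_mono hK ψ₀ (le_max_right t 0) (max_le ht hT)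
      gcongr
  have hcomp : ∀ q, LatticeDir.comp (s • κ) q = s * LatticeDir.comp κ q := fun q => by
    rcases q with ⟨j, b⟩
    cases b <;> simp [LatticeDir.comp]
  refine ⟨R, ⟨fun i => ?_, fun T => ⟨_, fun t ht => hRb (max T 0) (le_max_right _ _) t
    (ht.2.trans (le_max_left _ _))⟩, fun i => continuousOn_const, fun T => ⟨0, fun t _ => by simp⟩,
    fun i t ht => ?_⟩, hR, hRb⟩
  · simp only [hR]
    exact (continuous_const.mul (hv.continuous_fiberSum hK hu ψ₀ _ i)).continuousOn
  · set J := fiberSum p (LatticeKernel.twist (s • κ) (densityMoment P v u lam ψ₀ t)) with hJ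
    have hder := hv.hasDerivAt_fiberSum hK hu hU ψ₀ (s • κ) i ht hJ
    have hθ : ∀ z : CubicLattice d, ((expWeight η z : ℝ) : ℂ) ≠ 0 := fun z =>
      Complex.ofReal_ne_zero.mpr (expWeight_pos η z).ne'
    -- The truncated subtraction in `fiberRate` is exact on nonempty sets; on the empty set both
    -- sides vanish.
    have hN : ((2 * r * i.2.2.card : ℝ) : ℂ) =
        (2 * r : ℝ) * (excited p).indicator 1 i + fiberRate r i := by
      rw [fiberRate]
      by_cases hA : i.2.2 = ∅
      · have : i ∉ excited p := fun h => h hA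
        simp [this, hA]
      · have : i ∈ excited p := hA
        have hc : 1 ≤ i.2.2.card := Finset.card_pos.mpr (Finset.nonempty_iff_ne_empty.mpr hA)
        rw [Set.indicator_of_mem this, Nat.cast_sub hc]
        push_cast
        simp only [Pi.one_apply]
        ring
    have hRt : ∀ i, R t i = expWeight η i.2.1 * J i := hR t
    have hw := hder.const_mul (expWeight η i.2.1 : ℂ)
    simp only [← hR] at hw
    refine hw.congr_deriv ?_
    have hz : ((0 : ℝ → Ell2 ℂ (FiberIndex p)) t) i = 0 := rfl
    -- The quotients in the weighted hopping convert the weight of a neighboring component into that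
    -- of `i`.
    have e1 : ∀ (z z' : CubicLattice d) (c : ℂ),
        ((expWeight η z / expWeight η z' : ℝ) : ℂ) * (expWeight η z' * c) = expWeight η z * c :=
      fun z z' c => by
        rw [← mul_assoc]
        congr 1
        push_cast
        rw [div_mul_cancel₀ _ (hθ z')]
    rw [hz, add_zero, fiberGen_apply, hN]
    simp only [hRt, hcomp, sub_eq_add_neg i.2.1, e1, mul_left_comm _ (expWeight η i.2.1 : ℂ),
      ← Finset.mul_sum, Finset.sum_sub_distrib]
    push_cast
    ring

/-- The stationary vector sees only `z = 0` and the empty spin set, where the weight is `1`; adding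
up the residue classes gives the full sum along the diagonal. -/
theorem inner_fiberStat_eq_tsum {T : LatticeKernel d} {g g' : Ell2 ℝ (CubicLattice d)}
    (h : T.IsDominated g g') {η : ℝ} {f : Ell2 ℂ (FiberIndex p)}
    (hf : ∀ i, f i = expWeight η i.2.1 * fiberSum p T i) :
    ⟪fiberStat p, f⟫_ℂ = ((cellNorm p)⁻¹ : ℝ) * ∑' x, T x x ∅ := by
  classical
  rw [inner_fiberStat]
  congr 1
  have h1 := hasSum_sum fun (a : PeriodCell p) (_ : a ∈ Finset.univ) => h.hasSum (p := p) (a, 0, ∅)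
  simp only [hf, expWeight_zero_right, Complex.ofReal_one, one_mul]
  rw [← h1.tsum_eq]
  refine tsum_congr fun x => ?_
  simp [fiberTerm]

end FiberSolution

/-! ### Characteristic functions of the averaged densities. -/

section Diffusive

open scoped InnerProductSpace

/-- The stationary component of a solution is conserved at momentum zero. -/
theorem PerturbedGenerator.inner_eq_of_isWeakSolution {ι : Type*} (S : PerturbedGenerator ι)
    {R : ℝ → Ell2 ℂ ι} (hR : IsWeakSolution (S.Gs 0) S.b 0 R) {t : ℝ} (ht : 0 ≤ t) :
    ⟪S.e, R t⟫_ℂ = ⟪S.e, R 0⟫_ℂ := by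
  have hG : S.Gs 0 = S.G := by
    have := S.taylor 0 (by simp)
    simpa [sub_eq_zero] using this
  have hbe : ∀ j, (0 : Ell2 ℂ ι) j = S.b j * S.e j := fun j => by
    by_cases hb : S.b j = 0
    · simp [hb]
    · simp [S.e_apply j hb]
  have h := norm_image_sub_le_of_hasDerivAt_Ioo ht
    ((hR.continuousOn_inner S.e).mono Set.Icc_subset_Ici_self)
    (fun τ hτ => hR.hasDerivAt_inner hbe hτ.1) (C := 0) fun τ _ => by
      rw [hG, S.e_G]; simp
  rw [zero_mul] at h
  exact sub_eq_zero.mp (norm_le_zero_iff.mp h)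

variable {d : ℕ}

/-- The characteristic function of a weight on the lattice. -/
def latticeCharFun (ρ : CubicLattice d → ℝ) (k : Fin d → ℝ) : ℂ := ∑' x, latticePhase k x * ρ x

/-- A family of probability weights on the lattice whose characteristic functions behave as those
of a diffusion with diffusion matrix `D`. -/
structure IsDiffusive (D : Matrix (Fin d) (Fin d) ℝ) (ρ : ℝ≥0 → CubicLattice d → ℝ) : Prop where
  nonneg : ∀ t x, 0 ≤ ρ t x
  hasSum_one : ∀ t, HasSum (ρ t) 1
  charFun : ∀ κ : Fin d → ℝ, ∃ ν : ℂ, ν.re = κ ⬝ᵥ D.mulVec κ / 2 ∧ ∃ s₀ > 0,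
    (∃ C, ∀ s : ℝ, |s| ≤ s₀ → ∀ t : ℝ≥0,
      ‖latticeCharFun (ρ t) (s • κ) - Complex.exp (-(ν * s ^ 2 * (t : ℝ))) *
        latticeCharFun (ρ 0) (s • κ)‖ ≤ C * (|s| + |s| ^ 3 * t)) ∧
    ((Summable fun x => (1 + ‖latticeVec x‖ ^ 2) * ρ 0 x) → ∃ C, ∀ s : ℝ, |s| ≤ s₀ → ∀ t : ℝ≥0,
      ‖latticeCharFun (ρ t) (s • κ) + latticeCharFun (ρ t) (-(s • κ)) -
        Complex.exp (-(ν * s ^ 2 * (t : ℝ))) * (latticeCharFun (ρ 0) (s • κ) +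
          latticeCharFun (ρ 0) (-(s • κ)))‖ ≤ C * (s ^ 2 + |s| ^ 3 * t))

theorem norm_latticePhase_sub_le (k : Fin d → ℝ) (x : CubicLattice d) :
    ‖latticePhase k x - latticePhase (-k) x‖ ≤ 2 * |∑ j, k j * x j| := by
  set θ : ℝ := ∑ j, k j * x j with hθ
  have h1 : latticePhase k x - latticePhase (-k) x =
      latticePhase (-k) x * (Complex.exp (Complex.I * ((2 * θ : ℝ) : ℂ)) - 1) := by
    have e1 : latticePhase (-k) x = Complex.exp (-(Complex.I * (θ : ℂ))) := by
      rw [latticePhase]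
      simp [hθ]
    rw [e1, latticePhase, ← hθ, mul_sub, ← Complex.exp_add]
    push_cast
    ring_nf
  rw [h1, norm_mul, norm_latticePhase, one_mul]
  refine (Real.norm_exp_I_mul_ofReal_sub_one_le).trans_eq ?_
  rw [Real.norm_eq_abs, abs_mul, abs_two]

theorem norm_latticeVec_sq (x : CubicLattice d) : ‖latticeVec x‖ ^ 2 = ∑ j, (x j : ℝ) ^ 2 := by
  rw [EuclideanSpace.norm_sq_eq]
  simp [latticeVec]

theorem sq_sum_mul_le (κ : Fin d → ℝ) (x : CubicLattice d) :
    (∑ j, κ j * x j) ^ 2 ≤ (∑ j, κ j ^ 2) * ‖latticeVec x‖ ^ 2 := by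
  rw [norm_latticeVec_sq]
  exact Finset.sum_mul_sq_le_sq_mul_sq _ _ _

variable {p : Fin d → ℕ} [∀ j, NeZero (p j)]

theorem one_le_cellNorm : 1 ≤ cellNorm p := by
  have h1 : (1 : ℝ) ≤ cellNorm p ^ 2 := by
    rw [cellNorm_sq]
    exact_mod_cast Fintype.card_pos
  nlinarith [cellNorm_pos (p := p)]

/-- The averaged densities of solutions of the Schrödinger equation in a spin field are diffusive. -/
theorem exists_isDiffusive (U : PeriodCell p → ℝ) {lam rate : ℝ} (hlam : 0 < lam)
    (hrate : 0 < rate) : ∃ D : Matrix (Fin d) (Fin d) ℝ, D.PosDef ∧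
      ∀ (Ω : Type*) [MeasurableSpace Ω] (P : Measure Ω) [IsProbabilityMeasure P]
        (v : Ω → ℝ≥0 → CubicLattice d → ℝ), IsSpinField P rate v →
        ∀ (u : CubicLattice d → ℝ), (∀ x, u x = U (cellOf p x)) → ∀ ψ₀ : L2Lattice d, ‖ψ₀‖ = 1 →
          IsDiffusive D fun t x =>
            ∫ ω, ‖dysonSum (totalPotential u lam (v ω)) ψ₀ t x‖ ^ 2 ∂P := by
  obtain ⟨D, hD, η, hη, hS⟩ := exists_diffusion_matrix (p := p) U hlam hrate
  refine ⟨D, hD, fun Ω _ P _ v hv u hU ψ₀ hψ => ?_⟩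
  obtain ⟨K, hK, hu⟩ : ∃ K, 0 ≤ K ∧ ∀ x, |u x| + |lam| ≤ K := by
    refine ⟨∑ a, |U a| + |lam|, by positivity, fun x => ?_⟩
    rw [hU]
    gcongr
    exact Finset.single_le_sum (f := fun a => |U a|) (fun _ _ => abs_nonneg _) (Finset.mem_univ _)
  set ρ : ℝ≥0 → CubicLattice d → ℝ := fun t x =>
    ∫ ω, ‖dysonSum (totalPotential u lam (v ω)) ψ₀ t x‖ ^ 2 ∂P with hρ
  have hdiag : ∀ (t : ℝ≥0) x, densityMoment P v u lam ψ₀ t x x ∅ = (ρ t x : ℂ) := fun t x => by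
    rw [densityMoment, hρ]
    beta_reduce
    rw [← integral_complex_ofReal]
    refine integral_congr_ae (Eventually.of_forall fun ω => ?_)
    simp only [spinChar, Finset.prod_empty, mul_one, Real.toNNReal_coe, Complex.mul_conj']
    push_cast
    rfl
  have hρ0 : ∀ x, ρ 0 x = ‖ψ₀ x‖ ^ 2 := fun x => by
    have h1 := hdiag 0 x
    rw [NNReal.coe_zero, hv.densityMoment_zero hK hu, if_pos rfl, Complex.mul_conj'] at h1
    exact_mod_cast h1.symm
  choose R hR hRapp hRb using hv.exists_fiberSolution (p := p) hK hu hU ψ₀ hη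
  set Θ : ℝ := (∑' z : CubicLattice d, expWeight η z) *
    (‖majorant K ψ₀ 0‖ * ‖majorant K ψ₀ 0‖) with hΘ
  have hn := cellNorm_pos (p := p)
  -- The twisted diagonal sum is the characteristic function; so the quantity described by the
  -- perturbation theory is the wanted one.
  have hchar : ∀ κ s (t : ℝ≥0), ⟪fiberStat p, R κ s t⟫_ℂ =
      ((cellNorm p)⁻¹ : ℝ) * latticeCharFun (ρ t) (s • κ) := fun κ s t => by
    rw [inner_fiberStat_eq_tsum ((hv.isDominated_densityMoment hK hu ψ₀ t.coe_nonneg le_rfl).twist (s • κ))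
      (hRapp κ s t)]
    simp only [LatticeKernel.twist, hdiag]
    rfl
  have hnonneg : ∀ t x, 0 ≤ ρ t x := fun t x => integral_nonneg fun ω => by positivity
  have hsummable : ∀ t, Summable (ρ t) := fun t => by
    have h1 := (majorant K ψ₀ t).summable_mul_comp (majorant K ψ₀ t) (Equiv.refl _)
    refine Summable.of_nonneg_of_le (hnonneg t) (fun x => ?_) h1
    have h2 := hv.isDominated_densityMoment hK hu ψ₀ (P := P) t.coe_nonneg le_rfl x x ∅
    rw [hdiag, Complex.norm_real, Real.norm_of_nonneg (hnonneg t x)] at h2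
    exact h2
  -- Conservation of mass is conservation of the stationary component at momentum zero.
  have hone : ∀ t, HasSum (ρ t) 1 := fun t => by
    have h0 : HasSum (ρ 0) 1 := by
      have := Ell2.hasSum_norm_sq ψ₀
      rw [hψ, one_pow] at this
      exact this.congr_fun hρ0
    have hzero : ∀ t, latticeCharFun (ρ t) 0 = ((∑' x, ρ t x : ℝ) : ℂ) := fun t => by
      simp [latticeCharFun, Complex.ofReal_tsum]
    obtain ⟨S, hSG, hSb, hSe, -⟩ := hS 0
    have hRS := hR 0 0
    rw [← hSG, ← hSb] at hRS
    have h1 := S.inner_eq_of_isWeakSolution hRS t.coe_nonneg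
    rw [hSe] at h1
    have h2 := hchar 0 0 0
    rw [NNReal.coe_zero, ← h1] at h2
    have h3 := (hchar 0 0 t).symm.trans h2
    have h4 : (((cellNorm p)⁻¹ : ℝ) : ℂ) ≠ 0 := Complex.ofReal_ne_zero.mpr (inv_pos.mpr hn).ne'
    have h5 := mul_left_cancel₀ h4 h3
    rw [smul_zero, hzero, hzero, h0.tsum_eq] at h5
    have h6 : ∑' x, ρ t x = 1 := by exact_mod_cast h5
    rw [← h6]
    exact (hsummable t).hasSum
  have hφ1 : ∀ t k, ‖latticeCharFun (ρ t) k‖ ≤ 1 := fun t k => by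
    refine tsum_of_norm_bounded (hone t) fun x => ?_
    rw [norm_mul, norm_latticePhase, one_mul, Complex.norm_real, Real.norm_of_nonneg (hnonneg t x)]
  -- Characteristic functions are bounded by one, and `cellNorm ≥ 1`; this is the a priori bound
  -- that the perturbation theory asks for.
  have hle1 : ∀ κ s, ∀ t ≥ (0 : ℝ), ‖⟪fiberStat p, R κ s t⟫_ℂ‖ ≤ 1 := fun κ s t ht => by
    have h1 : ⟪fiberStat p, R κ s t⟫_ℂ = _ := hchar κ s ⟨t, ht⟩
    rw [h1, norm_mul, Complex.norm_real, Real.norm_of_nonneg (inv_pos.mpr hn).le]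
    exact mul_le_one₀ (inv_le_one_of_one_le₀ one_le_cellNorm) (norm_nonneg _) (hφ1 _ _)
  have hscale : ∀ {a : ℂ} {B : ℝ}, ‖((cellNorm p)⁻¹ : ℝ) * a‖ ≤ B → ‖a‖ ≤ cellNorm p * B :=
    fun {a B} h => by
      rw [norm_mul, Complex.norm_real, Real.norm_of_nonneg (inv_pos.mpr hn).le,
        inv_mul_le_iff₀ hn] at h
      exact h
  refine ⟨hnonneg, hone, fun κ => ?_⟩
  obtain ⟨S, hSG, hSb, hSe, hSν⟩ := hS κ
  have hRS : ∀ s, IsWeakSolution (S.Gs s) S.b 0 (R κ s) := fun s => by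
    rw [hSG, hSb]; exact hR κ s
  refine ⟨S.ν, hSν, S.s₀, S.s₀_pos, ?_, fun hsum => ?_⟩
  · obtain ⟨C, -, hC⟩ := S.exists_norm_inner_sub_le Θ
    refine ⟨cellNorm p * C, fun s hs t => ?_⟩
    have h1 := hC s hs (R κ s) (hRS s) (by rw [hSe]; exact hle1 κ s) (hRb κ s 0 le_rfl 0 le_rfl) t t.2
    have h2 := hchar κ s 0
    rw [NNReal.coe_zero] at h2
    rw [hSe, h2, hchar, mul_left_comm, ← mul_sub] at h1
    exact (hscale h1).trans_eq (mul_assoc _ _ _).symm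
  · have hmem : Memℓp (fun x : CubicLattice d => (∑ j, κ j * x j) * ‖ψ₀ x‖) 2 := by
      refine memℓp_two_iff.mpr (Summable.of_nonneg_of_le (fun x => by positivity) (fun x => ?_)
        (hsum.mul_left (∑ j, κ j ^ 2)))
      rw [Real.norm_eq_abs, sq_abs, mul_pow, hρ0]
      have h1 := sq_sum_mul_le κ x
      have h2 : (0 : ℝ) ≤ ∑ j, κ j ^ 2 := by positivity
      have h3 : 0 ≤ ‖ψ₀ x‖ ^ 2 := by positivity
      nlinarith [mul_le_mul_of_nonneg_right h1 h3, mul_nonneg h2 h3]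
    set h : Ell2 ℝ (CubicLattice d) := ⟨_, hmem⟩ with hh
    set Θ' : ℝ := (∑' z : CubicLattice d, expWeight η z) * (2 * ‖h‖ * ‖Ell2.abs ψ₀‖) with hΘ'
    -- At time zero only the empty spin set contributes, and the twists by `s κ` and `-s κ` differ
    -- by at most `2 |s| |κ · x|`; the finite second moment makes this square summable against `ψ₀`.
    have hdiff : ∀ s, ‖R κ s 0 - R κ (-s) 0‖ ≤ Θ' * |s| := fun s => by
      set T₀ := densityMoment P v u lam ψ₀ 0 with hT₀
      have hT0 : LatticeKernel.IsDominated T₀ (majorant K ψ₀ 0) (majorant K ψ₀ 0) :=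
        hv.isDominated_densityMoment hK hu ψ₀ le_rfl le_rfl
      obtain ⟨f, hf, hfn⟩ := exists_fiberVector (p := p) hη (T := fun x y A =>
        LatticeKernel.twist (s • κ) T₀ x y A - LatticeKernel.twist (-s • κ) T₀ x y A)
        (g := (2 * s) • h) (g' := Ell2.abs ψ₀) fun x y 𝒜 => by
          have e1 : ∀ A, ‖LatticeKernel.twist (s • κ) T₀ x y A -
              LatticeKernel.twist (-s • κ) T₀ x y A‖ ^ 2 = if ∅ = A then
                (‖latticePhase (s • κ) x - latticePhase (-s • κ) x‖ * (‖ψ₀ x‖ * ‖ψ₀ y‖)) ^ 2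
                else 0 := fun A => by
            simp only [LatticeKernel.twist, hT₀, hv.densityMoment_zero hK hu, ← sub_mul, norm_mul,
              @eq_comm _ ∅ A]
            split_ifs <;> simp
          simp only [e1]
          rw [Finset.sum_ite_eq]
          have e2 : ‖latticePhase (s • κ) x - latticePhase (-s • κ) x‖ * (‖ψ₀ x‖ * ‖ψ₀ y‖) ≤
              ‖((2 * s) • h) x‖ * ‖Ell2.abs ψ₀ y‖ := by
            have e3 : ((2 * s) • h) x = (2 * s) * ((∑ j, κ j * x j) * ‖ψ₀ x‖) := rfl
            have e4 := norm_latticePhase_sub_le (s • κ) x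
            rw [← neg_smul] at e4
            rw [e3, Ell2.abs_apply, norm_norm, ← mul_assoc]
            refine mul_le_mul_of_nonneg_right ?_ (norm_nonneg _)
            simp only [norm_mul, norm_norm]
            rw [← mul_assoc]
            refine mul_le_mul_of_nonneg_right (e4.trans_eq ?_) (norm_nonneg _)
            simp only [Pi.smul_apply, smul_eq_mul, mul_assoc, ← Finset.mul_sum, Real.norm_eq_abs,
              abs_mul, abs_two]
          split_ifs
          · gcongr
          · positivity
      have hfe : R κ s 0 - R κ (-s) 0 = f := by
        ext i
        rw [lp.coeFn_sub, Pi.sub_apply, hRapp, hRapp, hf,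
          fiberSum_twist_sub (hT0.twist _) (hT0.twist _), mul_sub]
      rw [hfe]
      refine hfn.trans_eq ?_
      rw [norm_smul, Real.norm_eq_abs, abs_mul, abs_two, hΘ']
      ring
    obtain ⟨C, hC⟩ := S.exists_norm_inner_add_sub_le Θ Θ'
    refine ⟨cellNorm p * C, fun s hs t => ?_⟩
    have h1 := hC s hs (R κ s) (R κ (-s)) (hRS s) (hRS (-s)) (by rw [hSe]; exact hle1 κ s)
      (by rw [hSe]; exact hle1 κ (-s)) (hRb κ s 0 le_rfl 0 le_rfl) (hRb κ (-s) 0 le_rfl 0 le_rfl)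
      (hdiff s) t t.2
    have h2 := hchar κ s 0
    have h3 := hchar κ (-s) 0
    rw [NNReal.coe_zero] at h2 h3
    rw [hSe, h2, h3, hchar, hchar, ← mul_add, ← mul_add, mul_left_comm, ← mul_sub, neg_smul] at h1
    exact (hscale h1).trans_eq (mul_assoc _ _ _).symm

end Diffusive

/-! ### The Gaussian density and the Gaussian measure. -/

section GaussianDensity

open scoped InnerProductSpace MatrixOrder
open Matrix

variable {d : ℕ}

theorem charFun_gaussianDensity_one (t : EuclideanSpace ℝ (Fin d)) :
    ∫ x : EuclideanSpace ℝ (Fin d), Complex.exp (⟪x, t⟫_ℝ * Complex.I) *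
      gaussianDensity 1 x = Complex.exp (-‖t‖ ^ 2 / 2) := by
  have h := GaussianFourier.integral_cexp_neg_mul_sq_norm_add_of_euclideanSpace (ι := Fin d)
    (b := (1 / 2 : ℂ)) (by norm_num) Complex.I t
  have e : ∀ x : EuclideanSpace ℝ (Fin d), Complex.exp (⟪x, t⟫_ℝ * Complex.I) *
      gaussianDensity 1 x = (((1 / (2 * Real.pi)) ^ ((d : ℝ) / 2) : ℝ) : ℂ) *
        Complex.exp (-(1 / 2 : ℂ) * ‖x‖ ^ 2 + Complex.I * ⟪t, x⟫_ℝ) := fun x => by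
    have hx : x.ofLp ⬝ᵥ x.ofLp = ‖x‖ ^ 2 := by
      rw [EuclideanSpace.real_norm_sq_eq]
      simp [dotProduct, sq]
    rw [gaussianDensity, inv_one, one_mulVec, det_one, Real.sqrt_one, inv_one, mul_one, hx,
      Complex.exp_add, real_inner_comm]
    push_cast
    ring_nf
  simp only [e]
  rw [integral_const_mul, h, ← mul_assoc]
  have e2 : (((1 / (2 * Real.pi)) ^ ((d : ℝ) / 2) : ℝ) : ℂ) *
      ((Real.pi : ℂ) / (1 / 2)) ^ ((Fintype.card (Fin d) : ℂ) / 2) = 1 := by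
    have e3 : ((Real.pi : ℂ) / (1 / 2)) ^ ((Fintype.card (Fin d) : ℂ) / 2) =
        (((2 * Real.pi) ^ ((d : ℝ) / 2) : ℝ) : ℂ) := by
      rw [Complex.ofReal_cpow (by positivity), Fintype.card_fin]
      push_cast
      congr 1
      ring
    rw [e3, ← Complex.ofReal_mul, ← Real.mul_rpow (by positivity) (by positivity),
      one_div_mul_cancel (by positivity), Real.one_rpow, Complex.ofReal_one]
  rw [e2, one_mul, Complex.I_sq]
  congr 1
  ring

theorem gaussianDensity_nonneg (D : Matrix (Fin d) (Fin d) ℝ) (x : EuclideanSpace ℝ (Fin d)) :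
    0 ≤ gaussianDensity D x := by
  unfold gaussianDensity
  positivity

theorem continuous_gaussianDensity (D : Matrix (Fin d) (Fin d) ℝ) :
    Continuous (gaussianDensity D) := by
  have h : Continuous fun x : EuclideanSpace ℝ (Fin d) => x.ofLp := PiLp.continuous_ofLp 2 _
  have h2 : Continuous fun x : EuclideanSpace ℝ (Fin d) => x.ofLp ⬝ᵥ D⁻¹ *ᵥ x.ofLp :=
    h.dotProduct (continuous_const.matrix_mulVec h)
  unfold gaussianDensity
  fun_prop

/-- The characteristic functions agree, and they determine finite measures. -/
theorem stdGaussian_eq_withDensity : stdGaussian (EuclideanSpace ℝ (Fin d)) =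
    volume.withDensity fun x => ENNReal.ofReal (gaussianDensity 1 x) := by
  have hint : Integrable (gaussianDensity (1 : Matrix (Fin d) (Fin d) ℝ)) := by
    have h := charFun_gaussianDensity_one (0 : EuclideanSpace ℝ (Fin d))
    simp only [inner_zero_right, Complex.ofReal_zero, zero_mul, Complex.exp_zero, one_mul] at h
    have h1 : Integrable fun x : EuclideanSpace ℝ (Fin d) => (gaussianDensity 1 x : ℂ) := by
      -- A nonintegrable function has integral `0` by convention, but the Fourier integral at
      -- frequency `0` is an exponential.
      by_contra hc
      rw [integral_undef hc] at h
      exact Complex.exp_ne_zero _ h.symm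
    exact h1.re
  have : IsFiniteMeasure (volume.withDensity fun x : EuclideanSpace ℝ (Fin d) =>
      ENNReal.ofReal (gaussianDensity 1 x)) := isFiniteMeasure_withDensity_ofReal hint.2
  refine Measure.ext_of_charFun (funext fun t => ?_)
  rw [charFun_stdGaussian, charFun_apply, ← charFun_gaussianDensity_one,
    integral_withDensity_eq_integral_toReal_smul
      (continuous_gaussianDensity 1).measurable.ennreal_ofReal
      (Eventually.of_forall fun x => ENNReal.ofReal_lt_top)]
  refine integral_congr_ae (Eventually.of_forall fun x => ?_)
  simp only [ENNReal.toReal_ofReal (gaussianDensity_nonneg 1 x), Complex.real_smul]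
  ring

/-- Integrals with respect to a nondegenerate Gaussian measure in terms of its density. -/
theorem integral_multivariateGaussian {D : Matrix (Fin d) (Fin d) ℝ} (hD : D.PosDef)
    {f : EuclideanSpace ℝ (Fin d) → ℝ} (hf : Continuous f) :
    ∫ x, f x ∂multivariateGaussian 0 D = ∫ x, f x * gaussianDensity D x := by
  -- The Gaussian measure with covariance `D` is the image of the standard one under the symmetric
  -- square root of `D`; the change of variables costs `|det B| = √(det D)`.
  set B := CFC.sqrt D with hB
  have hBB : B * B = D := CFC.sqrt_mul_sqrt_self _ hD.posSemidef.nonneg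
  have hBt : Bᵀ = B := by
    have := (CFC.sqrt_nonneg D).isSelfAdjoint
    rw [IsSelfAdjoint, star_eq_conjTranspose, conjTranspose_eq_transpose_of_trivial] at this
    exact this
  have hdet : B.det * B.det = D.det := by rw [← det_mul, hBB]
  have hDd : 0 < D.det := hD.det_pos
  have hBd : B.det ≠ 0 := fun h => by rw [h] at hdet; simp at hdet; exact hDd.ne hdet
  have habs : |B.det| = Real.sqrt D.det := by rw [← hdet, Real.sqrt_mul_self_eq_abs]
  set L : EuclideanSpace ℝ (Fin d) →L[ℝ] EuclideanSpace ℝ (Fin d) :=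
    toEuclideanCLM (𝕜 := ℝ) B with hL
  have hLof : ∀ x, (L x).ofLp = B *ᵥ x.ofLp := fun x => ofLp_toEuclideanCLM B x
  have hLdet : LinearMap.det (L : EuclideanSpace ℝ (Fin d) →ₗ[ℝ] EuclideanSpace ℝ (Fin d)) =
      B.det := by
    have : (L : EuclideanSpace ℝ (Fin d) →ₗ[ℝ] EuclideanSpace ℝ (Fin d)) =
        toLpLin 2 2 B := rfl
    rw [this]
    simp
  have hdens : ∀ x, gaussianDensity D (L x) = |B.det|⁻¹ * gaussianDensity 1 x := fun x => by
    have hq : (L x).ofLp ⬝ᵥ D⁻¹ *ᵥ (L x).ofLp = x.ofLp ⬝ᵥ x.ofLp := by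
      have hu : IsUnit B.det := isUnit_iff_ne_zero.mpr hBd
      rw [hLof, ← hBB, Matrix.mul_inv_rev, mulVec_mulVec, mul_assoc, nonsing_inv_mul _ hu, mul_one,
        dotProduct_mulVec, ← mulVec_transpose, transpose_nonsing_inv, hBt, mulVec_mulVec,
        nonsing_inv_mul _ hu, one_mulVec]
    rw [gaussianDensity, gaussianDensity, hq, inv_one, one_mulVec, det_one, Real.sqrt_one, habs]
    ring
  have h1 : ∫ x, f x ∂multivariateGaussian 0 D = ∫ x, gaussianDensity 1 x * f (L x) := by
    rw [multivariateGaussian, integral_map (by fun_prop) hf.aestronglyMeasurable,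
      stdGaussian_eq_withDensity, integral_withDensity_eq_integral_toReal_smul
      (continuous_gaussianDensity 1).measurable.ennreal_ofReal
      (Eventually.of_forall fun x => ENNReal.ofReal_lt_top)]
    refine integral_congr_ae (Eventually.of_forall fun x => ?_)
    simp only [ENNReal.toReal_ofReal (gaussianDensity_nonneg 1 x), smul_eq_mul, zero_add]
    rfl
  have hc : Continuous fun x => f x * gaussianDensity D x := hf.mul (continuous_gaussianDensity D)
  have h2 : ∫ x, f (L x) * gaussianDensity D (L x) =
      |B.det|⁻¹ * ∫ x, f x * gaussianDensity D x := by
    have h3 := Measure.map_linearMap_addHaar_eq_smul_addHaar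
      (volume : Measure (EuclideanSpace ℝ (Fin d)))
      (f := (L : EuclideanSpace ℝ (Fin d) →ₗ[ℝ] EuclideanSpace ℝ (Fin d))) (by rwa [hLdet])
    have h4 := integral_map (μ := volume) (φ := L) L.continuous.aemeasurable
      (f := fun x => f x * gaussianDensity D x) hc.aestronglyMeasurable
    rw [← h4]
    have h5 : Measure.map (L : EuclideanSpace ℝ (Fin d) → EuclideanSpace ℝ (Fin d)) volume =
        ENNReal.ofReal |(LinearMap.det
          (L : EuclideanSpace ℝ (Fin d) →ₗ[ℝ] EuclideanSpace ℝ (Fin d)))⁻¹| • volume := h3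
    rw [h5, integral_smul_measure, hLdet, ENNReal.toReal_ofReal (abs_nonneg _), abs_inv,
      smul_eq_mul]
  rw [h1]
  simp only [hdens] at h2
  have h6 : |B.det|⁻¹ ≠ 0 := inv_ne_zero (abs_ne_zero.mpr hBd)
  refine mul_left_cancel₀ h6 ?_
  rw [← h2, ← integral_const_mul]
  refine integral_congr_ae (Eventually.of_forall fun x => ?_)
  simp only
  ring

theorem integrable_norm_sq_multivariateGaussian (D : Matrix (Fin d) (Fin d) ℝ) :
    Integrable (fun x : EuclideanSpace ℝ (Fin d) => ‖x‖ ^ 2) (multivariateGaussian 0 D) :=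
  (IsGaussian.memLp_two_id (μ := multivariateGaussian (0 : EuclideanSpace ℝ (Fin d)) D)).integrable_norm_pow
    two_ne_zero

theorem integral_norm_sq_multivariateGaussian {D : Matrix (Fin d) (Fin d) ℝ} (hD : D.PosSemidef) :
    ∫ x, ‖x‖ ^ 2 ∂multivariateGaussian (0 : EuclideanSpace ℝ (Fin d)) D = D.trace := by
  have hm : ∀ i, MemLp (fun x : EuclideanSpace ℝ (Fin d) => x i) 2 (multivariateGaussian 0 D) :=
    fun i => (IsGaussian.memLp_two_id (μ := multivariateGaussian (0 : EuclideanSpace ℝ (Fin d)) D)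
      ).continuousLinearMap_comp (EuclideanSpace.proj i : EuclideanSpace ℝ (Fin d) →L[ℝ] ℝ)
  simp only [EuclideanSpace.real_norm_sq_eq]
  rw [integral_finsetSum _ fun i _ => (hm i).integrable_sq, trace]
  refine Finset.sum_congr rfl fun i _ => ?_
  have h1 : ∫ x, x i ∂multivariateGaussian (0 : EuclideanSpace ℝ (Fin d)) D = 0 := by
    have h2 := ContinuousLinearMap.integral_comp_id_comm (μ := multivariateGaussian
      (0 : EuclideanSpace ℝ (Fin d)) D) IsGaussian.integrable_id
      (EuclideanSpace.proj i : EuclideanSpace ℝ (Fin d) →L[ℝ] ℝ)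
    rw [integral_id_multivariateGaussian, map_zero] at h2
    exact h2
  have h3 := variance_eval_multivariateGaussian (μ := (0 : EuclideanSpace ℝ (Fin d))) hD i
  rw [variance_of_integral_eq_zero (hm i).aestronglyMeasurable.aemeasurable h1] at h3
  exact h3

end GaussianDensity

/-! ### Weak limits and unbounded test functions. -/

section WeakLimit

variable {E ι : Type*} [TopologicalSpace E] [MeasurableSpace E] [BorelSpace E]
  {l : Filter ι} {μ : ι → Measure E} [∀ i, IsProbabilityMeasure (μ i)]
  {γ : Measure E} [IsProbabilityMeasure γ]

/-- Lower semicontinuity of the integral of nonnegative functions under weak limits. -/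
theorem eventually_integral_gt_of_weak
    (hw : ∀ f : E → ℝ, Continuous f → (∃ C, ∀ x, |f x| ≤ C) →
      Tendsto (fun i => ∫ x, f x ∂μ i) l (𝓝 (∫ x, f x ∂γ)))
    {g : E → ℝ} (hg : Continuous g) (hg0 : ∀ x, 0 ≤ g x) (hi : ∀ i, Integrable g (μ i))
    (hiγ : Integrable g γ) {c : ℝ} (hc : c < ∫ x, g x ∂γ) : ∀ᶠ i in l, c < ∫ x, g x ∂μ i := by
  have hb : ∀ (n : ℕ) x, |min (g x) n| ≤ n := fun n x => by
    rw [abs_of_nonneg (le_min (hg0 x) n.cast_nonneg)]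
    exact min_le_right _ _
  have hcont : ∀ n : ℕ, Continuous fun x => min (g x) n := fun n => hg.min continuous_const
  -- Truncation at height `n` makes weak convergence applicable, and the truncated integrals are
  -- lower bounds for the full ones.
  have h1 : Tendsto (fun n : ℕ => ∫ x, min (g x) n ∂γ) atTop (𝓝 (∫ x, g x ∂γ)) := by
    refine tendsto_integral_of_dominated_convergence g
      (fun n => (hcont n).aestronglyMeasurable) hiγ (fun n => Eventually.of_forall fun x => ?_)
      (Eventually.of_forall fun x => ?_)
    · rw [Real.norm_eq_abs, abs_of_nonneg (le_min (hg0 x) n.cast_nonneg)]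
      exact min_le_left _ _
    · refine tendsto_const_nhds.congr' ?_
      filter_upwards [eventually_ge_atTop ⌈g x⌉₊] with n hn
      exact (min_eq_left ((Nat.le_ceil _).trans (by exact_mod_cast hn))).symm
  obtain ⟨n, hn⟩ := (h1.eventually_const_lt hc).exists
  filter_upwards [(hw _ (hcont n) ⟨n, hb n⟩).eventually_const_lt hn] with i hi'
  refine hi'.trans_le (integral_mono_of_nonneg (Eventually.of_forall fun x =>
    le_min (hg0 x) n.cast_nonneg) (hi i) (Eventually.of_forall fun x => min_le_left _ _))

/-- Weak convergence together with the convergence of the integrals of a dominating function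
implies the convergence of the integrals. -/
theorem tendsto_integral_of_weak_of_dominated
    (hw : ∀ f : E → ℝ, Continuous f → (∃ C, ∀ x, |f x| ≤ C) →
      Tendsto (fun i => ∫ x, f x ∂μ i) l (𝓝 (∫ x, f x ∂γ)))
    {h f : E → ℝ} (hh : Continuous h) (hf : Continuous f) (hfh : ∀ x, |f x| ≤ h x)
    (hi : ∀ i, Integrable h (μ i)) (hiγ : Integrable h γ)
    (hlim : Tendsto (fun i => ∫ x, h x ∂μ i) l (𝓝 (∫ x, h x ∂γ))) :
    Tendsto (fun i => ∫ x, f x ∂μ i) l (𝓝 (∫ x, f x ∂γ)) := by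
  have hfi : ∀ {ν : Measure E}, Integrable h ν → Integrable f ν := fun hν =>
    hν.mono' hf.aestronglyMeasurable (Eventually.of_forall hfh)
  rw [Metric.tendsto_nhds]
  intro ε hε
  -- Lower semicontinuity for the nonnegative functions `h + f` and `h - f`, together with
  -- convergence for `h`, bounds the integrals of `f` from both sides.
  have h1 := eventually_integral_gt_of_weak hw (hh.add hf)
    (fun x => by simp only [Pi.add_apply]; linarith [neg_abs_le (f x), hfh x])
    (fun i => (hi i).add (hfi (hi i)))
    (hiγ.add (hfi hiγ)) (sub_lt_self _ (half_pos hε))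
  have h2 := eventually_integral_gt_of_weak hw (hh.sub hf)
    (fun x => by simp only [Pi.sub_apply]; linarith [le_abs_self (f x), hfh x])
    (fun i => (hi i).sub (hfi (hi i)))
    (hiγ.sub (hfi hiγ)) (sub_lt_self _ (half_pos hε))
  have h3 := hlim.eventually_lt_const (lt_add_of_pos_right _ (half_pos hε))
  filter_upwards [h1, h2, h3] with i e1 e2 e3
  rw [integral_add' hiγ (hfi hiγ), integral_add' (hi i) (hfi (hi i))] at e1
  rw [integral_sub' hiγ (hfi hiγ), integral_sub' (hi i) (hfi (hi i))] at e2
  rw [Real.dist_eq, abs_lt]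
  constructor <;> linarith

end WeakLimit

/-! ### Rescaled lattice measures. -/

section LatticeMeasure

open scoped InnerProductSpace

variable {d : ℕ}

/-- The rescaled measure with given weights of the lattice points. -/
def latticeMeasure (ρ : CubicLattice d → ℝ) (c : ℝ) : Measure (EuclideanSpace ℝ (Fin d)) :=
  Measure.sum fun x : CubicLattice d => ENNReal.ofReal (ρ x) • Measure.dirac (c • latticeVec x)

variable {ρ : CubicLattice d → ℝ}

theorem isProbabilityMeasure_latticeMeasure (h0 : ∀ x, 0 ≤ ρ x) (h1 : HasSum ρ 1) (c : ℝ) :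
    IsProbabilityMeasure (latticeMeasure ρ c) := by
  constructor
  rw [latticeMeasure, Measure.sum_apply _ MeasurableSet.univ]
  simp only [Measure.smul_apply, measure_univ, smul_eq_mul, mul_one]
  rw [← ENNReal.ofReal_tsum_of_nonneg h0 h1.summable, h1.tsum_eq, ENNReal.ofReal_one]

theorem integrable_latticeMeasure_iff (h0 : ∀ x, 0 ≤ ρ x) (c : ℝ)
    {f : EuclideanSpace ℝ (Fin d) → ℝ} (hf : Continuous f) :
    Integrable f (latticeMeasure ρ c) ↔ Summable fun x => f (c • latticeVec x) * ρ x := by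
  rw [Integrable, and_iff_right hf.aestronglyMeasurable, HasFiniteIntegral, latticeMeasure,
    lintegral_sum_measure, ← summable_abs_iff]
  simp only [lintegral_smul_measure, lintegral_dirac' _ hf.measurable.enorm, smul_eq_mul]
  have e : ∀ x, ENNReal.ofReal (ρ x) * ‖f (c • latticeVec x)‖ₑ =
      ENNReal.ofReal |f (c • latticeVec x) * ρ x| := fun x => by
    rw [abs_mul, abs_of_nonneg (h0 x), ENNReal.ofReal_mul (abs_nonneg _), mul_comm,
      Real.enorm_eq_ofReal_abs]
  simp only [e]
  constructor
  · intro h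
    have := ENNReal.summable_toReal h.ne
    simpa only [ENNReal.toReal_ofReal (abs_nonneg _)] using this
  · intro h
    rw [← ENNReal.ofReal_tsum_of_nonneg (fun x => abs_nonneg _) h]
    exact ENNReal.ofReal_lt_top

theorem integral_latticeMeasure {F : Type*} [NormedAddCommGroup F] [NormedSpace ℝ F]
    [CompleteSpace F] (h0 : ∀ x, 0 ≤ ρ x) (c : ℝ) {f : EuclideanSpace ℝ (Fin d) → F} (hf : StronglyMeasurable f)
    (hi : Integrable f (latticeMeasure ρ c)) :
    ∫ r, f r ∂latticeMeasure ρ c = ∑' x, ρ x • f (c • latticeVec x) := by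
  rw [latticeMeasure, ← (hasSum_integral_measure hi).tsum_eq]
  refine tsum_congr fun x => ?_
  rw [integral_smul_measure, integral_dirac' _ _ hf, ENNReal.toReal_ofReal (h0 x)]

theorem charFun_latticeMeasure (h0 : ∀ x, 0 ≤ ρ x) (h1 : HasSum ρ 1) (c : ℝ)
    (κ : EuclideanSpace ℝ (Fin d)) :
    charFun (latticeMeasure ρ c) κ = latticeCharFun ρ (c • κ.ofLp) := by
  have := isProbabilityMeasure_latticeMeasure h0 h1 c
  have hc : Continuous fun r : EuclideanSpace ℝ (Fin d) => Complex.exp (⟪r, κ⟫_ℝ * Complex.I) := by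
    fun_prop
  rw [charFun_apply, integral_latticeMeasure h0 c hc.stronglyMeasurable, latticeCharFun]
  · refine tsum_congr fun x => ?_
    rw [Complex.real_smul, mul_comm, latticePhase]
    congr 2
    rw [mul_comm]
    congr 2
    simp only [PiLp.inner_apply, PiLp.smul_apply, latticeVec, smul_eq_mul, RCLike.inner_apply,
      conj_trivial, Pi.smul_apply]
    exact Finset.sum_congr rfl fun j _ => by ring
  · refine Integrable.of_bound hc.aestronglyMeasurable 1 (Eventually.of_forall fun r => ?_)
    rw [Complex.norm_exp_ofReal_mul_I]

end LatticeMeasure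

/-! ### The central limit theorem for bounded functions. -/

section CentralLimit

open scoped InnerProductSpace

variable {d : ℕ} {D : Matrix (Fin d) (Fin d) ℝ} {ρ : ℝ≥0 → CubicLattice d → ℝ}

theorem conj_latticeCharFun (ρ : CubicLattice d → ℝ) (k : Fin d → ℝ) :
    starRingEnd ℂ (latticeCharFun ρ k) = latticeCharFun ρ (-k) := by
  rw [latticeCharFun, latticeCharFun, Complex.conj_tsum]
  simp only [map_mul, conj_latticePhase, Complex.conj_ofReal]

theorem continuous_latticeCharFun {ρ : CubicLattice d → ℝ} (h : Summable ρ) :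
    Continuous (latticeCharFun ρ) := by
  refine continuous_tsum (u := fun x => |ρ x|) (fun x => ?_) h.abs fun x k => ?_
  · unfold latticePhase
    fun_prop
  · rw [norm_mul, norm_latticePhase, one_mul, Complex.norm_real, Real.norm_eq_abs]

theorem latticeCharFun_zero {ρ : CubicLattice d → ℝ} (h : HasSum ρ 1) : latticeCharFun ρ 0 = 1 := by
  have h1 : latticeCharFun ρ 0 = ((∑' x, ρ x : ℝ) : ℂ) := by
    simp [latticeCharFun, Complex.ofReal_tsum]
  rw [h1, h.tsum_eq, Complex.ofReal_one]

namespace IsDiffusive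

/-- With `s = σ / √t` the exponent `ν s² t` is constant, and the error `|s| + |s|³ t` is of order `1
/ √t`. -/
theorem tendsto_exp {κ : Fin d → ℝ} {ν : ℂ} {s₀ C : ℝ} (hs₀ : 0 < s₀) (h : IsDiffusive D ρ)
    (hC : ∀ s : ℝ, |s| ≤ s₀ → ∀ t : ℝ≥0,
      ‖latticeCharFun (ρ t) (s • κ) - Complex.exp (-(ν * s ^ 2 * (t : ℝ))) *
        latticeCharFun (ρ 0) (s • κ)‖ ≤ C * (|s| + |s| ^ 3 * t)) (σ : ℝ) :
    Tendsto (fun t : ℝ≥0 => latticeCharFun (ρ t) ((σ * (Real.sqrt t)⁻¹) • κ)) atTop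
      (𝓝 (Complex.exp (-(ν * σ ^ 2)))) := by
  have hinv : Tendsto (fun t : ℝ≥0 => (Real.sqrt t)⁻¹) atTop (𝓝 0) :=
    tendsto_inv_atTop_zero.comp (Real.tendsto_sqrt_atTop.comp (NNReal.tendsto_coe_atTop.mpr tendsto_id))
  have hs : Tendsto (fun t : ℝ≥0 => σ * (Real.sqrt t)⁻¹) atTop (𝓝 0) := by
    simpa using hinv.const_mul σ
  have h0 : Tendsto (fun t : ℝ≥0 => latticeCharFun (ρ 0) ((σ * (Real.sqrt t)⁻¹) • κ)) atTop
      (𝓝 1) := by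
    have hc := (continuous_latticeCharFun (h.hasSum_one 0).summable).tendsto (0 : Fin d → ℝ)
    rw [latticeCharFun_zero (h.hasSum_one 0)] at hc
    refine hc.comp ?_
    simpa using hs.smul_const κ
  have h1 := h0.const_mul (Complex.exp (-(ν * σ ^ 2)))
  rw [mul_one] at h1
  have h2 : Tendsto (fun t : ℝ≥0 => latticeCharFun (ρ t) ((σ * (Real.sqrt t)⁻¹) • κ) -
      Complex.exp (-(ν * σ ^ 2)) * latticeCharFun (ρ 0) ((σ * (Real.sqrt t)⁻¹) • κ)) atTop
      (𝓝 0) := by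
    have hb : Tendsto (fun t : ℝ≥0 => C * ((|σ| + |σ| ^ 3) * (Real.sqrt t)⁻¹)) atTop (𝓝 0) := by
      simpa using (hinv.const_mul (|σ| + |σ| ^ 3)).const_mul C
    refine squeeze_zero_norm' ?_ hb
    have hsmall : ∀ᶠ t : ℝ≥0 in atTop, |σ * (Real.sqrt t)⁻¹| < s₀ := by
      have := hs.abs
      rw [abs_zero] at this
      exact this.eventually_lt_const hs₀
    filter_upwards [hsmall, eventually_gt_atTop 0] with t ht ht0
    have hq : 0 < Real.sqrt t := Real.sqrt_pos.mpr ht0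
    have hqq : Real.sqrt t ^ 2 = t := Real.sq_sqrt t.coe_nonneg
    have h3 := hC _ ht.le t
    have e1 : (ν * ((σ * (Real.sqrt t)⁻¹ : ℝ) : ℂ) ^ 2 * ((t : ℝ) : ℂ)) = ν * σ ^ 2 := by
      have : (((σ * (Real.sqrt t)⁻¹) ^ 2 * t : ℝ) : ℂ) = ((σ ^ 2 : ℝ) : ℂ) := by
        congr 1
        have ht' : (t : ℝ) ≠ 0 := by exact_mod_cast ht0.ne'
        rw [mul_pow, inv_pow, hqq]
        field_simp
      push_cast at this
      rw [mul_assoc]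
      push_cast
      rw [this]
    rw [e1] at h3
    refine h3.trans_eq ?_
    rw [abs_mul, abs_of_pos (inv_pos.mpr hq)]
    have e2 : (Real.sqrt t)⁻¹ ^ 3 * (t : ℝ) = (Real.sqrt t)⁻¹ := by
      generalize hQ : Real.sqrt t = Q at hq hqq
      rw [← hqq]
      field_simp
    rw [mul_pow, mul_assoc, e2, ← add_mul]
  have h4 := h2.add h1
  rw [zero_add] at h4
  exact h4.congr fun t => by ring

/-- The weights are real, so the characteristic function at `-k` is the conjugate of that at `k`.
The limit depends on `σ²` only and thus equals its conjugate for every `σ`, which forces `ν` to be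
real. -/
theorem im_eq_zero {κ : Fin d → ℝ} {ν : ℂ} {s₀ C : ℝ} (hs₀ : 0 < s₀) (h : IsDiffusive D ρ)
    (hC : ∀ s : ℝ, |s| ≤ s₀ → ∀ t : ℝ≥0,
      ‖latticeCharFun (ρ t) (s • κ) - Complex.exp (-(ν * s ^ 2 * (t : ℝ))) *
        latticeCharFun (ρ 0) (s • κ)‖ ≤ C * (|s| + |s| ^ 3 * t)) : ν.im = 0 := by
  have hsin : ∀ σ : ℝ, Real.sin (ν.im * σ ^ 2) = 0 := fun σ => by
    have h1 := h.tendsto_exp hs₀ hC σ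
    have h2 := h.tendsto_exp hs₀ hC (-σ)
    have h3 := (Complex.continuous_conj.tendsto _).comp h1
    have h4 : (fun t : ℝ≥0 => latticeCharFun (ρ t) ((-σ * (Real.sqrt t)⁻¹) • κ)) =
        (starRingEnd ℂ) ∘ fun t : ℝ≥0 => latticeCharFun (ρ t) ((σ * (Real.sqrt t)⁻¹) • κ) := by
      ext t
      rw [Function.comp_apply, conj_latticeCharFun, neg_mul, neg_smul]
    rw [h4] at h2
    have h5 := tendsto_nhds_unique h2 h3
    have h6 := congrArg Complex.im h5
    have e : -(ν * ((-σ : ℝ) : ℂ) ^ 2) = -(ν * ((σ ^ 2 : ℝ) : ℂ)) := by push_cast; ring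
    have e' : -(ν * (σ : ℂ) ^ 2) = -(ν * ((σ ^ 2 : ℝ) : ℂ)) := by push_cast; ring
    rw [e, e', Complex.conj_im, Complex.exp_im, Complex.neg_im, Complex.im_mul_ofReal,
      Real.sin_neg] at h6
    have h7 := Real.exp_pos (-(ν * ((σ ^ 2 : ℝ) : ℂ))).re
    have h8 : Real.exp (-(ν * ((σ ^ 2 : ℝ) : ℂ))).re * Real.sin (ν.im * σ ^ 2) = 0 := by linarith
    exact (mul_eq_zero.mp h8).resolve_left h7.ne'
  by_contra hne
  -- For this `σ` the argument of the sine is `π / 2` or `-π / 2`.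
  have h1 := hsin (Real.sqrt (Real.pi / 2 / |ν.im|))
  rw [Real.sq_sqrt (by positivity)] at h1
  rcases abs_choice ν.im with h2 | h2
  · rw [h2, mul_div_cancel₀ _ hne, Real.sin_pi_div_two] at h1
    exact one_ne_zero h1
  · rw [h2, div_neg, mul_neg, mul_div_cancel₀ _ hne, Real.sin_neg, Real.sin_pi_div_two] at h1
    norm_num at h1

theorem tendsto_latticeCharFun (h : IsDiffusive D ρ) (κ : Fin d → ℝ) :
    Tendsto (fun t : ℝ≥0 => latticeCharFun (ρ t) ((Real.sqrt t)⁻¹ • κ)) atTop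
      (𝓝 (Complex.exp (-((κ ⬝ᵥ D.mulVec κ / 2 : ℝ) : ℂ)))) := by
  obtain ⟨ν, hν, s₀, hs₀, ⟨C, hC⟩, -⟩ := h.charFun κ
  have h1 := h.tendsto_exp hs₀ hC 1
  have h2 : ν = ((κ ⬝ᵥ D.mulVec κ / 2 : ℝ) : ℂ) := by
    rw [← hν]
    exact Complex.ext rfl (by rw [h.im_eq_zero hs₀ hC, Complex.ofReal_im])
  simpa only [one_mul, Complex.ofReal_one, one_pow, mul_one, h2] using h1

theorem isProbabilityMeasure (h : IsDiffusive D ρ) (t : ℝ≥0) (c : ℝ) :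
    IsProbabilityMeasure (latticeMeasure (ρ t) c) :=
  isProbabilityMeasure_latticeMeasure (h.nonneg t) (h.hasSum_one t) c

/-- Lévy's continuity theorem, applied along arbitrary sequences of times. -/
theorem tendsto_integral (h : IsDiffusive D ρ) (hD : D.PosDef)
    {f : EuclideanSpace ℝ (Fin d) → ℝ} (hf : Continuous f)
    (hb : ∃ C, ∀ r, |f r| ≤ C) :
    Tendsto (fun t : ℝ≥0 => ∫ r, f r ∂latticeMeasure (ρ t) (Real.sqrt t)⁻¹) atTop
      (𝓝 (∫ r, f r ∂multivariateGaussian 0 D)) := by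
  refine tendsto_of_seq_tendsto fun τ hτ => ?_
  let μ : ℕ → ProbabilityMeasure (EuclideanSpace ℝ (Fin d)) := fun n =>
    ⟨latticeMeasure (ρ (τ n)) (Real.sqrt (τ n))⁻¹, h.isProbabilityMeasure _ _⟩
  let γ : ProbabilityMeasure (EuclideanSpace ℝ (Fin d)) := ⟨multivariateGaussian 0 D, inferInstance⟩
  have hμ : Tendsto μ atTop (𝓝 γ) := by
    refine ProbabilityMeasure.tendsto_of_tendsto_charFun fun κ => ?_
    have h1 := (h.tendsto_latticeCharFun κ.ofLp).comp hτ
    have h2 : MeasureTheory.charFun (γ : Measure (EuclideanSpace ℝ (Fin d))) κ =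
        Complex.exp (-((κ.ofLp ⬝ᵥ D.mulVec κ.ofLp / 2 : ℝ) : ℂ)) := by
      change MeasureTheory.charFun (multivariateGaussian 0 D) κ = _
      rw [charFun_multivariateGaussian hD.posSemidef, inner_zero_right]
      push_cast
      ring_nf
    rw [h2]
    refine h1.congr fun n => ?_
    exact (charFun_latticeMeasure (h.nonneg _) (h.hasSum_one _) _ κ).symm
  obtain ⟨C, hC⟩ := hb
  exact (ProbabilityMeasure.tendsto_iff_forall_integral_tendsto.mp hμ)
    (BoundedContinuousFunction.ofNormedAddCommGroup f hf C hC)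

end IsDiffusive

end CentralLimit

/-! ### The second moment. -/

section SecondMoment

open Matrix

variable {d : ℕ} {D : Matrix (Fin d) (Fin d) ℝ}

/-- This is a second difference of the characteristic function at zero. For nonnegative weights all
terms are nonnegative, which allows the comparison with the second moment. -/
theorem hasSum_one_sub_cos {ρ : CubicLattice d → ℝ} (h : HasSum ρ 1) (κ : Fin d → ℝ) (s : ℝ) :
    HasSum (fun x => (2 - 2 * Real.cos (s * ∑ j, κ j * x j)) * ρ x)
      (2 - (latticeCharFun ρ (s • κ) + latticeCharFun ρ (-(s • κ))).re) := by
  have h1 : ∀ k : Fin d → ℝ, HasSum (fun x => latticePhase k x * ρ x) (latticeCharFun ρ k) :=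
    fun k => by
      refine (Summable.of_norm_bounded (g := fun x => |ρ x|) h.summable.abs fun x => ?_).hasSum
      rw [norm_mul, norm_latticePhase, one_mul, Complex.norm_real, Real.norm_eq_abs]
  have h2 := (h.mul_left 2).sub (Complex.hasSum_re ((h1 (s • κ)).add (h1 (-(s • κ)))))
  rw [mul_one] at h2
  refine h2.congr_fun fun x => ?_
  rw [← add_mul, ← conj_latticePhase, Complex.add_conj, latticePhase, ← Complex.ofReal_mul,
    Complex.ofReal_re, mul_comm Complex.I, Complex.exp_ofReal_mul_I_re, Finset.mul_sum]
  simp only [Pi.smul_apply, smul_eq_mul, mul_assoc]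
  ring

/-- `2 - 2 cos (s θ)` is the square of `2 sin (s θ / 2)`, whose difference quotient at zero tends to
`θ`. -/
theorem tendsto_one_sub_cos_div_sq (θ : ℝ) :
    Tendsto (fun s : ℝ => (s ^ 2)⁻¹ * (2 - 2 * Real.cos (s * θ))) (𝓝[>] 0) (𝓝 (θ ^ 2)) := by
  have h1 : HasDerivAt (fun s : ℝ => 2 * Real.sin (s * (θ / 2))) θ 0 := by
    have := (((hasDerivAt_id (0 : ℝ)).mul_const (θ / 2)).sin).const_mul 2
    convert! this using 1
    simp
    ring
  have h2 := (hasDerivAt_iff_tendsto_slope_zero.mp h1).mono_left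
    (nhdsWithin_mono 0 (fun s (hs : (0 : ℝ) < s) => hs.ne'))
  refine (h2.pow 2).congr fun s => ?_
  have e : s * θ = 2 * (s * (θ / 2)) := by ring
  rw [e, Real.cos_two_mul, Real.cos_sq']
  simp only [zero_add, zero_mul, Real.sin_zero, mul_zero, sub_zero, smul_eq_mul]
  rw [mul_pow, inv_pow]
  ring

/-- Fatou's argument: over a finite set the limit `s → 0` is taken termwise, and the resulting bound
does not depend on the set. So finiteness of the moment is obtained, not assumed. -/
theorem summable_sq_mul_of_le {ρ θ : CubicLattice d → ℝ} (h0 : ∀ x, 0 ≤ ρ x) {G : ℝ → ℝ}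
    {s₀ B C : ℝ} (hs₀ : 0 < s₀)
    (hG : ∀ s, HasSum (fun x => (2 - 2 * Real.cos (s * θ x)) * ρ x) (G s))
    (hle : ∀ s, 0 < s → s ≤ s₀ → G s ≤ s ^ 2 * (B + C * s)) :
    Summable (fun x => θ x ^ 2 * ρ x) ∧ ∑' x, θ x ^ 2 * ρ x ≤ B := by
  have hF : ∀ F : Finset (CubicLattice d), ∑ x ∈ F, θ x ^ 2 * ρ x ≤ B := fun F => by
    have h1 : Tendsto (fun s : ℝ => ∑ x ∈ F, (s ^ 2)⁻¹ * (2 - 2 * Real.cos (s * θ x)) * ρ x)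
        (𝓝[>] 0) (𝓝 (∑ x ∈ F, θ x ^ 2 * ρ x)) :=
      tendsto_finsetSum _ fun x _ => (tendsto_one_sub_cos_div_sq (θ x)).mul_const _
    have h2 : Tendsto (fun s : ℝ => B + C * s) (𝓝[>] 0) (𝓝 B) := by
      have : Continuous fun s : ℝ => B + C * s := by fun_prop
      simpa using (this.tendsto 0).mono_left nhdsWithin_le_nhds
    refine le_of_tendsto_of_tendsto h1 h2 ?_
    filter_upwards [Ioc_mem_nhdsGT hs₀] with s hs
    simp only [mul_assoc]
    rw [← Finset.mul_sum, inv_mul_le_iff₀ (pow_pos hs.1 2)]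
    refine (sum_le_hasSum F (fun x _ => mul_nonneg ?_ (h0 x)) (hG s)).trans (hle s hs.1 hs.2)
    linarith [Real.cos_le_one (s * θ x)]
  have hs := summable_of_sum_le (fun x => mul_nonneg (sq_nonneg (θ x)) (h0 x)) hF
  exact ⟨hs, hs.tsum_le_of_sum_le hF⟩

theorem hasSum_one_sub_cos_le {ρ θ : CubicLattice d → ℝ} (h0 : ∀ x, 0 ≤ ρ x) {s G : ℝ}
    (hG : HasSum (fun x => (2 - 2 * Real.cos (s * θ x)) * ρ x) G)
    (hs : Summable fun x => θ x ^ 2 * ρ x) : G ≤ s ^ 2 * ∑' x, θ x ^ 2 * ρ x := by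
  refine hasSum_le (fun x => ?_) hG (hs.hasSum.mul_left (s ^ 2))
  rw [← mul_assoc, ← mul_pow]
  refine mul_le_mul_of_nonneg_right ?_ (h0 x)
  linarith [Real.one_sub_sq_div_two_le_cos (x := s * θ x)]

namespace IsDiffusive

variable {ρ : ℝ≥0 → CubicLattice d → ℝ}

/-- The error `C (s² + s³ t)` of the symmetrized characteristic function, divided by `s²`, tends to
the constant `C` as `s → 0` at fixed `t`; so the deviation from linear growth is bounded uniformly
in time. The upper bound uses Fatou's argument, the lower one `2 - 2 cos θ ≤ θ²`. -/
theorem exists_sq_moment_bound (h : IsDiffusive D ρ) (hD : D.PosSemidef)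
    (h2 : Summable fun x => (1 + ‖latticeVec x‖ ^ 2) * ρ 0 x) (κ : Fin d → ℝ) :
    ∃ C, ∀ t : ℝ≥0, Summable (fun x => (∑ j, κ j * x j) ^ 2 * ρ t x) ∧
      |∑' x, (∑ j, κ j * x j) ^ 2 * ρ t x - t * (κ ⬝ᵥ D.mulVec κ)| ≤ C := by
  obtain ⟨ν, hν, s₀, hs₀, ⟨C₁, hC₁⟩, hsym⟩ := h.charFun κ
  obtain ⟨C, hC⟩ := hsym h2
  have him := h.im_eq_zero hs₀ hC₁
  set n : ℝ := κ ⬝ᵥ D.mulVec κ / 2 with hn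
  have hνn : ν = (n : ℂ) := Complex.ext hν (by rw [him, Complex.ofReal_im])
  have hn0 : 0 ≤ n := by
    have := hD.dotProduct_mulVec_nonneg κ
    rw [star_trivial] at this
    positivity
  have hM0 : Summable fun x => (∑ j, κ j * x j) ^ 2 * ρ 0 x := by
    refine Summable.of_nonneg_of_le (fun x => mul_nonneg (sq_nonneg _) (h.nonneg 0 x)) (fun x => ?_)
      (h2.mul_left (∑ j, κ j ^ 2))
    rw [← mul_assoc]
    refine mul_le_mul_of_nonneg_right ((sq_sum_mul_le κ x).trans ?_) (h.nonneg 0 x)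
    gcongr
    linarith
  set M₀ : ℝ := ∑' x, (∑ j, κ j * x j) ^ 2 * ρ 0 x with hM₀
  set A : ℝ≥0 → ℝ → ℝ := fun t s =>
    (latticeCharFun (ρ t) (s • κ) + latticeCharFun (ρ t) (-(s • κ))).re with hA
  have hG : ∀ t s, HasSum (fun x => (2 - 2 * Real.cos (s * ∑ j, κ j * x j)) * ρ t x)
      (2 - A t s) := fun t s => hasSum_one_sub_cos (h.hasSum_one t) κ s
  have hA2 : ∀ s, A 0 s ≤ 2 := fun s => by
    have := (hG 0 s).nonneg fun x => mul_nonneg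
      (by linarith [Real.cos_le_one (s * ∑ j, κ j * x j)]) (h.nonneg 0 x)
    linarith
  have hA0 : ∀ s, 2 - A 0 s ≤ s ^ 2 * M₀ := fun s =>
    hasSum_one_sub_cos_le (h.nonneg 0) (hG 0 s) hM0
  have hAt : ∀ (t : ℝ≥0) s, 0 < s → s ≤ s₀ →
      |A t s - Real.exp (-(n * s ^ 2 * t)) * A 0 s| ≤ C * (s ^ 2 + s ^ 3 * t) := fun t s h0 hs => by
    have h3 := hC s (by rwa [abs_of_pos h0]) t
    rw [abs_of_pos h0] at h3
    refine le_trans ?_ h3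
    have e : Complex.exp (-(ν * s ^ 2 * (t : ℝ))) = (Real.exp (-(n * s ^ 2 * t)) : ℝ) := by
      rw [hνn]
      push_cast
      rfl
    rw [e]
    refine le_trans (le_of_eq ?_) (Complex.abs_re_le_norm _)
    rw [Complex.sub_re, Complex.re_ofReal_mul]
  refine ⟨|M₀| + C + |C|, fun t => ?_⟩
  obtain ⟨hs, hup⟩ := summable_sq_mul_of_le (θ := fun x : CubicLattice d => ∑ j, κ j * x j)
    (B := 2 * n * t + M₀ + C) (C := C * t) (h.nonneg t) hs₀ (hG t) fun s h0 hs => by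
      have h3 := (abs_le.mp (hAt t s h0 hs)).1
      have h4 : 1 - Real.exp (-(n * s ^ 2 * t)) ≤ n * s ^ 2 * t := by
        linarith [Real.add_one_le_exp (-(n * s ^ 2 * t))]
      have h5 : Real.exp (-(n * s ^ 2 * t)) ≤ 1 := Real.exp_le_one_iff.mpr (by
        have := t.coe_nonneg
        have : 0 ≤ n * s ^ 2 * t := by positivity
        linarith)
      have h6 : Real.exp (-(n * s ^ 2 * t)) * (2 - A 0 s) ≤ 1 * (2 - A 0 s) :=
        mul_le_mul_of_nonneg_right h5 (by linarith [hA2 s])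
      nlinarith [hA0 s]
  refine ⟨hs, ?_⟩
  set M : ℝ := ∑' x, (∑ j, κ j * x j) ^ 2 * ρ t x with hM
  have hlow : 2 * n * t - C ≤ M := by
    -- The bound `exp (-a) ≤ 1 / (1 + a)` replaces the exponential by a rational expression from
    -- which `s²` factors out exactly.
    have h3 : Tendsto (fun s : ℝ => 2 * n * t / (1 + n * s ^ 2 * t) - C - C * t * s) (𝓝[>] 0)
        (𝓝 (2 * n * t - C)) := by
      have : ContinuousAt (fun s : ℝ => 2 * n * t / (1 + n * s ^ 2 * t) - C - C * t * s) 0 := by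
        refine ContinuousAt.sub (ContinuousAt.sub (ContinuousAt.div ?_ ?_ ?_) ?_) ?_
        · fun_prop
        · fun_prop
        · simp
        · fun_prop
        · fun_prop
      have h4 := this.tendsto.mono_left (nhdsWithin_le_nhds (s := Set.Ioi 0))
      simpa using h4
    refine le_of_tendsto h3 ?_
    filter_upwards [Ioc_mem_nhdsGT hs₀] with s hs'
    have h4 := (abs_le.mp (hAt t s hs'.1 hs'.2)).2
    have h5 := hasSum_one_sub_cos_le (h.nonneg t) (hG t s) hs
    have ha : 0 ≤ n * s ^ 2 * t := by
      have := t.coe_nonneg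
      positivity
    have h6 : Real.exp (-(n * s ^ 2 * t)) ≤ 1 / (1 + n * s ^ 2 * t) := by
      rw [Real.exp_neg, ← one_div]
      exact one_div_le_one_div_of_le (by linarith) (by linarith [Real.add_one_le_exp (n * s ^ 2 * t)])
    have h7 : Real.exp (-(n * s ^ 2 * t)) * A 0 s ≤ Real.exp (-(n * s ^ 2 * t)) * 2 :=
      mul_le_mul_of_nonneg_left (hA2 s) (Real.exp_pos _).le
    have h8 : 1 - 1 / (1 + n * s ^ 2 * t) = s ^ 2 * (n * t / (1 + n * s ^ 2 * t)) := by
      have : 1 + n * s ^ 2 * t ≠ 0 := by positivity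
      field_simp
      ring
    have h9 : s ^ 2 * (2 * n * t / (1 + n * s ^ 2 * t) - C - C * t * s) ≤ s ^ 2 * M := by
      have : s ^ 2 * (2 * n * t / (1 + n * s ^ 2 * t) - C - C * t * s) =
          2 * (1 - 1 / (1 + n * s ^ 2 * t)) - C * (s ^ 2 + s ^ 3 * t) := by
        rw [h8]
        ring
      rw [this]
      linarith
    exact le_of_mul_le_mul_left h9 (pow_pos hs'.1 2)
  have hK : κ ⬝ᵥ D.mulVec κ = 2 * n := by rw [hn]; ring
  rw [hK, abs_le]
  constructor <;> linarith [le_abs_self C, neg_abs_le C, le_abs_self M₀, abs_nonneg M₀]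

theorem exists_norm_sq_moment_bound (h : IsDiffusive D ρ) (hD : D.PosSemidef)
    (h2 : Summable fun x => (1 + ‖latticeVec x‖ ^ 2) * ρ 0 x) :
    ∃ C, ∀ t : ℝ≥0, Summable (fun x => ‖latticeVec x‖ ^ 2 * ρ t x) ∧
      |∑' x, ‖latticeVec x‖ ^ 2 * ρ t x - t * D.trace| ≤ C := by
  choose C hC using fun j => h.exists_sq_moment_bound hD h2 (Pi.single j 1)
  have e1 : ∀ (j : Fin d) (x : CubicLattice d),
      ∑ i, (Pi.single j (1 : ℝ) : Fin d → ℝ) i * (x i : ℝ) = x j := fun j x => by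
    simp [Pi.single_apply]
  have e2 : ∀ j : Fin d, (Pi.single j 1 : Fin d → ℝ) ⬝ᵥ D.mulVec (Pi.single j 1) = D j j :=
    fun j => by simp
  simp only [e1, e2] at hC
  refine ⟨∑ j, C j, fun t => ?_⟩
  have hs := hasSum_sum fun j (_ : j ∈ Finset.univ) => (hC j t).1.hasSum
  have e3 : ∀ x, ‖latticeVec x‖ ^ 2 * ρ t x = ∑ j, (x j : ℝ) ^ 2 * ρ t x := fun x => by
    rw [norm_latticeVec_sq, Finset.sum_mul]
  simp only [e3]
  refine ⟨hs.summable, ?_⟩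
  rw [hs.tsum_eq, Matrix.trace, Finset.mul_sum, ← Finset.sum_sub_distrib]
  exact (Finset.abs_sum_le_sum_abs _ _).trans (Finset.sum_le_sum fun j _ => (hC j t).2)

theorem tendsto_norm_sq_moment (h : IsDiffusive D ρ) (hD : D.PosSemidef)
    (h2 : Summable fun x => (1 + ‖latticeVec x‖ ^ 2) * ρ 0 x) :
    Tendsto (fun t : ℝ≥0 => 1 / (t : ℝ) * ∑' x, ‖latticeVec x‖ ^ 2 * ρ t x) atTop
      (𝓝 D.trace) := by
  obtain ⟨C, hC⟩ := h.exists_norm_sq_moment_bound hD h2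
  have h0 : Tendsto (fun t : ℝ≥0 => (t : ℝ)⁻¹ * C) atTop (𝓝 0) := by
    simpa using (tendsto_inv_atTop_zero.comp
      (NNReal.tendsto_coe_atTop.mpr tendsto_id)).mul_const C
  rw [tendsto_iff_norm_sub_tendsto_zero]
  refine squeeze_zero' (Eventually.of_forall fun _ => norm_nonneg _) ?_ h0
  filter_upwards [eventually_gt_atTop 0] with t ht
  have ht' : (0 : ℝ) < t := ht
  have e : 1 / (t : ℝ) * ∑' x, ‖latticeVec x‖ ^ 2 * ρ t x - D.trace =
      (t : ℝ)⁻¹ * (∑' x, ‖latticeVec x‖ ^ 2 * ρ t x - t * D.trace) := by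
    field_simp
  rw [e, norm_mul, Real.norm_of_nonneg (inv_nonneg.mpr ht'.le)]
  exact mul_le_mul_of_nonneg_left (hC t).2 (inv_nonneg.mpr ht'.le)

end IsDiffusive

end SecondMoment

/-! ### Quadratically bounded test functions. -/

section QuadraticallyBounded

namespace IsDiffusive

variable {d : ℕ} {D : Matrix (Fin d) (Fin d) ℝ} {ρ : ℝ≥0 → CubicLattice d → ℝ}

/-- The central limit theorem for a test function that is integrable with respect to the rescaled
densities. -/
theorem tendsto_tsum (h : IsDiffusive D ρ) (hD : D.PosDef) {f : EuclideanSpace ℝ (Fin d) → ℝ}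
    (hf : Continuous f)
    (hi : ∀ t : ℝ≥0, Summable fun x => f ((Real.sqrt t)⁻¹ • latticeVec x) * ρ t x)
    (hlim : Tendsto (fun t : ℝ≥0 => ∫ r, f r ∂latticeMeasure (ρ t) (Real.sqrt t)⁻¹) atTop
      (𝓝 (∫ r, f r ∂multivariateGaussian 0 D))) :
    Tendsto (fun t : ℝ≥0 => ∑' x, f ((Real.sqrt t)⁻¹ • latticeVec x) * ρ t x) atTop
      (𝓝 (∫ r, f r * gaussianDensity D r)) := by
  rw [← integral_multivariateGaussian hD hf]
  refine hlim.congr fun t => ?_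
  rw [integral_latticeMeasure (h.nonneg t) _ hf.stronglyMeasurable
    ((integrable_latticeMeasure_iff (h.nonneg t) _ hf).mpr (hi t))]
  exact tsum_congr fun x => by rw [smul_eq_mul, mul_comm]

theorem summable_of_bounded (h : IsDiffusive D ρ) {f : EuclideanSpace ℝ (Fin d) → ℝ}
    (hb : ∃ C, ∀ r, |f r| ≤ C) (t : ℝ≥0) :
    Summable fun x => f ((Real.sqrt t)⁻¹ • latticeVec x) * ρ t x := by
  obtain ⟨C, hC⟩ := hb
  refine Summable.of_norm_bounded (g := fun x => C * ρ t x)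
    ((h.hasSum_one t).summable.mul_left C) fun x => ?_
  rw [Real.norm_eq_abs, abs_mul, abs_of_nonneg (h.nonneg t x)]
  exact mul_le_mul_of_nonneg_right (hC _) (h.nonneg t x)

theorem summable_quadratic (h : IsDiffusive D ρ)
    (hs : ∀ t, Summable fun x => ‖latticeVec x‖ ^ 2 * ρ t x) (C : ℝ) (t : ℝ≥0) :
    HasSum (fun x => C * (1 + ‖(Real.sqrt t)⁻¹ • latticeVec x‖ ^ 2) * ρ t x)
      (C * (1 + 1 / (t : ℝ) * ∑' x, ‖latticeVec x‖ ^ 2 * ρ t x)) := by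
  have h1 := ((h.hasSum_one t).add ((hs t).hasSum.mul_left (1 / (t : ℝ)))).mul_left C
  refine h1.congr_fun fun x => ?_
  -- The square of `(√t)⁻¹` is the inverse of `t` also for `t = 0`, where both are `0` by
  -- convention.
  rw [norm_smul, norm_inv, Real.norm_of_nonneg (Real.sqrt_nonneg _), mul_pow, inv_pow,
    Real.sq_sqrt t.coe_nonneg]
  ring

theorem summable_of_quadratically_bounded (h : IsDiffusive D ρ)
    (hs : ∀ t, Summable fun x => ‖latticeVec x‖ ^ 2 * ρ t x)
    {f : EuclideanSpace ℝ (Fin d) → ℝ} {C : ℝ} (hC : ∀ r, |f r| ≤ C * (1 + ‖r‖ ^ 2)) (t : ℝ≥0) :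
    Summable fun x => f ((Real.sqrt t)⁻¹ • latticeVec x) * ρ t x := by
  refine Summable.of_norm_bounded (h.summable_quadratic hs C t).summable fun x => ?_
  rw [Real.norm_eq_abs, abs_mul, abs_of_nonneg (h.nonneg t x)]
  exact mul_le_mul_of_nonneg_right (hC _) (h.nonneg t x)

/-- The rescaled second moments tend to the trace, which is the second moment of the Gaussian. Hence
the integrals of `C (1 + |r|²)` converge, and the weak limit extends to all functions dominated by
it. -/
theorem tendsto_integral_of_quadratically_bounded (h : IsDiffusive D ρ) (hD : D.PosDef)
    (h2 : Summable fun x => (1 + ‖latticeVec x‖ ^ 2) * ρ 0 x)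
    {f : EuclideanSpace ℝ (Fin d) → ℝ} (hf : Continuous f) {C : ℝ}
    (hC : ∀ r, |f r| ≤ C * (1 + ‖r‖ ^ 2)) :
    Tendsto (fun t : ℝ≥0 => ∫ r, f r ∂latticeMeasure (ρ t) (Real.sqrt t)⁻¹) atTop
      (𝓝 (∫ r, f r ∂multivariateGaussian 0 D)) := by
  obtain ⟨B, hB⟩ := h.exists_norm_sq_moment_bound hD.posSemidef h2
  have hs := fun t => (hB t).1
  have hq : Continuous fun r : EuclideanSpace ℝ (Fin d) => C * (1 + ‖r‖ ^ 2) := by fun_prop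
  have hqi : ∀ t : ℝ≥0, Integrable (fun r : EuclideanSpace ℝ (Fin d) => C * (1 + ‖r‖ ^ 2))
      (latticeMeasure (ρ t) (Real.sqrt t)⁻¹) := fun t =>
    (integrable_latticeMeasure_iff (h.nonneg t) _ hq).mpr (h.summable_quadratic hs C t).summable
  have hγ : Integrable (fun r : EuclideanSpace ℝ (Fin d) => 1 + ‖r‖ ^ 2)
      (multivariateGaussian 0 D) :=
    (integrable_const 1).add (integrable_norm_sq_multivariateGaussian D)
  have := fun t : ℝ≥0 => h.isProbabilityMeasure t (Real.sqrt t)⁻¹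
  refine tendsto_integral_of_weak_of_dominated (fun g hg hb => h.tendsto_integral hD hg hb) hq hf hC
    hqi (hγ.const_mul C) ?_
  rw [integral_const_mul, integral_add (integrable_const 1)
    (integrable_norm_sq_multivariateGaussian D), integral_norm_sq_multivariateGaussian
    hD.posSemidef, integral_const, probReal_univ, one_smul]
  refine (((h.tendsto_norm_sq_moment hD.posSemidef h2).const_add 1).const_mul C).congr fun t => ?_
  rw [integral_latticeMeasure (h.nonneg t) _ hq.stronglyMeasurable (hqi t),
    ← (h.summable_quadratic hs C t).tsum_eq]
  exact tsum_congr fun x => by rw [smul_eq_mul, mul_comm]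

end IsDiffusive

end QuadraticallyBounded

/-! ### Periodicity and the proof of the theorem. -/

section Main

variable {d : ℕ} {p : Fin d → ℕ} {u : CubicLattice d → ℝ}

theorem IsPeriodicPotential.add_mul (hu : IsPeriodicPotential p u) (x k : CubicLattice d) :
    u (x + fun j => p j * k j) = u x := by
  have h1 : ∀ (j : Fin d) (m : ℤ) (x : CubicLattice d), u (x + Pi.single j (p j * m)) = u x := by
    intro j m
    induction m using Int.induction_on with
    | zero => simp
    | succ m ih =>
      intro x
      rw [mul_add, mul_one, Pi.single_add, ← add_assoc, hu.2, ih]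
    | pred m ih =>
      intro x
      rw [← hu.2 j, add_assoc, ← Pi.single_add, mul_sub, mul_one, sub_add_cancel, ih]
  have h2 : ∀ (F : Finset (Fin d)), u (x + ∑ j ∈ F, Pi.single j ((p j : ℤ) * k j)) = u x := by
    classical
    intro F
    induction F using Finset.induction_on with
    | empty => simp
    | insert j F hj ih => rw [Finset.sum_insert hj, add_comm (Pi.single _ _), ← add_assoc, h1, ih]
  have h3 := h2 Finset.univ
  rwa [Finset.univ_sum_single] at h3

theorem IsPeriodicPotential.exists_cell [∀ j, NeZero (p j)] (hu : IsPeriodicPotential p u) :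
    ∃ U : PeriodCell p → ℝ, ∀ x, u x = U (cellOf p x) := by
  refine ⟨fun a => u fun j => ((a j).val : ℤ), fun x => ?_⟩
  -- Division with remainder in each coordinate: a point is its residue plus a multiple of the
  -- periods.
  refine Eq.trans ?_ (hu.add_mul (fun j => ((cellOf p x j).val : ℤ)) fun j => x j / p j)
  congr 1
  ext j
  simp only [Pi.add_apply]
  rw [cellOf, ZMod.val_intCast, Int.emod_add_mul_ediv]

theorem IsSpinField.integrable_norm_sq_dysonSum {Ω : Type*} [MeasurableSpace Ω] {P : Measure Ω}
    [IsProbabilityMeasure P] {r lam K : ℝ} {v : Ω → ℝ≥0 → CubicLattice d → ℝ}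
    (hv : IsSpinField P r v) (hK : 0 ≤ K) (hu : ∀ x, |u x| + |lam| ≤ K) (ψ₀ : L2Lattice d)
    (t : ℝ≥0) (x : CubicLattice d) :
    Integrable (fun ω => ‖dysonSum (totalPotential u lam (v ω)) ψ₀ t x‖ ^ 2) P := by
  have h := (hv.integrable_mul_conj_mul hK hu ψ₀ t x x ∅).re
  refine h.congr (Eventually.of_forall fun ω => ?_)
  simp only [spinChar, Finset.prod_empty, mul_one, Real.toNNReal_coe, Complex.mul_conj',
    RCLike.re_to_complex]
  norm_cast

end Main

end

theorem theorem1p1 {d : ℕ} (hd : 0 < d) (p : Fin d → ℕ) (u : CubicLattice d → ℝ)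
    (hu : IsPeriodicPotential p u) (lam : ℝ) (hlam : 0 < lam) (rate : ℝ≥0) (hrate : 0 < rate) :
    ∃ D : Matrix (Fin d) (Fin d) ℝ, D.PosDef ∧
      ∀ (Ω : Type*) [MeasurableSpace Ω] (P : Measure Ω) [IsProbabilityMeasure P]
        (σ : CubicLattice d → Ω → ℝ) (N : CubicLattice d → ℝ≥0 → Ω → ℕ),
        IsFlipProcessData P rate σ N →
        ∀ ψ₀ : L2Lattice d, ‖ψ₀‖ = 1 →
          -- the initial value problem is almost surely uniquely solvable
          (∀ᵐ ω ∂P, ∃! φ : ℝ≥0 → L2Lattice d,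
            IsSchrodingerSolution u lam (flipSpin σ N ω) ψ₀ φ) ∧
          ∀ ψ : Ω → ℝ≥0 → L2Lattice d,
            (∀ᵐ ω ∂P, IsSchrodingerSolution u lam (flipSpin σ N ω) ψ₀ (ψ ω)) →
            -- the averages `𝔼 |ψ_t(x)|²` are well defined
            (∀ (t : ℝ≥0) (x : CubicLattice d), Integrable (fun ω => ‖ψ ω t x‖ ^ 2) P) ∧
            -- central limit theorem for bounded continuous functions
            (∀ f : EuclideanSpace ℝ (Fin d) → ℝ, Continuous f → (∃ C, ∀ r, |f r| ≤ C) →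
              CLTHolds P ψ D f) ∧
            -- if the initial value has a finite second moment
            ((Summable fun x : CubicLattice d => (1 + ‖latticeVec x‖ ^ 2) * ‖ψ₀ x‖ ^ 2) →
              -- diffusive scaling, with a finite and positive diffusion constant
              (∀ t : ℝ≥0, Summable fun x : CubicLattice d =>
                ‖latticeVec x‖ ^ 2 * meanDensity P ψ t x) ∧
              Tendsto (fun t : ℝ≥0 => (1 / (t : ℝ)) *
                ∑' x : CubicLattice d, ‖latticeVec x‖ ^ 2 * meanDensity P ψ t x)
                atTop (𝓝 D.trace) ∧
              0 < D.trace ∧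
              -- central limit theorem for quadratically bounded continuous functions
              (∀ f : EuclideanSpace ℝ (Fin d) → ℝ, Continuous f →
                (∃ C, ∀ r, (1 + ‖r‖ ^ 2)⁻¹ * |f r| ≤ C) → CLTHolds P ψ D f)) := by
  have hp : ∀ j, NeZero (p j) := fun j => ⟨(hu.1 j).ne'⟩
  obtain ⟨U, hU⟩ := hu.exists_cell
  -- `D` comes from the generator alone, before a probability space, an initial state or a test
  -- function is chosen.
  obtain ⟨D, hD, hdiff⟩ := exists_isDiffusive (p := p) U hlam (NNReal.coe_pos.mpr hrate)
  obtain ⟨K, hK, huK⟩ : ∃ K, 0 ≤ K ∧ ∀ x, |u x| + |lam| ≤ K := by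
    refine ⟨∑ a, |U a| + |lam|, by positivity, fun x => ?_⟩
    rw [hU]
    gcongr
    exact Finset.single_le_sum (f := fun a => |U a|) (fun _ _ => abs_nonneg _) (Finset.mem_univ _)
  refine ⟨D, hD, fun Ω _ P _ σ N hN ψ₀ hψ₀ => ?_⟩
  -- Almost surely the modification agrees with the flip process at all times and sites, so
  -- solutions and averages do not change.
  obtain ⟨v, hv, hvN⟩ := hN.exists_isSpinField
  have hv1 : ∀ ω s x, |v ω s x| ≤ 1 := fun ω s x => (hv.abs_eq_one ω s x).le
  have hvN' : ∀ᵐ ω ∂P, flipSpin σ N ω = v ω := hvN.mono fun ω h =>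
    funext fun t => funext fun x => (h t x).symm
  refine ⟨?_, fun ψ hψ => ?_⟩
  · filter_upwards [hvN'] with ω hω
    rw [hω]
    exact existsUnique_isSchrodingerSolution hK huK (hv1 ω) (hv.measurable_time ω) ψ₀
  have hψeq : ∀ᵐ ω ∂P, ∀ (t : ℝ≥0) x,
      ψ ω t x = dysonSum (totalPotential u lam (v ω)) ψ₀ t x := by
    filter_upwards [hvN', hψ] with ω hω h t x
    rw [hω] at h
    exact h.apply_eq hK huK (hv1 ω) (hv.measurable_time ω) t x
  have hae : ∀ (t : ℝ≥0) x, (fun ω => ‖dysonSum (totalPotential u lam (v ω)) ψ₀ t x‖ ^ 2) =ᵐ[P]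
      fun ω => ‖ψ ω t x‖ ^ 2 := fun t x => hψeq.mono fun ω h => by
    beta_reduce
    rw [h]
  have hρ : IsDiffusive D (meanDensity P ψ) := by
    convert hdiff Ω P v hv u hU ψ₀ hψ₀ using 1
    ext t x
    exact (integral_congr_ae (hae t x)).symm
  -- At time zero the time integral in the equation vanishes.
  have hρ0 : ∀ x, meanDensity P ψ 0 x = ‖ψ₀ x‖ ^ 2 := fun x => by
    have h1 : (fun ω => ‖ψ ω 0 x‖ ^ 2) =ᵐ[P] fun _ => ‖ψ₀ x‖ ^ 2 := hψ.mono fun ω h => by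
      have := h.integral_eq 0 x
      beta_reduce
      rw [this]
      simp
    rw [meanDensity, integral_congr_ae h1, integral_const, probReal_univ, one_smul]
  refine ⟨fun t x => (hv.integrable_norm_sq_dysonSum hK huK ψ₀ t x).congr (hae t x),
    fun f hf hb => ⟨hρ.summable_of_bounded hb, hρ.tendsto_tsum hD hf (hρ.summable_of_bounded hb)
      (hρ.tendsto_integral hD hf hb)⟩, fun h2 => ?_⟩
  simp only [← hρ0] at h2
  obtain ⟨B, hB⟩ := hρ.exists_norm_sq_moment_bound hD.posSemidef h2
  have hs := fun t => (hB t).1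
  -- Positivity of the trace needs at least one diagonal entry.
  have : Nonempty (Fin d) := ⟨⟨0, hd⟩⟩
  refine ⟨hs, hρ.tendsto_norm_sq_moment hD.posSemidef h2, hD.trace_pos, fun f hf hb => ?_⟩
  obtain ⟨C, hC⟩ := hb
  have hC' : ∀ r, |f r| ≤ C * (1 + ‖r‖ ^ 2) := fun r => by
    have h1 := hC r
    rwa [inv_mul_le_iff₀ (by positivity), mul_comm] at h1
  have hsf := hρ.summable_of_quadratically_bounded hs hC'
  exact ⟨hsf, hρ.tendsto_tsum hD hf hsf (hρ.tendsto_integral_of_quadratically_bounded hD h2 hf hC')⟩
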